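/- Let $m\ge 4$, let $N\subset\mathbb R^\ell$ be a compact smooth embedded submanifold of dimension $n$ without boundary, and let $\Lambda>0$. **Setting.** For open $\Omega\subset\mathbb R^m$, $W^{2,2}(\Omega,N)$ is the set of $f\in W^{2,2}(\Omega,\mathbb R^\ell)$ with $f(y)\in N$ for a.e. $y$, and $E(u)=\int_\Omega|\Delta u|^2$ ($\Delta$ the weak Laplacian). A map $f\in W^{2,2}(\Omega,N)$ is *stationary biharmonic* if $\frac{d}{dt}\big|_{t=0}E(f_t)=0$ both for $f_t=\pi_N(f+tX)$, for all $X\in C_0^\infty(\Omega,\mathbb R^\ell)$, where $\pi_N$ is the nearest point retraction onto $N$, and for $f_t(y)=f(y+t\xi(y))$, for all $\xi\in C_0^\infty(\Omega,\mathbb R^m)$. A map $f\in W^{2,2}(B_R(x),N)$ belongs to $H^2_\Lambda(B_R(x),N)$ if $\int_{B_R(x)}(|\nabla f|^2+|\nabla^2f|^2)<\Lambda$ and $$R^4\int_{B_R(x)}|\Delta f|^2+R^3\int_{\partial B_R(x)}\Big(\partial_X|\nabla f|^2+4|\nabla f|^2-4\frac{|\partial_Xf|^2}{|y-x|^2}\Big)d\mathcal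 H^{m-1}\le R^m\Lambda ,\qquad \partial_Xf=\sum_i(y_i-x_i)\partial_if,$$ where the boundary integral at radius $R$ is understood as the essential lower limit of the integrals over $\partial B_\rho(x)$ as $\rho\uparrow R$. A measurable map $h:\mathbb R^m\to N$ is *$k$-homogeneous* if $h(\lambda z)=h(z)$ for all $\lambda>0$ and $z\in\mathbb R^m$, and there is a $k$-dimensional linear subspace $V$ with $h(z+v)=h(z)$ for all $z\in\mathbb R^m$, $v\in V$. Put $T_{y,s}f(z)=f(y+sz)$. A measurable map $T:\mathbb R^m\to N$ is a *tangent map* of $f$ at $y$ if $\frac1{|B_1(0)|}\int_{B_1(0)}|T-T_{y,r_i}f|^2\to0$ for some sequence of positive numbers $r_i\to 0$. For $f:B_4(x)\to N$, $k\in\{0,1,2,\dots\}$, $\eta>0$ and $0<r<1$ let - $S^k(f)$ be the set of $y\in B_4(x)$ at which no tangent map of $f$ is $(k+1)$-homogeneous; - $S^k_{\eta,r}(f)$ be the set of $y\in B_2(x)$ such that $\frac1{|B_1(0)|}\int_{B_1(0)}|T_{y,s}f-h|^2>\eta$ for all $r\le s\le1$ and all $(k+1)$-homogeneous $h$; - $S^k_\eta(f)=\bigcap_{0<r<1}S^k_{\eta,r}(f)$.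 Let $T_r(A)$ be the $r$-tubular neighbourhood of $A$, and $\dim_{\mathrm{Min}}A=\inf\{d\ge0:\limsup_{\delta\to0}\delta^{d-m}\,\mathrm{Vol}(T_\delta(A))<\infty\}$. **Theorem.** For every $\eta>0$ there is a constant $C=C(m,N,\Lambda,\eta)$ such that for every $x\in\mathbb R^m$, every stationary biharmonic map $f:B_4(x)\to N$ with $f\in H^2_\Lambda(B_4(x),N)$, every integer $k\ge0$ and every $0<r<1$, $$\mathrm{Vol}\big(T_r(S^k_{\eta,r}(f))\cap B_1(x)\big)\le C\,r^{m-k-\eta}.$$ Moreover, for all such $x$, $f$ and $k$: one has $S^k(f)\cap B_2(x)=\bigcup_{\eta>0}S^k_\eta(f)$; the Minkowski dimension of $S^k_\eta(f)\cap B_1(x)$ is at most $k$ for every $\eta>0$; and consequently the Hausdorff dimension of $S^k(f)\cap B_1(x)$ is at most $k$. -/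

import Mathlib

open Set Filter Topology MeasureTheory
open scoped ContDiff

noncomputable section

namespace Biharmonic

/-- Euclidean space `ℝᵈ`. -/
abbrev Euc (d : ℕ) : Type := EuclideanSpace ℝ (Fin d)

/-! ### The target manifold -/

/-- `N ⊆ ℝˡ` is a compact smooth embedded submanifold of dimension `n`, without boundary:
around each of its points a smooth diffeomorphism between open subsets of `ℝˡ` flattens `N`
to an `n`-dimensional linear subspace. -/
structure IsCompactSubmanifold {l : ℕ} (n : ℕ) (N : Set (Euc l)) : Prop where
  isCompact : IsCompact N
  slice : ∀ p ∈ N, ∃ (Φ : OpenPartialHomeomorph (Euc l) (Euc l)) (V : Submodule ℝ (Euc l)),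
    p ∈ Φ.source ∧ ContDiffOn ℝ ∞ Φ Φ.source ∧ ContDiffOn ℝ ∞ Φ.symm Φ.target ∧
    Module.finrank ℝ V = n ∧ Φ '' (Φ.source ∩ N) = Φ.target ∩ (V : Set (Euc l))

/-- The nearest point retraction onto `N`. For compact nonempty `N` a nearest point always exists,
and when `N` is a compact submanifold it is unique for all points close enough to `N`. -/
def nearestPoint {l : ℕ} (N : Set (Euc l)) (y : Euc l) : Euc l :=
  Classical.epsilon fun p => p ∈ N ∧ ∀ q ∈ N, dist y p ≤ dist y q

/-! ### Weak derivatives and the Sobolev space `W^{2,2}` -/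

/-- `φ` is smooth with compact support inside `Ω`. -/
def IsTest {m : ℕ} {F : Type*} [NormedAddCommGroup F] [NormedSpace ℝ F]
    (Ω : Set (Euc m)) (φ : Euc m → F) : Prop :=
  ContDiff ℝ ∞ φ ∧ HasCompactSupport φ ∧ tsupport φ ⊆ Ω

/-- `g` is a weak `i`-th partial derivative of `u` on `Ω`. -/
def IsWeakPartial {m l : ℕ} (Ω : Set (Euc m)) (i : Fin m) (u g : Euc m → Euc l) : Prop :=
  LocallyIntegrableOn u Ω ∧ LocallyIntegrableOn g Ω ∧
    ∀ φ : Euc m → ℝ, IsTest Ω φ →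
      ∫ y in Ω, (fderiv ℝ φ y (EuclideanSpace.single i 1)) • u y = - ∫ y in Ω, φ y • g y

open Classical in
/-- The weak `i`-th partial derivative of `u` on `Ω` (unique up to a null subset of the open
set `Ω`; the zero function if there is none). -/
def weakPartial {m l : ℕ} (Ω : Set (Euc m)) (i : Fin m) (u : Euc m → Euc l) : Euc m → Euc l :=
  if h : ∃ g, IsWeakPartial Ω i u g then h.choose else 0

/-- The weak Laplacian `Δu = ∑ᵢ ∂ᵢ∂ᵢu` on `Ω`. -/
def weakLaplacian {m l : ℕ} (Ω : Set (Euc m)) (u : Euc m → Euc l) (y : Euc m) : Euc l :=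
  ∑ i, weakPartial Ω i (weakPartial Ω i u) y

/-- `u ∈ W^{2,2}(Ω, ℝˡ)`: `u` and its weak derivatives of order one and two exist and lie
in `L²(Ω)`. -/
structure MemW22 {m l : ℕ} (Ω : Set (Euc m)) (u : Euc m → Euc l) : Prop where
  memLp : MemLp u 2 (volume.restrict Ω)
  exists_partial : ∀ i, ∃ g, IsWeakPartial Ω i u g
  memLp_partial : ∀ i, MemLp (weakPartial Ω i u) 2 (volume.restrict Ω)
  exists_partial_partial : ∀ i j, ∃ g, IsWeakPartial Ω j (weakPartial Ω i u) g
  memLp_partial_partial : ∀ i j,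
    MemLp (weakPartial Ω j (weakPartial Ω i u)) 2 (volume.restrict Ω)

/-- `u ∈ W^{2,2}(Ω, N)`. -/
def MemW22Into {m l : ℕ} (Ω : Set (Euc m)) (N : Set (Euc l)) (u : Euc m → Euc l) : Prop :=
  MemW22 Ω u ∧ ∀ᵐ y ∂(volume.restrict Ω), u y ∈ N

/-! ### Biharmonic maps -/

/-- The biharmonic energy `E(u) = ∫_Ω |Δu|²`. -/
def biEnergy {m l : ℕ} (Ω : Set (Euc m)) (u : Euc m → Euc l) : ℝ :=
  ∫ y in Ω, ‖weakLaplacian Ω u y‖ ^ 2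

/-- `f ∈ W^{2,2}(Ω, N)` is weakly biharmonic: it is critical for `E` under all variations
`π_N (f + t X)` with `X ∈ C₀^∞(Ω, ℝˡ)`. -/
def IsWeaklyBiharmonic {m l : ℕ} (Ω : Set (Euc m)) (N : Set (Euc l)) (f : Euc m → Euc l) : Prop :=
  MemW22Into Ω N f ∧ ∀ X : Euc m → Euc l, IsTest Ω X →
    HasDerivAt (fun t : ℝ => biEnergy Ω fun y => nearestPoint N (f y + t • X y)) 0 0

/-- `f` is stationary biharmonic: it is weakly biharmonic and moreover critical for `E` under
all variations `f (y + t ξ(y))` of the domain with `ξ ∈ C₀^∞(Ω, ℝᵐ)`. -/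
def IsStationaryBiharmonic {m l : ℕ} (Ω : Set (Euc m)) (N : Set (Euc l)) (f : Euc m → Euc l) :
    Prop :=
  IsWeaklyBiharmonic Ω N f ∧ ∀ ξ : Euc m → Euc m, IsTest Ω ξ →
    HasDerivAt (fun t : ℝ => biEnergy Ω fun y => f (y + t • ξ y)) 0 0

/-! ### The space `H²_Λ` -/

/-- `|∇u|²` -/
def gradSq {m l : ℕ} (Ω : Set (Euc m)) (u : Euc m → Euc l) (y : Euc m) : ℝ :=
  ∑ i, ‖weakPartial Ω i u y‖ ^ 2

/-- `|∇²u|²` -/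
def hessSq {m l : ℕ} (Ω : Set (Euc m)) (u : Euc m → Euc l) (y : Euc m) : ℝ :=
  ∑ i, ∑ j, ‖weakPartial Ω j (weakPartial Ω i u) y‖ ^ 2

/-- `∂_X u = ∑ᵢ (yᵢ - xᵢ) ∂ᵢu`, where `X(y) = y - x`. -/
def radialDeriv {m l : ℕ} (Ω : Set (Euc m)) (x : Euc m) (u : Euc m → Euc l) (y : Euc m) : Euc l :=
  ∑ i, (y i - x i) • weakPartial Ω i u y

/-- `∂_X |∇u|² = 2 ∑ᵢⱼ (yⱼ - xⱼ) ⟨∂ᵢu, ∂ⱼ∂ᵢu⟩`, where `X(y) = y - x`. -/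
def radialDerivGradSq {m l : ℕ} (Ω : Set (Euc m)) (x : Euc m) (u : Euc m → Euc l) (y : Euc m) :
    ℝ :=
  2 * ∑ i, ∑ j, (y j - x j) *
    inner ℝ (weakPartial Ω i u y) (weakPartial Ω j (weakPartial Ω i u) y)

/-- The integral of `g` over the sphere `∂B_ρ(x)` with respect to the surface measure
(the normalised `(m-1)`-dimensional Hausdorff measure), written over the unit sphere. -/
def sphereIntegral {m : ℕ} (x : Euc m) (ρ : ℝ) (g : Euc m → ℝ) : ℝ :=
  ρ ^ (m - 1) *
    ∫ θ : Metric.sphere (0 : Euc m) 1, g (x + ρ • (θ : Euc m)) ∂((volume : Measure (Euc m)).toSphere)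

/-- `∫_{∂B_ρ(x)} (∂_X|∇u|² + 4|∇u|² - 4 |∂_X u|² / |y - x|²) dH^{m-1}`, for derivatives taken
in `Ω`. For `u ∈ W^{2,2}(Ω)` and `B_R(x) ⊆ Ω` this is well defined for almost every `ρ < R`. -/
def boundaryTerm {m l : ℕ} (Ω : Set (Euc m)) (x : Euc m) (u : Euc m → Euc l) (ρ : ℝ) : ℝ :=
  sphereIntegral x ρ fun y =>
    radialDerivGradSq Ω x u y + 4 * gradSq Ω u y
      - 4 * ‖radialDeriv Ω x u y‖ ^ 2 / ‖y - x‖ ^ 2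

/-- `f ∈ H²_Λ(B_R(x), N)`. Second derivatives of a `W^{2,2}(B_R(x))` map have no trace on
`∂B_R(x)`; the boundary term at radius `R` is read as the (essential) lower limit of the
boundary terms at radii `ρ ↑ R`, where null sets of radii are disregarded. -/
structure MemH2 {m l : ℕ} (Λ : ℝ) (x : Euc m) (R : ℝ) (N : Set (Euc l)) (f : Euc m → Euc l) :
    Prop where
  mem : MemW22Into (Metric.ball x R) N f
  sobolev_bound :
    ∫ y in Metric.ball x R, (gradSq (Metric.ball x R) f y + hessSq (Metric.ball x R) f y) < Λ
  energy_bound :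
    liminf (fun ρ : ℝ => ((R ^ 4 * biEnergy (Metric.ball x R) f
        + R ^ 3 * boundaryTerm (Metric.ball x R) x f ρ : ℝ) : EReal))
      (𝓝[<] R ⊓ ae volume) ≤ ((R ^ m * Λ : ℝ) : EReal)

/-! ### Homogeneity, tangent maps and singular strata -/

/-- The measurable map `h : ℝᵐ → N` is `k`-homogeneous at `y` (with respect to some
`k`-plane `V`). -/
def IsHomogeneousAt {m l : ℕ} (N : Set (Euc l)) (k : ℕ) (y : Euc m) (h : Euc m → Euc l) : Prop :=
  Measurable h ∧ (∀ z, h z ∈ N) ∧ (∀ a : ℝ, 0 < a → ∀ z, h (y + a • z) = h (y + z)) ∧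
    ∃ V : Submodule ℝ (Euc m), Module.finrank ℝ V = k ∧ ∀ z, ∀ v ∈ V, h (z + v) = h z

/-- The blow-up `T_{y,s} f (z) = f (y + s z)`. -/
def blowUp {m l : ℕ} (f : Euc m → Euc l) (y : Euc m) (s : ℝ) (z : Euc m) : Euc l :=
  f (y + s • z)

/-- `⨍_{B_1(0)} |g - h|²` -/
def meanSqDist {m l : ℕ} (g h : Euc m → Euc l) : ℝ :=
  ⨍ z in Metric.ball (0 : Euc m) 1, ‖g z - h z‖ ^ 2

/-- `T : ℝᵐ → N` is a tangent map of `f` at `y`. -/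
def IsTangentMap {m l : ℕ} (N : Set (Euc l)) (f : Euc m → Euc l) (y : Euc m)
    (T : Euc m → Euc l) : Prop :=
  Measurable T ∧ (∀ z, T z ∈ N) ∧ ∃ r : ℕ → ℝ, (∀ i, 0 < r i) ∧ Tendsto r atTop (𝓝 0) ∧
    Tendsto (fun i => meanSqDist T (blowUp f y (r i))) atTop (𝓝 0)

/-- The singular stratum `S^k(f)` of a map `f : Ω → N`: the points of `Ω` at which no tangent map
of `f` is `(k+1)`-homogeneous. -/
def stratum {m l : ℕ} (Ω : Set (Euc m)) (N : Set (Euc l)) (k : ℕ) (f : Euc m → Euc l) :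
    Set (Euc m) :=
  {y | y ∈ Ω ∧ ∀ T, IsTangentMap N f y T → ¬ IsHomogeneousAt N (k + 1) 0 T}

/-- The quantitative singular stratum `S^k_{η,r}(f)` of a map `f : B_4(x) → N`. -/
def quantStratum {m l : ℕ} (x : Euc m) (N : Set (Euc l)) (k : ℕ) (η r : ℝ) (f : Euc m → Euc l) :
    Set (Euc m) :=
  {y | y ∈ Metric.ball x 2 ∧ ∀ s : ℝ, r ≤ s → s ≤ 1 → ∀ h, IsHomogeneousAt N (k + 1) 0 h →
    η < meanSqDist (blowUp f y s) h}

/-- `S^k_η(f) = ⋂_{0<r<1} S^k_{η,r}(f)`. -/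
def etaStratum {m l : ℕ} (x : Euc m) (N : Set (Euc l)) (k : ℕ) (η : ℝ) (f : Euc m → Euc l) :
    Set (Euc m) :=
  ⋂ (r : ℝ) (_ : 0 < r ∧ r < 1), quantStratum x N k η r f

/-- The (upper) Minkowski dimension of `A ⊆ ℝᵐ`: the infimum of the `d ≥ 0` with
`limsup_{δ → 0} Vol(T_δ(A)) / δ^{m-d} < ∞`. -/
def minkowskiDim {m : ℕ} (A : Set (Euc m)) : ENNReal :=
  ⨅ (d : NNReal) (_ : limsup (fun δ : ℝ => volume (Metric.thickening δ A) /
    ENNReal.ofReal (δ ^ ((m : ℝ) - d))) (𝓝[>] 0) < ⊤), (d : ENNReal)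

end Biharmonic

end

open scoped ENNReal Convolution Pointwise

/-! The proof is a quantitative stratification in the style of Cheeger and Naber: a monotone
density, a cone-splitting principle proved by compactness, and a count of coverings over scales.

Monotone density. Stationarity under domain variations is tested with the fields `ψ(z)(z - y)`,
where `ψ` is a smooth radial cutoff at scale `r`, and combined with a Pohozaev identity. Discarding
a square of favourable sign (`integral_pohozaev_nonneg`, `stationary_inequality`) produces a
smoothed scale-invariant quantity `theta` whose `r`-derivative is at least `4(m - 2) r^(1-m)` times
a weighted integral of the squared radial derivative (`exists_hasDerivAt_theta`). Some terms of
`theta` have no sign, so its positivity is not evident. A second monotone combination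
(`antitoneOn_defect`), which tends to `0` at Lebesgue points as the radius shrinks, shows that
`theta` dominates twice the scaled gradient energy; here `m ≥ 4` enters. Thus `theta` is
nonnegative, nondecreasing in `r` and bounded in terms of `m` and `Λ`, it controls the scaled
gradient energy, and its drop between `r` and `2r` controls the radial energy. These facts form
`IsDensity`, the only information about the equation that the rest of the argument uses.

Cone splitting. Blow-ups take values in the compact set `N` and are uniformly equicontinuous in the
mean, so they are precompact in `L²`. A small density drop at a point makes the blow-up almost
invariant under dilations about that point. In a limit the invariance is exact, and invariance under
dilations about `0` and about `v` implies invariance under translations along `v`. Hence small drops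
at `y` and at `k + 1` quantitatively independent neighbours force closeness to a `(k+1)`-homogeneous
map. Conversely (`exists_pinching`), where `y` has a small drop but its blow-up stays away from
`(k+1)`-homogeneous maps, all nearby points with small drop lie close to a plane of dimension at
most `k`.

Counting. Along the scales `γ^j / 8` the drops at a point sum to at most a constant, so all but a
bounded number of scales are good. A good scale multiplies the number of covering sets by `c γ^(-k)`
with `c` independent of `γ`, a bad one by a fixed constant, and there are at most `2^n` patterns of
bad scales among the first `n`. Choosing `γ` so small that `2c ≤ γ^(-η)` gives at most `C r^(-k-η)`
sets of diameter `r` (`exists_smallCover_quantStratum`). The volume, Minkowski and Hausdorff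
statements follow, and the union formula (`stratum_inter_ball_eq`) follows from the same compactness
theorem (`exists_homogeneous_limit`). -/

namespace Biharmonic

/-! ### Uniqueness of weak derivatives -/

section WeakPartial

variable {m l : ℕ} {Ω : Set (Euc m)} {i : Fin m} {u u' g g' : Euc m → Euc l}

lemma locallyIntegrableOn_congr (hΩ : MeasurableSet Ω) (h : u =ᵐ[volume.restrict Ω] u')
    (hu : LocallyIntegrableOn u Ω) : LocallyIntegrableOn u' Ω := by
  intro x hx
  obtain ⟨t, ht, hut⟩ := hu x hx
  refine ⟨t ∩ Ω, inter_mem ht self_mem_nhdsWithin, ?_⟩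
  refine (hut.mono_set inter_subset_left).congr_fun_ae ?_
  exact ae_mono (Measure.restrict_mono inter_subset_right le_rfl) h

lemma IsWeakPartial.congr (hΩ : MeasurableSet Ω) (h : IsWeakPartial Ω i u g)
    (hu : u =ᵐ[volume.restrict Ω] u') (hg : g =ᵐ[volume.restrict Ω] g') :
    IsWeakPartial Ω i u' g' := by
  refine ⟨locallyIntegrableOn_congr hΩ hu h.1, locallyIntegrableOn_congr hΩ hg h.2.1, ?_⟩
  intro φ hφ
  have h1 := h.2.2 φ hφ
  have e1 : ∫ y in Ω, (fderiv ℝ φ y (EuclideanSpace.single i 1)) • u' y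
      = ∫ y in Ω, (fderiv ℝ φ y (EuclideanSpace.single i 1)) • u y := by
    apply integral_congr_ae
    filter_upwards [hu] with y hy
    rw [hy]
  have e2 : ∫ y in Ω, φ y • g' y = ∫ y in Ω, φ y • g y := by
    apply integral_congr_ae
    filter_upwards [hg] with y hy
    rw [hy]
  rw [e1, e2, h1]

lemma IsTest.integrableOn_smul {φ : Euc m → ℝ} (hφ : IsTest Ω φ)
    (hg : LocallyIntegrableOn g Ω) : IntegrableOn (fun y => φ y • g y) Ω := by
  have hK : IntegrableOn g (tsupport φ) :=
    hg.integrableOn_compact_subset hφ.2.2 hφ.2.1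
  have : IntegrableOn (fun y => φ y • g y) (tsupport φ) :=
    hK.continuousOn_smul hφ.1.continuous.continuousOn hφ.2.1
  have h2 : Integrable (fun y => φ y • g y) := by
    refine (integrableOn_iff_integrable_of_support_subset ?_).1 this
    intro y hy
    apply subset_tsupport
    intro h0
    exact hy (by simp [h0])
  exact h2.integrableOn

/-- The difference of two weak derivatives integrates to zero against every test function, so the
fundamental lemma of the calculus of variations applies. -/
lemma IsWeakPartial.ae_eq (hΩ : IsOpen Ω) (h : IsWeakPartial Ω i u g)
    (h' : IsWeakPartial Ω i u g') : g =ᵐ[volume.restrict Ω] g' := by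
  have := hΩ.ae_eq_zero_of_integral_contDiff_smul_eq_zero (μ := volume) (f := fun y => g y - g' y)
    (h.2.1.sub h'.2.1) ?_
  · rw [EventuallyEq, ae_restrict_iff' hΩ.measurableSet]
    filter_upwards [this] with y hy hyΩ
    exact sub_eq_zero.1 (hy hyΩ)
  · intro φ h1 h2 h3
    have hφ : IsTest Ω φ := ⟨h1, h2, h3⟩
    have e : ∫ y, φ y • (g y - g' y) = ∫ y in Ω, φ y • (g y - g' y) := by
      rw [setIntegral_eq_integral_of_forall_compl_eq_zero]
      intro y hy
      rw [image_eq_zero_of_notMem_tsupport (fun hh => hy (h3 hh)), zero_smul]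
    rw [e]
    simp_rw [smul_sub]
    rw [integral_sub (hφ.integrableOn_smul h.2.1) (hφ.integrableOn_smul h'.2.1)]
    have a := h.2.2 φ hφ
    have b := h'.2.2 φ hφ
    rw [a] at b
    rw [neg_inj.1 b, sub_self]

lemma isWeakPartial_weakPartial (h : ∃ g, IsWeakPartial Ω i u g) :
    IsWeakPartial Ω i u (weakPartial Ω i u) := by
  unfold weakPartial
  rw [dif_pos h]
  exact h.choose_spec

lemma IsWeakPartial.weakPartial_ae_eq (hΩ : IsOpen Ω) (h : IsWeakPartial Ω i u g) :
    weakPartial Ω i u =ᵐ[volume.restrict Ω] g :=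
  (isWeakPartial_weakPartial ⟨g, h⟩).ae_eq hΩ h

end WeakPartial

/-! ### Mollification and convergence in `L²` -/

section Mollification

lemma sq_lintegral_le {α : Type*} [MeasurableSpace α] (ν : Measure α) [IsProbabilityMeasure ν]
    {f : α → ℝ≥0∞} (hf : AEMeasurable f ν) : (∫⁻ a, f a ∂ν) ^ 2 ≤ ∫⁻ a, f a ^ 2 ∂ν := by
  have h := ENNReal.lintegral_mul_le_Lp_mul_Lq ν Real.HolderConjugate.two_two hf
    (aemeasurable_const (b := (1 : ℝ≥0∞)))
  simp only [Pi.mul_apply, mul_one, ENNReal.one_rpow, lintegral_const, measure_univ, one_mul] at h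
  calc (∫⁻ a, f a ∂ν) ^ 2 ≤ ((∫⁻ a, f a ^ (2 : ℝ) ∂ν) ^ (1 / 2 : ℝ)) ^ 2 := by gcongr
    _ = ∫⁻ a, f a ^ 2 ∂ν := by
      rw [← ENNReal.rpow_natCast, ← ENNReal.rpow_mul]
      simp

variable {E F : Type*} [NormedAddCommGroup E] [InnerProductSpace ℝ E] [FiniteDimensional ℝ E]
  [MeasurableSpace E] [BorelSpace E] [NormedAddCommGroup F] [NormedSpace ℝ F] [CompleteSpace F]

/-- Mollification of `u` by a normalised bump function. -/
noncomputable def moll (φ : ContDiffBump (0 : E)) (u : E → F) : E → F :=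
  φ.normed volume ⋆[ContinuousLinearMap.lsmul ℝ ℝ, volume] u

lemma moll_apply (φ : ContDiffBump (0 : E)) (u : E → F) (z : E) :
    moll φ u z = ∫ h, φ.normed volume h • u (z - h) := rfl

lemma moll_integrable (φ : ContDiffBump (0 : E)) {u : E → F} (hu : LocallyIntegrable u) (z : E) :
    Integrable fun h => φ.normed volume h • u (z - h) :=
  φ.hasCompactSupport_normed.convolutionExists_left (ContinuousLinearMap.lsmul ℝ ℝ)
    φ.continuous_normed hu z

lemma contDiff_moll (φ : ContDiffBump (0 : E)) {u : E → F} (hu : LocallyIntegrable u) :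
    ContDiff ℝ ∞ (moll φ u) :=
  φ.hasCompactSupport_normed.contDiff_convolution_left _ φ.contDiff_normed hu

/-- `moll φ u z` is the mean of the translates `u (z - h)` for a probability measure in `h`;
Jensen's inequality followed by Tonelli bounds the error by the worst translate. The set `B` is
arbitrary because the estimate is used globally for convergence and on a ball for Rellich
compactness. -/
lemma lintegral_enorm_moll_sub_sq_le (φ : ContDiffBump (0 : E)) {u : E → F}
    (hu : LocallyIntegrable u) (B : Set E) {K : ℝ≥0∞}
    (hK : ∀ h, ‖h‖ < φ.rOut → ∫⁻ z in B, ‖u (z - h) - u z‖ₑ ^ 2 ≤ K) :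
    ∫⁻ z in B, ‖moll φ u z - u z‖ₑ ^ 2 ≤ K := by
  set ν : Measure E := volume.withDensity fun h => ENNReal.ofReal (φ.normed volume h) with hν
  have hmφ : Measurable fun h => ENNReal.ofReal (φ.normed volume h) :=
    φ.continuous_normed.measurable.ennreal_ofReal
  have hνP : IsProbabilityMeasure ν := by
    constructor
    rw [hν, withDensity_apply _ MeasurableSet.univ, Measure.restrict_univ,
      ← ofReal_integral_eq_lintegral_ofReal φ.integrable_normed
        (Eventually.of_forall φ.nonneg_normed), φ.integral_normed, ENNReal.ofReal_one]
  have hac : ν ≪ volume := withDensity_absolutelyContinuous _ _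
  have hum : AEStronglyMeasurable u volume := hu.aestronglyMeasurable
  have hsub : ∀ z, AEStronglyMeasurable (fun h => u (z - h)) volume := fun z =>
    hum.comp_quasiMeasurePreserving (quasiMeasurePreserving_sub_left_of_right_invariant volume z)
  have hpt : ∀ z, ‖moll φ u z - u z‖ₑ ^ 2 ≤ ∫⁻ h, ‖u (z - h) - u z‖ₑ ^ 2 ∂ν := by
    intro z
    have h1 : moll φ u z - u z = ∫ h, φ.normed volume h • (u (z - h) - u z) := by
      simp_rw [smul_sub]
      rw [integral_sub (moll_integrable φ hu z) (φ.integrable_normed.smul_const _),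
        φ.integral_normed_smul, moll_apply]
    have h2 : ‖moll φ u z - u z‖ₑ ≤ ∫⁻ h, ‖u (z - h) - u z‖ₑ ∂ν := by
      have hm : AEMeasurable (fun h => ‖u (z - h) - u z‖ₑ) volume :=
        ((hsub z).sub aestronglyMeasurable_const).enorm
      rw [h1, hν, lintegral_withDensity_eq_lintegral_mul₀ hmφ.aemeasurable hm]
      refine (enorm_integral_le_lintegral_enorm _).trans (lintegral_mono fun h => ?_)
      simp only [Pi.mul_apply, enorm_smul]
      rw [Real.enorm_of_nonneg (φ.nonneg_normed h)]
    calc ‖moll φ u z - u z‖ₑ ^ 2 ≤ (∫⁻ h, ‖u (z - h) - u z‖ₑ ∂ν) ^ 2 := by gcongr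
      _ ≤ _ := sq_lintegral_le ν (((hsub z).sub aestronglyMeasurable_const).mono_ac hac).enorm
  have hjoint : AEMeasurable (Function.uncurry fun z h => ‖u (z - h) - u z‖ₑ ^ 2)
      ((volume.restrict B).prod ν) := by
    have e1 : AEStronglyMeasurable (fun p : E × E => u (p.1 - p.2)) (volume.prod volume) :=
      hum.comp_quasiMeasurePreserving (quasiMeasurePreserving_sub volume volume)
    have e2 : AEStronglyMeasurable (fun p : E × E => u p.1) (volume.prod volume) :=
      hum.comp_quasiMeasurePreserving Measure.quasiMeasurePreserving_fst
    have e3 : ((volume.restrict B).prod ν) ≪ (volume : Measure E).prod (volume : Measure E) :=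
      Measure.AbsolutelyContinuous.prod Measure.restrict_le_self.absolutelyContinuous hac
    exact (((e1.sub e2).mono_ac e3).enorm.pow_const 2)
  calc ∫⁻ z in B, ‖moll φ u z - u z‖ₑ ^ 2
      ≤ ∫⁻ z in B, ∫⁻ h, ‖u (z - h) - u z‖ₑ ^ 2 ∂ν := lintegral_mono fun z => hpt z
    _ = ∫⁻ h, (∫⁻ z in B, ‖u (z - h) - u z‖ₑ ^ 2) ∂ν := lintegral_lintegral_swap hjoint
    _ ≤ ∫⁻ _, K ∂ν := by
      apply lintegral_mono_ae
      rw [hν, ae_withDensity_iff hmφ]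
      refine Eventually.of_forall fun h hh => hK h ?_
      by_contra hcon
      apply hh
      have : h ∉ Function.support (φ.normed volume) := by
        rw [φ.support_normed_eq]; simpa using hcon
      rw [Function.notMem_support.1 this, ENNReal.ofReal_zero]
    _ = K := by simp

end Mollification

section LTwo

variable {E F : Type*} [NormedAddCommGroup E] [InnerProductSpace ℝ E] [FiniteDimensional ℝ E]
  [MeasurableSpace E] [BorelSpace E] [NormedAddCommGroup F]

lemma eLpNorm_two_sq {α : Type*} [MeasurableSpace α] (μ : Measure α) (f : α → F) :
    eLpNorm f 2 μ ^ 2 = ∫⁻ a, ‖f a‖ₑ ^ 2 ∂μ := by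
  rw [eLpNorm_eq_lintegral_rpow_enorm_toReal two_ne_zero ENNReal.ofNat_ne_top,
    ← ENNReal.rpow_natCast, ← ENNReal.rpow_mul]
  simp

/-- Continuity at `0` of the action of translations on `L²`. -/
lemma exists_eLpNorm_translate_le {u : E → F} (hu : MemLp u 2 volume) {δ : ℝ≥0∞} (hδ : 0 < δ) :
    ∃ ε > 0, ∀ h : E, ‖h‖ < ε → eLpNorm (fun z => u (z - h) - u z) 2 volume ≤ δ := by
  haveI : Fact ((1 : ℝ≥0∞) ≤ 2) := ⟨one_le_two⟩
  haveI : Fact ((2 : ℝ≥0∞) ≠ ⊤) := ⟨ENNReal.ofNat_ne_top⟩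
  have hc : Continuous fun h : E => (DomAddAct.mk (-h) +ᵥ hu.toLp u : Lp F 2 volume) :=
    Continuous.vadd (DomAddAct.mkHomeomorph.continuous.comp continuous_neg) continuous_const
  have h0 := hc.tendsto 0
  rw [neg_zero] at h0
  have e0 : (DomAddAct.mk (0 : E) +ᵥ hu.toLp u : Lp F 2 volume) = hu.toLp u := by
    have : DomAddAct.mk (0 : E) = 0 := rfl
    rw [this, zero_vadd]
  rw [e0] at h0
  have h1 := (EMetric.tendsto_nhds.1 h0) δ hδ
  obtain ⟨ε, hε, h2⟩ := Metric.eventually_nhds_iff.1 h1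
  refine ⟨ε, hε, fun h hh => ?_⟩
  have h3 := h2 (y := h) (by simpa using hh)
  rw [DomAddAct.mk_vadd_toLp, Lp.edist_toLp_toLp] at h3
  refine le_of_eq_of_le ?_ h3.le
  congr 1
  ext z
  simp [sub_eq_add_neg, add_comm]

variable [NormedSpace ℝ F] [CompleteSpace F]

lemma tendsto_eLpNorm_moll_sub {u : E → F} (hu : MemLp u 2 volume)
    {φ : ℕ → ContDiffBump (0 : E)} (hφ : Tendsto (fun n => (φ n).rOut) atTop (𝓝 0)) :
    Tendsto (fun n => eLpNorm (fun z => moll (φ n) u z - u z) 2 volume) atTop (𝓝 0) := by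
  rw [ENNReal.tendsto_nhds_zero]
  intro δ hδ
  obtain ⟨ε, hε, h⟩ := exists_eLpNorm_translate_le hu hδ
  filter_upwards [hφ.eventually (gt_mem_nhds hε)] with n hn
  have h1 := lintegral_enorm_moll_sub_sq_le (φ n) (hu.locallyIntegrable one_le_two) univ
    (K := δ ^ 2) (fun h' hh' => by
      rw [Measure.restrict_univ, ← eLpNorm_two_sq]
      gcongr
      exact h h' (hh'.trans hn))
  rw [Measure.restrict_univ, ← eLpNorm_two_sq] at h1
  exact (ENNReal.pow_le_pow_left_iff two_ne_zero).1 h1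

end LTwo

/-! ### Smooth approximation in `W^{2,2}` -/

section Approx

/-- The classical `i`-th partial derivative. -/
noncomputable def pd {m : ℕ} {F : Type*} [NormedAddCommGroup F] [NormedSpace ℝ F] (i : Fin m)
    (u : Euc m → F) (z : Euc m) : F :=
  fderiv ℝ u z (EuclideanSpace.single i 1)

variable {m l : ℕ}

lemma contDiff_pd {F : Type*} [NormedAddCommGroup F] [NormedSpace ℝ F] {u : Euc m → F}
    (hu : ContDiff ℝ ∞ u) (i : Fin m) : ContDiff ℝ ∞ (pd i u) :=
  (hu.fderiv_right (m := ∞) (by simp)).clm_apply contDiff_const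

/-- The derivative falls on the kernel, and `y ↦ φ(z - y)` is an admissible test function because
the closed ball of radius `rOut` about `z` stays inside `Ω`. -/
lemma pd_moll {Ω : Set (Euc m)} (hΩ : MeasurableSet Ω) {i : Fin m} {u g : Euc m → Euc l}
    (hu : LocallyIntegrable (Ω.indicator u)) (h : IsWeakPartial Ω i u g)
    (φ : ContDiffBump (0 : Euc m)) {z : Euc m} (hz : Metric.closedBall z φ.rOut ⊆ Ω) :
    pd i (moll φ (Ω.indicator u)) z = moll φ (Ω.indicator g) z := by
  have hd := (φ.hasCompactSupport_normed (μ := volume)).hasFDerivAt_convolution_left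
    (ContinuousLinearMap.lsmul ℝ ℝ) (φ.contDiff_normed (n := 1)) hu z
  have hcs : HasCompactSupport (fderiv ℝ (φ.normed volume)) :=
    φ.hasCompactSupport_normed.fderiv ℝ
  have hcc : Continuous (fderiv ℝ (φ.normed volume)) :=
    (φ.contDiff_normed (n := 1)).continuous_fderiv one_ne_zero
  have hint := hcs.convolutionExists_left
    ((ContinuousLinearMap.lsmul ℝ ℝ : ℝ →L[ℝ] Euc l →L[ℝ] Euc l).precompL (Euc m)) hcc hu z
  have e1 : pd i (moll φ (Ω.indicator u)) z
      = ∫ t, (fderiv ℝ (φ.normed volume) t (EuclideanSpace.single i 1)) •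
          Ω.indicator u (z - t) := by
    unfold pd moll
    rw [hd.fderiv, convolution_def, ContinuousLinearMap.integral_apply hint]
    rfl
  set ψ : Euc m → ℝ := fun y => φ.normed volume (z - y) with hψ
  have hψt : IsTest Ω ψ := by
    refine ⟨φ.contDiff_normed.comp (contDiff_const.sub contDiff_id), ?_, ?_⟩
    · exact φ.hasCompactSupport_normed.comp_homeomorph (Homeomorph.subLeft z)
    · refine Subset.trans ?_ hz
      have : tsupport ψ = (fun y => z - y) ⁻¹' tsupport (φ.normed volume) :=
        tsupport_comp_eq_preimage (φ.normed volume) (Homeomorph.subLeft z)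
      rw [this, φ.tsupport_normed_eq]
      intro y hy
      simpa [dist_eq_norm, norm_sub_rev] using hy
  have hdψ : ∀ y, fderiv ℝ ψ y (EuclideanSpace.single i 1)
      = - fderiv ℝ (φ.normed volume) (z - y) (EuclideanSpace.single i 1) := by
    intro y
    have : HasFDerivAt ψ ((fderiv ℝ (φ.normed volume) (z - y)).comp
        (-ContinuousLinearMap.id ℝ (Euc m))) y := by
      have h1 : HasFDerivAt (fun y => z - y) (-ContinuousLinearMap.id ℝ (Euc m)) y :=
        (hasFDerivAt_id y).const_sub z
      have h2 : HasFDerivAt (φ.normed volume) (fderiv ℝ (φ.normed volume) (z - y)) (z - y) :=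
        ((φ.contDiff_normed (n := 1)).differentiable one_ne_zero _).hasFDerivAt
      exact h2.comp y h1
    rw [this.fderiv]
    simp
  have e2 := h.2.2 ψ hψt
  rw [e1, ← integral_sub_left_eq_self _ volume z]
  simp_rw [sub_sub_cancel]
  have e3 : ∫ y, (fderiv ℝ (φ.normed volume) (z - y) (EuclideanSpace.single i 1)) •
      Ω.indicator u y = - ∫ y in Ω, (fderiv ℝ ψ y (EuclideanSpace.single i 1)) • u y := by
    rw [← integral_indicator hΩ, ← integral_neg]
    congr 1 with y : 1
    by_cases hy : y ∈ Ω <;> simp [hy, hdψ]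
  rw [e3, e2, neg_neg, moll_apply, ← integral_sub_left_eq_self _ volume z, ← integral_indicator hΩ]
  congr 1 with y : 1
  by_cases hy : y ∈ Ω <;> simp [hy, hψ]

/-- Mollify the extension of `f` by zero. The extension spoils the derivatives only near the
boundary, so the derivatives converge on strictly smaller concentric balls. -/
lemma exists_smooth_approx {x : Euc m} {R R' : ℝ} (hR : R' < R) {f : Euc m → Euc l}
    (hf : MemW22 (Metric.ball x R) f) :
    ∃ u : ℕ → Euc m → Euc l, (∀ n, ContDiff ℝ ∞ (u n)) ∧
      Tendsto (fun n => eLpNorm (fun z => u n z - f z) 2 (volume.restrict (Metric.ball x R')))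
        atTop (𝓝 0) ∧
      (∀ i, Tendsto (fun n => eLpNorm (fun z => pd i (u n) z - weakPartial (Metric.ball x R) i f z)
        2 (volume.restrict (Metric.ball x R'))) atTop (𝓝 0)) ∧
      ∀ i j, Tendsto (fun n => eLpNorm (fun z => pd j (pd i (u n)) z -
        weakPartial (Metric.ball x R) j (weakPartial (Metric.ball x R) i f) z)
        2 (volume.restrict (Metric.ball x R'))) atTop (𝓝 0) := by
  set Ω := Metric.ball x R with hΩ
  have hm : MeasurableSet Ω := Metric.isOpen_ball.measurableSet
  have hsub : Metric.ball x R' ⊆ Ω := Metric.ball_subset_ball hR.le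
  obtain ⟨φ, hφ, hφ'⟩ : ∃ φ : ℕ → ContDiffBump (0 : Euc m),
      Tendsto (fun n => (φ n).rOut) atTop (𝓝 0) ∧ ∀ n, (φ n).rOut ≤ (R - R') / 4 := by
    have hrad : ∀ n : ℕ, 0 < (R - R') / 4 / (n + 1) := fun n => by
      have : 0 < R - R' := by linarith
      positivity
    refine ⟨fun n => ⟨(R - R') / 4 / (n + 1) / 2, (R - R') / 4 / (n + 1), half_pos (hrad n),
      half_lt_self (hrad n)⟩, ?_, fun n => ?_⟩
    · have := (tendsto_const_div_atTop_nhds_zero_nat ((R - R') / 4)).comp (tendsto_add_atTop_nat 1)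
      refine this.congr fun n => ?_
      simp
    · have : (0 : ℝ) ≤ n := n.cast_nonneg
      exact div_le_self (by linarith) (by linarith)
  have key : ∀ g : Euc m → Euc l, MemLp g 2 (volume.restrict Ω) →
      Tendsto (fun n => eLpNorm (fun z => moll (φ n) (Ω.indicator g) z - g z) 2
        (volume.restrict (Metric.ball x R'))) atTop (𝓝 0) := by
    intro g hg
    have h0 : MemLp (Ω.indicator g) 2 volume := (memLp_indicator_iff_restrict hm).2 hg
    have h1 := tendsto_eLpNorm_moll_sub h0 hφ
    suffices hle : ∀ n, eLpNorm (fun z => moll (φ n) (Ω.indicator g) z - g z) 2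
        (volume.restrict (Metric.ball x R')) ≤
        eLpNorm (fun z => moll (φ n) (Ω.indicator g) z - Ω.indicator g z) 2 volume from
      tendsto_of_tendsto_of_tendsto_of_le_of_le tendsto_const_nhds h1 (fun n => zero_le) hle
    intro n
    have h2 : eLpNorm (fun z => moll (φ n) (Ω.indicator g) z - g z) 2
        (volume.restrict (Metric.ball x R')) =
        eLpNorm (fun z => moll (φ n) (Ω.indicator g) z - Ω.indicator g z) 2
        (volume.restrict (Metric.ball x R')) := by
      apply eLpNorm_congr_ae
      filter_upwards [ae_restrict_mem Metric.isOpen_ball.measurableSet] with z hz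
      rw [indicator_of_mem (hsub hz)]
    rw [h2]
    exact eLpNorm_mono_measure _ Measure.restrict_le_self
  have hli : ∀ g : Euc m → Euc l, MemLp g 2 (volume.restrict Ω) →
      LocallyIntegrable (Ω.indicator g) := fun g hg =>
    ((memLp_indicator_iff_restrict hm).2 hg).locallyIntegrable one_le_two
  -- The first-order identity is proved on a ball halfway to `R`, so that it holds in a
  -- neighbourhood of each point of `B_{R'}` and can be differentiated once more there.
  have d1 : ∀ n i, ∀ z ∈ Metric.ball x (R' + (R - R') / 2),
      pd i (moll (φ n) (Ω.indicator f)) z = moll (φ n) (Ω.indicator (weakPartial Ω i f)) z := by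
    intro n i z hz
    refine pd_moll hm (hli f hf.memLp) (isWeakPartial_weakPartial (hf.exists_partial i)) (φ n) ?_
    refine Metric.closedBall_subset_ball' ?_
    have := hφ' n
    rw [Metric.mem_ball] at hz
    linarith
  have d2 : ∀ n i j, ∀ z ∈ Metric.ball x R',
      pd j (pd i (moll (φ n) (Ω.indicator f))) z
        = moll (φ n) (Ω.indicator (weakPartial Ω j (weakPartial Ω i f))) z := by
    intro n i j z hz
    have hz' : z ∈ Metric.ball x (R' + (R - R') / 2) :=
      Metric.ball_subset_ball (by linarith) hz
    have : pd i (moll (φ n) (Ω.indicator f)) =ᶠ[𝓝 z]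
        moll (φ n) (Ω.indicator (weakPartial Ω i f)) := by
      filter_upwards [Metric.isOpen_ball.mem_nhds hz'] with w hw using d1 n i w hw
    have e : pd j (pd i (moll (φ n) (Ω.indicator f))) z
        = pd j (moll (φ n) (Ω.indicator (weakPartial Ω i f))) z := by
      unfold pd at this ⊢
      rw [this.fderiv_eq]
    rw [e]
    refine pd_moll hm (hli _ (hf.memLp_partial i))
      (isWeakPartial_weakPartial (hf.exists_partial_partial i j)) (φ n) ?_
    refine Metric.closedBall_subset_ball' ?_
    have := hφ' n
    rw [Metric.mem_ball] at hz
    linarith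
  refine ⟨fun n => moll (φ n) (Ω.indicator f), fun n => contDiff_moll _ (hli f hf.memLp),
    key f hf.memLp, fun i => ?_, fun i j => ?_⟩
  · refine (key _ (hf.memLp_partial i)).congr fun n => eLpNorm_congr_ae ?_
    filter_upwards [ae_restrict_mem Metric.isOpen_ball.measurableSet] with z hz
    rw [d1 n i z (Metric.ball_subset_ball (by linarith) hz)]
  · refine (key _ (hf.memLp_partial_partial i j)).congr fun n => eLpNorm_congr_ae ?_
    filter_upwards [ae_restrict_mem Metric.isOpen_ball.measurableSet] with z hz
    rw [d2 n i j z hz]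

end Approx

/-! ### The radial field and a Pohozaev identity -/

section Euler

variable {m : ℕ}

lemma pd_mul {a b : Euc m → ℝ} (ha : ContDiff ℝ ∞ a) (hb : ContDiff ℝ ∞ b) (i : Fin m)
    (z : Euc m) : pd i (fun z => a z * b z) z = pd i a z * b z + a z * pd i b z := by
  unfold pd
  rw [fderiv_fun_mul (ha.differentiable (by simp) z) (hb.differentiable (by simp) z)]
  simp
  ring

lemma pd_add {F : Type*} [NormedAddCommGroup F] [NormedSpace ℝ F] {a b : Euc m → F}
    (ha : ContDiff ℝ ∞ a) (hb : ContDiff ℝ ∞ b) (i : Fin m)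
    (z : Euc m) : pd i (fun z => a z + b z) z = pd i a z + pd i b z := by
  unfold pd
  rw [fderiv_fun_add (ha.differentiable (by simp) z) (hb.differentiable (by simp) z)]
  simp

lemma pd_sum {F : Type*} [NormedAddCommGroup F] [NormedSpace ℝ F] {ι : Type*} (s : Finset ι)
    {a : ι → Euc m → F} (ha : ∀ j ∈ s, ContDiff ℝ ∞ (a j)) (i : Fin m) (z : Euc m) :
    pd i (fun z => ∑ j ∈ s, a j z) z = ∑ j ∈ s, pd i (a j) z := by
  unfold pd
  rw [fderiv_fun_sum fun j hj => (ha j hj).differentiable (by simp) z]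
  simp

lemma pd_comm {F : Type*} [NormedAddCommGroup F] [NormedSpace ℝ F] {a : Euc m → F}
    (ha : ContDiff ℝ ∞ a) (i j : Fin m) (z : Euc m) : pd i (pd j a) z = pd j (pd i a) z := by
  have hs : IsSymmSndFDerivAt ℝ a z := ha.contDiffAt.isSymmSndFDerivAt (by
    rw [minSmoothness_of_isRCLikeNormedField]; exact WithTop.coe_le_coe.2 le_top)
  have hd : DifferentiableAt ℝ (fderiv ℝ a) z :=
    ((ha.fderiv_right (m := ∞) (by simp)).differentiable (by simp)) z
  have key : ∀ i j : Fin m, pd i (pd j a) z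
      = fderiv ℝ (fderiv ℝ a) z (EuclideanSpace.single i 1) (EuclideanSpace.single j 1) := by
    intro i j
    unfold pd
    rw [fderiv_clm_apply hd (differentiableAt_const _)]
    simp
  rw [key, key]
  exact hs _ _

/-- The `j`-th coordinate of `z - y`. -/
def coordSub (y : Euc m) (j : Fin m) (z : Euc m) : ℝ := z j - y j

lemma contDiff_coordSub (y : Euc m) (j : Fin m) : ContDiff ℝ ∞ (coordSub y j) := by
  unfold coordSub
  exact (EuclideanSpace.proj j : Euc m →L[ℝ] ℝ).contDiff.sub contDiff_const

lemma pd_coordSub (y : Euc m) (i j : Fin m) (z : Euc m) :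
    pd i (coordSub y j) z = if i = j then 1 else 0 := by
  have h : HasFDerivAt (coordSub y j) (EuclideanSpace.proj j : Euc m →L[ℝ] ℝ) z :=
    (EuclideanSpace.proj j : Euc m →L[ℝ] ℝ).hasFDerivAt.sub_const _
  unfold pd
  rw [h.fderiv]
  simp [eq_comm]

/-- The derivative along the radial field `z - y`. -/
noncomputable def euler {F : Type*} [NormedAddCommGroup F] [NormedSpace ℝ F] (y : Euc m) (u : Euc m → F)
    (z : Euc m) : F :=
  ∑ j, coordSub y j z • pd j u z

lemma contDiff_euler {F : Type*} [NormedAddCommGroup F] [NormedSpace ℝ F] (y : Euc m)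
    {u : Euc m → F} (hu : ContDiff ℝ ∞ u) : ContDiff ℝ ∞ (euler y u) :=
  ContDiff.sum fun j _ => (contDiff_coordSub y j).smul (contDiff_pd hu j)

/-- The commutator of `∂ᵢ` with `T = (z - y)·∇` is `∂ᵢ`. -/
lemma pd_euler (y : Euc m) {u : Euc m → ℝ} (hu : ContDiff ℝ ∞ u) (i : Fin m) (z : Euc m) :
    pd i (euler y u) z = euler y (pd i u) z + pd i u z := by
  unfold euler
  simp only [smul_eq_mul]
  rw [pd_sum _ fun j _ => (contDiff_coordSub y j).mul (contDiff_pd hu j)]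
  simp_rw [pd_mul (contDiff_coordSub y _) (contDiff_pd hu _), pd_coordSub, pd_comm hu i,
    Finset.sum_add_distrib]
  simp [add_comm]

lemma euler_mul (y : Euc m) {a b : Euc m → ℝ} (ha : ContDiff ℝ ∞ a) (hb : ContDiff ℝ ∞ b)
    (z : Euc m) :
    euler y (fun z => a z * b z) z = euler y a z * b z + a z * euler y b z := by
  unfold euler
  simp_rw [pd_mul ha hb, smul_eq_mul, Finset.sum_mul, Finset.mul_sum, ← Finset.sum_add_distrib]
  exact Finset.sum_congr rfl fun j _ => by ring

/-- The functions with vanishing integral. -/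
def NullInt {E : Type*} [MeasurableSpace E] (μ : Measure E) (g : E → ℝ) : Prop :=
  Integrable g μ ∧ ∫ z, g z ∂μ = 0

section NullInt

variable {E : Type*} [MeasurableSpace E] {μ : Measure E} {g g' : E → ℝ}

lemma NullInt.add (h : NullInt μ g) (h' : NullInt μ g') : NullInt μ fun z => g z + g' z :=
  ⟨h.1.add h'.1, by rw [integral_add h.1 h'.1, h.2, h'.2, add_zero]⟩

lemma NullInt.const_mul (c : ℝ) (h : NullInt μ g) : NullInt μ fun z => c * g z :=
  ⟨h.1.const_mul c, by rw [integral_const_mul, h.2, mul_zero]⟩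

lemma NullInt.sum {ι : Type*} (s : Finset ι) {g : ι → E → ℝ} (h : ∀ i ∈ s, NullInt μ (g i)) :
    NullInt μ fun z => ∑ i ∈ s, g i z :=
  ⟨integrable_finsetSum s fun i hi => (h i hi).1, by
    rw [integral_finsetSum s fun i hi => (h i hi).1]
    exact Finset.sum_eq_zero fun i hi => (h i hi).2⟩

end NullInt

lemma hasCompactSupport_pd {a : Euc m → ℝ} (ha : HasCompactSupport a) (i : Fin m) :
    HasCompactSupport (pd i a) := ha.fderiv_apply ℝ _

lemma nullInt_pd {a : Euc m → ℝ} (ha : ContDiff ℝ ∞ a) (hc : HasCompactSupport a) (i : Fin m) :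
    NullInt volume (pd i a) := by
  have hi : Integrable (pd i a) := (contDiff_pd ha i).continuous.integrable_of_hasCompactSupport
    (hasCompactSupport_pd hc i)
  refine ⟨hi, ?_⟩
  have := integral_mul_fderiv_eq_neg_fderiv_mul_of_integrable (μ := (volume : Measure (Euc m)))
    (f := fun _ => (1 : ℝ)) (g := a) (v := EuclideanSpace.single i 1) (by simp)
    (by simp only [one_mul]; exact hi) (by simpa using ha.continuous.integrable_of_hasCompactSupport hc)
    (by simp) (fun x _ => ha.differentiable (by simp) x)
  simpa [pd] using this

/-- `T a + m a` is the divergence of the compactly supported field `a(z)(z - y)`. -/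
lemma nullInt_euler (y : Euc m) {a : Euc m → ℝ} (ha : ContDiff ℝ ∞ a)
    (hc : HasCompactSupport a) : NullInt volume fun z => euler y a z + m * a z := by
  have h : ∀ j, NullInt volume (pd j fun z => coordSub y j z * a z) := fun j =>
    nullInt_pd ((contDiff_coordSub y j).mul ha) hc.mul_left j
  have h2 := NullInt.sum Finset.univ fun j _ => h j
  convert h2 using 2 with z
  simp_rw [pd_mul (contDiff_coordSub y _) ha, pd_coordSub, Finset.sum_add_distrib]
  simp [euler, add_comm]

/-- A Pohozaev-type identity: for a radial weight `w`, the quadratic form obtained by testing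
`Δ²u` with a radial field, rewritten as a sum of squares. -/
lemma nullInt_pohozaev (y : Euc m) {u w τ : Euc m → ℝ} (hu : ContDiff ℝ ∞ u)
    (hw : ContDiff ℝ ∞ w) (hwc : HasCompactSupport w)
    (hτ : ∀ j z, pd j w z = τ z * coordSub y j z) :
    NullInt volume fun z =>
      2 * (∑ j, pd j (pd j u) z) * (2 * w z * euler y (euler y u) z
        + (m * w z + euler y w z) * euler y u z)
      - 4 * w z * ∑ j, pd j (euler y u) z ^ 2
      + (euler y (euler y w) z + (m - 4) * euler y w z
        + (m - 2) * (euler y w z + (m - 4) * w z)) * ∑ j, pd j u z ^ 2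
      + 4 * τ z * euler y u z ^ 2 := by
  set v := euler y u with hv
  have hvs : ContDiff ℝ ∞ v := contDiff_euler y hu
  have hTv := contDiff_euler y hvs
  have hTw := contDiff_euler y hw
  have hTwc : HasCompactSupport (euler y w) := by
    refine hwc.mono' ?_
    intro z hz
    by_contra hcon
    apply hz
    have : ∀ j, pd j w z = 0 := fun j => by
      unfold pd
      rw [fderiv_of_notMem_tsupport ℝ hcon]; rfl
    simp [euler, this]
  -- With this value the coefficient of `∇u·∇v` in the final sum vanishes.
  set c : Euc m → ℝ := fun z => euler y w z + (m - 4) * w z with hc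
  have hcs : ContDiff ℝ ∞ c := hTw.add (contDiff_const.mul hw)
  have hcc : HasCompactSupport c := hTwc.add hwc.mul_left
  have hΔ : ContDiff ℝ ∞ fun z => ∑ j, pd j (pd j u) z :=
    ContDiff.sum fun j _ => contDiff_pd (contDiff_pd hu j) j
  have hTc : ∀ z, euler y c z = euler y (euler y w) z + (m - 4) * euler y w z := by
    intro z
    have h0 : ∀ j, pd j (fun _ : Euc m => (m : ℝ) - 4) z = 0 := fun j => by simp [pd]
    have h1 : ∀ j, pd j c z = pd j (euler y w) z + (m - 4) * pd j w z := fun j => by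
      rw [hc, pd_add hTw (contDiff_const.mul hw), pd_mul contDiff_const hw, h0]
      ring
    have h2 : euler y c z = ∑ j, coordSub y j z * pd j c z := rfl
    have h3 : euler y (euler y w) z = ∑ j, coordSub y j z * pd j (euler y w) z := rfl
    have h4 : euler y w z = ∑ j, coordSub y j z * pd j w z := rfl
    rw [h2, h3, h4, Finset.mul_sum, ← Finset.sum_add_distrib]
    exact Finset.sum_congr rfl fun j _ => by rw [h1]; ring
  -- Commuting the radial field past the Laplacian costs `2Δ`.
  have hTΔ : ∀ z, euler y (fun z => ∑ j, pd j (pd j u) z) z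
      = ∑ j, pd j (pd j v) z - 2 * ∑ j, pd j (pd j u) z := by
    intro z
    have e1 : ∀ j, pd j (pd j v) z = euler y (pd j (pd j u)) z + 2 * pd j (pd j u) z := by
      intro j
      have : pd j v = fun z => euler y (pd j u) z + pd j u z := funext (pd_euler y hu j)
      rw [this, pd_add (contDiff_euler y (contDiff_pd hu j)) (contDiff_pd hu j),
        pd_euler y (contDiff_pd hu j)]
      ring
    simp_rw [e1, Finset.sum_add_distrib, ← Finset.mul_sum]
    simp only [add_sub_cancel_right, euler, smul_eq_mul]
    simp_rw [pd_sum Finset.univ (fun k _ => contDiff_pd (contDiff_pd hu k) k), Finset.mul_sum]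
    exact Finset.sum_comm
  -- Six families of exact divergences, with `v = Tu`. In the combination `N` below, the terms
  -- containing `vΔv`, `∇u·∇v` and `τ v Tv` cancel, and what remains is the integrand.
  have n1 : ∀ j, NullInt volume (pd j fun z => pd j u z * (w z * euler y v z)) := fun j =>
    nullInt_pd ((contDiff_pd hu j).mul (hw.mul hTv)) (hwc.mul_right.mul_left) j
  have n2 := fun j => nullInt_euler y
    (((hw.mul (contDiff_pd hu j))).mul (contDiff_pd hvs j))
    (hwc.mul_right.mul_right : HasCompactSupport fun z => w z * pd j u z * pd j v z)
  have n3 := nullInt_euler y (hΔ.mul (hw.mul hvs))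
    (hwc.mul_right.mul_left : HasCompactSupport fun z => (∑ j, pd j (pd j u) z) * (w z * v z))
  have n4 : ∀ j, NullInt volume (pd j fun z => w z * v z * pd j v z) := fun j =>
    nullInt_pd ((hw.mul hvs).mul (contDiff_pd hvs j)) (hwc.mul_right.mul_right) j
  have n5 : ∀ j, NullInt volume (pd j fun z => w z * v z * pd j u z) := fun j =>
    nullInt_pd ((hw.mul hvs).mul (contDiff_pd hu j)) (hwc.mul_right.mul_right) j
  have n6 := fun j => nullInt_euler y (hcs.mul ((contDiff_pd hu j).mul (contDiff_pd hu j)))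
    (hcc.mul_right : HasCompactSupport fun z => c z * (pd j u z * pd j u z))
  have N := ((NullInt.sum Finset.univ fun j _ => (((n1 j).const_mul 2).add
    ((n2 j).const_mul (-2))).add ((((n4 j).const_mul (-2)).add ((n5 j).const_mul 4)).add
    (n6 j))).add (n3.const_mul 2))
  convert N using 2 with z
  have hwz := fun j => hτ j z
  have hvz : v z = ∑ j, coordSub y j z * pd j u z := rfl
  have hTvz : euler y v z = ∑ j, coordSub y j z * pd j v z := rfl
  have hpv : ∀ j, euler y (pd j u) z = pd j v z - pd j u z := fun j => by
    rw [hv, pd_euler y hu]; ring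
  have expand : ∀ j,
      2 * pd j (fun z => pd j u z * (w z * euler y v z)) z +
        -2 * (euler y (fun z => w z * pd j u z * pd j v z) z + m * (w z * pd j u z * pd j v z)) +
        (-2 * pd j (fun z => w z * v z * pd j v z) z +
          4 * pd j (fun z => w z * v z * pd j u z) z +
        (euler y (fun z => c z * (pd j u z * pd j u z)) z + m * (c z * (pd j u z * pd j u z))))
      = (2 * w z * euler y v z + 4 * w z * v z) * pd j (pd j u) z
        + (2 * τ z * euler y v z + 4 * τ z * v z) * (coordSub y j z * pd j u z)
        + (-2 * τ z * v z) * (coordSub y j z * pd j v z)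
        + (-4 * w z) * pd j v z ^ 2 + (-2 * w z * v z) * pd j (pd j v) z
        + (-2 * euler y w z + 8 * w z - 2 * m * w z + 2 * c z) * (pd j u z * pd j v z)
        + (euler y c z - 2 * c z + m * c z) * pd j u z ^ 2 := by
    intro j
    rw [pd_mul (contDiff_pd hu j) (hw.mul hTv), pd_mul hw hTv,
      euler_mul y (hw.mul (contDiff_pd hu j)) (contDiff_pd hvs j),
      euler_mul y hw (contDiff_pd hu j), pd_mul (hw.mul hvs) (contDiff_pd hvs j),
      pd_mul (hw.mul hvs) (contDiff_pd hu j), pd_mul hw hvs,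
      euler_mul y hcs ((contDiff_pd hu j).mul (contDiff_pd hu j)),
      euler_mul y (contDiff_pd hu j) (contDiff_pd hu j), pd_euler y hvs, hpv j, hwz j]
    ring
  rw [Finset.sum_congr rfl fun j _ => expand j]
  simp only [Finset.sum_add_distrib, ← Finset.mul_sum, ← hvz, ← hTvz]
  rw [euler_mul y hΔ (hw.mul hvs), euler_mul y hw hvs, hTΔ z, hTc z]
  simp only [hc]
  ring

end Euler

/-! ### Algebra of `L²` convergence -/

section TendstoLtwo

variable {α : Type*} [MeasurableSpace α] {μ : Measure α} {F : Type*} [NormedAddCommGroup F]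

/-- Convergence in `L²(μ)`. -/
structure TendstoLtwo (μ : Measure α) (p : ℕ → α → F) (q : α → F) : Prop where
  memLp_seq : ∀ n, MemLp (p n) 2 μ
  memLp : MemLp q 2 μ
  tendsto : Tendsto (fun n => eLpNorm (fun z => p n z - q z) 2 μ) atTop (𝓝 0)

namespace TendstoLtwo

variable {p p' : ℕ → α → F} {q q' : α → F}

lemma add (h : TendstoLtwo μ p q) (h' : TendstoLtwo μ p' q') :
    TendstoLtwo μ (fun n z => p n z + p' n z) (fun z => q z + q' z) := by
  refine ⟨fun n => (h.memLp_seq n).add (h'.memLp_seq n), h.memLp.add h'.memLp, ?_⟩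
  have h3 := h.tendsto.add h'.tendsto
  rw [add_zero] at h3
  refine tendsto_of_tendsto_of_tendsto_of_le_of_le tendsto_const_nhds h3 (fun _ => zero_le)
    fun n => ?_
  refine le_trans (le_of_eq ?_) (eLpNorm_add_le ((h.memLp_seq n).sub h.memLp).1
    ((h'.memLp_seq n).sub h'.memLp).1 one_le_two)
  congr 1 with z
  simp only [Pi.add_apply, Pi.sub_apply]
  abel

lemma zero : TendstoLtwo μ (fun _ _ => (0 : F)) (fun _ => 0) :=
  ⟨fun _ => MemLp.zero, MemLp.zero, by simp⟩

lemma sum {ι : Type*} (s : Finset ι) {p : ι → ℕ → α → F} {q : ι → α → F}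
    (h : ∀ i ∈ s, TendstoLtwo μ (p i) (q i)) :
    TendstoLtwo μ (fun n z => ∑ i ∈ s, p i n z) (fun z => ∑ i ∈ s, q i z) := by
  classical
  induction s using Finset.induction_on with
  | empty => simpa using zero
  | insert a s ha ih =>
    simp_rw [Finset.sum_insert ha]
    exact (h a (Finset.mem_insert_self a s)).add
      (ih fun i hi => h i (Finset.mem_insert_of_mem hi))

variable [NormedSpace ℝ F]

lemma smul (h : TendstoLtwo μ p q) {c : α → ℝ} (hc : AEStronglyMeasurable c μ) {M : ℝ}
    (hM : ∀ᵐ z ∂μ, |c z| ≤ M) :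
    TendstoLtwo μ (fun n z => c z • p n z) (fun z => c z • q z) := by
  have hcL : MemLp c ⊤ μ := memLp_top_of_bound hc M hM
  refine ⟨fun n => (h.memLp_seq n).smul hcL, h.memLp.smul hcL, ?_⟩
  have h3 := ENNReal.Tendsto.const_mul (a := ENNReal.ofReal M) h.tendsto
    (Or.inr ENNReal.ofReal_ne_top)
  rw [mul_zero] at h3
  refine tendsto_of_tendsto_of_tendsto_of_le_of_le tendsto_const_nhds h3 (fun _ => zero_le)
    fun n => ?_
  refine eLpNorm_le_mul_eLpNorm_of_ae_le_mul ?_ 2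
  filter_upwards [hM] with z hz
  rw [← smul_sub, norm_smul]
  exact mul_le_mul_of_nonneg_right hz (norm_nonneg _)

end TendstoLtwo

lemma TendstoLtwo.integral_inner {F : Type*} [NormedAddCommGroup F] [InnerProductSpace ℝ F]
    {p p' : ℕ → α → F} {q q' : α → F}
    (h : TendstoLtwo μ p q) (h' : TendstoLtwo μ p' q') :
    Tendsto (fun n => ∫ z, inner ℝ (p n z) (p' n z) ∂μ) atTop (𝓝 (∫ z, inner ℝ (q z) (q' z) ∂μ)) := by
  have key : ∀ {a b : α → F} (ha : MemLp a 2 μ) (hb : MemLp b 2 μ),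
      ∫ z, inner ℝ (a z) (b z) ∂μ = inner ℝ (ha.toLp a) (hb.toLp b) := by
    intro a b ha hb
    rw [L2.inner_def]
    apply integral_congr_ae
    filter_upwards [ha.coeFn_toLp, hb.coeFn_toLp] with z h1 h2
    rw [h1, h2]
  have conv : ∀ {p : ℕ → α → F} {q : α → F} (h : TendstoLtwo μ p q),
      Tendsto (fun n => (h.memLp_seq n).toLp (p n)) atTop (𝓝 (h.memLp.toLp q)) := by
    intro p q h
    rw [Lp.tendsto_Lp_iff_tendsto_eLpNorm'']
    exact h.tendsto
  simp_rw [fun n => key (h.memLp_seq n) (h'.memLp_seq n), key h.memLp h'.memLp]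
  exact (conv h).inner (conv h')

lemma integrable_inner_of_memLp {F : Type*} [NormedAddCommGroup F] [InnerProductSpace ℝ F]
    {a b : α → F} (ha : MemLp a 2 μ) (hb : MemLp b 2 μ) :
    Integrable (fun z => inner ℝ (a z) (b z)) μ := by
  refine (L2.integrable_inner (𝕜 := ℝ) (ha.toLp a) (hb.toLp b)).congr ?_
  filter_upwards [ha.coeFn_toLp, hb.coeFn_toLp] with z h1 h2
  rw [h1, h2]

end TendstoLtwo

/-! ### The Pohozaev inequality for `W^{2,2}` maps -/

section Weighted

variable {m l : ℕ}

lemma exists_abs_le_ball {c : Euc m → ℝ} (hc : Continuous c) (x : Euc m) (R : ℝ) :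
    ∃ M, ∀ᵐ z ∂(volume.restrict (Metric.ball x R)), |c z| ≤ M := by
  obtain ⟨M, hM⟩ := (isCompact_closedBall x R).exists_bound_of_continuousOn hc.continuousOn
  refine ⟨M, ?_⟩
  filter_upwards [ae_restrict_mem Metric.isOpen_ball.measurableSet] with z hz
  exact hM z (Metric.ball_subset_closedBall hz)

lemma TendstoLtwo.smul_continuous {F : Type*} [NormedAddCommGroup F] [NormedSpace ℝ F]
    {x : Euc m} {R : ℝ} {p : ℕ → Euc m → F} {q : Euc m → F}
    (h : TendstoLtwo (volume.restrict (Metric.ball x R)) p q) {c : Euc m → ℝ} (hc : Continuous c) :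
    TendstoLtwo (volume.restrict (Metric.ball x R)) (fun n z => c z • p n z)
      (fun z => c z • q z) := by
  obtain ⟨M, hM⟩ := exists_abs_le_ball hc x R
  exact h.smul hc.aestronglyMeasurable hM

lemma memLp_ball_of_continuous {F : Type*} [NormedAddCommGroup F] {c : Euc m → F}
    (hc : Continuous c) (x : Euc m) (R : ℝ) : MemLp c 2 (volume.restrict (Metric.ball x R)) := by
  obtain ⟨M, hM⟩ := (isCompact_closedBall x R).exists_bound_of_continuousOn hc.continuousOn
  haveI : IsFiniteMeasure (volume.restrict (Metric.ball x R)) :=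
    ⟨by rw [Measure.restrict_apply_univ]; exact measure_ball_lt_top⟩
  refine MemLp.of_bound hc.aestronglyMeasurable M ?_
  filter_upwards [ae_restrict_mem Metric.isOpen_ball.measurableSet] with z hz
  exact hM z (Metric.ball_subset_closedBall hz)

/-- Smooth approximation of a `W^{2,2}` map together with its derivatives. -/
lemma exists_tendstoLtwo {x : Euc m} {R R' : ℝ} (hR : R' < R) {f : Euc m → Euc l}
    (hf : MemW22 (Metric.ball x R) f) :
    ∃ u : ℕ → Euc m → Euc l, (∀ n, ContDiff ℝ ∞ (u n)) ∧
      TendstoLtwo (volume.restrict (Metric.ball x R')) u f ∧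
      (∀ i, TendstoLtwo (volume.restrict (Metric.ball x R')) (fun n => pd i (u n))
        (weakPartial (Metric.ball x R) i f)) ∧
      ∀ i j, TendstoLtwo (volume.restrict (Metric.ball x R')) (fun n => pd j (pd i (u n)))
        (weakPartial (Metric.ball x R) j (weakPartial (Metric.ball x R) i f)) := by
  obtain ⟨u, hu, h0, h1, h2⟩ := exists_smooth_approx hR hf
  have hmono : ∀ {g : Euc m → Euc l}, MemLp g 2 (volume.restrict (Metric.ball x R)) →
      MemLp g 2 (volume.restrict (Metric.ball x R')) := fun hg =>
    hg.mono_measure (Measure.restrict_mono (Metric.ball_subset_ball hR.le) le_rfl)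
  exact ⟨u, hu, ⟨fun n => memLp_ball_of_continuous (hu n).continuous x R', hmono hf.memLp, h0⟩,
    fun i => ⟨fun n => memLp_ball_of_continuous (contDiff_pd (hu n) i).continuous x R',
      hmono (hf.memLp_partial i), h1 i⟩,
    fun i j => ⟨fun n => memLp_ball_of_continuous
      (contDiff_pd (contDiff_pd (hu n) i) j).continuous x R',
      hmono (hf.memLp_partial_partial i j), h2 i j⟩⟩

lemma pd_apply {u : Euc m → Euc l} (hu : ContDiff ℝ ∞ u) (j : Fin m) (a : Fin l) (z : Euc m) :
    pd j (fun z => u z a) z = pd j u z a := by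
  have h : HasFDerivAt (fun z => u z a)
      ((EuclideanSpace.proj a : Euc l →L[ℝ] ℝ).comp (fderiv ℝ u z)) z :=
    (EuclideanSpace.proj a : Euc l →L[ℝ] ℝ).hasFDerivAt.comp z
      (hu.differentiable (by simp) z).hasFDerivAt
  unfold pd
  rw [h.fderiv]
  rfl

lemma euler_apply (y : Euc m) {u : Euc m → Euc l} (hu : ContDiff ℝ ∞ u) (a : Fin l) (z : Euc m) :
    euler y (fun z => u z a) z = euler y u z a := by
  simp [euler, pd_apply hu]

lemma contDiff_apply_coord {u : Euc m → Euc l} (hu : ContDiff ℝ ∞ u) (a : Fin l) :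
    ContDiff ℝ ∞ fun z => u z a :=
  (EuclideanSpace.proj a : Euc l →L[ℝ] ℝ).contDiff.comp hu

lemma pd_smul {F : Type*} [NormedAddCommGroup F] [NormedSpace ℝ F] {a : Euc m → ℝ} {b : Euc m → F}
    (ha : ContDiff ℝ ∞ a) (hb : ContDiff ℝ ∞ b) (i : Fin m) (z : Euc m) :
    pd i (fun z => a z • b z) z = a z • pd i b z + pd i a z • b z := by
  unfold pd
  rw [fderiv_fun_smul (ha.differentiable (by simp) z) (hb.differentiable (by simp) z)]
  simp

/-- The second radial derivative `∂_X ∂_X u`, `X(z) = z - y`, in terms of weak derivatives. -/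
noncomputable def radialDeriv2 (Ω : Set (Euc m)) (y : Euc m) (u : Euc m → Euc l) (z : Euc m) :
    Euc l :=
  ∑ i, ∑ j, (coordSub y i z * coordSub y j z) • weakPartial Ω j (weakPartial Ω i u) z
    + radialDeriv Ω y u z

lemma euler_euler (y : Euc m) {u : Euc m → Euc l} (hu : ContDiff ℝ ∞ u) (z : Euc m) :
    euler y (euler y u) z =
      ∑ i, ∑ j, (coordSub y i z * coordSub y j z) • pd j (pd i u) z + euler y u z := by
  have h : ∀ j, pd j (euler y u) z =
      ∑ i, (coordSub y i z • pd j (pd i u) z) + pd j u z := by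
    intro j
    have hs : ∀ i ∈ Finset.univ, ContDiff ℝ ∞ fun z => coordSub y i z • pd i u z := fun i _ =>
      (contDiff_coordSub y i).smul (contDiff_pd hu i)
    have e : ∀ i, pd j (fun z => coordSub y i z • pd i u z) z =
        coordSub y i z • pd j (pd i u) z + (if j = i then (1 : ℝ) else 0) • pd i u z := by
      intro i
      rw [← pd_coordSub y j i z, pd_smul (contDiff_coordSub y i) (contDiff_pd hu i)]
    have e2 : pd j (euler y u) z = ∑ i, pd j (fun z => coordSub y i z • pd i u z) z :=
      pd_sum Finset.univ hs j z
    rw [e2, Finset.sum_congr rfl fun i _ => e i, Finset.sum_add_distrib]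
    simp
  have : euler y (euler y u) z = ∑ j, coordSub y j z • pd j (euler y u) z := rfl
  rw [this, Finset.sum_congr rfl fun j _ => by rw [h j]]
  simp_rw [smul_add, Finset.smul_sum, Finset.sum_add_distrib, smul_smul]
  rw [Finset.sum_comm]
  simp_rw [mul_comm]
  rfl

/-- The quadratic integrand of the Pohozaev inequality, as a function of the jet of a map. -/
noncomputable def pohozaevForm (a b c τ : ℝ) (lap v v2 : Euc l) (g2 : ℝ) : ℝ :=
  2 * inner ℝ lap ((2 * a) • v2 + b • v) + c * g2 + 4 * τ * ‖v‖ ^ 2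

/-- Sum the scalar identity over the components of `u`. The form omits the term `-4 w |∇(Tu)|²`, so
its integral equals that of `4 w |∇(Tu)|²`, which is nonnegative since `w ≥ 0`. -/
lemma integral_pohozaev_smooth (y : Euc m) {u : Euc m → Euc l} {w τ : Euc m → ℝ}
    (hu : ContDiff ℝ ∞ u) (hw : ContDiff ℝ ∞ w) (hwc : HasCompactSupport w)
    (hτ : ∀ j z, pd j w z = τ z * coordSub y j z) (hw0 : ∀ z, 0 ≤ w z) (hτs : Continuous τ)
    (hτc : HasCompactSupport τ) :
    0 ≤ ∫ z, pohozaevForm (w z) (m * w z + euler y w z)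
      (euler y (euler y w) z + (m - 4) * euler y w z
        + (m - 2) * (euler y w z + (m - 4) * w z)) (τ z)
      (∑ j, pd j (pd j u) z) (euler y u z) (euler y (euler y u) z) (∑ j, ‖pd j u z‖ ^ 2) := by
  have h := NullInt.sum Finset.univ fun (a : Fin l) _ =>
    nullInt_pohozaev y (contDiff_apply_coord hu a) hw hwc hτ
  have hnn : 0 ≤ ∫ z, 4 * w z * ∑ a : Fin l, ∑ j, pd j (euler y fun z => u z a) z ^ 2 := by
    refine integral_nonneg fun z => ?_
    have := hw0 z
    positivity
  have hint : Integrable fun z => 4 * w z * ∑ a : Fin l, ∑ j, pd j (euler y fun z => u z a) z ^ 2 := by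
    refine Continuous.integrable_of_hasCompactSupport ?_ ?_
    · refine (continuous_const.mul hw.continuous).mul ?_
      refine continuous_finsetSum _ fun a _ => continuous_finsetSum _ fun j _ => ?_
      exact (contDiff_pd (contDiff_euler y (contDiff_apply_coord hu a)) j).continuous.pow 2
    · exact (hwc.mul_left).mul_right
  have e : ∀ z, pohozaevForm (w z) (m * w z + euler y w z)
      (euler y (euler y w) z + (m - 4) * euler y w z
        + (m - 2) * (euler y w z + (m - 4) * w z)) (τ z)
      (∑ j, pd j (pd j u) z) (euler y u z) (euler y (euler y u) z) (∑ j, ‖pd j u z‖ ^ 2)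
      = (∑ a : Fin l, (2 * (∑ j, pd j (pd j fun z => u z a) z) *
          (2 * w z * euler y (euler y fun z => u z a) z
        + (m * w z + euler y w z) * euler y (fun z => u z a) z)
      - 4 * w z * ∑ j, pd j (euler y fun z => u z a) z ^ 2
      + (euler y (euler y w) z + (m - 4) * euler y w z
        + (m - 2) * (euler y w z + (m - 4) * w z)) * ∑ j, pd j (fun z => u z a) z ^ 2
      + 4 * τ z * euler y (fun z => u z a) z ^ 2))
      + 4 * w z * ∑ a : Fin l, ∑ j, pd j (euler y fun z => u z a) z ^ 2 := by
    intro z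
    have e1 : ∀ (a : Fin l) j, pd j (pd j fun z => u z a) z = pd j (pd j u) z a := by
      intro a j
      rw [show (pd j fun z => u z a) = fun z => pd j u z a from funext (pd_apply hu j a),
        pd_apply (contDiff_pd hu j)]
    have e2 : ∀ a : Fin l, euler y (euler y fun z => u z a) z = euler y (euler y u) z a := by
      intro a
      rw [show (euler y fun z => u z a) = fun z => euler y u z a from funext (euler_apply y hu a),
        euler_apply y (contDiff_euler y hu)]
    have e3 : ∀ a : Fin l, (∑ j, pd j (pd j u) z a) = (∑ j, pd j (pd j u) z) a := fun a => by simp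
    simp only [e1, e2, e3, pd_apply hu, euler_apply y hu]
    unfold pohozaevForm
    generalize (∑ j, pd j (pd j u) z) = L
    have k1 : 2 * inner ℝ L ((2 * w z) • euler y (euler y u) z
        + (m * w z + euler y w z) • euler y u z) = ∑ a, 2 * L a * (2 * w z * euler y (euler y u) z a
          + (m * w z + euler y w z) * euler y u z a) := by
      rw [PiLp.inner_apply, Finset.mul_sum]
      refine Finset.sum_congr rfl fun a _ => ?_
      simp
      ring
    have k2 : ∀ c : ℝ, c * ∑ j, ‖pd j u z‖ ^ 2 = ∑ a, c * ∑ j, pd j u z a ^ 2 := by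
      intro c
      rw [← Finset.mul_sum, Finset.sum_comm]
      simp_rw [EuclideanSpace.norm_sq_eq, Real.norm_eq_abs, sq_abs]
    have k3 : 4 * τ z * ‖euler y u z‖ ^ 2 = ∑ a, 4 * τ z * euler y u z a ^ 2 := by
      rw [← Finset.mul_sum]
      simp_rw [EuclideanSpace.norm_sq_eq, Real.norm_eq_abs, sq_abs]
    rw [k1, k2, k3, ← Finset.sum_add_distrib, ← Finset.sum_add_distrib,
      Finset.mul_sum Finset.univ _ (4 * w z), ← Finset.sum_add_distrib]
    refine Finset.sum_congr rfl fun a _ => ?_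
    ring
  simp_rw [e]
  rw [integral_add h.1 hint, h.2, zero_add]
  exact hnn

lemma norm_sq_eq_inner {F : Type*} [NormedAddCommGroup F] [InnerProductSpace ℝ F] (v : F) :
    ‖v‖ ^ 2 = inner ℝ v v := (real_inner_self_eq_norm_sq v).symm

/-- The form is quadratic in the derivatives of order one and two with bounded continuous
coefficients, hence continuous under `L²` convergence of these derivatives; the smooth case passes
to the limit. -/
lemma integral_pohozaev_nonneg {x : Euc m} {R : ℝ} {f : Euc m → Euc l}
    (hf : MemW22 (Metric.ball x R) f) (y : Euc m) {w τ : Euc m → ℝ}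
    (hw : ContDiff ℝ ∞ w) (hwc : HasCompactSupport w)
    (hws : tsupport w ⊆ Metric.ball x R) (hτ : ∀ j z, pd j w z = τ z * coordSub y j z)
    (hw0 : ∀ z, 0 ≤ w z) (hτs : Continuous τ) (hτz : tsupport τ ⊆ tsupport w) :
    0 ≤ ∫ z in Metric.ball x R, pohozaevForm (w z) (m * w z + euler y w z)
      (euler y (euler y w) z + (m - 4) * euler y w z
        + (m - 2) * (euler y w z + (m - 4) * w z)) (τ z)
      (weakLaplacian (Metric.ball x R) f z) (radialDeriv (Metric.ball x R) y f z)
      (radialDeriv2 (Metric.ball x R) y f z) (gradSq (Metric.ball x R) f z) := by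
  -- Approximations converge only on smaller balls, and one of these already contains the supports
  -- of all the coefficients.
  obtain ⟨R', hR', hsub⟩ := exists_lt_subset_ball (isClosed_tsupport w) hws
  obtain ⟨u, hu, h0, h1, h2⟩ := exists_tendstoLtwo hR' hf
  set B := Metric.ball x R' with hB
  have hT0 : ∀ (c : Euc m → ℝ), tsupport c ⊆ tsupport w → ∀ j, tsupport (pd j c) ⊆ tsupport w := by
    intro c hc j
    exact (tsupport_fderiv_apply_subset ℝ _).trans hc
  have hE0 : ∀ (c : Euc m → ℝ), tsupport c ⊆ tsupport w → tsupport (euler y c) ⊆ tsupport w := by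
    intro c hc
    refine closure_minimal (fun z hz => ?_) (isClosed_tsupport w)
    by_contra hcon
    apply hz
    have : ∀ j, pd j c z = 0 := fun j =>
      image_eq_zero_of_notMem_tsupport fun hh => hcon (hT0 c hc j hh)
    simp [euler, this]
  have hwE := hE0 w subset_rfl
  have hwEE := hE0 _ hwE
  set b : Euc m → ℝ := fun z => m * w z + euler y w z with hb
  set c : Euc m → ℝ := fun z => euler y (euler y w) z + (m - 4) * euler y w z
        + (m - 2) * (euler y w z + (m - 4) * w z) with hc
  have hEw := contDiff_euler y hw
  have hEEw := contDiff_euler y hEw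
  have hbc : Continuous b := (continuous_const.mul hw.continuous).add hEw.continuous
  have hcc : Continuous c := (hEEw.continuous.add (continuous_const.mul hEw.continuous)).add
    (continuous_const.mul (hEw.continuous.add (continuous_const.mul hw.continuous)))
  have hzero : ∀ z, z ∉ B → w z = 0 ∧ b z = 0 ∧ c z = 0 ∧ τ z = 0 := by
    intro z hz
    have hz' : z ∉ tsupport w := fun hh => hz (hsub hh)
    have a1 := image_eq_zero_of_notMem_tsupport hz'
    have a2 := image_eq_zero_of_notMem_tsupport fun hh => hz' (hwE hh)
    have a3 := image_eq_zero_of_notMem_tsupport fun hh => hz' (hwEE hh)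
    have a4 := image_eq_zero_of_notMem_tsupport fun hh => hz' (hτz hh)
    simp [hb, hc, a1, a2, a3, a4]
  have hP0 : ∀ z, z ∉ B → ∀ (L v v2 : Euc l) (g : ℝ),
      pohozaevForm (w z) (b z) (c z) (τ z) L v v2 g = 0 := by
    intro z hz L v v2 g
    obtain ⟨a1, a2, a3, a4⟩ := hzero z hz
    simp [pohozaevForm, a1, a2, a3, a4]
  have hsm : ∀ n, 0 ≤ ∫ z in B, pohozaevForm (w z) (b z) (c z) (τ z)
      (∑ j, pd j (pd j (u n)) z) (∑ j, coordSub y j z • pd j (u n) z)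
      (∑ i, ∑ j, (coordSub y i z * coordSub y j z) • pd j (pd i (u n)) z +
        ∑ j, coordSub y j z • pd j (u n) z) (∑ j, ‖pd j (u n) z‖ ^ 2) := by
    intro n
    have h3 := integral_pohozaev_smooth y (hu n) hw hwc hτ hw0 hτs
      (hwc.of_isClosed_subset (isClosed_tsupport τ) hτz)
    rw [setIntegral_eq_integral_of_forall_compl_eq_zero fun z hz => hP0 z hz _ _ _ _]
    simp_rw [euler_euler y (hu n)] at h3
    exact h3
  have hv := TendstoLtwo.sum Finset.univ fun j _ =>
    (h1 j).smul_continuous (contDiff_coordSub y j).continuous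
  have hL := TendstoLtwo.sum Finset.univ fun j _ => h2 j j
  have hv2 := (TendstoLtwo.sum Finset.univ fun i _ => TendstoLtwo.sum Finset.univ fun j _ =>
    (h2 i j).smul_continuous (c := fun z => coordSub y i z * coordSub y j z)
      ((contDiff_coordSub y i).continuous.mul (contDiff_coordSub y j).continuous)).add hv
  have hW := (hv2.smul_continuous (c := fun z => 2 * w z) (continuous_const.mul hw.continuous)).add
    (hv.smul_continuous hbc)
  have t1 := hL.integral_inner hW
  have t2 := tendsto_finsetSum Finset.univ fun j _ =>
    ((h1 j).smul_continuous hcc).integral_inner (h1 j)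
  have t3 := (hv.smul_continuous (c := fun z => 4 * τ z) (continuous_const.mul hτs)).integral_inner hv
  have t := ((t1.const_mul 2).add t2).add t3
  have comb : ∀ (L v v2 : Euc m → Euc l) (g : Fin m → Euc m → Euc l),
      MemLp L 2 (volume.restrict B) → MemLp v 2 (volume.restrict B) →
      MemLp (fun z => (2 * w z) • v2 z + b z • v z) 2 (volume.restrict B) →
      (∀ j, MemLp (g j) 2 (volume.restrict B)) →
      (∀ j, MemLp (fun z => c z • g j z) 2 (volume.restrict B)) →
      MemLp (fun z => (4 * τ z) • v z) 2 (volume.restrict B) →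
      2 * (∫ z in B, inner ℝ (L z) ((2 * w z) • v2 z + b z • v z))
        + ∑ j, (∫ z in B, inner ℝ (c z • g j z) (g j z))
        + ∫ z in B, inner ℝ ((4 * τ z) • v z) (v z)
      = ∫ z in B, pohozaevForm (w z) (b z) (c z) (τ z) (L z) (v z) (v2 z) (∑ j, ‖g j z‖ ^ 2) := by
    intro L v v2 g i1 i2 i3 i4 i5 i6
    have j1 := (integrable_inner_of_memLp i1 i3).const_mul 2
    have j2 := integrable_finsetSum Finset.univ fun j _ => integrable_inner_of_memLp (i5 j) (i4 j)
    have j3 := integrable_inner_of_memLp i6 i2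
    have j12 : Integrable (fun z => 2 * inner ℝ (L z) ((2 * w z) • v2 z + b z • v z)
        + ∑ j, inner ℝ (c z • g j z) (g j z)) (volume.restrict B) := j1.add j2
    rw [← integral_const_mul, ← integral_finsetSum _ fun j _ =>
      integrable_inner_of_memLp (i5 j) (i4 j), ← integral_add j1 j2, ← integral_add j12 j3]
    congr 1 with z
    simp only [pohozaevForm, norm_sq_eq_inner, Finset.mul_sum, real_inner_smul_left, Pi.add_apply]
  have tt : Tendsto (fun n => ∫ z in B, pohozaevForm (w z) (b z) (c z) (τ z)
      (∑ j, pd j (pd j (u n)) z) (∑ j, coordSub y j z • pd j (u n) z)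
      (∑ i, ∑ j, (coordSub y i z * coordSub y j z) • pd j (pd i (u n)) z +
        ∑ j, coordSub y j z • pd j (u n) z) (∑ j, ‖pd j (u n) z‖ ^ 2)) atTop
      (𝓝 (∫ z in B, pohozaevForm (w z) (b z) (c z) (τ z)
      (weakLaplacian (Metric.ball x R) f z) (radialDeriv (Metric.ball x R) y f z)
      (radialDeriv2 (Metric.ball x R) y f z) (gradSq (Metric.ball x R) f z))) := by
    have hcg := fun j => (h1 j).smul_continuous hcc
    have hτv := hv.smul_continuous (c := fun z => 4 * τ z) (continuous_const.mul hτs)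
    have e1 := fun n => comb _ _ _ (fun j => pd j (u n)) (hL.memLp_seq n) (hv.memLp_seq n)
      (hW.memLp_seq n) (fun j => (h1 j).memLp_seq n) (fun j => (hcg j).memLp_seq n)
      (hτv.memLp_seq n)
    have e2 := comb _ _ _ (fun j => weakPartial (Metric.ball x R) j f) hL.memLp hv.memLp
      hW.memLp (fun j => (h1 j).memLp) (fun j => (hcg j).memLp) hτv.memLp
    have e3 := Tendsto.congr e1 t
    rw [e2] at e3
    exact e3
  have hlim := ge_of_tendsto' tt hsm
  have hBΩ : B ⊆ Metric.ball x R := Metric.ball_subset_ball hR'.le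
  refine hlim.trans (le_of_eq ?_)
  symm
  apply setIntegral_eq_of_subset_of_forall_sdiff_eq_zero Metric.isOpen_ball.measurableSet hBΩ
  intro z hz
  exact hP0 z hz.2 _ _ _ _

end Weighted

/-! ### Jacobians of the maps `y ↦ y + t ξ(y)` -/

section Det

variable {m : ℕ}

/-- The determinant is a polynomial in the entries whose derivative at the identity is the trace.
Entries bounded by `B` make `t • A` uniformly small, so the first-order error is `o(t)` uniformly in
`A`. -/
lemma exists_abs_det_sub_le (B : ℝ) {ε : ℝ} (hε : 0 < ε) :
    ∃ δ > 0, ∀ (A : Matrix (Fin m) (Fin m) ℝ), (∀ i j, |A i j| ≤ B) → ∀ t : ℝ, |t| < δ →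
      |(1 + t • A).det - 1 - t * A.trace| ≤ ε * |t| := by
  let g : (Fin m → Fin m → ℝ) → ℝ := fun M => (1 + Matrix.of M).det
  have hg : ContDiff ℝ 1 g := by
    have : g = fun M => ∑ σ : Equiv.Perm (Fin m), (Equiv.Perm.sign σ : ℝ) *
        ∏ i, ((1 : Matrix (Fin m) (Fin m) ℝ) (σ i) i + M (σ i) i) := by
      funext M
      simp [g, Matrix.det_apply']
    rw [this]
    refine ContDiff.sum fun σ _ => contDiff_const.mul (contDiff_prod fun i _ => ?_)
    exact contDiff_const.add (contDiff_apply_apply ℝ ℝ (σ i) i)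
  have hd : HasFDerivAt g (fderiv ℝ g 0) 0 := (hg.differentiable one_ne_zero 0).hasFDerivAt
  have hline : ∀ M : Fin m → Fin m → ℝ, fderiv ℝ g 0 M = (Matrix.of M).trace := by
    intro M
    have h1 : HasDerivAt (fun t : ℝ => g (t • M)) (fderiv ℝ g 0 M) 0 := by
      have h2 : HasDerivAt (fun t : ℝ => t • M) M 0 := by
        simpa using (hasDerivAt_id (0 : ℝ)).smul_const M
      have h3 : HasFDerivAt g (fderiv ℝ g 0) ((0 : ℝ) • M) := by rw [zero_smul]; exact hd
      exact h3.comp_hasDerivAt 0 h2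
    have h4 : HasDerivAt (fun t : ℝ => g (t • M)) (Matrix.of M).trace 0 := by
      have : (fun t : ℝ => g (t • M)) = fun t => 1 + (Matrix.of M).trace * t +
          (Matrix.det (1 + (Polynomial.X : Polynomial ℝ) •
            (Matrix.of M).map Polynomial.C)).divX.divX.eval t * t ^ 2 := by
        funext t
        exact Matrix.det_one_add_smul t (Matrix.of M)
      rw [this]
      set P := (Matrix.det (1 + (Polynomial.X : Polynomial ℝ) •
            (Matrix.of M).map Polynomial.C)).divX.divX
      have := (((hasDerivAt_id (0 : ℝ)).const_mul (Matrix.of M).trace).const_add 1).add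
        ((P.hasDerivAt 0).mul (hasDerivAt_pow 2 (0 : ℝ)))
      refine HasDerivAt.congr_deriv this ?_
      simp
    exact h1.unique h4
  rw [hasFDerivAt_iff_isLittleO_nhds_zero] at hd
  have hB' : 0 < |B| + 1 := by positivity
  have h5 := hd.def (div_pos hε hB')
  obtain ⟨δ, hδ, h6⟩ := Metric.eventually_nhds_iff.1 h5
  refine ⟨δ / (|B| + 1), by positivity, fun A hA t ht => ?_⟩
  set M : Fin m → Fin m → ℝ := fun i j => t * A i j with hM
  have hnorm : ‖M‖ ≤ |t| * (|B| + 1) := by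
    have h0 : 0 ≤ |t| * (|B| + 1) := by positivity
    refine (pi_norm_le_iff_of_nonneg h0).2 fun i => (pi_norm_le_iff_of_nonneg h0).2
      fun j => ?_
    rw [hM, Real.norm_eq_abs, abs_mul]
    gcongr
    exact (hA i j).trans ((le_abs_self B).trans (by linarith))
  have h7 := h6 (y := M) (by
    rw [dist_zero_right]
    exact hnorm.trans_lt ((lt_div_iff₀ hB').1 ht))
  rw [hline, zero_add] at h7
  have e0 : Matrix.of M = t • A := rfl
  have e1 : g M = (1 + t • A).det := rfl
  have e2 : g 0 = 1 := by
    have : g 0 = (1 + (0 : Matrix (Fin m) (Fin m) ℝ)).det := rfl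
    rw [this, add_zero, Matrix.det_one]
  rw [e1, e2, e0, Matrix.trace_smul, smul_eq_mul, Real.norm_eq_abs] at h7
  refine h7.trans ?_
  calc ε / (|B| + 1) * ‖M‖ ≤ ε / (|B| + 1) * (|t| * (|B| + 1)) := by
        gcongr
    _ = ε * |t| := by field_simp

end Det

section Flow

variable {m : ℕ} {ξ : Euc m → Euc m}

/-- The Jacobian matrix of `ξ`. -/
noncomputable def jacMat (ξ : Euc m → Euc m) (y : Euc m) : Matrix (Fin m) (Fin m) ℝ :=
  Matrix.of fun i j => pd j ξ y i

/-- The Jacobian determinant of `y ↦ y + t ξ(y)`. -/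
noncomputable def jacDet (ξ : Euc m → Euc m) (t : ℝ) (y : Euc m) : ℝ := (1 + t • jacMat ξ y).det

/-- The divergence of `ξ`. -/
noncomputable def divg (ξ : Euc m → Euc m) (y : Euc m) : ℝ := ∑ i, pd i ξ y i

lemma continuous_divg (hξ : ContDiff ℝ ∞ ξ) : Continuous (divg ξ) :=
  continuous_finsetSum _ fun i _ => (contDiff_apply_coord (contDiff_pd hξ i) i).continuous

lemma exists_bound_of_test {F : Type*} [NormedAddCommGroup F] {c : Euc m → F} (hc : Continuous c)
    (hs : HasCompactSupport c) : ∃ M, 0 ≤ M ∧ ∀ y, ‖c y‖ ≤ M := by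
  obtain ⟨M, hM⟩ := hs.exists_bound_of_continuous hc
  exact ⟨max M 0, le_max_right _ _, fun y => (hM y).trans (le_max_left _ _)⟩

lemma hasCompactSupport_pd' {F : Type*} [NormedAddCommGroup F] [NormedSpace ℝ F] {a : Euc m → F}
    (ha : HasCompactSupport a) (i : Fin m) : HasCompactSupport (pd i a) := ha.fderiv_apply ℝ _

lemma exists_bound_pd (hξ : ContDiff ℝ ∞ ξ) (hc : HasCompactSupport ξ) :
    ∃ B, 0 ≤ B ∧ ∀ i y, ‖pd i ξ y‖ ≤ B := by
  choose M h0 hM using fun i => exists_bound_of_test (contDiff_pd hξ i).continuous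
    (hasCompactSupport_pd' hc i)
  refine ⟨∑ i, M i, Finset.sum_nonneg fun i _ => h0 i, fun i y => (hM i y).trans ?_⟩
  exact Finset.single_le_sum (fun i _ => h0 i) (Finset.mem_univ i)

lemma exists_jacDet_sub_le (hξ : ContDiff ℝ ∞ ξ) (hc : HasCompactSupport ξ) {ε : ℝ} (hε : 0 < ε) :
    ∃ δ > 0, ∀ t : ℝ, |t| < δ → ∀ y, |jacDet ξ t y - 1 - t * divg ξ y| ≤ ε * |t| := by
  obtain ⟨B, hB0, hB⟩ := exists_bound_pd hξ hc
  obtain ⟨δ, hδ, h⟩ := exists_abs_det_sub_le (m := m) B hε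
  exact ⟨δ, hδ, fun t ht y => h (jacMat ξ y)
    (fun i j => (PiLp.norm_apply_le (pd j ξ y) i).trans (hB j y)) t ht⟩

lemma tendsto_jacDet (hξ : ContDiff ℝ ∞ ξ) (hc : HasCompactSupport ξ) {ε : ℝ} (hε : 0 < ε) :
    ∃ δ > 0, ∀ t : ℝ, |t| < δ → ∀ y, |jacDet ξ t y - 1| ≤ ε := by
  obtain ⟨δ, hδ, h⟩ := exists_jacDet_sub_le hξ hc one_pos
  obtain ⟨M, hM0, hM⟩ := exists_bound_of_test (continuous_divg hξ) (by
    refine hc.mono' fun y hy => ?_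
    by_contra hcon
    apply hy
    have : ∀ i, pd i ξ y = 0 := fun i => by
      unfold pd
      rw [fderiv_of_notMem_tsupport ℝ hcon]; rfl
    simp [divg, this] : HasCompactSupport (divg ξ))
  refine ⟨min δ (ε / (1 + M)), by positivity, fun t ht y => ?_⟩
  have h1 := h t (ht.trans_le (min_le_left _ _)) y
  have h2 : |t| * (1 + M) ≤ ε := by
    rw [← le_div_iff₀ (by positivity)]
    exact (ht.trans_le (min_le_right _ _)).le
  have h3 : |t * divg ξ y| ≤ |t| * M := by
    rw [abs_mul]
    exact mul_le_mul_of_nonneg_left (hM y) (abs_nonneg t)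
  calc |jacDet ξ t y - 1| = |(jacDet ξ t y - 1 - t * divg ξ y) + t * divg ξ y| := by ring_nf
    _ ≤ 1 * |t| + |t| * M := (abs_add_le _ _).trans (add_le_add h1 h3)
    _ ≤ ε := by linarith

lemma hasFDerivAt_shift (hξ : ContDiff ℝ ∞ ξ) (t : ℝ) (y : Euc m) :
    HasFDerivAt (fun y => y + t • ξ y) (ContinuousLinearMap.id ℝ (Euc m) + t • fderiv ℝ ξ y) y :=
  (hasFDerivAt_id y).add ((hξ.differentiable (by simp) y).hasFDerivAt.const_smul t)

lemma det_fderiv_shift (t : ℝ) (y : Euc m) :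
    (ContinuousLinearMap.id ℝ (Euc m) + t • fderiv ℝ ξ y).det = jacDet ξ t y := by
  unfold jacDet
  rw [ContinuousLinearMap.det, ← LinearMap.det_toMatrix (EuclideanSpace.basisFun (Fin m) ℝ).toBasis]
  congr 1
  ext i j
  rw [LinearMap.toMatrix_apply]
  simp [jacMat, pd, Matrix.one_apply, Pi.single_apply]

/-- A compactly supported smooth field is Lipschitz, so for small `t` the map is a perturbation of
the identity with Lipschitz constant below `1`, hence a homeomorphism. -/
lemma exists_flow (hξ : ContDiff ℝ ∞ ξ) (hc : HasCompactSupport ξ) :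
    ∃ t₀ > 0, ∃ Ψ : ℝ → Euc m ≃ₜ Euc m, ∀ t, |t| < t₀ →
      (∀ y, Ψ t y = y + t • ξ y) ∧ ∀ y, 1 / 2 ≤ jacDet ξ t y := by
  obtain ⟨δ, hδ, hJ⟩ := tendsto_jacDet hξ hc (half_pos one_pos)
  obtain ⟨K, hK⟩ := (hξ.of_le (m := 1) (by simp)).lipschitzWith_of_hasCompactSupport hc one_ne_zero
  have hex : ∀ t : ℝ, |t| < 1 / (K + 1) → ∃ Ψ : Euc m ≃ₜ Euc m, ∀ y, Ψ y = y + t • ξ y := by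
    intro t ht
    have happ : ApproximatesLinearOn (fun y => y + t • ξ y)
        ((ContinuousLinearEquiv.refl ℝ (Euc m)) : Euc m →L[ℝ] Euc m) univ
        (Real.toNNReal (|t| * K)) := by
      rw [ApproximatesLinearOn.approximatesLinearOn_iff_lipschitzOnWith]
      have hL : LipschitzWith (Real.toNNReal (|t| * K)) fun y => t • ξ y := by
        refine LipschitzWith.of_dist_le_mul fun a b => ?_
        rw [dist_smul₀, Real.coe_toNNReal _ (by positivity), Real.norm_eq_abs, mul_assoc]
        exact mul_le_mul_of_nonneg_left (hK.dist_le_mul a b) (abs_nonneg t)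
      have e : (fun y => y + t • ξ y) -
          ⇑((ContinuousLinearEquiv.refl ℝ (Euc m)) : Euc m →L[ℝ] Euc m) = fun y => t • ξ y := by
        funext y
        simp
      rw [e]
      exact hL.lipschitzOnWith
    have hlt : |t| * K < 1 := by
      have h1 : |t| * (K + 1) < 1 := by
        rwa [lt_div_iff₀ (by positivity)] at ht
      have := abs_nonneg t
      linarith
    have hcond : Subsingleton (Euc m) ∨ Real.toNNReal (|t| * K) <
        ‖((ContinuousLinearEquiv.refl ℝ (Euc m)).symm : Euc m →L[ℝ] Euc m)‖₊⁻¹ := by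
      rcases subsingleton_or_nontrivial (Euc m) with h | h
      · exact Or.inl h
      · right
        have : ‖((ContinuousLinearEquiv.refl ℝ (Euc m)).symm : Euc m →L[ℝ] Euc m)‖₊ = 1 :=
          NNReal.eq (ContinuousLinearMap.norm_id)
        rw [this, inv_one, Real.toNNReal_lt_one]
        exact hlt
    exact ⟨happ.toHomeomorph _ hcond, fun y => rfl⟩
  -- For large `t` the identity serves as a filler value; nothing is claimed there.
  refine ⟨min δ (1 / (K + 1)), by positivity, fun t => if h : |t| < 1 / (K + 1) then
    (hex t h).choose else Homeomorph.refl _, fun t ht => ⟨fun y => ?_, fun y => ?_⟩⟩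
  · have h := ht.trans_le (min_le_right _ _)
    simp only [h, dif_pos]
    exact (hex t h).choose_spec y
  · have := (abs_le.1 (hJ t (ht.trans_le (min_le_left _ _)) y)).1
    linarith

/-- `Ψ` is a diffeomorphism of the form `y ↦ y + t ξ(y)` with Jacobian bounded below. -/
structure IsShift (ξ : Euc m → Euc m) (t : ℝ) (Ψ : Euc m ≃ₜ Euc m) : Prop where
  apply_eq : ∀ y, Ψ y = y + t • ξ y
  half_le : ∀ y, 1 / 2 ≤ jacDet ξ t y

namespace IsShift

variable {t : ℝ} {Ψ : Euc m ≃ₜ Euc m}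

/-- Points outside `U` are fixed, so by injectivity and surjectivity `U` is carried onto itself. -/
lemma image_eq (h : IsShift ξ t Ψ) {U : Set (Euc m)} (hU : tsupport ξ ⊆ U) : Ψ '' U = U := by
  have hfix : ∀ y, y ∉ U → Ψ y = y := fun y hy => by
    rw [h.apply_eq, image_eq_zero_of_notMem_tsupport fun hh => hy (hU hh), smul_zero, add_zero]
  ext z
  constructor
  · rintro ⟨y, hy, rfl⟩
    by_contra hcon
    have h1 := hfix _ hcon
    have h2 := Ψ.injective h1
    rw [h2] at hcon
    exact hcon hy
  · intro hz
    refine ⟨Ψ.symm z, ?_, Ψ.apply_symm_apply z⟩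
    by_contra hcon
    have h1 := hfix _ hcon
    rw [Ψ.apply_symm_apply] at h1
    rw [← h1] at hcon
    exact hcon hz

lemma setIntegral_eq (h : IsShift ξ t Ψ) (hξ : ContDiff ℝ ∞ ξ) {U : Set (Euc m)}
    (hm : MeasurableSet U) (hU : tsupport ξ ⊆ U) {F : Type*} [NormedAddCommGroup F]
    [NormedSpace ℝ F] (g : Euc m → F) :
    ∫ y in U, jacDet ξ t y • g (Ψ y) = ∫ z in U, g z := by
  have h1 := integral_image_eq_integral_abs_det_fderiv_smul volume hm (f := Ψ)
    (f' := fun y => ContinuousLinearMap.id ℝ (Euc m) + t • fderiv ℝ ξ y)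
    (fun y _ => by
      have : (Ψ : Euc m → Euc m) = fun y => y + t • ξ y := funext h.apply_eq
      rw [this]
      exact (hasFDerivAt_shift hξ t y).hasFDerivWithinAt) Ψ.injective.injOn g
  rw [h.image_eq hU] at h1
  rw [h1]
  congr 1 with y
  rw [det_fderiv_shift, abs_of_nonneg (by linarith [h.half_le y])]

/-- The Jacobian is at least `1/2`, so volumes pull back with a factor of at most `2`. -/
lemma map_le (h : IsShift ξ t Ψ) (hξ : ContDiff ℝ ∞ ξ) {U : Set (Euc m)}
    (hm : MeasurableSet U) (hU : tsupport ξ ⊆ U) :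
    Measure.map Ψ (volume.restrict U) ≤ (2 : ℝ≥0∞) • volume.restrict U := by
  refine Measure.le_iff.2 fun s hs => ?_
  have h1 := lintegral_image_eq_lintegral_abs_det_fderiv_mul volume hm (f := Ψ)
    (f' := fun y => ContinuousLinearMap.id ℝ (Euc m) + t • fderiv ℝ ξ y)
    (fun y _ => by
      have : (Ψ : Euc m → Euc m) = fun y => y + t • ξ y := funext h.apply_eq
      rw [this]
      exact (hasFDerivAt_shift hξ t y).hasFDerivWithinAt) Ψ.injective.injOn (s.indicator (1 : Euc m → ℝ≥0∞))
  rw [h.image_eq hU, lintegral_indicator_one hs] at h1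
  rw [Measure.map_apply Ψ.measurable hs, Measure.smul_apply, h1,
    ← lintegral_indicator_one (Ψ.measurable hs), smul_eq_mul, ← lintegral_const_mul' _ _ (by simp)]
  refine lintegral_mono fun y => ?_
  rw [det_fderiv_shift, ← mul_assoc]
  have h2 : (1 : ℝ≥0∞) ≤ 2 * ENNReal.ofReal |jacDet ξ t y| := by
    rw [show (2 : ℝ≥0∞) = ENNReal.ofReal 2 by simp, ← ENNReal.ofReal_mul (by norm_num),
      ← ENNReal.ofReal_one]
    refine ENNReal.ofReal_le_ofReal ?_
    have := h.half_le y
    rw [abs_of_nonneg (by linarith)]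
    linarith
  calc (Ψ ⁻¹' s).indicator (1 : Euc m → ℝ≥0∞) y = 1 * s.indicator 1 (Ψ y) := by
        rw [one_mul]; rfl
    _ ≤ _ := by gcongr

end IsShift

end Flow

/-! ### `L²` bounds under composition and closedness of weak derivatives -/

section Comp

variable {α β : Type*} [MeasurableSpace α] [MeasurableSpace β] {μ : Measure α} {ν : Measure β}
  {F : Type*} [NormedAddCommGroup F] {φ : α → β} {C : ℝ≥0∞}

lemma aestronglyMeasurable_comp_of_map_le (hφ : Measurable φ) (h : Measure.map φ μ ≤ C • ν)
    {g : β → F} (hg : AEStronglyMeasurable g ν) : AEStronglyMeasurable (fun a => g (φ a)) μ :=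
  (hg.mono_ac ((Measure.absolutelyContinuous_of_le h).trans
    Measure.smul_absolutelyContinuous)).comp_measurable hφ

lemma eLpNorm_comp_le_of_map_le (hφ : Measurable φ) (h : Measure.map φ μ ≤ C • ν) (hC : C ≠ 0)
    {g : β → F} (hg : AEStronglyMeasurable g ν) (p : ℝ≥0∞) :
    eLpNorm (fun a => g (φ a)) p μ ≤ C ^ (1 / p).toReal * eLpNorm g p ν := by
  have hg' := hg.mono_ac ((Measure.absolutelyContinuous_of_le h).trans
    Measure.smul_absolutelyContinuous)
  have e : eLpNorm (fun a => g (φ a)) p μ = eLpNorm g p (Measure.map φ μ) :=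
    (eLpNorm_map_measure hg' hφ.aemeasurable).symm
  rw [e]
  refine (eLpNorm_mono_measure g h).trans ?_
  rw [eLpNorm_smul_measure_of_ne_zero hC, smul_eq_mul]

lemma memLp_comp_of_map_le (hφ : Measurable φ) (h : Measure.map φ μ ≤ C • ν) (hC : C ≠ 0)
    (hC' : C ≠ ⊤) {p : ℝ≥0∞} {g : β → F} (hg : MemLp g p ν) : MemLp (fun a => g (φ a)) p μ :=
  ⟨aestronglyMeasurable_comp_of_map_le hφ h hg.1,
    (eLpNorm_comp_le_of_map_le hφ h hC hg.1 p).trans_lt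
      (ENNReal.mul_lt_top (ENNReal.rpow_lt_top_of_nonneg ENNReal.toReal_nonneg hC') hg.2)⟩

lemma TendstoLtwo.comp (hφ : Measurable φ) (h : Measure.map φ μ ≤ C • ν) (hC : C ≠ 0)
    (hC' : C ≠ ⊤) {p : ℕ → β → F} {q : β → F} (H : TendstoLtwo ν p q) :
    TendstoLtwo μ (fun n a => p n (φ a)) (fun a => q (φ a)) := by
  refine ⟨fun n => memLp_comp_of_map_le hφ h hC hC' (H.memLp_seq n),
    memLp_comp_of_map_le hφ h hC hC' H.memLp, ?_⟩
  have h3 := ENNReal.Tendsto.const_mul (a := C ^ (1 / (2 : ℝ≥0∞)).toReal) H.tendsto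
    (Or.inr (ENNReal.rpow_lt_top_of_nonneg ENNReal.toReal_nonneg hC').ne)
  rw [mul_zero] at h3
  exact tendsto_of_tendsto_of_tendsto_of_le_of_le tendsto_const_nhds h3 (fun _ => zero_le)
    fun n => eLpNorm_comp_le_of_map_le hφ h hC ((H.memLp_seq n).sub H.memLp).1 2

end Comp

section Closure

variable {m l : ℕ}

lemma TendstoLtwo.integral {α : Type*} [MeasurableSpace α] {μ : Measure α} [IsFiniteMeasure μ]
    {F : Type*} [NormedAddCommGroup F] [NormedSpace ℝ F] [CompleteSpace F]
    {p : ℕ → α → F} {q : α → F} (h : TendstoLtwo μ p q) :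
    Tendsto (fun n => ∫ z, p n z ∂μ) atTop (𝓝 (∫ z, q z ∂μ)) := by
  refine tendsto_integral_of_L1' q (h.memLp.integrable one_le_two).1
    (Eventually.of_forall fun n => (h.memLp_seq n).integrable one_le_two) ?_
  have h3 := ENNReal.Tendsto.mul_const (b := μ univ ^ (1 / (1 : ℝ≥0∞).toReal - 1 / (2 : ℝ≥0∞).toReal))
    h.tendsto (Or.inr (ENNReal.rpow_ne_top_of_nonneg (by norm_num) (measure_ne_top μ _)))
  rw [zero_mul] at h3
  exact tendsto_of_tendsto_of_tendsto_of_le_of_le tendsto_const_nhds h3 (fun _ => zero_le)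
    fun n => eLpNorm_le_eLpNorm_mul_rpow_measure_univ one_le_two
      ((h.memLp_seq n).sub h.memLp).1

lemma TendstoLtwo.mono_measure {α : Type*} [MeasurableSpace α] {μ ν : Measure α}
    {F : Type*} [NormedAddCommGroup F] {p : ℕ → α → F} {q : α → F} (h : TendstoLtwo ν p q)
    (hμ : μ ≤ ν) : TendstoLtwo μ p q :=
  ⟨fun n => (h.memLp_seq n).mono_measure hμ, h.memLp.mono_measure hμ,
    tendsto_of_tendsto_of_tendsto_of_le_of_le tendsto_const_nhds h.tendsto (fun _ => zero_le)
      fun _ => eLpNorm_mono_measure _ hμ⟩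

lemma TendstoLtwo.seq_smul_zero {α : Type*} [MeasurableSpace α] {μ : Measure α}
    {F : Type*} [NormedAddCommGroup F] [NormedSpace ℝ F] {p : ℕ → α → F} {q : α → F}
    (h : TendstoLtwo μ p q) {t : ℕ → ℝ} (ht : Tendsto t atTop (𝓝 0)) :
    TendstoLtwo μ (fun n z => t n • p n z) (fun _ => 0) := by
  refine ⟨fun n => (h.memLp_seq n).const_smul (t n), MemLp.zero, ?_⟩
  have h1 : Tendsto (fun n => ‖t n‖ₑ) atTop (𝓝 0) := by
    have := (continuous_enorm.tendsto (0 : ℝ)).comp ht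
    rwa [enorm_zero] at this
  have h2 : Tendsto (fun n => eLpNorm (fun z => p n z - q z) 2 μ + eLpNorm q 2 μ) atTop
      (𝓝 (0 + eLpNorm q 2 μ)) := h.tendsto.add_const _
  have h3 := ENNReal.Tendsto.mul h1 (Or.inr (by simpa using h.memLp.2.ne)) h2
    (Or.inr ENNReal.zero_ne_top)
  rw [zero_mul] at h3
  refine tendsto_of_tendsto_of_tendsto_of_le_of_le tendsto_const_nhds h3 (fun _ => zero_le)
    fun n => ?_
  simp only [sub_zero]
  have e : eLpNorm (fun z => t n • p n z) 2 μ = ‖t n‖ₑ * eLpNorm (p n) 2 μ :=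
    eLpNorm_const_smul (t n) (p n) 2 μ
  rw [e]
  gcongr
  refine le_trans (le_of_eq ?_) (eLpNorm_add_le ((h.memLp_seq n).sub h.memLp).1
    h.memLp.1 one_le_two)
  congr 1 with z
  simp

instance isFiniteMeasure_restrict_ball (x : Euc m) (R : ℝ) :
    IsFiniteMeasure (volume.restrict (Metric.ball x R)) :=
  ⟨by rw [Measure.restrict_apply_univ]; exact measure_ball_lt_top⟩

lemma locallyIntegrableOn_ball_of_memLp {x : Euc m} {R R₀ : ℝ} (hR₀ : R₀ < R) {g : Euc m → Euc l}
    (h : ∀ R', R₀ < R' → R' < R → MemLp g 2 (volume.restrict (Metric.ball x R'))) :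
    LocallyIntegrableOn g (Metric.ball x R) := by
  intro z hz
  obtain ⟨R', h1, h2⟩ := exists_between (max_lt (Metric.mem_ball.1 hz) hR₀)
  have hz' : z ∈ Metric.ball x R' := (le_max_left _ _).trans_lt h1
  exact ⟨Metric.ball x R', mem_nhdsWithin_of_mem_nhds (Metric.isOpen_ball.mem_nhds hz'),
    (h R' ((le_max_right _ _).trans_lt h1) h2).integrable one_le_two⟩

lemma integral_pd_smul_eq_neg {ψ : Euc m → ℝ} (hψ : ContDiff ℝ ∞ ψ) (hc : HasCompactSupport ψ)
    {u : Euc m → Euc l} (hu : ContDiff ℝ ∞ u) (i : Fin m) :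
    ∫ y, pd i ψ y • u y = - ∫ y, ψ y • pd i u y := by
  have h := integral_smul_fderiv_eq_neg_fderiv_smul_of_integrable
    (μ := (volume : Measure (Euc m))) (f := ψ) (g := u) (v := EuclideanSpace.single i 1) ?_ ?_ ?_
    (fun z _ => hψ.differentiable (by simp) z) (fun z _ => hu.differentiable (by simp) z)
  · unfold pd
    rw [h, neg_neg]
  · exact ((contDiff_pd hψ i).continuous.smul hu.continuous).integrable_of_hasCompactSupport
      (hasCompactSupport_pd hc i).smul_right
  · exact (hψ.continuous.smul (contDiff_pd hu i).continuous).integrable_of_hasCompactSupport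
      hc.smul_right
  · exact (hψ.continuous.smul hu.continuous).integrable_of_hasCompactSupport hc.smul_right

/-- Integration by parts passes to the limit. Each test function lives in some smaller ball, so
balls with radius close to `R` suffice; the freedom in `R₀` allows the approximation to be
restricted to balls containing the support of a deformation. -/
lemma isWeakPartial_of_tendsto {x : Euc m} {R R₀ : ℝ} (hR₀ : R₀ < R) {i : Fin m}
    {f g : Euc m → Euc l}
    (h : ∀ R', R₀ < R' → R' < R → ∃ u : ℕ → Euc m → Euc l, (∀ n, ContDiff ℝ ∞ (u n)) ∧
      TendstoLtwo (volume.restrict (Metric.ball x R')) u f ∧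
      TendstoLtwo (volume.restrict (Metric.ball x R')) (fun n => pd i (u n)) g) :
    IsWeakPartial (Metric.ball x R) i f g := by
  refine ⟨locallyIntegrableOn_ball_of_memLp hR₀ fun R' h1 h2 => ?_,
    locallyIntegrableOn_ball_of_memLp hR₀ fun R' h1 h2 => ?_, ?_⟩
  · obtain ⟨u, -, hu, -⟩ := h R' h1 h2
    exact hu.memLp
  · obtain ⟨u, -, -, hu⟩ := h R' h1 h2
    exact hu.memLp
  · intro ψ hψ
    obtain ⟨R₁, hR₁, hsub⟩ := exists_lt_subset_ball (isClosed_tsupport ψ) hψ.2.2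
    obtain ⟨R', h1, h2⟩ := exists_between (max_lt hR₁ hR₀)
    obtain ⟨u, hus, hu, hg⟩ := h R' ((le_max_right _ _).trans_lt h1) h2
    set B := Metric.ball x R'
    have hsub' : tsupport ψ ⊆ B :=
      hsub.trans (Metric.ball_subset_ball ((le_max_left _ _).trans h1.le))
    have hBR : B ⊆ Metric.ball x R := Metric.ball_subset_ball h2.le
    have t1 := (hu.smul_continuous (contDiff_pd hψ.1 i).continuous).integral
    have t2 := (hg.smul_continuous hψ.1.continuous).integral
    have z1 : ∀ z, z ∉ B → pd i ψ z = 0 := fun z hz =>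
      image_eq_zero_of_notMem_tsupport fun hh => hz
        (((tsupport_fderiv_apply_subset ℝ _).trans hsub') hh)
    have z2 : ∀ z, z ∉ B → ψ z = 0 := fun z hz =>
      image_eq_zero_of_notMem_tsupport fun hh => hz (hsub' hh)
    have e : ∀ n, ∫ z in B, pd i ψ z • u n z = - ∫ z in B, ψ z • pd i (u n) z := by
      intro n
      rw [setIntegral_eq_integral_of_forall_compl_eq_zero fun z hz => by rw [z1 z hz, zero_smul],
        setIntegral_eq_integral_of_forall_compl_eq_zero fun z hz => by rw [z2 z hz, zero_smul]]
      exact integral_pd_smul_eq_neg hψ.1 hψ.2.1 (hus n) i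
    have key := tendsto_nhds_unique (t1.congr e) t2.neg
    have e1 : ∫ y in Metric.ball x R, (fderiv ℝ ψ y (EuclideanSpace.single i 1)) • f y
        = ∫ y in B, pd i ψ y • f y := by
      apply setIntegral_eq_of_subset_of_forall_sdiff_eq_zero Metric.isOpen_ball.measurableSet hBR
      intro z hz
      have := z1 z hz.2
      unfold pd at this
      rw [this, zero_smul]
    have e2 : ∫ y in Metric.ball x R, ψ y • g y = ∫ y in B, ψ y • g y := by
      apply setIntegral_eq_of_subset_of_forall_sdiff_eq_zero Metric.isOpen_ball.measurableSet hBR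
      intro z hz
      rw [z2 z hz.2, zero_smul]
    rw [e1, e2, key]

end Closure

/-! ### The weak Laplacian of a deformed map -/

section ChainRule

variable {m l : ℕ}

lemma sum_apply_smul_single (v : Euc m) :
    v = ∑ j, v j • (EuclideanSpace.single j (1 : ℝ) : Euc m) := by
  have := (EuclideanSpace.basisFun (Fin m) ℝ).sum_repr v
  simpa using this.symm

lemma pd_comp {F : Type*} [NormedAddCommGroup F] [NormedSpace ℝ F] {u : Euc m → F}
    {φ : Euc m → Euc m} (hu : ContDiff ℝ ∞ u) (hφ : ContDiff ℝ ∞ φ)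
    (i : Fin m) (y : Euc m) :
    pd i (fun y => u (φ y)) y = ∑ j, (pd i φ y j) • pd j u (φ y) := by
  have h : HasFDerivAt (fun y => u (φ y)) ((fderiv ℝ u (φ y)).comp (fderiv ℝ φ y)) y :=
    (hu.differentiable (by simp) _).hasFDerivAt.comp y (hφ.differentiable (by simp) y).hasFDerivAt
  have e : pd i (fun y => u (φ y)) y = fderiv ℝ u (φ y) (pd i φ y) := by
    unfold pd
    rw [h.fderiv]
    rfl
  rw [e]
  conv_lhs => rw [sum_apply_smul_single (pd i φ y)]
  simp [pd]

lemma pd_pd_comp {F : Type*} [NormedAddCommGroup F] [NormedSpace ℝ F] {u : Euc m → F}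
    {φ : Euc m → Euc m} (hu : ContDiff ℝ ∞ u) (hφ : ContDiff ℝ ∞ φ)
    (i : Fin m) (y : Euc m) :
    pd i (pd i fun y => u (φ y)) y = ∑ j, ((pd i (pd i φ) y j) • pd j u (φ y) +
      pd i φ y j • ∑ k, pd i φ y k • pd k (pd j u) (φ y)) := by
  have e : (pd i fun y => u (φ y)) = fun y => ∑ j, (pd i φ y j) • pd j u (φ y) :=
    funext (pd_comp hu hφ i)
  have hs : ∀ j, ContDiff ℝ ∞ fun y => pd i φ y j := fun j =>
    contDiff_apply_coord (contDiff_pd hφ i) j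
  have hc : ∀ j, ContDiff ℝ ∞ fun y => pd j u (φ y) := fun j => (contDiff_pd hu j).comp hφ
  have e2 := pd_sum Finset.univ (a := fun j y => pd i φ y j • pd j u (φ y))
    (fun j _ => (hs j).smul (hc j)) i y
  rw [e, e2]
  refine Finset.sum_congr rfl fun j _ => ?_
  rw [pd_smul (hs j) (hc j), pd_comp (contDiff_pd hu j) hφ, pd_apply (contDiff_pd hφ i), add_comm]

lemma contDiff_shift {ξ : Euc m → Euc m} (hξ : ContDiff ℝ ∞ ξ) (t : ℝ) :
    ContDiff ℝ ∞ fun y => y + t • ξ y := contDiff_id.add (hξ.const_smul t)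

lemma pd_shift {ξ : Euc m → Euc m} (hξ : ContDiff ℝ ∞ ξ) (t : ℝ) (i : Fin m) (y : Euc m) :
    pd i (fun y => y + t • ξ y) y = EuclideanSpace.single i 1 + t • pd i ξ y := by
  unfold pd
  rw [(hasFDerivAt_shift hξ t y).fderiv]
  rfl

lemma pd_pd_shift {ξ : Euc m → Euc m} (hξ : ContDiff ℝ ∞ ξ) (t : ℝ) (i : Fin m) (y : Euc m) :
    pd i (pd i fun y => y + t • ξ y) y = t • pd i (pd i ξ) y := by
  rw [show (pd i fun y => y + t • ξ y) = fun y => EuclideanSpace.single i 1 + t • pd i ξ y from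
    funext (pd_shift hξ t i)]
  have h : HasFDerivAt (fun y => (EuclideanSpace.single i 1 : Euc m) + t • pd i ξ y)
      (t • fderiv ℝ (pd i ξ) y) y :=
    (((contDiff_pd hξ i).differentiable (by simp) y).hasFDerivAt.const_smul t).const_add _
  have e : pd i (fun y => (EuclideanSpace.single i 1 : Euc m) + t • pd i ξ y) y =
      (t • fderiv ℝ (pd i ξ) y) (EuclideanSpace.single i 1) := by
    rw [← h.fderiv]; rfl
  rw [e]
  rfl

variable {x : Euc m} {R : ℝ} {f : Euc m → Euc l} {ξ : Euc m → Euc m}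

/-- The first order part of the Laplacian of `f (y + t ξ(y))`, transported by `φ`. -/
noncomputable def varOne (Ω : Set (Euc m)) (f : Euc m → Euc l) (ξ : Euc m → Euc m)
    (φ : Euc m → Euc m) (y : Euc m) : Euc l :=
  ∑ i, ∑ j, (pd i (pd i ξ) y j) • weakPartial Ω j f (φ y) +
    ∑ i, ∑ k, (pd i ξ y k) • (weakPartial Ω k (weakPartial Ω i f) (φ y)
      + weakPartial Ω i (weakPartial Ω k f) (φ y))

/-- The second order part of the Laplacian of `f (y + t ξ(y))`, transported by `φ`. -/
noncomputable def varTwo (Ω : Set (Euc m)) (f : Euc m → Euc l) (ξ : Euc m → Euc m)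
    (φ : Euc m → Euc m) (y : Euc m) : Euc l :=
  ∑ i, ∑ j, ∑ k, (pd i ξ y j * pd i ξ y k) • weakPartial Ω k (weakPartial Ω j f) (φ y)

/-- The classical chain rule holds for smooth approximations and survives in the limit. Inserting
`Dφ = 1 + t Dξ` then sorts the second derivatives by powers of `t`, with the derivatives of `f`
still evaluated at `Ψ y`. -/
lemma weakLaplacian_shift_ae (hf : MemW22 (Metric.ball x R) f) (hξ : ContDiff ℝ ∞ ξ)
    (hξs : tsupport ξ ⊆ Metric.ball x R) {t : ℝ} {Ψ : Euc m ≃ₜ Euc m} (h : IsShift ξ t Ψ) :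
    weakLaplacian (Metric.ball x R) (fun y => f (y + t • ξ y))
      =ᵐ[volume.restrict (Metric.ball x R)] fun y =>
      weakLaplacian (Metric.ball x R) f (Ψ y) + t • (varOne (Metric.ball x R) f ξ Ψ y
        + t • varTwo (Metric.ball x R) f ξ Ψ y) := by
  obtain ⟨R₀, hR₀, hsub⟩ := exists_lt_subset_ball (isClosed_tsupport ξ) hξs
  set Ω := Metric.ball x R with hΩ
  have hφ := contDiff_shift hξ t
  have hΨ : (fun y => y + t • ξ y) = Ψ := (funext h.apply_eq).symm
  set φ : Euc m → Euc m := fun y => y + t • ξ y with hφd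
  have hcoef : ∀ i j, Continuous fun y => pd i φ y j := fun i j =>
    (contDiff_apply_coord (contDiff_pd hφ i) j).continuous
  have hcoef2 : ∀ i j, Continuous fun y => pd i (pd i φ) y j := fun i j =>
    (contDiff_apply_coord (contDiff_pd (contDiff_pd hφ i) i) j).continuous
  -- A ball containing the support of `ξ` is mapped onto itself, so convergence on that ball is
  -- preserved by composition.
  have hcomp : ∀ R', R₀ < R' → ∀ {p : ℕ → Euc m → Euc l} {q : Euc m → Euc l},
      TendstoLtwo (volume.restrict (Metric.ball x R')) p q →
      TendstoLtwo (volume.restrict (Metric.ball x R')) (fun n y => p n (φ y))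
        (fun y => q (φ y)) := by
    intro R' hR' p q H
    have hm := h.map_le hξ (U := Metric.ball x R') Metric.isOpen_ball.measurableSet
      (hsub.trans (Metric.ball_subset_ball hR'.le))
    rw [← hΨ] at hm
    exact H.comp hφ.continuous.measurable hm two_ne_zero ENNReal.ofNat_ne_top
  have w1 : ∀ i, IsWeakPartial Ω i (fun y => f (φ y))
      (fun y => ∑ j, (pd i φ y j) • weakPartial Ω j f (φ y)) := by
    intro i
    refine isWeakPartial_of_tendsto hR₀ fun R' hR' hR'' => ?_
    obtain ⟨u, hu, h0, h1, h2⟩ := exists_tendstoLtwo hR'' hf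
    refine ⟨fun n y => u n (φ y), fun n => (hu n).comp hφ, hcomp R' hR' h0, ?_⟩
    have e : (fun n => pd i fun y => u n (φ y)) =
        fun n y => ∑ j, (pd i φ y j) • pd j (u n) (φ y) :=
      funext fun n => funext fun y => pd_comp (hu n) hφ i y
    rw [e]
    exact TendstoLtwo.sum Finset.univ fun j _ => (hcomp R' hR' (h1 j)).smul_continuous (hcoef i j)
  have w2 : ∀ i, IsWeakPartial Ω i (fun y => ∑ j, (pd i φ y j) • weakPartial Ω j f (φ y))
      (fun y => ∑ j, ((pd i (pd i φ) y j) • weakPartial Ω j f (φ y) +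
      pd i φ y j • ∑ k, pd i φ y k • weakPartial Ω k (weakPartial Ω j f) (φ y))) := by
    intro i
    refine isWeakPartial_of_tendsto hR₀ fun R' hR' hR'' => ?_
    obtain ⟨u, hu, h0, h1, h2⟩ := exists_tendstoLtwo hR'' hf
    refine ⟨fun n => pd i fun y => u n (φ y), fun n => contDiff_pd ((hu n).comp hφ) i, ?_, ?_⟩
    · have e : (fun n => pd i fun y => u n (φ y)) =
          fun n y => ∑ j, (pd i φ y j) • pd j (u n) (φ y) :=
        funext fun n => funext fun y => pd_comp (hu n) hφ i y
      rw [e]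
      exact TendstoLtwo.sum Finset.univ fun j _ =>
        (hcomp R' hR' (h1 j)).smul_continuous (hcoef i j)
    · have e : (fun n => pd i (pd i fun y => u n (φ y))) =
          fun n y => ∑ j, ((pd i (pd i φ) y j) • pd j (u n) (φ y) +
            pd i φ y j • ∑ k, pd i φ y k • pd k (pd j (u n)) (φ y)) :=
        funext fun n => funext fun y => pd_pd_comp (hu n) hφ i y
      rw [e]
      exact TendstoLtwo.sum Finset.univ fun j _ =>
        ((hcomp R' hR' (h1 j)).smul_continuous (hcoef2 i j)).add
        ((TendstoLtwo.sum Finset.univ fun k _ =>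
          (hcomp R' hR' (h2 j k)).smul_continuous (hcoef i k)).smul_continuous (hcoef i j))
  have hopen : IsOpen Ω := Metric.isOpen_ball
  have a1 : ∀ i, weakPartial Ω i (weakPartial Ω i fun y => f (φ y)) =ᵐ[volume.restrict Ω]
      (fun y => ∑ j, ((pd i (pd i φ) y j) • weakPartial Ω j f (φ y) +
      pd i φ y j • ∑ k, pd i φ y k • weakPartial Ω k (weakPartial Ω j f) (φ y))) := by
    intro i
    have b := (w1 i).weakPartial_ae_eq hopen
    exact ((w2 i).congr hopen.measurableSet b.symm (ae_eq_refl _)).weakPartial_ae_eq hopen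
  have a2 := ae_all_iff.2 a1
  filter_upwards [a2] with y hy
  unfold weakLaplacian
  rw [Finset.sum_congr rfl fun i _ => hy i]
  rw [← hΨ]
  have c1 : ∀ i j, pd i φ y j = (if j = i then 1 else 0) + t * pd i ξ y j := by
    intro i j
    rw [hφd, pd_shift hξ]
    simp [Pi.single_apply]
  have c2 : ∀ i j, pd i (pd i φ) y j = t * pd i (pd i ξ) y j := by
    intro i j
    rw [hφd, pd_pd_shift hξ]
    simp
  simp only [c1, c2, varOne, varTwo]
  simp only [add_smul, smul_add, ite_smul, one_smul, zero_smul, Finset.sum_add_distrib,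
    Finset.smul_sum, Finset.sum_ite_eq', Finset.mem_univ, if_true, smul_smul, mul_assoc,
    Finset.sum_ite_eq, smul_ite, smul_zero]
  have s1 : ∀ i j k : Fin m, (((if j = i then 1 else 0) + t * pd i ξ y j) * (t * pd i ξ y k)) •
      weakPartial Ω k (weakPartial Ω j f) (φ y) =
      (if j = i then (t * pd i ξ y k) • weakPartial Ω k (weakPartial Ω j f) (φ y) else 0) +
        (t * (t * (pd i ξ y j * pd i ξ y k))) • weakPartial Ω k (weakPartial Ω j f) (φ y) := by
    intro i j k
    split_ifs
    · rw [← add_smul]; ring_nf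
    · rw [zero_add, zero_add]; ring_nf
  have s2 : ∀ i : Fin m, ∑ j : Fin m, ∑ k : Fin m, (if j = i then (t * pd i ξ y k) •
      weakPartial Ω k (weakPartial Ω j f) (φ y) else 0) =
      ∑ k : Fin m, (t * pd i ξ y k) • weakPartial Ω k (weakPartial Ω i f) (φ y) := by
    intro i
    rw [Finset.sum_comm]
    simp
  simp only [s1, Finset.sum_add_distrib, s2]
  abel

end ChainRule

/-! ### The first variation formula -/

section FirstVariation

variable {m l : ℕ} {x : Euc m} {R : ℝ} {ξ : Euc m → Euc m}

/-- Replace `G` by a continuous compactly supported `g` close to it in `L²`. Uniform continuity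
controls `g ∘ Ψ - g`, and the bound on the push-forward controls `(G - g) ∘ Ψ`. -/
lemma tendstoLtwo_comp_shift (hξ : ContDiff ℝ ∞ ξ) (hc : HasCompactSupport ξ)
    (hξs : tsupport ξ ⊆ Metric.ball x R) {t : ℕ → ℝ} (ht : Tendsto t atTop (𝓝 0))
    {Ψ : ℕ → Euc m ≃ₜ Euc m} (h : ∀ n, IsShift ξ (t n) (Ψ n)) {G : Euc m → Euc l}
    (hG : MemLp G 2 (volume.restrict (Metric.ball x R))) :
    TendstoLtwo (volume.restrict (Metric.ball x R)) (fun n y => G (Ψ n y)) G := by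
  set μ := volume.restrict (Metric.ball x R) with hμ
  have hmap : ∀ n, Measure.map (Ψ n) μ ≤ (2 : ℝ≥0∞) • μ := fun n =>
    (h n).map_le hξ Metric.isOpen_ball.measurableSet hξs
  have hmem : ∀ {g : Euc m → Euc l}, MemLp g 2 μ → ∀ n, MemLp (fun y => g (Ψ n y)) 2 μ :=
    fun hg n => memLp_comp_of_map_le (Ψ n).measurable (hmap n) two_ne_zero ENNReal.ofNat_ne_top hg
  refine ⟨hmem hG, hG, ?_⟩
  rw [ENNReal.tendsto_nhds_zero]
  intro ε hε
  set K : ℝ≥0∞ := 2 ^ (1 / (2 : ℝ≥0∞)).toReal with hK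
  have hKt : K ≠ ⊤ := ENNReal.rpow_ne_top_of_nonneg ENNReal.toReal_nonneg ENNReal.ofNat_ne_top
  obtain ⟨δ, hδ, hδε⟩ : ∃ δ : ℝ≥0∞, 0 < δ ∧ K * δ + δ + δ ≤ ε := by
    have hc0 : Tendsto (fun δ : ℝ≥0∞ => K * δ + δ + δ) (𝓝 0) (𝓝 (K * 0 + 0 + 0)) :=
      ((ENNReal.Tendsto.const_mul tendsto_id (Or.inr hKt)).add tendsto_id).add tendsto_id
    simp only [mul_zero, add_zero] at hc0
    have h1 := hc0.eventually (ge_mem_nhds hε)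
    have h2 : ∀ᶠ δ in 𝓝[>] (0 : ℝ≥0∞), K * δ + δ + δ ≤ ε := h1.filter_mono nhdsWithin_le_nhds
    obtain ⟨δ, h3, h4⟩ := (h2.and self_mem_nhdsWithin).exists
    exact ⟨δ, h4, h3⟩
  obtain ⟨g, hgs, hge, hgc, hgm⟩ :=
    hG.exists_hasCompactSupport_eLpNorm_sub_le ENNReal.ofNat_ne_top hδ.ne'
  have hunif : UniformContinuous g := hgs.uniformContinuous_of_continuous hgc
  obtain ⟨M, hM0, hM⟩ := exists_bound_of_test hξ.continuous hc
  -- choose the uniform closeness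
  set V : ℝ≥0∞ := μ univ ^ (2 : ℝ≥0∞).toReal⁻¹ with hV
  have hVt : V ≠ ⊤ := ENNReal.rpow_ne_top_of_nonneg (by simp) (measure_ne_top μ _)
  obtain ⟨r, hr, hrδ⟩ : ∃ r : ℝ, 0 < r ∧ V * ENNReal.ofReal r ≤ δ := by
    have hc0 : Tendsto (fun r : ℝ => V * ENNReal.ofReal r) (𝓝 0) (𝓝 (V * ENNReal.ofReal 0)) :=
      ENNReal.Tendsto.const_mul (ENNReal.continuous_ofReal.tendsto 0) (Or.inr hVt)
    rw [ENNReal.ofReal_zero, mul_zero] at hc0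
    have h2 : ∀ᶠ r in 𝓝[>] (0 : ℝ), V * ENNReal.ofReal r ≤ δ :=
      (hc0.eventually (ge_mem_nhds hδ)).filter_mono nhdsWithin_le_nhds
    obtain ⟨r, h3, h4⟩ := (h2.and self_mem_nhdsWithin).exists
    exact ⟨r, h4, h3⟩
  obtain ⟨s, hs, hgs'⟩ := Metric.uniformContinuous_iff.1 hunif r hr
  have hev : ∀ᶠ n in atTop, |t n| * (M + 1) < s := by
    have := (ht.abs.mul_const (M + 1))
    rw [abs_zero, zero_mul] at this
    exact this.eventually (gt_mem_nhds hs)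
  filter_upwards [hev] with n hn
  have e1 : eLpNorm (fun y => G (Ψ n y) - g (Ψ n y)) 2 μ ≤ K * δ :=
    (eLpNorm_comp_le_of_map_le (Ψ n).measurable (hmap n) two_ne_zero (hG.sub hgm).1 2).trans
      (by gcongr)
  have e2 : eLpNorm (fun y => g (Ψ n y) - g y) 2 μ ≤ δ := by
    refine (eLpNorm_le_of_ae_bound (C := r) (Eventually.of_forall fun y => ?_)).trans hrδ
    rw [← dist_eq_norm]
    refine (hgs' ?_).le
    rw [(h n).apply_eq, dist_eq_norm, add_sub_cancel_left, norm_smul, Real.norm_eq_abs]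
    calc |t n| * ‖ξ y‖ ≤ |t n| * (M + 1) := by gcongr; linarith [hM y]
      _ < s := hn
  have e3 : eLpNorm (fun y => g y - G y) 2 μ ≤ δ := by
    have : eLpNorm (fun y => g y - G y) 2 μ = eLpNorm (G - g) 2 μ := by
      rw [eLpNorm_sub_comm]; rfl
    rw [this]; exact hge
  refine le_trans ?_ hδε
  have m1 := ((hmem hG n).sub (hmem hgm n)).1
  have m2 := ((hmem hgm n).sub hgm).1
  have m3 := (hgm.sub hG).1
  calc eLpNorm (fun y => G (Ψ n y) - G y) 2 μ
      = eLpNorm ((((fun y => G (Ψ n y)) - fun y => g (Ψ n y)) + ((fun y => g (Ψ n y)) - g))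
          + (g - G)) 2 μ := by
        congr 1 with y
        simp
    _ ≤ eLpNorm (((fun y => G (Ψ n y)) - fun y => g (Ψ n y)) + ((fun y => g (Ψ n y)) - g)) 2 μ
          + eLpNorm (g - G) 2 μ := eLpNorm_add_le (m1.add m2) m3 one_le_two
    _ ≤ (eLpNorm ((fun y => G (Ψ n y)) - fun y => g (Ψ n y)) 2 μ
          + eLpNorm ((fun y => g (Ψ n y)) - g) 2 μ) + eLpNorm (g - G) 2 μ := by
        gcongr
        exact eLpNorm_add_le m1 m2 one_le_two
    _ ≤ K * δ + δ + δ := by gcongr <;> assumption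

lemma memLp_weakLaplacian {f : Euc m → Euc l} (hf : MemW22 (Metric.ball x R) f) :
    MemLp (weakLaplacian (Metric.ball x R) f) 2 (volume.restrict (Metric.ball x R)) :=
  memLp_finsetSum _ fun i _ => hf.memLp_partial_partial i i

/-- The first variation formula for the biharmonic energy under domain variations. -/
lemma first_variation {f : Euc m → Euc l} (hf : MemW22 (Metric.ball x R) f)
    (hξt : IsTest (Metric.ball x R) ξ)
    (hd : HasDerivAt (fun t : ℝ => biEnergy (Metric.ball x R) fun y => f (y + t • ξ y)) 0 0) :
    2 * ∫ y in Metric.ball x R, inner ℝ (weakLaplacian (Metric.ball x R) f y)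
        (varOne (Metric.ball x R) f ξ id y)
      = ∫ y in Metric.ball x R, divg ξ y * ‖weakLaplacian (Metric.ball x R) f y‖ ^ 2 := by
  obtain ⟨hξ, hc, hξs⟩ := hξt
  set Ω := Metric.ball x R with hΩ
  have hΩm : MeasurableSet Ω := Metric.isOpen_ball.measurableSet
  set L := weakLaplacian Ω f with hL
  obtain ⟨t₀, ht₀, Φ, hΦ⟩ := exists_flow hξ hc
  -- The derivative is assumed to exist, so its value may be identified along one sequence `t_n →
  -- 0`.
  set t : ℕ → ℝ := fun n => t₀ / 2 / (n + 1) with ht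
  have htpos : ∀ n, 0 < t n := fun n => by positivity
  have htlt : ∀ n, |t n| < t₀ := fun n => by
    rw [abs_of_pos (htpos n)]
    have : t n ≤ t₀ / 2 := div_le_self (by positivity) (by linarith [(n.cast_nonneg : (0 : ℝ) ≤ n)])
    linarith
  have ht0 : Tendsto t atTop (𝓝 0) := by
    have := (tendsto_const_div_atTop_nhds_zero_nat (t₀ / 2)).comp (tendsto_add_atTop_nat 1)
    refine this.congr fun n => ?_
    simp [ht]
  set Ψ : ℕ → Euc m ≃ₜ Euc m := fun n => Φ (t n) with hΨ
  have hS : ∀ n, IsShift ξ (t n) (Ψ n) := fun n => ⟨(hΦ _ (htlt n)).1, (hΦ _ (htlt n)).2⟩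
  have hcomp : ∀ {G : Euc m → Euc l}, MemLp G 2 (volume.restrict Ω) →
      TendstoLtwo (volume.restrict Ω) (fun n y => G (Ψ n y)) G := fun hG =>
    tendstoLtwo_comp_shift hξ hc hξs ht0 hS hG
  have hcoef : ∀ i j, Continuous fun y => pd i ξ y j := fun i j =>
    (contDiff_apply_coord (contDiff_pd hξ i) j).continuous
  have hcoef2 : ∀ i j, Continuous fun y => pd i (pd i ξ) y j := fun i j =>
    (contDiff_apply_coord (contDiff_pd (contDiff_pd hξ i) i) j).continuous
  have hLm : MemLp L 2 (volume.restrict Ω) := memLp_weakLaplacian hf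
  have cL : TendstoLtwo (volume.restrict Ω) (fun n y => L (Ψ n y)) L := hcomp hLm
  have c1 : TendstoLtwo (volume.restrict Ω) (fun n => varOne Ω f ξ (Ψ n)) (varOne Ω f ξ id) := by
    refine TendstoLtwo.add ?_ ?_
    · exact TendstoLtwo.sum _ fun i _ => TendstoLtwo.sum _ fun j _ =>
        (hcomp (hf.memLp_partial j)).smul_continuous (hcoef2 i j)
    · exact TendstoLtwo.sum _ fun i _ => TendstoLtwo.sum _ fun k _ =>
        ((hcomp (hf.memLp_partial_partial i k)).add
          (hcomp (hf.memLp_partial_partial k i))).smul_continuous (hcoef i k)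
  have c2 : TendstoLtwo (volume.restrict Ω) (fun n => varTwo Ω f ξ (Ψ n)) (varTwo Ω f ξ id) :=
    TendstoLtwo.sum _ fun i _ => TendstoLtwo.sum _ fun j _ => TendstoLtwo.sum _ fun k _ =>
      (hcomp (hf.memLp_partial_partial j k)).smul_continuous
        (c := fun y => pd i ξ y j * pd i ξ y k) ((hcoef i j).mul (hcoef i k))
  have cW := c1.add (c2.seq_smul_zero ht0)
  simp only [add_zero] at cW
  set W : ℕ → Euc m → Euc l := fun n z => varOne Ω f ξ (Ψ n) z + t n • varTwo Ω f ξ (Ψ n) z with hW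
  -- the energies along the sequence
  have hE : ∀ n, biEnergy Ω (fun y => f (y + t n • ξ y)) =
      (∫ y in Ω, ‖L (Ψ n y)‖ ^ 2) + 2 * t n * (∫ y in Ω, inner ℝ (L (Ψ n y)) (W n y))
        + t n ^ 2 * ∫ y in Ω, inner ℝ (W n y) (W n y) := by
    intro n
    have hae := weakLaplacian_shift_ae hf hξ hξs (hS n)
    unfold biEnergy
    have e : ∫ y in Ω, ‖weakLaplacian Ω (fun y => f (y + t n • ξ y)) y‖ ^ 2 =
        ∫ y in Ω, (‖L (Ψ n y)‖ ^ 2 + 2 * t n * inner ℝ (L (Ψ n y)) (W n y)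
          + t n ^ 2 * inner ℝ (W n y) (W n y)) := by
      apply integral_congr_ae
      filter_upwards [hae] with y hy
      rw [hy, norm_add_sq_real, real_inner_smul_right, norm_smul, mul_pow, Real.norm_eq_abs,
        sq_abs, real_inner_self_eq_norm_sq]
      ring
    rw [e]
    have i1 : Integrable (fun y => ‖L (Ψ n y)‖ ^ 2) (volume.restrict Ω) := by
      simp_rw [norm_sq_eq_inner]
      exact integrable_inner_of_memLp (cL.memLp_seq n) (cL.memLp_seq n)
    have i2 := (integrable_inner_of_memLp (cL.memLp_seq n) (cW.memLp_seq n)).const_mul (2 * t n)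
    have i3 := (integrable_inner_of_memLp (cW.memLp_seq n) (cW.memLp_seq n)).const_mul (t n ^ 2)
    have i12 : Integrable (fun y => ‖L (Ψ n y)‖ ^ 2 + 2 * t n * inner ℝ (L (Ψ n y)) (W n y))
      (volume.restrict Ω) := i1.add i2
    rw [integral_add i12 i3, integral_add i1 i2, integral_const_mul, integral_const_mul]
  have hE0 : biEnergy Ω (fun y => f (y + (0 : ℝ) • ξ y)) = ∫ y in Ω, ‖L y‖ ^ 2 := by
    simp only [zero_smul, add_zero]
    rfl
  -- `L` is merely in `L²`, so `L ∘ Ψ` cannot be differentiated in `t`. Writing the undeformed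
  -- energy by a change of variables places the whole difference in the Jacobian.
  have hJ : ∀ n, ∫ y in Ω, ‖L y‖ ^ 2 = ∫ y in Ω, jacDet ξ (t n) y * ‖L (Ψ n y)‖ ^ 2 := fun n =>
    ((hS n).setIntegral_eq hξ hΩm hξs fun z => ‖L z‖ ^ 2).symm
  -- the slope of the energy
  have hslope : Tendsto (fun n => (biEnergy Ω (fun y => f (y + t n • ξ y))
      - biEnergy Ω (fun y => f (y + (0 : ℝ) • ξ y))) / t n) atTop (𝓝 0) := by
    have h1 := hasDerivAt_iff_tendsto_slope.1 hd
    have h2 : Tendsto t atTop (𝓝[≠] 0) := tendsto_nhdsWithin_iff.2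
      ⟨ht0, Eventually.of_forall fun n => (htpos n).ne'⟩
    refine (h1.comp h2).congr fun n => ?_
    simp [slope_def_field]
  have l1 := cL.integral_inner cW
  have l2 := cW.integral_inner cW
  have hdiv := continuous_divg hξ
  have l3 : Tendsto (fun n => ∫ y in Ω, divg ξ y * ‖L (Ψ n y)‖ ^ 2) atTop
      (𝓝 (∫ y in Ω, divg ξ y * ‖L y‖ ^ 2)) := by
    have := (cL.smul_continuous hdiv).integral_inner cL
    simp_rw [real_inner_smul_left, real_inner_self_eq_norm_sq] at this
    exact this
  have l4 : Tendsto (fun n => ∫ y in Ω, ‖L (Ψ n y)‖ ^ 2) atTop (𝓝 (∫ y in Ω, ‖L y‖ ^ 2)) := by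
    have := cL.integral_inner cL
    simp_rw [real_inner_self_eq_norm_sq] at this
    exact this
  have iL : ∀ n, Integrable (fun y => ‖L (Ψ n y)‖ ^ 2) (volume.restrict Ω) := fun n => by
    simp_rw [norm_sq_eq_inner]
    exact integrable_inner_of_memLp (cL.memLp_seq n) (cL.memLp_seq n)
  have iD : ∀ n, Integrable (fun y => divg ξ y * ‖L (Ψ n y)‖ ^ 2) (volume.restrict Ω) := fun n => by
    have := integrable_inner_of_memLp ((cL.smul_continuous hdiv).memLp_seq n) (cL.memLp_seq n)
    simp_rw [real_inner_smul_left, real_inner_self_eq_norm_sq] at this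
    exact this
  -- The Jacobian equals `1 + t div ξ` up to a uniform `o(t)`, so the difference quotient of the
  -- transported energies cancels the divergence term in the limit.
  have l5 : Tendsto (fun n => ((∫ y in Ω, ‖L (Ψ n y)‖ ^ 2) - ∫ y in Ω, ‖L y‖ ^ 2) / t n
      + ∫ y in Ω, divg ξ y * ‖L (Ψ n y)‖ ^ 2) atTop (𝓝 0) := by
    rw [Metric.tendsto_atTop]
    intro ε hε
    set A : ℝ := (∫ y in Ω, ‖L y‖ ^ 2) + 1 with hA
    have hA0 : 0 < A := by
      have : 0 ≤ ∫ y in Ω, ‖L y‖ ^ 2 := integral_nonneg fun y => by positivity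
      linarith
    obtain ⟨δ, hδ, hJd⟩ := exists_jacDet_sub_le hξ hc (div_pos hε (mul_pos two_pos hA0))
    have ev1 := ht0.eventually (Metric.ball_mem_nhds 0 hδ)
    have ev2 := l4.eventually (gt_mem_nhds (lt_add_one _))
    obtain ⟨n₀, hn₀⟩ := eventually_atTop.1 (ev1.and ev2)
    refine ⟨n₀, fun n hn => ?_⟩
    obtain ⟨h1, h2⟩ := hn₀ n hn
    rw [dist_zero_right, Real.norm_eq_abs] at h1
    have hJc : Integrable (fun y => jacDet ξ (t n) y * ‖L (Ψ n y)‖ ^ 2) (volume.restrict Ω) := by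
      have hcd : Continuous (jacDet ξ (t n)) := by
        unfold jacDet
        have hj : Continuous fun y => jacMat ξ y := continuous_matrix fun i j => hcoef j i
        exact Continuous.matrix_det (continuous_const.add (hj.const_smul (t n)))
      have := integrable_inner_of_memLp ((cL.smul_continuous hcd).memLp_seq n) (cL.memLp_seq n)
      simp_rw [real_inner_smul_left, real_inner_self_eq_norm_sq] at this
      exact this
    have e : ((∫ y in Ω, ‖L (Ψ n y)‖ ^ 2) - ∫ y in Ω, ‖L y‖ ^ 2) / t n
        + (∫ y in Ω, divg ξ y * ‖L (Ψ n y)‖ ^ 2) =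
        - (∫ y in Ω, (jacDet ξ (t n) y - 1 - t n * divg ξ y) * ‖L (Ψ n y)‖ ^ 2) / t n := by
      have e1 : ∫ y in Ω, (jacDet ξ (t n) y - 1 - t n * divg ξ y) * ‖L (Ψ n y)‖ ^ 2 =
          (∫ y in Ω, jacDet ξ (t n) y * ‖L (Ψ n y)‖ ^ 2) - (∫ y in Ω, ‖L (Ψ n y)‖ ^ 2)
          - t n * ∫ y in Ω, divg ξ y * ‖L (Ψ n y)‖ ^ 2 := by
        have hJL : Integrable (fun y => jacDet ξ (t n) y * ‖L (Ψ n y)‖ ^ 2 - ‖L (Ψ n y)‖ ^ 2)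
          (volume.restrict Ω) := hJc.sub (iL n)
        rw [← integral_const_mul, ← integral_sub hJc (iL n),
          ← integral_sub hJL ((iD n).const_mul _)]
        congr 1 with y
        ring
      rw [e1, ← hJ n]
      have := (htpos n).ne'
      field_simp
      ring
    rw [dist_zero_right, e, norm_div, norm_neg]
    have e2 : ‖∫ y in Ω, (jacDet ξ (t n) y - 1 - t n * divg ξ y) * ‖L (Ψ n y)‖ ^ 2‖ ≤
        ∫ y in Ω, ε / (2 * A) * |t n| * ‖L (Ψ n y)‖ ^ 2 := by
      refine norm_integral_le_of_norm_le ((iL n).const_mul _) (Eventually.of_forall fun y => ?_)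
      rw [norm_mul, Real.norm_eq_abs, Real.norm_of_nonneg (by positivity : 0 ≤ ‖L (Ψ n y)‖ ^ 2)]
      exact mul_le_mul_of_nonneg_right (hJd _ h1 y) (by positivity)
    rw [integral_const_mul] at e2
    have htn : ‖t n‖ = |t n| := Real.norm_eq_abs _
    have htp : 0 < |t n| := abs_pos.2 (htpos n).ne'
    rw [htn, div_lt_iff₀ htp]
    refine e2.trans_lt ?_
    calc ε / (2 * A) * |t n| * ∫ y in Ω, ‖L (Ψ n y)‖ ^ 2 ≤ ε / (2 * A) * |t n| * A := by
          gcongr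
      _ = ε / 2 * |t n| := by field_simp
      _ < ε * |t n| := by gcongr; linarith
  have l6 := (l5.sub l3).add ((l1.const_mul 2).add (ht0.mul l2))
  have key : ∀ n, ((∫ y in Ω, ‖L (Ψ n y)‖ ^ 2) - ∫ y in Ω, ‖L y‖ ^ 2) / t n
      + (∫ y in Ω, divg ξ y * ‖L (Ψ n y)‖ ^ 2) - (∫ y in Ω, divg ξ y * ‖L (Ψ n y)‖ ^ 2)
      + (2 * (∫ y in Ω, inner ℝ (L (Ψ n y)) (W n y)) + t n * ∫ y in Ω, inner ℝ (W n y) (W n y))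
      = (biEnergy Ω (fun y => f (y + t n • ξ y))
      - biEnergy Ω (fun y => f (y + (0 : ℝ) • ξ y))) / t n := by
    intro n
    rw [hE, hE0]
    have := (htpos n).ne'
    field_simp
    ring
  have := tendsto_nhds_unique (l6.congr key) hslope
  linarith

end FirstVariation

/-! ### Radial kernels -/

/-- A smooth radial profile vanishing on `[1, ∞)`. -/
structure IsCutoff (k : ℝ → ℝ) : Prop where
  contDiff : ContDiff ℝ ∞ k
  zero : ∀ s, 1 ≤ s → k s = 0

namespace IsCutoff

variable {k k' : ℝ → ℝ}

lemma deriv (h : IsCutoff k) : IsCutoff (deriv k) := by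
  have hc : ContDiff ℝ ∞ (_root_.deriv k) := (contDiff_infty_iff_deriv.1 h.contDiff).2
  refine ⟨hc, ?_⟩
  have h1 : ∀ s ∈ Ioi (1 : ℝ), _root_.deriv k s = 0 := fun s hs => by
    have : k =ᶠ[𝓝 s] fun _ => 0 := by
      filter_upwards [Ioi_mem_nhds hs] with t ht using h.zero t (le_of_lt ht)
    rw [this.deriv_eq, deriv_const]
  have h2 : EqOn (_root_.deriv k) (fun _ => 0) (closure (Ioi 1)) :=
    EqOn.closure h1 hc.continuous continuous_const
  rw [closure_Ioi] at h2
  exact fun s hs => h2 hs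

lemma add (h : IsCutoff k) (h' : IsCutoff k') : IsCutoff fun s => k s + k' s :=
  ⟨h.contDiff.add h'.contDiff, fun s hs => by simp [h.zero s hs, h'.zero s hs]⟩

lemma const_mul (h : IsCutoff k) (c : ℝ) : IsCutoff fun s => c * k s :=
  ⟨contDiff_const.mul h.contDiff, fun s hs => by simp [h.zero s hs]⟩

lemma id_mul (h : IsCutoff k) : IsCutoff fun s => s * k s :=
  ⟨contDiff_id.mul h.contDiff, fun s hs => by simp [h.zero s hs]⟩

lemma exists_bound (h : IsCutoff k) : ∃ M : ℝ, 0 ≤ M ∧ ∀ s, 0 ≤ s → |k s| ≤ M := by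
  obtain ⟨M, hM⟩ := (isCompact_Icc (a := (0 : ℝ)) (b := 1)).exists_bound_of_continuousOn
    h.contDiff.continuous.continuousOn
  refine ⟨max M 0, le_max_right _ _, fun s hs => ?_⟩
  rcases le_total s 1 with h1 | h1
  · exact (hM s ⟨hs, h1⟩).trans (le_max_left _ _)
  · rw [h.zero s h1, abs_zero]; exact le_max_right _ _

end IsCutoff

/-- The action `k ↦ 2 s k'` of the radial derivative on profiles. -/
noncomputable def eulerProfile (k : ℝ → ℝ) (s : ℝ) : ℝ := 2 * (s * deriv k s)

lemma IsCutoff.eulerProfile {k : ℝ → ℝ} (h : IsCutoff k) : IsCutoff (eulerProfile k) :=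
  h.deriv.id_mul.const_mul 2

section Kernel

variable {m : ℕ} {k : ℝ → ℝ}

/-- The kernel `k (|z - y|² / r²)`. -/
noncomputable def ker (k : ℝ → ℝ) (y : Euc m) (r : ℝ) (z : Euc m) : ℝ := k (‖z - y‖ ^ 2 / r ^ 2)

lemma contDiff_ker (hk : ContDiff ℝ ∞ k) (y : Euc m) (r : ℝ) : ContDiff ℝ ∞ (ker k y r) :=
  hk.comp (((contDiff_id.sub contDiff_const).norm_sq ℝ).div_const _)

lemma pd_ker (hk : ContDiff ℝ ∞ k) (y : Euc m) (r : ℝ) (j : Fin m) (z : Euc m) :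
    pd j (ker k y r) z = 2 / r ^ 2 * ker (deriv k) y r z * coordSub y j z := by
  have h1 : HasFDerivAt (fun z : Euc m => z - y) (ContinuousLinearMap.id ℝ (Euc m)) z :=
    (hasFDerivAt_id z).sub_const y
  have h2 := (h1.norm_sq).mul_const ((r ^ 2)⁻¹)
  have h3 : HasDerivAt k (deriv k (‖z - y‖ ^ 2 * (r ^ 2)⁻¹)) (‖z - y‖ ^ 2 * (r ^ 2)⁻¹) :=
    (hk.differentiable (by simp) _).hasDerivAt
  have h4 := h3.comp_hasFDerivAt z h2
  have e : ker k y r = k ∘ fun z => ‖z - y‖ ^ 2 * (r ^ 2)⁻¹ := by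
    ext z; simp [ker, div_eq_mul_inv]
  unfold pd
  rw [e, h4.fderiv]
  simp [ker, coordSub, div_eq_mul_inv, EuclideanSpace.inner_single_right]
  ring

lemma sum_coordSub_sq (y z : Euc m) : ∑ j, coordSub y j z ^ 2 = ‖z - y‖ ^ 2 := by
  rw [EuclideanSpace.norm_sq_eq]
  simp [coordSub]

lemma euler_ker (hk : ContDiff ℝ ∞ k) (y : Euc m) (r : ℝ) (z : Euc m) :
    euler y (ker k y r) z = ker (eulerProfile k) y r z := by
  unfold euler
  simp_rw [pd_ker hk, smul_eq_mul]
  have : ∀ j, coordSub y j z * (2 / r ^ 2 * ker (deriv k) y r z * coordSub y j z) =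
      2 / r ^ 2 * ker (deriv k) y r z * coordSub y j z ^ 2 := fun j => by ring
  simp_rw [this, ← Finset.mul_sum, sum_coordSub_sq]
  simp only [ker, eulerProfile]
  ring

lemma ker_eq_zero (hk : IsCutoff k) {y : Euc m} {r : ℝ} (hr : 0 < r) {z : Euc m}
    (hz : z ∉ Metric.ball y r) : ker k y r z = 0 := by
  apply hk.zero
  rw [Metric.mem_ball, not_lt, dist_eq_norm] at hz
  rw [one_le_div (by positivity)]
  gcongr

lemma support_ker_subset (hk : IsCutoff k) {y : Euc m} {r : ℝ} (hr : 0 < r) :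
    Function.support (ker k y r) ⊆ Metric.ball y r := fun z hz => by
  by_contra h
  exact hz (ker_eq_zero hk hr h)

lemma tsupport_ker_subset (hk : IsCutoff k) {y : Euc m} {r : ℝ} (hr : 0 < r) :
    tsupport (ker k y r) ⊆ Metric.closedBall y r :=
  (closure_mono (support_ker_subset hk hr)).trans Metric.closure_ball_subset_closedBall

lemma hasCompactSupport_ker (hk : IsCutoff k) {y : Euc m} {r : ℝ} (hr : 0 < r) :
    HasCompactSupport (ker k y r) :=
  HasCompactSupport.of_support_subset_isCompact (isCompact_closedBall y r)
    ((support_ker_subset hk hr).trans Metric.ball_subset_closedBall)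

end Kernel

/-! ### First variation along radial fields -/

section RadialVariation

variable {m l : ℕ}

/-- The first variation along the radial field `ψ(z) (z - y)`. -/
lemma varOne_radial (Ω : Set (Euc m)) (f : Euc m → Euc l) (y : Euc m) {ψ w : Euc m → ℝ}
    (hψ : ContDiff ℝ ∞ ψ) (hw : ContDiff ℝ ∞ w)
    (h : ∀ j z, pd j ψ z = -(w z * coordSub y j z)) (z : Euc m) :
    varOne Ω f (fun z => ψ z • (z - y)) id z =
      (2 * ψ z) • weakLaplacian Ω f z
        - ((2 * w z) • radialDeriv2 Ω y f z + (m * w z + euler y w z) • radialDeriv Ω y f z) := by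
  set ξ : Euc m → Euc m := fun z => ψ z • (z - y) with hξ
  have hξs : ContDiff ℝ ∞ ξ := hψ.smul (contDiff_id.sub contDiff_const)
  have hco : ∀ j, (fun z => ξ z j) = fun z => ψ z * coordSub y j z := fun j => by
    ext z; simp [hξ, coordSub]
  have h1 : ∀ i j, (fun z => pd i ξ z j) =
      fun z => -(w z * (coordSub y i z * coordSub y j z)) + ψ z * (if i = j then 1 else 0) := by
    intro i j
    ext z
    rw [← pd_apply hξs, hco, pd_mul hψ (contDiff_coordSub y j), h, pd_coordSub]
    ring
  have hneg : ∀ (a : Euc m → ℝ) i z, ContDiff ℝ ∞ a → pd i (fun z => -a z) z = -pd i a z := by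
    intro a i z ha
    unfold pd
    rw [fderiv_fun_neg]
    rfl
  -- Second derivatives of the field, computed from `∇ψ = -w (z - y)`; the derivatives of `w` enter
  -- after summation only through its radial derivative.
  have h2 : ∀ i j, pd i (pd i ξ) z j =
      -(pd i w z * (coordSub y i z * coordSub y j z) + w z * coordSub y j z
        + 2 * (if i = j then 1 else 0) * w z * coordSub y i z) := by
    intro i j
    have hm : ContDiff ℝ ∞ fun z => coordSub y i z * coordSub y j z :=
      (contDiff_coordSub y i).mul (contDiff_coordSub y j)
    have hψ' : ContDiff ℝ ∞ fun z => ψ z * (if i = j then (1 : ℝ) else 0) :=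
      hψ.mul contDiff_const
    have hd : pd i (fun z => ψ z * (if i = j then (1 : ℝ) else 0)) z =
        pd i ψ z * (if i = j then (1 : ℝ) else 0) := by
      rw [pd_mul hψ contDiff_const]
      simp [pd]
    rw [← pd_apply (contDiff_pd hξs i), h1, pd_add (hw.mul hm).neg hψ',
      hneg _ _ _ (hw.mul hm), pd_mul hw hm, pd_mul (contDiff_coordSub y i) (contDiff_coordSub y j),
      hd, h, pd_coordSub, pd_coordSub]
    simp only [if_true]
    ring
  have h1' : ∀ i j, pd i ξ z j =
      -(w z * (coordSub y i z * coordSub y j z)) + ψ z * (if i = j then 1 else 0) :=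
    fun i j => congrFun (h1 i j) z
  have hX : ∀ j, z j - y j = coordSub y j z := fun j => rfl
  have hv : radialDeriv Ω y f z = ∑ j, coordSub y j z • weakPartial Ω j f z := rfl
  set a := fun j => coordSub y j z with ha
  set F := fun j => weakPartial Ω j f z with hF
  set H := fun i j => weakPartial Ω j (weakPartial Ω i f) z with hH
  have key1 : ∑ i, ∑ j, (pd i (pd i ξ) z j) • F j =
      -((m * w z + euler y w z + 2 * w z) • radialDeriv Ω y f z) := by
    rw [Finset.sum_comm]
    have : ∀ j, ∑ i, (pd i (pd i ξ) z j) • F j =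
        -((m * w z + euler y w z + 2 * w z) • (a j • F j)) := by
      intro j
      rw [← Finset.sum_smul, smul_smul, ← neg_smul]
      congr 1
      simp_rw [h2, Finset.sum_neg_distrib, Finset.sum_add_distrib]
      simp only [euler, smul_eq_mul, mul_ite, mul_one, mul_zero, ite_mul, zero_mul,
        Finset.sum_ite_eq', Finset.sum_const, Finset.card_univ, Fintype.card_fin, nsmul_eq_mul,
        Finset.mem_univ, if_true]
      have e : ∑ i, pd i w z * (coordSub y i z * coordSub y j z) =
        (∑ i, coordSub y i z * pd i w z) * coordSub y j z := by
        rw [Finset.sum_mul]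
        exact Finset.sum_congr rfl fun i _ => by ring
      rw [e]
      simp only [ha]
      ring
    rw [Finset.sum_congr rfl fun j _ => this j, Finset.sum_neg_distrib, ← Finset.smul_sum, hv]
  have hR2 : radialDeriv2 Ω y f z - radialDeriv Ω y f z = ∑ i, ∑ j, (a i * a j) • H i j := by
    simp [radialDeriv2, ha, hH]
  have hR2' : radialDeriv2 Ω y f z - radialDeriv Ω y f z = ∑ i, ∑ j, (a i * a j) • H j i := by
    rw [hR2, Finset.sum_comm]
    simp_rw [mul_comm]
  have key2 : ∑ i, ∑ j, (pd i ξ z j) • (H i j + H j i) =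
      -((2 * w z) • (radialDeriv2 Ω y f z - radialDeriv Ω y f z))
        + (2 * ψ z) • weakLaplacian Ω f z := by
    simp_rw [h1', add_smul, Finset.sum_add_distrib, mul_ite, mul_one, mul_zero, ite_smul, zero_smul,
      Finset.sum_ite_eq, Finset.mem_univ, if_true, smul_add, Finset.sum_add_distrib, neg_smul,
      Finset.sum_neg_distrib, mul_smul (w z), ← Finset.smul_sum]
    have e1 : ∑ i, ∑ j, (coordSub y i z * coordSub y j z) • H i j =
      radialDeriv2 Ω y f z - radialDeriv Ω y f z := hR2.symm
    have e2 : ∑ i, ∑ j, (coordSub y i z * coordSub y j z) • H j i =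
      radialDeriv2 Ω y f z - radialDeriv Ω y f z := hR2'.symm
    have e3 : ∑ i, H i i = weakLaplacian Ω f z := rfl
    rw [e1, e2, e3]
    module
  have hvar : varOne Ω f ξ id z = ∑ i, ∑ j, (pd i (pd i ξ) z j) • F j +
      ∑ i, ∑ j, (pd i ξ z j) • (H i j + H j i) := rfl
  rw [hvar, key1, key2]
  module

end RadialVariation

/-! ### Admissible radial profiles -/

section Profile

/-- A cutoff which is strictly decreasing on `(-∞, 1)`. -/
structure IsProfile (p : ℝ → ℝ) : Prop extends IsCutoff p where
  deriv_neg : ∀ s, s < 1 → deriv p s < 0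

/-- The profile `-2 p'`. -/
noncomputable def slopeProfile (p : ℝ → ℝ) (s : ℝ) : ℝ := -2 * deriv p s

/-- The profile governing the gradient term of the monotone quantity. -/
noncomputable def gradProfile (m : ℕ) (p : ℝ → ℝ) (s : ℝ) : ℝ :=
  (m - 4) * slopeProfile p s + eulerProfile (slopeProfile p) s

variable {p : ℝ → ℝ}

lemma IsCutoff.slopeProfile (h : IsCutoff p) : IsCutoff (slopeProfile p) := h.deriv.const_mul (-2)

lemma IsCutoff.gradProfile (h : IsCutoff p) (m : ℕ) : IsCutoff (gradProfile m p) :=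
  (h.slopeProfile.const_mul _).add h.slopeProfile.eulerProfile

lemma IsProfile.slopeProfile_pos (h : IsProfile p) {s : ℝ} (hs : s < 1) : 0 < slopeProfile p s := by
  have := h.deriv_neg s hs
  unfold slopeProfile
  linarith

lemma IsProfile.slopeProfile_nonneg (h : IsProfile p) (s : ℝ) : 0 ≤ slopeProfile p s := by
  rcases lt_or_ge s 1 with hs | hs
  · exact (h.slopeProfile_pos hs).le
  · rw [h.toIsCutoff.slopeProfile.zero s hs]

lemma eulerProfile_const_mul (c : ℝ) (k : ℝ → ℝ) :
    eulerProfile (fun s => c * k s) = fun s => c * eulerProfile k s := by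
  ext s
  simp only [eulerProfile, deriv_const_mul_field]
  ring

lemma IsProfile.nonneg (h : IsProfile p) (s : ℝ) : 0 ≤ p s := by
  rcases le_or_gt 1 s with hs | hs
  · rw [h.zero s hs]
  · have hanti : AntitoneOn p (Iic 1) := by
      refine antitoneOn_of_deriv_nonpos (convex_Iic 1) h.contDiff.continuous.continuousOn
        (h.contDiff.differentiable (by simp)).differentiableOn fun t ht => ?_
      rw [interior_Iic] at ht
      exact (h.deriv_neg t ht).le
    have := hanti (mem_Iic.2 hs.le) (mem_Iic.2 le_rfl) hs.le
    rwa [h.zero 1 le_rfl] at this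

/-- The function `exp (-1/(1 - s))`, extended by zero beyond `s = 1`. -/
lemma exists_isProfile : ∃ p : ℝ → ℝ, IsProfile p := by
  refine ⟨fun s => expNegInvGlue (1 - s), ⟨⟨?_, fun s hs => ?_⟩, fun s hs => ?_⟩⟩
  · exact expNegInvGlue.contDiff.comp (contDiff_const.sub contDiff_id)
  · exact expNegInvGlue.zero_of_nonpos (by linarith)
  · have h1 : HasDerivAt (fun s : ℝ => Real.exp (-(1 - s)⁻¹))
        (Real.exp (-(1 - s)⁻¹) * -(-(-1) / (1 - s) ^ 2)) s := by
      have h0 : HasDerivAt (fun s : ℝ => 1 - s) (-1) s := (hasDerivAt_id s).const_sub 1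
      exact ((h0.fun_inv (by linarith)).fun_neg).exp
    have h2 : (fun s => expNegInvGlue (1 - s)) =ᶠ[𝓝 s] fun s => Real.exp (-(1 - s)⁻¹) := by
      filter_upwards [Iio_mem_nhds hs] with t ht
      have : ¬ (1 - t ≤ 0) := by
        rw [mem_Iio] at ht
        linarith
      simp [expNegInvGlue, this]
    rw [h2.deriv_eq, h1.deriv]
    have : 0 < (1 - s) ^ 2 := pow_pos (by linarith) 2
    have h3 := Real.exp_pos (-(1 - s)⁻¹)
    have h4 : 0 < 1 / (1 - s) ^ 2 := by positivity
    simp only [neg_neg]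
    nlinarith [mul_pos h3 h4]

end Profile

/-! ### The inequality expressing stationarity -/

section Inequality

variable {m l : ℕ} {x : Euc m} {R : ℝ} {f : Euc m → Euc l}

/-- The squared derivative of `f` in the direction of `z - y`. -/
noncomputable def angSq (Ω : Set (Euc m)) (f : Euc m → Euc l) (y z : Euc m) : ℝ :=
  ‖radialDeriv Ω y f z‖ ^ 2 / ‖z - y‖ ^ 2

lemma norm_radialDeriv_sq_le (Ω : Set (Euc m)) (f : Euc m → Euc l) (y z : Euc m) :
    ‖radialDeriv Ω y f z‖ ^ 2 ≤ ‖z - y‖ ^ 2 * gradSq Ω f z := by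
  have h : ‖radialDeriv Ω y f z‖ ≤ ∑ i, |coordSub y i z| * ‖weakPartial Ω i f z‖ :=
    (norm_sum_le _ _).trans (Finset.sum_le_sum fun i _ => by rw [norm_smul]; rfl)
  calc ‖radialDeriv Ω y f z‖ ^ 2 ≤ (∑ i, |coordSub y i z| * ‖weakPartial Ω i f z‖) ^ 2 := by gcongr
    _ ≤ (∑ i, |coordSub y i z| ^ 2) * ∑ i, ‖weakPartial Ω i f z‖ ^ 2 :=
        Finset.sum_mul_sq_le_sq_mul_sq _ _ _
    _ = _ := by simp_rw [sq_abs, sum_coordSub_sq, gradSq]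

lemma angSq_nonneg (Ω : Set (Euc m)) (f : Euc m → Euc l) (y z : Euc m) : 0 ≤ angSq Ω f y z := by
  unfold angSq; positivity

lemma gradSq_nonneg (Ω : Set (Euc m)) (f : Euc m → Euc l) (z : Euc m) : 0 ≤ gradSq Ω f z :=
  Finset.sum_nonneg fun _ _ => by positivity

lemma angSq_le (Ω : Set (Euc m)) (f : Euc m → Euc l) (y z : Euc m) :
    angSq Ω f y z ≤ gradSq Ω f z := by
  unfold angSq
  rcases eq_or_ne z y with rfl | h
  · simp [gradSq_nonneg]
  · rw [div_le_iff₀ (by have := norm_pos_iff.2 (sub_ne_zero.2 h); positivity), mul_comm]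
    exact norm_radialDeriv_sq_le Ω f y z

lemma norm_radialDeriv_sq_eq (Ω : Set (Euc m)) (f : Euc m → Euc l) (y z : Euc m) :
    ‖radialDeriv Ω y f z‖ ^ 2 = ‖z - y‖ ^ 2 * angSq Ω f y z := by
  unfold angSq
  rcases eq_or_ne z y with rfl | h
  · simp [radialDeriv]
  · have := norm_pos_iff.2 (sub_ne_zero.2 h)
    field_simp

lemma memLp_radialDeriv (hf : MemW22 (Metric.ball x R) f) (y : Euc m) :
    MemLp (radialDeriv (Metric.ball x R) y f) 2 (volume.restrict (Metric.ball x R)) :=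
  memLp_finsetSum _ fun i _ =>
    ((⟨fun _ => hf.memLp_partial i, hf.memLp_partial i, by simp⟩ :
      TendstoLtwo _ (fun _ => weakPartial (Metric.ball x R) i f) _).smul_continuous
      (contDiff_coordSub y i).continuous).memLp

lemma integrable_norm_sq_of_memLp {α F : Type*} [MeasurableSpace α] {μ : Measure α}
    [NormedAddCommGroup F] {g : α → F} (h : MemLp g 2 μ) :
    Integrable (fun z => ‖g z‖ ^ 2) μ := by
  simpa using h.integrable_norm_pow two_ne_zero

lemma integrable_gradSq (hf : MemW22 (Metric.ball x R) f) :
    Integrable (gradSq (Metric.ball x R) f) (volume.restrict (Metric.ball x R)) :=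
  integrable_finsetSum _ fun i _ => integrable_norm_sq_of_memLp (hf.memLp_partial i)

lemma integrable_lapSq (hf : MemW22 (Metric.ball x R) f) :
    Integrable (fun z => ‖weakLaplacian (Metric.ball x R) f z‖ ^ 2)
      (volume.restrict (Metric.ball x R)) :=
  integrable_norm_sq_of_memLp (memLp_weakLaplacian hf)

lemma integrable_angSq (hf : MemW22 (Metric.ball x R) f) (y : Euc m) :
    Integrable (angSq (Metric.ball x R) f y) (volume.restrict (Metric.ball x R)) := by
  refine (integrable_gradSq hf).mono' ?_ (Eventually.of_forall fun z => ?_)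
  · exact (((memLp_radialDeriv hf y).1.norm.pow 2).aemeasurable.div
      ((continuous_id.sub continuous_const).norm.pow 2).measurable.aemeasurable).aestronglyMeasurable
  · rw [Real.norm_of_nonneg (angSq_nonneg _ _ _ _)]
    exact angSq_le _ _ _ _

/-- The integral of `g` against the kernel `k (|z - y|² / r²)`. -/
noncomputable def kerInt (Ω : Set (Euc m)) (k : ℝ → ℝ) (g : Euc m → ℝ) (y : Euc m) (r : ℝ) : ℝ :=
  ∫ z in Ω, ker k y r z * g z

lemma integrable_ker_mul {k : ℝ → ℝ} (hk : IsCutoff k) {μ : Measure (Euc m)} {g : Euc m → ℝ}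
    (hg : Integrable g μ) (y : Euc m) (r : ℝ) : Integrable (fun z => ker k y r z * g z) μ := by
  obtain ⟨M, -, hM⟩ := hk.exists_bound
  exact hg.bdd_mul (contDiff_ker hk.contDiff y r).continuous.aestronglyMeasurable
    (Eventually.of_forall fun z => hM _ (by positivity))

lemma memLp_continuous_smul {g : Euc m → Euc l} (hg : MemLp g 2 (volume.restrict (Metric.ball x R)))
    {c : Euc m → ℝ} (hc : Continuous c) :
    MemLp (fun z => c z • g z) 2 (volume.restrict (Metric.ball x R)) :=
  ((⟨fun _ => hg, hg, by simp⟩ : TendstoLtwo _ (fun _ => g) g).smul_continuous hc).memLp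

/-- The differential inequality expressing the stationarity under radial variations. -/
lemma stationary_inequality (hf : MemW22 (Metric.ball x R) f)
    (hs : ∀ ξ : Euc m → Euc m, IsTest (Metric.ball x R) ξ →
      HasDerivAt (fun t : ℝ => biEnergy (Metric.ball x R) fun y => f (y + t • ξ y)) 0 0)
    {p : ℝ → ℝ} (hp : IsProfile p) {y : Euc m} {r : ℝ} (hr : 0 < r)
    (hy : Metric.closedBall y r ⊆ Metric.ball x R) :
    0 ≤ kerInt (Metric.ball x R) (fun s => (4 - m) * p s - eulerProfile p s)
        (fun z => ‖weakLaplacian (Metric.ball x R) f z‖ ^ 2) y r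
      + (r ^ 2)⁻¹ * (kerInt (Metric.ball x R)
          (fun s => (m - 2) * gradProfile m p s + eulerProfile (gradProfile m p) s)
          (gradSq (Metric.ball x R) f) y r
        + kerInt (Metric.ball x R) (fun s => 4 * eulerProfile (slopeProfile p) s)
          (angSq (Metric.ball x R) f y) y r) := by
  set Ω := Metric.ball x R with hΩ
  have hpc := hp.toIsCutoff
  set q := slopeProfile p with hq
  have hqc : IsCutoff q := hpc.slopeProfile
  set c := (r ^ 2)⁻¹ with hc
  have hc0 : 0 < c := by positivity
  set ψ := ker p y r with hψ
  -- These weights satisfy `∇ψ = -w (z - y)` and `∇w = τ (z - y)`, so the weight produced by the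
  -- first variation along `ψ (z - y)` is also the weight of the Pohozaev inequality.
  set w := ker (fun s => c * q s) y r with hw
  set τ := ker (fun s => 2 * c ^ 2 * deriv q s) y r with hτ
  have hcq : IsCutoff fun s => c * q s := hqc.const_mul c
  have hψs : ContDiff ℝ ∞ ψ := contDiff_ker hpc.contDiff y r
  have hws : ContDiff ℝ ∞ w := contDiff_ker hcq.contDiff y r
  have hψw : ∀ j z, pd j ψ z = -(w z * coordSub y j z) := by
    intro j z
    rw [hψ, pd_ker hpc.contDiff]
    simp only [hw, ker, hq, slopeProfile, hc]
    ring
  have hwτ : ∀ j z, pd j w z = τ z * coordSub y j z := by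
    intro j z
    rw [hw, pd_ker hcq.contDiff]
    simp only [hτ, ker, deriv_const_mul_field, hc]
    ring
  have hTw : ∀ z, euler y w z = c * ker (eulerProfile q) y r z := by
    intro z
    rw [hw, euler_ker hcq.contDiff, eulerProfile_const_mul]
    rfl
  have hTws : euler y w = ker (fun s => c * eulerProfile q s) y r := funext hTw
  have hTTw : ∀ z, euler y (euler y w) z = c * ker (eulerProfile (eulerProfile q)) y r z := by
    intro z
    rw [hTws, euler_ker (hqc.eulerProfile.const_mul c).contDiff, eulerProfile_const_mul]
    rfl
  -- the variation field
  set ξ : Euc m → Euc m := fun z => ψ z • (z - y) with hξ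
  have hξt : IsTest Ω ξ := by
    refine ⟨hψs.smul (contDiff_id.sub contDiff_const), ?_, ?_⟩
    · exact (hasCompactSupport_ker hpc hr).smul_right
    · exact (closure_mono (Function.support_smul_subset_left _ _)).trans
        ((tsupport_ker_subset hpc hr).trans hy)
  have hvar := first_variation hf hξt (hs ξ hξt)
  have hdiv : ∀ z, divg ξ z = ker (fun s => m * p s + eulerProfile p s) y r z := by
    intro z
    have h1 : ∀ i, pd i ξ z i = -(w z * coordSub y i z ^ 2) + ψ z := by
      intro i
      rw [← pd_apply hξt.1]
      have : (fun z => ξ z i) = fun z => ψ z * coordSub y i z := by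
        ext z; simp [hξ, coordSub]
      rw [this, pd_mul hψs (contDiff_coordSub y i), hψw, pd_coordSub, if_pos rfl]
      ring
    unfold divg
    simp_rw [h1, Finset.sum_add_distrib, Finset.sum_neg_distrib, ← Finset.mul_sum,
      sum_coordSub_sq]
    simp only [hw, hψ, ker, hq, slopeProfile, eulerProfile, hc, Finset.sum_const, Finset.card_univ,
      Fintype.card_fin, nsmul_eq_mul]
    ring
  set L := weakLaplacian Ω f with hL
  have hLm : MemLp L 2 (volume.restrict Ω) := memLp_weakLaplacian hf
  -- `A` is the Laplacian part of the Pohozaev form. By the first variation its integral is that of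
  -- `(4ψ - div ξ)|Δf|²`, which eliminates the second radial derivative.
  set A : Euc m → ℝ := fun z => 2 * inner ℝ (L z)
    ((2 * w z) • radialDeriv2 Ω y f z + (m * w z + euler y w z) • radialDeriv Ω y f z) with hA
  have hAe : ∀ z, A z = 4 * (ψ z * ‖L z‖ ^ 2) - 2 * inner ℝ (L z) (varOne Ω f ξ id z) := by
    intro z
    rw [varOne_radial Ω f y hψs hws hψw z, inner_sub_right, real_inner_smul_right,
      real_inner_self_eq_norm_sq]
    simp only [hA]
    ring
  have hvm : MemLp (varOne Ω f ξ id) 2 (volume.restrict Ω) := by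
    refine MemLp.add (memLp_finsetSum _ fun i _ => memLp_finsetSum _ fun j _ => ?_)
      (memLp_finsetSum _ fun i _ => memLp_finsetSum _ fun k _ => ?_)
    · exact memLp_continuous_smul (hf.memLp_partial j)
        (contDiff_apply_coord (contDiff_pd (contDiff_pd hξt.1 i) i) j).continuous
    · exact memLp_continuous_smul ((hf.memLp_partial_partial i k).add (hf.memLp_partial_partial k i))
        (contDiff_apply_coord (contDiff_pd hξt.1 i) k).continuous
  have iV : Integrable (fun z => inner ℝ (L z) (varOne Ω f ξ id z)) (volume.restrict Ω) :=
    integrable_inner_of_memLp hLm hvm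
  have i1 := integrable_lapSq hf
  have i2 := integrable_gradSq hf
  have i3 := integrable_angSq hf y
  have iψ := integrable_ker_mul hpc i1 y r
  have iA : Integrable A (volume.restrict Ω) := by
    rw [funext hAe]
    exact (iψ.const_mul 4).sub (iV.const_mul 2)
  have hAint : ∫ z in Ω, A z = kerInt Ω (fun s => (4 - m) * p s - eulerProfile p s)
      (fun z => ‖L z‖ ^ 2) y r := by
    have hk1 : IsCutoff fun s => m * p s + eulerProfile p s :=
      (hpc.const_mul _).add hpc.eulerProfile
    rw [integral_congr_ae (Eventually.of_forall hAe),
      integral_sub (iψ.const_mul 4) (iV.const_mul 2), integral_const_mul, integral_const_mul, hvar,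
      ← integral_const_mul]
    simp_rw [hdiv]
    rw [← integral_sub (iψ.const_mul 4) (integrable_ker_mul hk1 i1 y r)]
    unfold kerInt
    congr 1 with z
    simp only [ker, hψ]
    ring
  -- Since the profile is strictly decreasing, `w` is positive on all of `B_r(y)`, outside which `τ`
  -- vanishes.
  have hqτ : tsupport τ ⊆ tsupport w := by
    have hdc : IsCutoff fun s => 2 * c ^ 2 * deriv q s := hqc.deriv.const_mul _
    refine closure_mono ((support_ker_subset hdc hr).trans fun z hz => ?_)
    have : ‖z - y‖ ^ 2 / r ^ 2 < 1 := by
      rw [div_lt_one (by positivity)]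
      rw [Metric.mem_ball, dist_eq_norm] at hz
      gcongr
    exact (mul_pos hc0 (hp.slopeProfile_pos this)).ne'
  have hmain := integral_pohozaev_nonneg hf y hws (hasCompactSupport_ker hcq hr)
    ((tsupport_ker_subset hcq hr).trans hy) hwτ
    (fun z => mul_nonneg hc0.le (hp.slopeProfile_nonneg _))
    (contDiff_ker (hqc.deriv.const_mul _).contDiff y r).continuous hqτ
  have hκc : IsCutoff (gradProfile m p) := hpc.gradProfile m
  have hk2 : IsCutoff fun s => (m - 2) * gradProfile m p s + eulerProfile (gradProfile m p) s :=
    (hκc.const_mul _).add hκc.eulerProfile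
  have hk3 : IsCutoff fun s => 4 * eulerProfile q s := hqc.eulerProfile.const_mul 4
  -- With `κ = (m - 4) q + E q`, where `E` is `eulerProfile`, the coefficient of `|∇f|²` factors as
  -- `c ((m - 2) κ + E κ)`. This is the form that integrates to `r^(2-m) ∫ κ |∇f|²`.
  have heκ : ∀ s, eulerProfile (gradProfile m p) s =
      (m - 4) * eulerProfile q s + eulerProfile (eulerProfile q) s := by
    intro s
    have d1 : DifferentiableAt ℝ (fun s => ((m : ℝ) - 4) * q s) s :=
      ((hqc.const_mul _).contDiff.differentiable (by simp)) s
    have d2 : DifferentiableAt ℝ (eulerProfile q) s :=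
      (hqc.eulerProfile.contDiff.differentiable (by simp)) s
    have : deriv (gradProfile m p) s = (m - 4) * deriv q s + deriv (eulerProfile q) s := by
      have e : gradProfile m p = fun s => ((m : ℝ) - 4) * q s + eulerProfile q s := rfl
      rw [e, deriv_fun_add d1 d2, deriv_const_mul_field]
    have e1 : eulerProfile (gradProfile m p) s = 2 * (s * deriv (gradProfile m p) s) := rfl
    have e2 : eulerProfile q s = 2 * (s * deriv q s) := rfl
    have e3 : eulerProfile (eulerProfile q) s = 2 * (s * deriv (eulerProfile q) s) := rfl
    rw [e1, this, e2, e3]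
    ring
  have hsplit : ∀ z, pohozaevForm (w z) (m * w z + euler y w z)
      (euler y (euler y w) z + (m - 4) * euler y w z
        + (m - 2) * (euler y w z + (m - 4) * w z)) (τ z) (L z) (radialDeriv Ω y f z)
      (radialDeriv2 Ω y f z) (gradSq Ω f z) =
      A z + (c * (ker (fun s => (m - 2) * gradProfile m p s + eulerProfile (gradProfile m p) s)
        y r z * gradSq Ω f z)
      + c * (ker (fun s => 4 * eulerProfile q s) y r z * angSq Ω f y z)) := by
    intro z
    unfold pohozaevForm
    rw [hTTw, hTw, norm_radialDeriv_sq_eq]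
    have e0 : gradProfile m p = fun s => ((m : ℝ) - 4) * q s + eulerProfile q s := rfl
    have hsq : ‖z - y‖ ^ 2 * (r ^ 2)⁻¹ = ‖z - y‖ ^ 2 / r ^ 2 := (div_eq_mul_inv _ _).symm
    simp only [hA, ker, heκ, hTw]
    simp only [e0, hw, hτ, ker]
    have e2 : eulerProfile q (‖z - y‖ ^ 2 / r ^ 2) =
      2 * (‖z - y‖ ^ 2 * c * deriv q (‖z - y‖ ^ 2 / r ^ 2)) := by
      rw [eulerProfile, hc, hsq]
    have e4 : 4 * (2 * c ^ 2 * deriv q (‖z - y‖ ^ 2 / r ^ 2)) * (‖z - y‖ ^ 2 * angSq Ω f y z) =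
      c * (4 * eulerProfile q (‖z - y‖ ^ 2 / r ^ 2) * angSq Ω f y z) := by
      rw [e2]; ring
    rw [e4]
    ring
  rw [integral_congr_ae (Eventually.of_forall hsplit)] at hmain
  have j2 := (integrable_ker_mul hk2 i2 y r).const_mul c
  have j3 := (integrable_ker_mul hk3 i3 y r).const_mul c
  have j23 : Integrable (fun z => c * (ker (fun s => (m - 2) * gradProfile m p s
      + eulerProfile (gradProfile m p) s) y r z * gradSq Ω f z)
      + c * (ker (fun s => 4 * eulerProfile q s) y r z * angSq Ω f y z)) (volume.restrict Ω) :=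
    j2.add j3
  rw [integral_add iA j23, hAint, integral_add j2 j3, integral_const_mul, integral_const_mul]
    at hmain
  unfold kerInt at hmain ⊢
  linarith

end Inequality

/-! ### Kernel integrals as functions of the radius and the centre -/

section KernelCalculus

variable {m : ℕ} {k k' : ℝ → ℝ} {Ω : Set (Euc m)} {g : Euc m → ℝ} {y : Euc m} {r : ℝ}

lemma kerInt_add (hk : IsCutoff k) (hk' : IsCutoff k') (hg : Integrable g (volume.restrict Ω))
    (y : Euc m) (r : ℝ) :
    kerInt Ω (fun s => k s + k' s) g y r = kerInt Ω k g y r + kerInt Ω k' g y r := by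
  unfold kerInt
  rw [← integral_add (integrable_ker_mul hk hg y r) (integrable_ker_mul hk' hg y r)]
  congr 1 with z
  simp only [ker]
  ring

lemma kerInt_const_mul (c : ℝ) (k : ℝ → ℝ) (g : Euc m → ℝ) (y : Euc m) (r : ℝ) :
    kerInt Ω (fun s => c * k s) g y r = c * kerInt Ω k g y r := by
  unfold kerInt
  rw [← integral_const_mul]
  congr 1 with z
  simp only [ker]
  ring

lemma kerInt_lin (hk : IsCutoff k) (hk' : IsCutoff k') (hg : Integrable g (volume.restrict Ω))
    (a : ℝ) (y : Euc m) (r : ℝ) :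
    kerInt Ω (fun s => a * k s - k' s) g y r = a * kerInt Ω k g y r - kerInt Ω k' g y r := by
  have h := kerInt_add (hk.const_mul a) (hk'.const_mul (-1)) hg y r
  rw [kerInt_const_mul, kerInt_const_mul] at h
  have e : (fun s => a * k s - k' s) = fun s => a * k s + -1 * k' s := by ext s; ring
  rw [e, h]
  ring

lemma kerInt_nonneg (hk : ∀ s, 0 ≤ k s) (hg : ∀ z, 0 ≤ g z) (y : Euc m) (r : ℝ) :
    0 ≤ kerInt Ω k g y r :=
  integral_nonneg fun z => mul_nonneg (hk _) (hg z)

/-- At `s = |z - y|²/r²` one has `∂_r k(s) = -r⁻¹ (2 s k'(s))`: differentiation in the radius acts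
on profiles through `eulerProfile`. For `ρ > r/2` the derivative is dominated uniformly. -/
lemma hasDerivAt_kerInt (hk : IsCutoff k) (hg : Integrable g (volume.restrict Ω)) (y : Euc m)
    (hr : 0 < r) :
    HasDerivAt (fun r => kerInt Ω k g y r) (-(r⁻¹ * kerInt Ω (eulerProfile k) g y r)) r := by
  obtain ⟨M, hM0, hM⟩ := hk.eulerProfile.exists_bound
  have h := (hasDerivAt_integral_of_dominated_loc_of_deriv_le (μ := volume.restrict Ω)
    (F := fun r z => ker k y r z * g z)
    (F' := fun r z => -(r⁻¹ * ker (eulerProfile k) y r z) * g z)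
    (bound := fun z => (2 / r) * M * |g z|) (x₀ := r) (Ioi_mem_nhds (half_lt_self hr))
    (Eventually.of_forall fun ρ => (integrable_ker_mul hk hg y ρ).1)
    (integrable_ker_mul hk hg y r) ?_ ?_ (hg.abs.const_mul _) ?_).2
  · refine h.congr_deriv ?_
    unfold kerInt
    rw [← integral_const_mul, ← integral_neg]
    congr 1 with z
    ring
  · have := ((integrable_ker_mul hk.eulerProfile hg y r).const_mul (-r⁻¹)).1
    refine this.congr (Eventually.of_forall fun z => ?_)
    ring
  · refine Eventually.of_forall fun z ρ hρ => ?_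
    have hρ0 : r / 2 < ρ := hρ
    have hρ1 : 0 < ρ := by linarith
    have h1 : ρ⁻¹ ≤ 2 / r := by
      rw [inv_le_comm₀ hρ1 (by positivity), inv_div]
      exact hρ0.le
    have h2 : |ker (eulerProfile k) y ρ z| ≤ M := hM _ (by positivity)
    rw [Real.norm_eq_abs, abs_mul, abs_neg, abs_mul, abs_of_pos (inv_pos.2 hρ1)]
    gcongr
  · refine Eventually.of_forall fun z ρ hρ => ?_
    have hρ0 : r / 2 < ρ := hρ
    have hρ1 : 0 < ρ := by linarith
    have h1 : HasDerivAt (fun ρ : ℝ => ‖z - y‖ ^ 2 / ρ ^ 2)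
        (‖z - y‖ ^ 2 * (-(2 * ρ) / (ρ ^ 2) ^ 2)) ρ := by
      have := ((hasDerivAt_pow 2 ρ).fun_inv (by positivity)).const_mul (‖z - y‖ ^ 2)
      simpa [div_eq_mul_inv] using this
    have h2 : HasDerivAt k (deriv k (‖z - y‖ ^ 2 / ρ ^ 2)) (‖z - y‖ ^ 2 / ρ ^ 2) :=
      (hk.contDiff.differentiable (by simp) _).hasDerivAt
    have h3 := (h2.comp ρ h1).mul_const (g z)
    have e : -(ρ⁻¹ * ker (eulerProfile k) y ρ z) * g z =
        deriv k (‖z - y‖ ^ 2 / ρ ^ 2) * (‖z - y‖ ^ 2 * (-(2 * ρ) / (ρ ^ 2) ^ 2)) * g z := by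
      simp only [ker, eulerProfile]
      field_simp
    rw [e]
    exact h3

lemma hasDerivAt_zpow_mul_kerInt (hk : IsCutoff k) (hg : Integrable g (volume.restrict Ω))
    (y : Euc m) (hr : 0 < r) (a : ℤ) :
    HasDerivAt (fun r => r ^ a * kerInt Ω k g y r)
      (r ^ (a - 1) * (a * kerInt Ω k g y r - kerInt Ω (eulerProfile k) g y r)) r := by
  have h := (hasDerivAt_zpow a r (Or.inl hr.ne')).mul (hasDerivAt_kerInt hk hg y hr)
  refine h.congr_deriv ?_
  rw [zpow_sub_one₀ hr.ne']
  field_simp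
  ring

/-- Dominated convergence in the centre. Continuity of the integrand is required only for almost
every `z`, because `angSq` need not be continuous where the centre meets `z`. -/
lemma continuousAt_kerInt (hk : IsCutoff k) {G : Euc m → Euc m → ℝ} {B : Euc m → ℝ}
    (hG : ∀ y, AEStronglyMeasurable (G y) (volume.restrict Ω)) (hGB : ∀ y z, |G y z| ≤ B z)
    (hB : Integrable B (volume.restrict Ω))
    (hc : ∀ᵐ z ∂(volume.restrict Ω), ContinuousAt (fun y => G y z) y) (r : ℝ) :
    ContinuousAt (fun y => kerInt Ω k (G y) y r) y := by
  obtain ⟨M, hM0, hM⟩ := hk.exists_bound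
  unfold kerInt
  refine continuousAt_of_dominated (bound := fun z => M * B z) (Eventually.of_forall fun y => ?_)
    (Eventually.of_forall fun y => Eventually.of_forall fun z => ?_) (hB.const_mul M) ?_
  · exact (contDiff_ker hk.contDiff y r).continuous.aestronglyMeasurable.mul (hG y)
  · rw [norm_mul]
    exact mul_le_mul (hM _ (by positivity)) (hGB y z) (norm_nonneg _) hM0
  · filter_upwards [hc] with z hz
    refine ContinuousAt.mul ?_ hz
    have : Continuous fun y : Euc m => ‖z - y‖ ^ 2 / r ^ 2 := by fun_prop
    exact (hk.contDiff.continuous.comp this).continuousAt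

lemma abs_kerInt_le (hk : IsCutoff k) {M : ℝ} (hM : ∀ s, 0 ≤ s → |k s| ≤ M)
    (hΩ : MeasurableSet Ω)
    {G : Euc m → ℝ} (hgG : ∀ z, |g z| ≤ G z) (hG : Integrable G (volume.restrict Ω))
    (y : Euc m) (hr : 0 < r) :
    |kerInt Ω k g y r| ≤ M * ∫ z in Metric.closedBall y r, Ω.indicator G z := by
  have hG0 : ∀ z, 0 ≤ G z := fun z => (abs_nonneg _).trans (hgG z)
  have hM0 : 0 ≤ M := (abs_nonneg _).trans (hM 0 le_rfl)
  have hGi : Integrable (Ω.indicator G) := (integrable_indicator_iff hΩ).2 hG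
  unfold kerInt
  rw [← integral_indicator hΩ, ← integral_const_mul,
    ← integral_indicator Metric.isClosed_closedBall.measurableSet, ← Real.norm_eq_abs]
  refine norm_integral_le_of_norm_le
    ((hGi.const_mul M).indicator Metric.isClosed_closedBall.measurableSet)
    (Eventually.of_forall fun z => ?_)
  by_cases hz : z ∈ Ω
  · rw [indicator_of_mem hz]
    by_cases hzb : z ∈ Metric.closedBall y r
    · rw [indicator_of_mem hzb, indicator_of_mem hz, norm_mul]
      exact mul_le_mul (hM _ (by positivity)) (hgG z) (norm_nonneg _) hM0
    · rw [ker_eq_zero hk hr fun h => hzb (Metric.ball_subset_closedBall h), zero_mul, norm_zero]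
      rw [indicator_of_notMem hzb]
  · rw [indicator_of_notMem hz, norm_zero]
    refine indicator_nonneg (fun w _ => mul_nonneg hM0 (indicator_nonneg (fun w _ => hG0 w) w)) z

end KernelCalculus

/-! ### Two monotone quantities -/

section Monotone

variable {m l : ℕ} {x : Euc m} {R : ℝ} {f : Euc m → Euc l} {p : ℝ → ℝ}

/-- The squared Laplacian. -/
noncomputable def lapSq (Ω : Set (Euc m)) (f : Euc m → Euc l) (z : Euc m) : ℝ :=
  ‖weakLaplacian Ω f z‖ ^ 2

/-- The monotone quantity of a stationary biharmonic map. -/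
noncomputable def theta (Ω : Set (Euc m)) (f : Euc m → Euc l) (p : ℝ → ℝ) (y : Euc m) (r : ℝ) :
    ℝ :=
  r ^ (4 - m : ℤ) * kerInt Ω p (lapSq Ω f) y r
    - r ^ (2 - m : ℤ) * kerInt Ω (gradProfile m p) (gradSq Ω f) y r
    - 4 * (r ^ (2 - m : ℤ) * kerInt Ω (slopeProfile p) (angSq Ω f y) y r)

lemma lapSq_nonneg (Ω : Set (Euc m)) (f : Euc m → Euc l) (z : Euc m) : 0 ≤ lapSq Ω f z := by
  unfold lapSq; positivity

/-- Termwise differentiation gives `r^(3-m)` times the nonnegative expression of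
`stationary_inequality`. The radial term is left over because differentiating its factor `r^(2-m)`
has no counterpart in that expression. -/
lemma exists_hasDerivAt_theta (hf : MemW22 (Metric.ball x R) f)
    (hs : ∀ ξ : Euc m → Euc m, IsTest (Metric.ball x R) ξ →
      HasDerivAt (fun t : ℝ => biEnergy (Metric.ball x R) fun y => f (y + t • ξ y)) 0 0)
    (hp : IsProfile p) {y : Euc m} {r : ℝ} (hr : 0 < r)
    (hy : Metric.closedBall y r ⊆ Metric.ball x R) :
    ∃ θ', HasDerivAt (theta (Metric.ball x R) f p y) θ' r ∧
      4 * (m - 2) * (r ^ (1 - m : ℤ) *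
        kerInt (Metric.ball x R) (slopeProfile p) (angSq (Metric.ball x R) f y) y r) ≤ θ' := by
  set Ω := Metric.ball x R with hΩ
  have hpc := hp.toIsCutoff
  have hqc := hpc.slopeProfile
  have hκc := hpc.gradProfile m
  have i1 : Integrable (lapSq Ω f) (volume.restrict Ω) := integrable_lapSq hf
  have i2 := integrable_gradSq hf
  have i3 := integrable_angSq hf y
  have d1 := hasDerivAt_zpow_mul_kerInt hpc i1 y hr (4 - m)
  have d2 := hasDerivAt_zpow_mul_kerInt hκc i2 y hr (2 - m)
  have d3 := hasDerivAt_zpow_mul_kerInt hqc i3 y hr (2 - m)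
  refine ⟨_, (d1.sub d2).sub (d3.const_mul 4), ?_⟩
  have hE := stationary_inequality hf hs hp hr hy
  have e1 := kerInt_lin hpc hpc.eulerProfile i1 (4 - m) y r
  have e2 : kerInt Ω (fun s => (m - 2) * gradProfile m p s + eulerProfile (gradProfile m p) s)
      (gradSq Ω f) y r = (m - 2) * kerInt Ω (gradProfile m p) (gradSq Ω f) y r
        + kerInt Ω (eulerProfile (gradProfile m p)) (gradSq Ω f) y r := by
    rw [kerInt_add (hκc.const_mul _) hκc.eulerProfile i2, kerInt_const_mul]
  have e3 := kerInt_const_mul (Ω := Ω) 4 (eulerProfile (slopeProfile p)) (angSq Ω f y) y r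
  have hz3 : r ^ (4 - m - 1 : ℤ) = r ^ (3 - m : ℤ) := by congr 1; ring
  have hz1 : r ^ (2 - m - 1 : ℤ) = r ^ (1 - m : ℤ) := by congr 1; ring
  have hz : r ^ (1 - m : ℤ) = r ^ (3 - m : ℤ) * (r ^ 2)⁻¹ := by
    rw [← zpow_natCast, ← zpow_neg, ← zpow_add₀ hr.ne']
    congr 1
    push_cast
    ring
  have hE' := mul_nonneg (zpow_nonneg hr.le (3 - m : ℤ)) hE
  have e1' : kerInt Ω (fun s => (4 - m) * p s - eulerProfile p s)
      (fun z => ‖weakLaplacian Ω f z‖ ^ 2) y r = _ := e1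
  rw [e1', e2, e3] at hE'
  rw [hz3, hz1, hz]
  push_cast
  linear_combination hE'

lemma theta_monotoneOn (hm : 4 ≤ m) (hf : MemW22 (Metric.ball x R) f)
    (hs : ∀ ξ : Euc m → Euc m, IsTest (Metric.ball x R) ξ →
      HasDerivAt (fun t : ℝ => biEnergy (Metric.ball x R) fun y => f (y + t • ξ y)) 0 0)
    (hp : IsProfile p) {y : Euc m} {ρ : ℝ} (hy : Metric.closedBall y ρ ⊆ Metric.ball x R) :
    MonotoneOn (theta (Metric.ball x R) f p y) (Ioc 0 ρ) := by
  have hm' : (4 : ℝ) ≤ m := by exact_mod_cast hm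
  have hd : ∀ r ∈ Ioc 0 ρ, ∃ θ', HasDerivAt (theta (Metric.ball x R) f p y) θ' r ∧ 0 ≤ θ' := by
    intro r hr
    obtain ⟨θ', h1, h2⟩ := exists_hasDerivAt_theta hf hs hp hr.1
      ((Metric.closedBall_subset_closedBall hr.2).trans hy)
    refine ⟨θ', h1, le_trans ?_ h2⟩
    have := kerInt_nonneg (Ω := Metric.ball x R) hp.slopeProfile_nonneg
      (angSq_nonneg (Metric.ball x R) f y) y r
    have h3 := zpow_nonneg hr.1.le (1 - m : ℤ)
    have : 0 ≤ (m : ℝ) - 2 := by linarith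
    positivity
  refine monotoneOn_of_deriv_nonneg (convex_Ioc 0 ρ) (fun r hr => ?_) (fun r hr => ?_)
    fun r hr => ?_
  · obtain ⟨θ', h1, -⟩ := hd r hr
    exact h1.continuousAt.continuousWithinAt
  · obtain ⟨θ', h1, -⟩ := hd r (interior_subset hr)
    exact h1.differentiableAt.differentiableWithinAt
  · obtain ⟨θ', h1, h2⟩ := hd r (interior_subset hr)
    rwa [h1.deriv]

/-- The scaled gradient energy. -/
noncomputable def gradScaled (Ω : Set (Euc m)) (f : Euc m → Euc l) (p : ℝ → ℝ) (y : Euc m)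
    (r : ℝ) : ℝ :=
  r ^ (2 - m : ℤ) * kerInt Ω (slopeProfile p) (gradSq Ω f) y r

/-- Since `gradProfile = (m - 4) q + E q`, the gradient terms cancel in the derivative. There remain
`-2 r^(5-m) ∫ p |Δf|²`, the term `8 r^(3-m) ∫ q angSq` and `-r² θ'`; the last absorbs the second
because `4(m - 2) ≥ 8` when `m ≥ 4`. -/
lemma antitoneOn_defect (hm : 4 ≤ m) (hf : MemW22 (Metric.ball x R) f)
    (hs : ∀ ξ : Euc m → Euc m, IsTest (Metric.ball x R) ξ →
      HasDerivAt (fun t : ℝ => biEnergy (Metric.ball x R) fun y => f (y + t • ξ y)) 0 0)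
    (hp : IsProfile p) {y : Euc m} {ρ : ℝ} (hy : Metric.closedBall y ρ ⊆ Metric.ball x R) :
    AntitoneOn (fun r => 2 * (r ^ (4 - m : ℤ) * kerInt (Metric.ball x R) (slopeProfile p)
      (gradSq (Metric.ball x R) f) y r) - r ^ 2 * theta (Metric.ball x R) f p y r) (Ioc 0 ρ) := by
  set Ω := Metric.ball x R with hΩ
  have hm' : (4 : ℝ) ≤ m := by exact_mod_cast hm
  have hpc := hp.toIsCutoff
  have hqc := hpc.slopeProfile
  have hκc := hpc.gradProfile m
  have i2 := integrable_gradSq hf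
  have hd : ∀ r ∈ Ioc 0 ρ, ∃ Q', HasDerivAt (fun r => 2 * (r ^ (4 - m : ℤ) *
      kerInt Ω (slopeProfile p) (gradSq Ω f) y r) - r ^ 2 * theta Ω f p y r) Q' r ∧ Q' ≤ 0 := by
    intro r hr
    obtain ⟨θ', h1, h2⟩ := exists_hasDerivAt_theta hf hs hp hr.1
      ((Metric.closedBall_subset_closedBall hr.2).trans hy)
    have d1 := (hasDerivAt_zpow_mul_kerInt hqc i2 y hr.1 (4 - m)).const_mul 2
    have d2 := (hasDerivAt_pow 2 r).mul h1
    refine ⟨_, d1.sub d2, ?_⟩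
    have hκ : kerInt Ω (gradProfile m p) (gradSq Ω f) y r =
        (m - 4) * kerInt Ω (slopeProfile p) (gradSq Ω f) y r
          + kerInt Ω (eulerProfile (slopeProfile p)) (gradSq Ω f) y r := by
      have := kerInt_add (hqc.const_mul (m - 4)) hqc.eulerProfile i2 y r
      rw [kerInt_const_mul] at this
      exact this
    have n1 := kerInt_nonneg (Ω := Ω) hp.nonneg (lapSq_nonneg Ω f) y r
    have n3 := kerInt_nonneg (Ω := Ω) hp.slopeProfile_nonneg (angSq_nonneg Ω f y) y r
    have hr0 := hr.1
    have hz : ∀ a : ℤ, 0 ≤ r ^ a := fun a => zpow_nonneg hr0.le a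
    have z1 : r ^ (4 - m - 1 : ℤ) = r ^ (1 - m : ℤ) * r ^ 2 := by
      rw [← zpow_natCast, ← zpow_add₀ hr0.ne']; congr 1; push_cast; ring
    have z2 : r ^ (2 - m : ℤ) = r ^ (1 - m : ℤ) * r := by
      rw [← zpow_add_one₀ hr0.ne']; congr 1; ring
    have z3 : r ^ (4 - m : ℤ) = r ^ (1 - m : ℤ) * r ^ 3 := by
      rw [← zpow_natCast, ← zpow_add₀ hr0.ne']; congr 1; push_cast; ring
    have h4 : r ^ 2 * (4 * (m - 2) * (r ^ (1 - m : ℤ) *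
        kerInt Ω (slopeProfile p) (angSq Ω f y) y r)) ≤ r ^ 2 * θ' := by gcongr
    have n4 : 0 ≤ (4 * (m - 2) - 8) * (r ^ 2 * (r ^ (1 - m : ℤ) *
        kerInt Ω (slopeProfile p) (angSq Ω f y) y r)) :=
      mul_nonneg (by linarith) (mul_nonneg (by positivity) (mul_nonneg (hz _) n3))
    have n5 : 0 ≤ 2 * r ^ 4 * (r ^ (1 - m : ℤ) * kerInt Ω p (lapSq Ω f) y r) :=
      mul_nonneg (by positivity) (mul_nonneg (hz _) n1)
    simp only [theta]
    rw [hκ, z1, z2, z3]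
    push_cast
    linear_combination h4 + n4 + n5
  refine antitoneOn_of_deriv_nonpos (convex_Ioc 0 ρ) (fun r hr => ?_) (fun r hr => ?_)
    fun r hr => ?_
  · obtain ⟨θ', h1, -⟩ := hd r hr
    exact h1.continuousAt.continuousWithinAt
  · obtain ⟨θ', h1, -⟩ := hd r (interior_subset hr)
    exact h1.differentiableAt.differentiableWithinAt
  · obtain ⟨θ', h1, h2⟩ := hd r (interior_subset hr)
    rwa [h1.deriv]

end Monotone

/-! ### Positivity and bounds for the density -/

section Density

variable {m l : ℕ} {x : Euc m} {R : ℝ} {f : Euc m → Euc l} {p : ℝ → ℝ}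

/-- Where the averages of `G` converge, the kernel integral is `O(r^m)`, so the product is `O(r^4)`.
-/
lemma tendsto_zpow_mul_kerInt {k : ℝ → ℝ} (hk : IsCutoff k) {Ω : Set (Euc m)}
    (hΩ : MeasurableSet Ω) {g G : Euc m → ℝ} (hgG : ∀ z, |g z| ≤ G z)
    (hG : Integrable G (volume.restrict Ω)) {y : Euc m} {c : ℝ}
    (hy : Tendsto (fun r => ⨍ z in Metric.closedBall y r, Ω.indicator G z) (𝓝[>] 0) (𝓝 c)) :
    Tendsto (fun r => r ^ (4 - m : ℤ) * kerInt Ω k g y r) (𝓝[>] 0) (𝓝 0) := by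
  obtain ⟨M, hM0, hM⟩ := hk.exists_bound
  set V := (volume : Measure (Euc m)).real (Metric.ball 0 1) with hV
  have hr0 : Tendsto (fun r : ℝ => r) (𝓝[>] 0) (𝓝 0) := tendsto_id.mono_left nhdsWithin_le_nhds
  have hlim : Tendsto (fun r => r ^ 4 * (M * V * ⨍ z in Metric.closedBall y r, Ω.indicator G z))
      (𝓝[>] 0) (𝓝 0) := by
    have := (hr0.pow 4).mul (hy.const_mul (M * V))
    simpa using this
  refine squeeze_zero_norm' ?_ hlim
  filter_upwards [self_mem_nhdsWithin] with r hr
  have hr : 0 < r := hr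
  have h1 := abs_kerInt_le hk hM hΩ hgG hG y hr
  have hvol : (volume : Measure (Euc m)).real (Metric.closedBall y r) = r ^ m * V := by
    rw [Measure.addHaar_real_closedBall _ _ hr.le, finrank_euclideanSpace_fin]
  have hav : ∫ z in Metric.closedBall y r, Ω.indicator G z =
      r ^ m * V * ⨍ z in Metric.closedBall y r, Ω.indicator G z := by
    rw [← hvol]
    have := measure_smul_setAverage (μ := (volume : Measure (Euc m))) (Ω.indicator G)
      (measure_closedBall_lt_top (x := y) (r := r)).ne
    rw [smul_eq_mul] at this
    exact this.symm
  rw [hav] at h1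
  have hz : r ^ (4 - m : ℤ) = r ^ 4 / r ^ m := by
    rw [zpow_sub₀ hr.ne']
    simp only [zpow_natCast]
    norm_cast
  rw [norm_mul, Real.norm_of_nonneg (zpow_nonneg hr.le _), Real.norm_eq_abs, hz]
  calc r ^ 4 / r ^ m * |kerInt Ω k g y r|
      ≤ r ^ 4 / r ^ m * (M * (r ^ m * V * ⨍ z in Metric.closedBall y r, Ω.indicator G z)) := by
        gcongr
    _ = _ := by
        have := (pow_pos hr m).ne'
        field_simp

lemma continuous_angSq_at {Ω : Set (Euc m)} {y z : Euc m} (h : z ≠ y) :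
    ContinuousAt (fun y => angSq Ω f y z) y := by
  unfold angSq radialDeriv
  refine ContinuousAt.div ?_ ?_ ?_
  · have : Continuous fun y : Euc m => ‖∑ i, (z i - y i) • weakPartial Ω i f z‖ ^ 2 := by fun_prop
    exact this.continuousAt
  · have : Continuous fun y : Euc m => ‖z - y‖ ^ 2 := by fun_prop
    exact this.continuousAt
  · have := norm_pos_iff.2 (sub_ne_zero.2 h)
    positivity

/-- This continuity extends an inequality from almost every centre to every centre. -/
lemma continuousAt_theta_sub (hm : 4 ≤ m) (hf : MemW22 (Metric.ball x R) f) (hp : IsProfile p)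
    (y : Euc m) (r : ℝ) :
    ContinuousAt (fun y => 2 * gradScaled (Metric.ball x R) f p y r
      - theta (Metric.ball x R) f p y r) y := by
  haveI : Nonempty (Fin m) := ⟨⟨0, by omega⟩⟩
  set Ω := Metric.ball x R
  have i1 : Integrable (lapSq Ω f) (volume.restrict Ω) := integrable_lapSq hf
  have i2 := integrable_gradSq hf
  have c1 : ContinuousAt (fun y => kerInt Ω p (lapSq Ω f) y r) y :=
    continuousAt_kerInt hp.toIsCutoff (G := fun _ => lapSq Ω f) (B := lapSq Ω f) (fun _ => i1.1)
      (fun _ z => (abs_of_nonneg (lapSq_nonneg Ω f z)).le) i1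
      (Eventually.of_forall fun z => continuousAt_const) r
  have c2 : ∀ {k : ℝ → ℝ}, IsCutoff k →
      ContinuousAt (fun y => kerInt Ω k (gradSq Ω f) y r) y := fun hk =>
    continuousAt_kerInt hk (G := fun _ => gradSq Ω f) (B := gradSq Ω f) (fun _ => i2.1)
      (fun _ z => (abs_of_nonneg (gradSq_nonneg Ω f z)).le) i2
      (Eventually.of_forall fun z => continuousAt_const) r
  have c3 : ContinuousAt (fun y => kerInt Ω (slopeProfile p) (angSq Ω f y) y r) y := by
    refine continuousAt_kerInt hp.toIsCutoff.slopeProfile (B := gradSq Ω f)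
      (fun y => (integrable_angSq hf y).1)
      (fun y z => by rw [abs_of_nonneg (angSq_nonneg _ _ _ _)]; exact angSq_le _ _ _ _) i2 ?_ r
    filter_upwards [Measure.ae_ne (volume.restrict Ω) y] with z hz
    exact continuous_angSq_at hz
  unfold gradScaled theta
  exact (continuousAt_const.mul (continuousAt_const.mul (c2 hp.toIsCutoff.slopeProfile))).sub
    (((continuousAt_const.mul c1).sub (continuousAt_const.mul (c2 (hp.toIsCutoff.gradProfile m)))).sub
      (continuousAt_const.mul (continuousAt_const.mul c3)))

/-- The scaled gradient energy is controlled by the monotone quantity. -/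
lemma two_mul_gradScaled_le_theta (hm : 4 ≤ m) (hf : MemW22 (Metric.ball x R) f)
    (hs : ∀ ξ : Euc m → Euc m, IsTest (Metric.ball x R) ξ →
      HasDerivAt (fun t : ℝ => biEnergy (Metric.ball x R) fun y => f (y + t • ξ y)) 0 0)
    (hp : IsProfile p) {y : Euc m} {r : ℝ} (hr : 0 < r) (hy : dist y x + r < R) :
    2 * gradScaled (Metric.ball x R) f p y r ≤ theta (Metric.ball x R) f p y r := by
  set Ω := Metric.ball x R with hΩ
  have hΩm : MeasurableSet Ω := Metric.isOpen_ball.measurableSet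
  have hpc := hp.toIsCutoff
  have hqc := hpc.slopeProfile
  have i1 : Integrable (lapSq Ω f) (volume.restrict Ω) := integrable_lapSq hf
  have i2 := integrable_gradSq hf
  set G := fun z => lapSq Ω f z + gradSq Ω f z with hG
  have hGi : Integrable G (volume.restrict Ω) := i1.add i2
  have b1 : ∀ z, |lapSq Ω f z| ≤ G z := fun z => by
    rw [abs_of_nonneg (lapSq_nonneg _ _ _)]
    exact le_add_of_nonneg_right (gradSq_nonneg _ _ _)
  have b2 : ∀ z, |gradSq Ω f z| ≤ G z := fun z => by
    rw [abs_of_nonneg (gradSq_nonneg _ _ _)]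
    exact le_add_of_nonneg_left (lapSq_nonneg _ _ _)
  have b3 : ∀ y z, |angSq Ω f y z| ≤ G z := fun y z => by
    rw [abs_of_nonneg (angSq_nonneg _ _ _ _)]
    exact (angSq_le _ _ _ _).trans ((le_abs_self _).trans (b2 z))
  have hloc : LocallyIntegrable (Ω.indicator G) volume :=
    ((integrable_indicator_iff hΩm).2 hGi).locallyIntegrable
  have hleb := IsUnifLocDoublingMeasure.ae_tendsto_average (μ := (volume : Measure (Euc m))) hloc 1
  -- At a Lebesgue point of the energy densities the nonincreasing defect tends to `0` as the radius
  -- tends to `0`, hence is nonpositive at radius `r`.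
  have hae : ∀ᵐ y' : Euc m, dist y' x + r < R →
      2 * gradScaled Ω f p y' r - theta Ω f p y' r ≤ 0 := by
    filter_upwards [hleb] with y' hL hy'
    have hL' : Tendsto (fun r => ⨍ z in Metric.closedBall y' r, Ω.indicator G z) (𝓝[>] 0)
        (𝓝 (Ω.indicator G y')) := by
      refine hL (fun _ => y') (fun t => t) tendsto_id ?_
      filter_upwards [self_mem_nhdsWithin] with t ht
      rw [one_mul]
      exact Metric.mem_closedBall_self (le_of_lt ht)
    have hsub : Metric.closedBall y' r ⊆ Ω := fun z hz => by
      rw [hΩ, Metric.mem_ball]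
      rw [Metric.mem_closedBall] at hz
      linarith [dist_triangle z y' x]
    have hanti := antitoneOn_defect hm hf hs hp hsub
    set Q : ℝ → ℝ := fun r => 2 * (r ^ (4 - m : ℤ) * kerInt Ω (slopeProfile p)
      (gradSq Ω f) y' r) - r ^ 2 * theta Ω f p y' r with hQ
    have t1 := tendsto_zpow_mul_kerInt hpc hΩm b1 hGi hL'
    have t2 := tendsto_zpow_mul_kerInt hqc hΩm b2 hGi hL'
    have t3 := tendsto_zpow_mul_kerInt (hpc.gradProfile m) hΩm b2 hGi hL'
    have t4 := tendsto_zpow_mul_kerInt hqc hΩm (b3 y') hGi hL'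
    have hr0 : Tendsto (fun r : ℝ => r ^ 2) (𝓝[>] 0) (𝓝 0) := by
      have : Tendsto (fun r : ℝ => r) (𝓝[>] 0) (𝓝 0) := tendsto_id.mono_left nhdsWithin_le_nhds
      simpa using this.pow 2
    have hQ0 : Tendsto Q (𝓝[>] 0) (𝓝 0) := by
      have := (((t2.const_mul 2).sub (hr0.mul t1)).add t3).add (t4.const_mul 4)
      simp only [mul_zero, sub_zero, add_zero] at this
      refine this.congr' ?_
      filter_upwards [self_mem_nhdsWithin] with t ht
      have ht : 0 < t := ht
      have z2 : t ^ (4 - m : ℤ) = t ^ 2 * t ^ (2 - m : ℤ) := by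
        rw [← zpow_natCast, ← zpow_add₀ ht.ne']; congr 1; push_cast; ring
      simp only [hQ, theta]
      rw [z2]
      ring
    have hQr : Q r ≤ 0 := by
      refine ge_of_tendsto hQ0 ?_
      filter_upwards [Ioc_mem_nhdsGT hr] with t ht
      exact hanti ht (right_mem_Ioc.2 hr) ht.2
    have e : Q r = r ^ 2 * (2 * gradScaled Ω f p y' r - theta Ω f p y' r) := by
      have z2 : r ^ (4 - m : ℤ) = r ^ 2 * r ^ (2 - m : ℤ) := by
        rw [← zpow_natCast, ← zpow_add₀ hr.ne']; congr 1; push_cast; ring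
      simp only [hQ, gradScaled]
      rw [z2]
      ring
    rw [e] at hQr
    exact nonpos_of_mul_nonpos_right hQr (by positivity)
  -- A strict violation at `y` would persist in a neighbourhood, which meets the dense set of good
  -- centres.
  by_contra hcon
  push Not at hcon
  have hc := continuousAt_theta_sub hm hf hp y r
  have h1 : ∀ᶠ y' in 𝓝 y, 0 < 2 * gradScaled Ω f p y' r - theta Ω f p y' r :=
    hc.eventually (lt_mem_nhds (by linarith))
  have h2 : ∀ᶠ y' in 𝓝 y, dist y' x + r < R := by
    have : Continuous fun y' => dist y' x + r := by fun_prop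
    exact this.continuousAt.eventually (gt_mem_nhds hy)
  obtain ⟨y', h6, h3⟩ := dense_iff_inter_open.1 (Measure.dense_of_ae hae) _
    isOpen_interior ⟨y, mem_interior_iff_mem_nhds.2 (h1.and h2)⟩
  obtain ⟨h4, h5⟩ := interior_subset h6
  exact absurd (h3 h5) (not_le.2 h4)

lemma mul_setIntegral_le_kerInt {k : ℝ → ℝ} (hk : IsCutoff k) (hk0 : ∀ s, 0 ≤ k s)
    {Ω B : Set (Euc m)} (hB : MeasurableSet B) (hBΩ : B ⊆ Ω) {g : Euc m → ℝ} (hg0 : ∀ z, 0 ≤ g z)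
    (hg : Integrable g (volume.restrict Ω)) {c r : ℝ} {y : Euc m}
    (hc : ∀ z ∈ B, c ≤ ker k y r z) :
    c * ∫ z in B, g z ≤ kerInt Ω k g y r := by
  have hi := integrable_ker_mul hk hg y r
  rw [← integral_const_mul]
  have hmono : volume.restrict B ≤ volume.restrict Ω := Measure.restrict_mono hBΩ le_rfl
  calc ∫ z in B, c * g z ≤ ∫ z in B, ker k y r z * g z := by
        refine setIntegral_mono_on ((hg.mono_measure hmono).const_mul c) (hi.mono_measure hmono) hB
          fun z hz => mul_le_mul_of_nonneg_right (hc z hz) (hg0 z)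
    _ ≤ ∫ z in Ω, ker k y r z * g z :=
        integral_mono_measure hmono (Eventually.of_forall fun z => mul_nonneg (hk0 _) (hg0 z)) hi

lemma lapSq_le (Ω : Set (Euc m)) (f : Euc m → Euc l) (z : Euc m) :
    lapSq Ω f z ≤ m * hessSq Ω f z := by
  have h1 : lapSq Ω f z ≤ (∑ i, ‖weakPartial Ω i (weakPartial Ω i f) z‖) ^ 2 := by
    unfold lapSq weakLaplacian
    gcongr
    exact norm_sum_le _ _
  have h2 : (∑ i, ‖weakPartial Ω i (weakPartial Ω i f) z‖) ^ 2 ≤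
      m * ∑ i, ‖weakPartial Ω i (weakPartial Ω i f) z‖ ^ 2 := by
    simpa using sq_sum_le_card_mul_sum_sq (s := Finset.univ)
      (f := fun i => ‖weakPartial Ω i (weakPartial Ω i f) z‖)
  refine h1.trans (h2.trans ?_)
  unfold hessSq
  gcongr with i
  exact Finset.single_le_sum (f := fun j => ‖weakPartial Ω j (weakPartial Ω i f) z‖ ^ 2)
    (fun j _ => by positivity) (Finset.mem_univ i)

/-- The analytic consequences of stationarity used in the quantitative stratification. -/
structure IsDensity (C : ℝ) (x : Euc m) (f : Euc m → Euc l) (Θ : Euc m → ℝ → ℝ) : Prop where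
  nonneg : ∀ y ∈ Metric.ball x 2, ∀ r ∈ Ioc (0 : ℝ) 1, 0 ≤ Θ y r
  le : ∀ y ∈ Metric.ball x 2, ∀ r ∈ Ioc (0 : ℝ) 1, Θ y r ≤ C
  monotone : ∀ y ∈ Metric.ball x 2, MonotoneOn (Θ y) (Ioc 0 1)
  gradSq_le : ∀ y ∈ Metric.ball x 2, ∀ r ∈ Ioc (0 : ℝ) 1,
    ∫ z in Metric.ball y (r / 2), gradSq (Metric.ball x 4) f z ≤ C * (r ^ m / r ^ 2)
  radial_le : ∀ y ∈ Metric.ball x 2, ∀ r, 0 < r → 2 * r ≤ 1 →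
    ∫ z in Metric.ball y (r / 2), ‖radialDeriv (Metric.ball x 4) y f z‖ ^ 2 ≤
      C * r ^ m * (Θ y (2 * r) - Θ y r)

/-- The density is `theta` for one fixed profile, so the constant depends only on `m` and `Λ`.
Monotonicity reduces the upper bound to `r = 1`, where the kernels are bounded and the Sobolev
energy is below `Λ`. -/
lemma exists_isDensity (hm : 4 ≤ m) (Λ : ℝ) : ∃ C : ℝ, 0 < C ∧ ∀ (l : ℕ) (x : Euc m)
    (f : Euc m → Euc l), MemW22 (Metric.ball x 4) f →
    (∀ ξ : Euc m → Euc m, IsTest (Metric.ball x 4) ξ →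
      HasDerivAt (fun t : ℝ => biEnergy (Metric.ball x 4) fun y => f (y + t • ξ y)) 0 0) →
    ∫ y in Metric.ball x 4, (gradSq (Metric.ball x 4) f y + hessSq (Metric.ball x 4) f y) < Λ →
    ∃ Θ : Euc m → ℝ → ℝ, IsDensity C x f Θ := by
  obtain ⟨p, hp⟩ := exists_isProfile
  have hpc := hp.toIsCutoff
  have hqc := hpc.slopeProfile
  have hκc := hpc.gradProfile m
  obtain ⟨Mp, hMp0, hMp⟩ := hpc.exists_bound
  obtain ⟨Mκ, hMκ0, hMκ⟩ := hκc.exists_bound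
  have hm' : (4 : ℝ) ≤ m := by exact_mod_cast hm
  -- On `B_{r/2}(y)` the kernel argument lies in `[0, 1/4]`. There the slope profile has a positive
  -- minimum `c₀`, which turns kernel integrals into lower bounds for ball integrals.
  obtain ⟨s₀, hs₀, hmin⟩ := (isCompact_Icc (a := (0 : ℝ)) (b := 1 / 4)).exists_isMinOn
    ⟨0, by constructor <;> norm_num⟩ hqc.contDiff.continuous.continuousOn
  set c₀ := slopeProfile p s₀ with hc₀
  have hc₀pos : 0 < c₀ := hp.slopeProfile_pos (by linarith [hs₀.2])
  have hker : ∀ {y z : Euc m} {r : ℝ}, 0 < r → z ∈ Metric.ball y (r / 2) →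
      c₀ ≤ ker (slopeProfile p) y r z := by
    intro y z r hr hz
    refine hmin (a := ‖z - y‖ ^ 2 / r ^ 2) ⟨by positivity, ?_⟩
    rw [Metric.mem_ball, dist_eq_norm] at hz
    rw [div_le_iff₀ (by positivity)]
    have : ‖z - y‖ ^ 2 ≤ (r / 2) ^ 2 := by gcongr
    linarith [this, show (r / 2) ^ 2 = 1 / 4 * r ^ 2 by ring]
  set A := (Mp * m + Mκ) * |Λ| with hA
  have hA0 : 0 ≤ A := by positivity
  refine ⟨A + A / c₀ + 2 ^ m / c₀ + 1, by positivity, fun l x f hf hs hΛ => ?_⟩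
  set Ω := Metric.ball x 4 with hΩ
  have i1 : Integrable (lapSq Ω f) (volume.restrict Ω) := integrable_lapSq hf
  have i2 := integrable_gradSq hf
  have ih : Integrable (hessSq Ω f) (volume.restrict Ω) :=
    integrable_finsetSum _ fun i _ => integrable_finsetSum _ fun j _ =>
      integrable_norm_sq_of_memLp (hf.memLp_partial_partial i j)
  have hh0 : ∀ z, 0 ≤ hessSq Ω f z := fun z =>
    Finset.sum_nonneg fun _ _ => Finset.sum_nonneg fun _ _ => by positivity
  rw [integral_add i2 ih] at hΛ
  have I2 : 0 ≤ ∫ z in Ω, gradSq Ω f z := integral_nonneg fun z => gradSq_nonneg Ω f z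
  have Ih : 0 ≤ ∫ z in Ω, hessSq Ω f z := integral_nonneg hh0
  have I1 : ∫ z in Ω, lapSq Ω f z ≤ m * ∫ z in Ω, hessSq Ω f z := by
    rw [← integral_const_mul]
    exact integral_mono i1 (ih.const_mul _) fun z => lapSq_le Ω f z
  have hsub : ∀ y ∈ Metric.ball x 2, ∀ r ≤ (1 : ℝ), Metric.closedBall y r ⊆ Ω :=
    fun y hy r hr z hz => by
      rw [hΩ, Metric.mem_ball]
      rw [Metric.mem_closedBall] at hz
      rw [Metric.mem_ball] at hy
      linarith [dist_triangle z y x]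
  have hub : ∀ {k : ℝ → ℝ} {M : ℝ}, IsCutoff k → (∀ s, 0 ≤ s → |k s| ≤ M) → ∀ {g : Euc m → ℝ},
      (∀ z, 0 ≤ g z) → Integrable g (volume.restrict Ω) → ∀ y r,
      |kerInt Ω k g y r| ≤ M * ∫ z in Ω, g z := by
    intro k M hk hM g hg0 hg y r
    unfold kerInt
    rw [← integral_const_mul, ← Real.norm_eq_abs]
    refine norm_integral_le_of_norm_le (hg.const_mul M) (Eventually.of_forall fun z => ?_)
    rw [norm_mul, Real.norm_of_nonneg (hg0 z)]
    exact mul_le_mul_of_nonneg_right (hM _ (by positivity)) (hg0 z)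
  have hmono : ∀ y ∈ Metric.ball x 2, MonotoneOn (theta Ω f p y) (Ioc 0 1) := fun y hy =>
    theta_monotoneOn hm hf hs hp (hsub y hy 1 le_rfl)
  have h2Φ : ∀ y ∈ Metric.ball x 2, ∀ r ∈ Ioc (0 : ℝ) 1,
      2 * gradScaled Ω f p y r ≤ theta Ω f p y r := fun y hy r hr =>
    two_mul_gradScaled_le_theta hm hf hs hp hr.1 (by
      rw [Metric.mem_ball] at hy
      linarith [hr.2])
  have hΦ0 : ∀ y, ∀ r ∈ Ioc (0 : ℝ) 1, 0 ≤ gradScaled Ω f p y r := fun y r hr =>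
    mul_nonneg (zpow_nonneg hr.1.le _) (kerInt_nonneg hp.slopeProfile_nonneg (gradSq_nonneg Ω f) y r)
  have hΘA : ∀ y ∈ Metric.ball x 2, ∀ r ∈ Ioc (0 : ℝ) 1, theta Ω f p y r ≤ A := by
    intro y hy r hr
    refine (hmono y hy hr (right_mem_Ioc.2 one_pos) hr.2).trans ?_
    have a1 := hub hpc hMp (lapSq_nonneg Ω f) i1 y 1
    have a2 := hub hκc hMκ (gradSq_nonneg Ω f) i2 y 1
    have a3 := kerInt_nonneg (Ω := Ω) hp.slopeProfile_nonneg (angSq_nonneg Ω f y) y 1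
    unfold theta
    simp only [one_zpow, one_mul]
    have b1 := (abs_le.1 a1).2
    have b2 := (abs_le.1 a2).1
    have b3 : Mp * ∫ z in Ω, lapSq Ω f z ≤ Mp * (m * |Λ|) := by
      refine mul_le_mul_of_nonneg_left (I1.trans ?_) hMp0
      refine mul_le_mul_of_nonneg_left ?_ (by linarith)
      linarith [le_abs_self Λ]
    have b4 : Mκ * ∫ z in Ω, gradSq Ω f z ≤ Mκ * |Λ| :=
      mul_le_mul_of_nonneg_left (by linarith [le_abs_self Λ]) hMκ0
    have : A = Mp * (m * |Λ|) + Mκ * |Λ| := by rw [hA]; ring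
    linarith
  have hA1 : 0 ≤ A / c₀ := by positivity
  have hA2 : 0 ≤ 2 ^ m / c₀ := by positivity
  refine ⟨theta Ω f p, ?_, ?_, hmono, ?_, ?_⟩
  · intro y hy r hr
    have := h2Φ y hy r hr
    have := hΦ0 y r hr
    linarith
  · intro y hy r hr
    have := hΘA y hy r hr
    linarith
  · intro y hy r hr
    have h1 := mul_setIntegral_le_kerInt hqc hp.slopeProfile_nonneg
      (Metric.isOpen_ball (x := y) (ε := r / 2)).measurableSet
      ((Metric.ball_subset_closedBall).trans (hsub y hy (r / 2) (by linarith [hr.1, hr.2])))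
      (gradSq_nonneg Ω f) i2 (fun z hz => hker hr.1 hz)
    have h2 := h2Φ y hy r hr
    have h3 := hΘA y hy r hr
    have hz : r ^ (2 - m : ℤ) = r ^ 2 / r ^ m := by
      rw [zpow_sub₀ hr.1.ne']
      simp only [zpow_natCast]
      norm_cast
    have hΦ : r ^ 2 / r ^ m * (c₀ * ∫ z in Metric.ball y (r / 2), gradSq Ω f z) ≤ A := by
      have h4 : gradScaled Ω f p y r ≤ A := by
        have := hΦ0 y r hr
        linarith
      refine le_trans ?_ h4
      unfold gradScaled
      rw [hz]
      have := hr.1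
      gcongr
    have hr0 := hr.1
    have h5 : ∫ z in Metric.ball y (r / 2), gradSq Ω f z ≤ A / c₀ * (r ^ m / r ^ 2) := by
      rw [div_mul_div_comm, le_div_iff₀ (by positivity)]
      rw [div_mul_eq_mul_div, div_le_iff₀ (by positivity)] at hΦ
      linarith
    refine h5.trans (mul_le_mul_of_nonneg_right ?_ (by positivity))
    linarith
  · intro y hy r hr0 hr1
    have hsubt : ∀ t ≤ (1 : ℝ), Metric.closedBall y t ⊆ Ω := hsub y hy
    have hdt : ∀ t : ℝ, 0 < t → t ≤ 1 → _ := fun t ht ht1 =>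
      exists_hasDerivAt_theta hf hs hp ht (hsubt t ht1)
    -- By the mean value theorem the drop over `[r, 2r]` is `r θ'(t)` with `r < t < 2r`, and `θ'(t)`
    -- controls the radial energy on `B_{t/2}(y)`, which contains `B_{r/2}(y)`.
    obtain ⟨t, ht, hslope⟩ := exists_deriv_eq_slope (theta Ω f p y)
      (by linarith : r < 2 * r)
      (fun t ht => by
        obtain ⟨θ', h1, -⟩ := hdt t (by linarith [ht.1]) (by linarith [ht.2])
        exact h1.continuousAt.continuousWithinAt)
      (fun t ht => by
        obtain ⟨θ', h1, -⟩ := hdt t (by linarith [ht.1]) (by linarith [ht.2])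
        exact h1.differentiableAt.differentiableWithinAt)
    have ht0 : 0 < t := by linarith [ht.1]
    obtain ⟨θ', h1, h2⟩ := hdt t ht0 (by linarith [ht.2])
    rw [h1.deriv] at hslope
    have hBΩ : Metric.ball y (r / 2) ⊆ Ω :=
      Metric.ball_subset_closedBall.trans (hsubt _ (by linarith))
    have i3 := integrable_angSq hf y
    have h3 := mul_setIntegral_le_kerInt hqc hp.slopeProfile_nonneg
      (Metric.isOpen_ball (x := y) (ε := r / 2)).measurableSet hBΩ
      (angSq_nonneg Ω f y) i3 (fun z hz => hker ht0
        (Metric.ball_subset_ball (by linarith [ht.1]) hz))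
    have iv := integrable_norm_sq_of_memLp (memLp_radialDeriv hf y)
    have hle : volume.restrict (Metric.ball y (r / 2)) ≤ volume.restrict Ω :=
      Measure.restrict_mono hBΩ le_rfl
    have h4 : ∫ z in Metric.ball y (r / 2), ‖radialDeriv Ω y f z‖ ^ 2 ≤
        r ^ 2 * ∫ z in Metric.ball y (r / 2), angSq Ω f y z := by
      rw [← integral_const_mul]
      refine setIntegral_mono_on (iv.mono_measure hle) ((i3.mono_measure hle).const_mul _)
        Metric.isOpen_ball.measurableSet fun z hz => ?_
      rw [norm_radialDeriv_sq_eq]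
      have h5 := angSq_nonneg Ω f y z
      rw [Metric.mem_ball, dist_eq_norm] at hz
      gcongr
      linarith
    set J := ∫ z in Metric.ball y (r / 2), angSq Ω f y z with hJ
    set K := kerInt Ω (slopeProfile p) (angSq Ω f y) y t with hK
    have hJ0 : 0 ≤ J := integral_nonneg fun z => angSq_nonneg Ω f y z
    have hK0 : 0 ≤ K := kerInt_nonneg hp.slopeProfile_nonneg (angSq_nonneg Ω f y) y t
    have hz : t ^ (1 - m : ℤ) = t / t ^ m := by
      rw [zpow_sub₀ ht0.ne', zpow_one, zpow_natCast]
    rw [hz] at h2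
    have h6 : r / (2 * r) ^ m * (c₀ * J) ≤ t / t ^ m * K := by
      have := ht.1.le
      have := ht.2.le
      gcongr
    have h7 : r / (2 * r) ^ m * (c₀ * J) ≤ θ' := by
      have h8 : 0 ≤ t / t ^ m * K := by positivity
      nlinarith
    have hΔ : theta Ω f p y (2 * r) - theta Ω f p y r = r * θ' := by
      rw [hslope]
      have : 2 * r - r ≠ 0 := by linarith
      field_simp
      ring
    have h9 : r ^ 2 * J ≤ 2 ^ m / c₀ * r ^ m * (r * θ') := by
      have : r ^ 2 * J = 2 ^ m / c₀ * r ^ m * (r * (r / (2 * r) ^ m * (c₀ * J))) := by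
        rw [mul_pow]
        field_simp
      rw [this]
      gcongr
    rw [hΔ]
    refine h4.trans (h9.trans ?_)
    have hθ : 0 ≤ r * θ' := mul_nonneg hr0.le (le_trans (by positivity) h7)
    gcongr
    linarith

end Density

/-! ### Differences along affine fields -/

section AffineDifference

variable {m l : ℕ}

/-- The affine vector field `h + c z`. -/
noncomputable def affField (h : Euc m) (c : ℝ) (z : Euc m) : Euc m := h + c • z

/-- The derivative of `f` along an affine field. -/
noncomputable def affDeriv (Ω : Set (Euc m)) (h : Euc m) (c : ℝ) (f : Euc m → Euc l) (z : Euc m) :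
    Euc l :=
  ∑ i, (affField h c z i) • weakPartial Ω i f z

/-- The map is `z ↦ (1 + c) z + h` with `1 + c ≥ 1/2`, so it shrinks volume by a factor of at most
`2^m`. -/
lemma map_affine_le {h : Euc m} {c : ℝ} (hc : |c| ≤ 1 / 2) {B B' : Set (Euc m)}
    (hB' : MeasurableSet B') (hBB : ∀ z ∈ B, z + affField h c z ∈ B') :
    Measure.map (fun z => z + affField h c z) (volume.restrict B) ≤
      (2 ^ m : ℝ≥0∞) • volume.restrict B' := by
  have hmeas : Measurable fun z : Euc m => z + affField h c z := by
    unfold affField; fun_prop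
  have hc1 : 1 / 2 ≤ 1 + c := by linarith [(abs_le.1 hc).1]
  refine Measure.le_iff.2 fun S hS => ?_
  rw [Measure.map_apply hmeas hS, Measure.restrict_apply (hmeas hS), Measure.smul_apply,
    Measure.restrict_apply hS, smul_eq_mul]
  have hsub : (fun z => z + affField h c z) ⁻¹' S ∩ B ⊆
      (fun z : Euc m => (1 + c) • z) ⁻¹' ((fun z => z + h) ⁻¹' (S ∩ B')) := by
    rintro z ⟨h1, h2⟩
    have e : (1 + c) • z + h = z + affField h c z := by
      unfold affField; module
    refine ⟨?_, ?_⟩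
    · change (1 + c) • z + h ∈ S
      rw [e]; exact h1
    · change (1 + c) • z + h ∈ B'
      rw [e]; exact hBB z h2
  refine (measure_mono hsub).trans ?_
  rw [Measure.addHaar_preimage_smul _ (by linarith), measure_preimage_add_right,
    finrank_euclideanSpace_fin]
  gcongr
  rw [show (2 : ℝ≥0∞) ^ m = ENNReal.ofReal (2 ^ m) by
    rw [ENNReal.ofReal_pow (by norm_num)]; norm_num]
  apply ENNReal.ofReal_le_ofReal
  rw [abs_of_nonneg (by positivity), ← inv_pow]
  gcongr
  rw [inv_le_comm₀ (by linarith) (by norm_num)]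
  linarith

/-- Write the difference as an integral of the derivative along the segment `z + t X(z)`. An affine
field satisfies `X(z + t X(z)) = (1 + tc) X(z)`, so replacing `X(z)` by the field at the moved point
costs a factor `4` in the square; the change of variables costs `2^m`. -/
lemma lintegral_affine_sub_sq_le {u : Euc m → Euc l} (hu : ContDiff ℝ ∞ u) {h : Euc m} {c : ℝ}
    (hc : |c| ≤ 1 / 2) {B B' : Set (Euc m)} (hB' : MeasurableSet B')
    (hBB : ∀ t ∈ Icc (0 : ℝ) 1, ∀ z ∈ B, z + t • affField h c z ∈ B') :
    ∫⁻ z in B, ‖u (z + affField h c z) - u z‖ₑ ^ 2 ≤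
      2 ^ (m + 2) * ∫⁻ z in B', ‖∑ i, (affField h c z i) • pd i u z‖ₑ ^ 2 := by
  set V : Euc m → Euc l := fun z => ∑ i, (affField h c z i) • pd i u z with hV
  have hVc : Continuous V := by
    refine continuous_finsetSum _ fun i _ => ?_
    have h1 : Continuous fun z : Euc m => affField h c z i := by unfold affField; fun_prop
    exact h1.smul (contDiff_pd hu i).continuous
  have hVf : ∀ z, V z = fderiv ℝ u z (affField h c z) := by
    intro z
    conv_rhs => rw [sum_apply_smul_single (affField h c z), map_sum]
    simp only [map_smul]
    rfl
  have hfield : ∀ (t : ℝ) z, affField h c (z + t • affField h c z) =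
      (1 + t * c) • affField h c z := by
    intro t z; unfold affField; module
  have hderiv : ∀ z (t : ℝ), HasDerivAt (fun t : ℝ => u (z + t • affField h c z))
      (fderiv ℝ u (z + t • affField h c z) (affField h c z)) t := by
    intro z t
    have h1 : HasDerivAt (fun t : ℝ => z + t • affField h c z) (affField h c z) t := by
      simpa using ((hasDerivAt_id t).smul_const (affField h c z)).const_add z
    exact ((hu.differentiable (by simp) _).hasFDerivAt).comp_hasDerivAt t h1
  have hcontd : ∀ z, Continuous fun t : ℝ => fderiv ℝ u (z + t • affField h c z) (affField h c z) := by
    intro z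
    have h1 : Continuous (fderiv ℝ u) := hu.continuous_fderiv (by simp)
    have h2 : Continuous fun t : ℝ => z + t • affField h c z := by fun_prop
    exact (h1.comp h2).clm_apply continuous_const
  have hpt : ∀ z, ‖u (z + affField h c z) - u z‖ₑ ^ 2 ≤
      ∫⁻ t in Icc (0 : ℝ) 1, 4 * ‖V (z + t • affField h c z)‖ₑ ^ 2 := by
    intro z
    have h1 : u (z + affField h c z) - u z =
        ∫ t in Icc (0 : ℝ) 1, fderiv ℝ u (z + t • affField h c z) (affField h c z) := by
      have := intervalIntegral.integral_eq_sub_of_hasDerivAt (a := 0) (b := 1)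
        (fun t _ => hderiv z t) ((hcontd z).intervalIntegrable 0 1)
      rw [intervalIntegral.integral_of_le zero_le_one, ← integral_Icc_eq_integral_Ioc] at this
      rw [this]
      simp
    rw [h1]
    haveI : IsProbabilityMeasure (volume.restrict (Icc (0 : ℝ) 1)) := ⟨by simp⟩
    have h2 := sq_lintegral_le (volume.restrict (Icc (0 : ℝ) 1))
      (f := fun t => ‖fderiv ℝ u (z + t • affField h c z) (affField h c z)‖ₑ)
      (hcontd z).enorm.aemeasurable
    refine (pow_le_pow_left' (enorm_integral_le_lintegral_enorm _) 2).trans (h2.trans ?_)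
    refine setLIntegral_mono' measurableSet_Icc fun t ht => ?_
    have htc : 1 / 2 ≤ 1 + t * c := by
      have : |t * c| ≤ 1 / 2 := by
        rw [abs_mul, abs_of_nonneg ht.1]
        nlinarith [abs_nonneg c, ht.2]
      linarith [(abs_le.1 this).1]
    have e : V (z + t • affField h c z) =
        (1 + t * c) • fderiv ℝ u (z + t • affField h c z) (affField h c z) := by
      rw [hVf, hfield, map_smul]
    rw [e, enorm_smul, mul_pow, ← mul_assoc]
    refine le_mul_of_one_le_left' ?_
    have h4 : (2⁻¹ : ℝ≥0∞) ≤ ‖1 + t * c‖ₑ := by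
      rw [Real.enorm_eq_ofReal (by linarith), show (2⁻¹ : ℝ≥0∞) = ENNReal.ofReal (1 / 2) by
        rw [one_div, ENNReal.ofReal_inv_of_pos two_pos]; norm_num]
      exact ENNReal.ofReal_le_ofReal htc
    calc (1 : ℝ≥0∞) = 4 * 2⁻¹ ^ 2 := by
          rw [show (4 : ℝ≥0∞) = 2 ^ 2 by norm_num, ← mul_pow,
            ENNReal.mul_inv_cancel two_ne_zero ENNReal.ofNat_ne_top, one_pow]
      _ ≤ 4 * ‖1 + t * c‖ₑ ^ 2 := by gcongr
  have hmeas2 : Measurable fun q : Euc m × ℝ => 4 * ‖V (q.1 + q.2 • affField h c q.1)‖ₑ ^ 2 := by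
    have : Continuous fun q : Euc m × ℝ => V (q.1 + q.2 • affField h c q.1) := by
      refine hVc.comp ?_
      unfold affField
      fun_prop
    exact (this.measurable.enorm.pow_const 2).const_mul 4
  calc ∫⁻ z in B, ‖u (z + affField h c z) - u z‖ₑ ^ 2
      ≤ ∫⁻ z in B, ∫⁻ t in Icc (0 : ℝ) 1, 4 * ‖V (z + t • affField h c z)‖ₑ ^ 2 :=
        lintegral_mono fun z => hpt z
    _ = ∫⁻ t in Icc (0 : ℝ) 1, ∫⁻ z in B, 4 * ‖V (z + t • affField h c z)‖ₑ ^ 2 :=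
        lintegral_lintegral_swap hmeas2.aemeasurable
    _ ≤ ∫⁻ t in Icc (0 : ℝ) 1, 2 ^ (m + 2) * ∫⁻ z in B', ‖V z‖ₑ ^ 2 := by
        refine setLIntegral_mono' measurableSet_Icc fun t ht => ?_
        have htc : |t * c| ≤ 1 / 2 := by
          rw [abs_mul, abs_of_nonneg ht.1]
          nlinarith [abs_nonneg c, ht.2]
        have e : ∀ z, z + t • affField h c z = z + affField (t • h) (t * c) z := by
          intro z; unfold affField; module
        have hmap := map_affine_le (h := t • h) htc hB' (B := B) fun z hz => by
          rw [← e]; exact hBB t ht z hz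
        have hm1 : Measurable fun z : Euc m => z + affField (t • h) (t * c) z := by
          unfold affField; fun_prop
        simp_rw [e]
        have hVm : Measurable fun z => 4 * ‖V z‖ₑ ^ 2 :=
          (hVc.measurable.enorm.pow_const 2).const_mul 4
        calc ∫⁻ z in B, 4 * ‖V (z + affField (t • h) (t * c) z)‖ₑ ^ 2
            = ∫⁻ z, 4 * ‖V z‖ₑ ^ 2 ∂(Measure.map (fun z => z + affField (t • h) (t * c) z)
                (volume.restrict B)) := (lintegral_map hVm hm1).symm
          _ ≤ ∫⁻ z, 4 * ‖V z‖ₑ ^ 2 ∂((2 ^ m : ℝ≥0∞) • volume.restrict B') :=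
              lintegral_mono' hmap le_rfl
          _ = 2 ^ (m + 2) * ∫⁻ z in B', ‖V z‖ₑ ^ 2 := by
              rw [lintegral_smul_measure, lintegral_const_mul _ (hVc.measurable.enorm.pow_const 2),
                smul_eq_mul, ← mul_assoc]
              congr 1
              rw [pow_add]
              norm_num
    _ = _ := by simp [hV]

lemma ofReal_integral_norm_sq {α F : Type*} [MeasurableSpace α] {μ : Measure α}
    [NormedAddCommGroup F] {g : α → F} (h : MemLp g 2 μ) :
    ENNReal.ofReal (∫ z, ‖g z‖ ^ 2 ∂μ) = ∫⁻ z, ‖g z‖ₑ ^ 2 ∂μ := by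
  rw [ofReal_integral_eq_lintegral_ofReal (integrable_norm_sq_of_memLp h)
    (Eventually.of_forall fun z => by positivity)]
  refine lintegral_congr fun z => ?_
  rw [ENNReal.ofReal_pow (norm_nonneg _), ofReal_norm]

/-- Both sides are continuous under the smooth approximation on `B_{R'}`. Affine shifts with `|c| ≤
1/2` preserve `L²` convergence, so the left side causes no difficulty. -/
lemma integral_affine_sub_sq_le {x : Euc m} {R R' : ℝ} (hR : R' < R) {f : Euc m → Euc l}
    (hf : MemW22 (Metric.ball x R) f) {h : Euc m} {c : ℝ}
    (hc : |c| ≤ 1 / 2) {B B' : Set (Euc m)} (hB' : MeasurableSet B')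
    (hB'R : B' ⊆ Metric.ball x R')
    (hBB : ∀ t ∈ Icc (0 : ℝ) 1, ∀ z ∈ B, z + t • affField h c z ∈ B') :
    ∫ z in B, ‖f (z + affField h c z) - f z‖ ^ 2 ≤
      2 ^ (m + 2) * ∫ z in B', ‖affDeriv (Metric.ball x R) h c f z‖ ^ 2 := by
  obtain ⟨u, hu, h0, h1, -⟩ := exists_tendstoLtwo hR hf
  set μ := volume.restrict (Metric.ball x R') with hμ
  have hBsub : B ⊆ B' := fun z hz => by
    simpa using hBB 0 ⟨le_rfl, zero_le_one⟩ z hz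
  have hle' : volume.restrict B' ≤ μ := Measure.restrict_mono hB'R le_rfl
  have hle : volume.restrict B ≤ μ := Measure.restrict_mono (hBsub.trans hB'R) le_rfl
  have hm1 : Measurable fun z : Euc m => z + affField h c z := by unfold affField; fun_prop
  have hmap : Measure.map (fun z => z + affField h c z) (volume.restrict B) ≤
      (2 ^ m : ℝ≥0∞) • μ := by
    refine (map_affine_le hc hB' fun z hz => ?_).trans (by gcongr)
    simpa using hBB 1 ⟨zero_le_one, le_rfl⟩ z hz
  have t1 := TendstoLtwo.comp hm1 hmap (by simp) (by simp) h0
  have t2 := t1.add ((h0.mono_measure hle).smul (c := fun _ => (-1 : ℝ)) aestronglyMeasurable_const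
    (M := 1) (Eventually.of_forall fun _ => by simp))
  have hcoef : ∀ i, Continuous fun z : Euc m => affField h c z i := fun i => by
    unfold affField; fun_prop
  have t3 := (TendstoLtwo.sum Finset.univ fun i _ => (h1 i).smul_continuous (hcoef i)).mono_measure
    hle'
  have l2 := t2.integral_inner t2
  have l3 := t3.integral_inner t3
  simp_rw [real_inner_self_eq_norm_sq] at l2 l3
  have l3' := l3.const_mul ((2 : ℝ) ^ (m + 2))
  have hfin := le_of_tendsto_of_tendsto' l2 l3' fun n => ?_
  · simpa [affDeriv, sub_eq_add_neg] using hfin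
  · rw [← ENNReal.ofReal_le_ofReal_iff (by positivity), ENNReal.ofReal_mul (by positivity),
      ofReal_integral_norm_sq (t2.memLp_seq n), ofReal_integral_norm_sq (t3.memLp_seq n)]
    have := lintegral_affine_sub_sq_le (hu n) hc hB' hBB
    have e2 : ENNReal.ofReal ((2 : ℝ) ^ (m + 2)) = 2 ^ (m + 2) := by
      rw [ENNReal.ofReal_pow (by norm_num)]; norm_num
    rw [e2]
    simpa [sub_eq_add_neg] using this

end AffineDifference

/-! ### Consequences of the density bounds for blow-ups -/

section Scaled

variable {m l : ℕ} {x : Euc m} {f : Euc m → Euc l} {C : ℝ} {Θ : Euc m → ℝ → ℝ}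

lemma setIntegral_ball_comp_affine (F : Euc m → ℝ) (y : Euc m) {s : ℝ} (hs : 0 < s) (ρ : ℝ) :
    ∫ z in Metric.ball (0 : Euc m) ρ, F (y + s • z) =
      (s ^ m)⁻¹ * ∫ w in Metric.ball y (s * ρ), F w := by
  have h1 := Measure.setIntegral_comp_smul (volume : Measure (Euc m)) (fun w => F (y + w))
    (Metric.ball (0 : Euc m) ρ) hs.ne'
  rw [h1, finrank_euclideanSpace_fin, abs_of_pos (by positivity), smul_eq_mul,
    smul_ball hs.ne', smul_zero, Real.norm_of_nonneg hs.le]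
  congr 1
  have h2 := (measurePreserving_add_left (volume : Measure (Euc m)) y).setIntegral_preimage_emb
    (measurableEmbedding_addLeft y) F (Metric.ball y (s * ρ))
  rw [← h2]
  congr 2
  ext z
  simp [dist_eq_norm]

lemma norm_affDeriv_sq_le (Ω : Set (Euc m)) (f : Euc m → Euc l) (h : Euc m) (c : ℝ) (z : Euc m) :
    ‖affDeriv Ω h c f z‖ ^ 2 ≤ ‖affField h c z‖ ^ 2 * gradSq Ω f z := by
  have := norm_radialDeriv_sq_le Ω f (z - affField h c z) z
  simpa [radialDeriv, affDeriv] using this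

/-- Blow-ups of a stationary biharmonic map are equicontinuous in the mean. -/
lemma IsDensity.integral_translate_le (D : IsDensity C x f Θ) (hf : MemW22 (Metric.ball x 4) f)
    {y : Euc m} (hy : y ∈ Metric.ball x 2) {s : ℝ} (hs : 0 < s) (hs1 : 4 * s ≤ 1) {h : Euc m}
    (hh : ‖h‖ ≤ 1) :
    ∫ z in Metric.ball (0 : Euc m) 1, ‖blowUp f y s (z + h) - blowUp f y s z‖ ^ 2 ≤
      2 ^ (m + 2) * 4 ^ m * C * ‖h‖ ^ 2 := by
  set Ω := Metric.ball x 4 with hΩ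
  rw [Metric.mem_ball] at hy
  have e := setIntegral_ball_comp_affine (fun w => ‖f (w + affField (s • h) 0 w) - f w‖ ^ 2) y hs 1
  have e' : ∫ z in Metric.ball (0 : Euc m) 1, ‖blowUp f y s (z + h) - blowUp f y s z‖ ^ 2 =
      (s ^ m)⁻¹ * ∫ w in Metric.ball y s, ‖f (w + affField (s • h) 0 w) - f w‖ ^ 2 := by
    rw [mul_one] at e
    rw [← e]
    simp only [blowUp, affField, zero_smul, add_zero, smul_add, add_assoc]
  have hB'R : Metric.ball y (2 * s) ⊆ Metric.ball x 3 :=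
    Metric.ball_subset_ball' (by linarith)
  have hfield : ∀ w, affField (s • h) 0 w = s • h := fun w => by simp [affField]
  have hmain := integral_affine_sub_sq_le (by norm_num : (3 : ℝ) < 4) hf (h := s • h) (c := 0)
    (by norm_num) (B := Metric.ball y s) (Metric.isOpen_ball (x := y) (ε := 2 * s)).measurableSet
    hB'R (fun t ht z hz => by
      rw [hfield, Metric.mem_ball, dist_eq_norm]
      rw [Metric.mem_ball, dist_eq_norm] at hz
      calc ‖z + t • s • h - y‖ = ‖(z - y) + t • s • h‖ := by congr 1; abel
        _ ≤ ‖z - y‖ + ‖t • s • h‖ := norm_add_le _ _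
        _ ≤ ‖z - y‖ + s := by
            gcongr
            rw [norm_smul, norm_smul, Real.norm_of_nonneg ht.1, Real.norm_of_nonneg hs.le]
            calc t * (s * ‖h‖) ≤ 1 * (s * 1) := by
                  have := ht.2
                  gcongr
              _ = s := by ring
        _ < 2 * s := by linarith)
  -- At radius `4s` the gradient bound covers `B_{2s}(y)`, which contains the segments of length at
  -- most `s` issuing from `B_s(y)`.
  have hg := D.gradSq_le y (Metric.mem_ball.2 hy) (4 * s) ⟨by positivity, hs1⟩
  rw [show 4 * s / 2 = 2 * s by ring] at hg
  have i2 := integrable_gradSq hf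
  have hsub : Metric.ball y (2 * s) ⊆ Ω := hB'R.trans (Metric.ball_subset_ball (by norm_num))
  have hle : volume.restrict (Metric.ball y (2 * s)) ≤ volume.restrict Ω :=
    Measure.restrict_mono hsub le_rfl
  have h3 : ∫ z in Metric.ball y (2 * s), ‖affDeriv Ω (s • h) 0 f z‖ ^ 2 ≤
      (s * ‖h‖) ^ 2 * ∫ z in Metric.ball y (2 * s), gradSq Ω f z := by
    rw [← integral_const_mul]
    refine integral_mono_of_nonneg (Eventually.of_forall fun z => by positivity)
      ((i2.mono_measure hle).const_mul _) (Eventually.of_forall fun z => ?_)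
    have := norm_affDeriv_sq_le Ω f (s • h) 0 z
    rwa [hfield, norm_smul, Real.norm_of_nonneg hs.le] at this
  rw [e']
  have hG0 : 0 ≤ ∫ z in Metric.ball y (2 * s), gradSq Ω f z :=
    integral_nonneg fun z => gradSq_nonneg Ω f z
  have hX0 : 0 ≤ C * ((4 * s) ^ m / (4 * s) ^ 2) := hG0.trans hg
  -- The gradient bound itself forces the sign of `C`.
  have hC : 0 ≤ C := by
    by_contra hneg
    have : 0 < (4 * s) ^ m / (4 * s) ^ 2 := by positivity
    nlinarith
  calc (s ^ m)⁻¹ * ∫ w in Metric.ball y s, ‖f (w + affField (s • h) 0 w) - f w‖ ^ 2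
      ≤ (s ^ m)⁻¹ * (2 ^ (m + 2) * ((s * ‖h‖) ^ 2 * (C * ((4 * s) ^ m / (4 * s) ^ 2)))) := by
        gcongr
        exact hmain.trans (by gcongr; exact h3.trans (by gcongr))
    _ = 2 ^ (m + 2) * 4 ^ m * C * ‖h‖ ^ 2 / 16 := by
        rw [mul_pow, mul_pow, mul_pow]
        field_simp
        norm_num
    _ ≤ 2 ^ (m + 2) * 4 ^ m * C * ‖h‖ ^ 2 := div_le_self (by positivity) (by norm_num)

/-- Pinching of the density makes a blow-up almost invariant under dilations. -/
lemma IsDensity.integral_dilate_le (D : IsDensity C x f Θ) (hC : 0 ≤ C)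
    (hf : MemW22 (Metric.ball x 4) f)
    {y b : Euc m} {s : ℝ} (hs : 0 < s) (hs1 : 8 * s ≤ 1) (hb : ‖b‖ < 1)
    (hy' : y + s • b ∈ Metric.ball x 2) {c : ℝ} (hc : c ∈ Icc (-(1 / 2) : ℝ) 0) :
    ∫ z in Metric.ball (0 : Euc m) 1, ‖blowUp f y s (z + c • (z - b)) - blowUp f y s z‖ ^ 2 ≤
      2 ^ (m + 2) * 4 ^ m * C * (Θ (y + s • b) (8 * s) - Θ (y + s • b) (4 * s)) := by
  set Ω := Metric.ball x 4 with hΩ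
  set y' := y + s • b with hy'd
  -- In the original coordinates a dilation about `b` is a dilation about `y' = y + s b`, generated
  -- by the radial field of `y'`.
  have hfield : ∀ w, affField (-(c • y')) c w = c • (w - y') := fun w => by
    unfold affField; module
  have e := setIntegral_ball_comp_affine
    (fun w => ‖f (w + affField (-(c • y')) c w) - f w‖ ^ 2) y hs 1
  have e' : ∫ z in Metric.ball (0 : Euc m) 1,
      ‖blowUp f y s (z + c • (z - b)) - blowUp f y s z‖ ^ 2 =
      (s ^ m)⁻¹ * ∫ w in Metric.ball y s, ‖f (w + affField (-(c • y')) c w) - f w‖ ^ 2 := by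
    rw [mul_one] at e
    rw [← e]
    simp only [blowUp, hfield]
    congr 1 with z
    congr 4
    rw [hy'd]
    module
  have hy'x := Metric.mem_ball.1 hy'
  have hB'R : Metric.ball y' (2 * s) ⊆ Metric.ball x 3 :=
    Metric.ball_subset_ball' (by linarith)
  have hmain := integral_affine_sub_sq_le (by norm_num : (3 : ℝ) < 4) hf (h := -(c • y')) (c := c)
    (abs_le.2 ⟨hc.1, hc.2.trans (by norm_num)⟩) (B := Metric.ball y s)
    (Metric.isOpen_ball (x := y') (ε := 2 * s)).measurableSet
    hB'R (fun t ht z hz => by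
      rw [hfield, Metric.mem_ball, dist_eq_norm]
      rw [Metric.mem_ball, dist_eq_norm] at hz
      have h1 : z + t • c • (z - y') - y' = (1 + t * c) • (z - y') := by module
      have h2 : |1 + t * c| ≤ 1 := by
        rw [abs_le]
        constructor <;> nlinarith [ht.1, ht.2, hc.1, hc.2]
      have h3 : ‖z - y'‖ < 2 * s := by
        calc ‖z - y'‖ = ‖(z - y) - s • b‖ := by rw [hy'd]; congr 1; abel
          _ ≤ ‖z - y‖ + ‖s • b‖ := norm_sub_le _ _
          _ < s + s := by
              rw [norm_smul, Real.norm_of_nonneg hs.le]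
              have : s * ‖b‖ ≤ s * 1 := by gcongr
              linarith
          _ = 2 * s := by ring
      rw [h1, norm_smul, Real.norm_eq_abs]
      exact (mul_le_of_le_one_left (norm_nonneg _) h2).trans_lt h3)
  -- Since `‖b‖ < 1`, the ball `B_s(y)` lies in `B_{2s}(y')`, where the radial energy is bounded by
  -- the drop between `4s` and `8s`.
  have hg := D.radial_le y' hy' (4 * s) (by positivity) (by linarith)
  rw [show 4 * s / 2 = 2 * s by ring, show 2 * (4 * s) = 8 * s by ring] at hg
  have hsub : Metric.ball y' (2 * s) ⊆ Ω := hB'R.trans (Metric.ball_subset_ball (by norm_num))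
  have hle : volume.restrict (Metric.ball y' (2 * s)) ≤ volume.restrict Ω :=
    Measure.restrict_mono hsub le_rfl
  have h3 : ∫ z in Metric.ball y' (2 * s), ‖affDeriv Ω (-(c • y')) c f z‖ ^ 2 ≤
      ∫ z in Metric.ball y' (2 * s), ‖radialDeriv Ω y' f z‖ ^ 2 := by
    refine integral_mono_of_nonneg (Eventually.of_forall fun z => by positivity)
      ((integrable_norm_sq_of_memLp (memLp_radialDeriv hf y')).mono_measure hle)
      (Eventually.of_forall fun z => ?_)
    have : affDeriv Ω (-(c • y')) c f z = c • radialDeriv Ω y' f z := by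
      unfold affDeriv radialDeriv
      rw [Finset.smul_sum]
      refine Finset.sum_congr rfl fun i _ => ?_
      rw [hfield, smul_smul]
      simp
    simp only [this, norm_smul, mul_pow, Real.norm_eq_abs, sq_abs]
    refine mul_le_of_le_one_left (by positivity) ?_
    nlinarith [hc.1, hc.2]
  have hΘ : 0 ≤ Θ y' (8 * s) - Θ y' (4 * s) := sub_nonneg.2 (D.monotone y' hy'
    ⟨by positivity, by linarith⟩ ⟨by positivity, hs1⟩ (by linarith))
  rw [e']
  calc (s ^ m)⁻¹ * ∫ w in Metric.ball y s, ‖f (w + affField (-(c • y')) c w) - f w‖ ^ 2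
      ≤ (s ^ m)⁻¹ * (2 ^ (m + 2) * (C * (4 * s) ^ m * (Θ y' (8 * s) - Θ y' (4 * s)))) := by
        gcongr
        exact hmain.trans (by gcongr; exact h3.trans hg)
    _ = _ := by
        rw [mul_pow]
        field_simp

end Scaled

/-! ### Compactness in `L²` -/

section Rellich

variable {m l : ℕ}

/-- Weak sequential compactness of bounded sequences in `L²`. -/
lemma exists_subseq_tendsto_integral_inner {μ : Measure (Euc m)} [IsFiniteMeasure μ]
    {g : ℕ → Euc m → Euc l} (hg : ∀ i, MemLp (g i) 2 μ) {M : ℝ≥0∞} (hM : M ≠ ⊤)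
    (hgM : ∀ i, eLpNorm (g i) 2 μ ≤ M) :
    ∃ φ : ℕ → ℕ, StrictMono φ ∧ ∀ k : Euc m → Euc l, MemLp k 2 μ →
      ∃ L : ℝ, Tendsto (fun i => ∫ z, inner ℝ (g (φ i) z) (k z) ∂μ) atTop (𝓝 L) := by
  set H := Lp (Euc l) 2 μ
  haveI : Fact ((2 : ℝ≥0∞) ≠ ⊤) := ⟨ENNReal.ofNat_ne_top⟩
  set Λ : ℕ → WeakDual ℝ H := fun i => StrongDual.toWeakDual (innerSL ℝ ((hg i).toLp (g i))) with hΛ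
  have hmem : ∀ i, Λ i ∈ WeakDual.toStrongDual ⁻¹' Metric.closedBall (0 : StrongDual ℝ H) M.toReal := by
    intro i
    rw [mem_preimage, mem_closedBall_zero_iff]
    have : WeakDual.toStrongDual (Λ i) = innerSL ℝ ((hg i).toLp (g i)) := rfl
    rw [this, innerSL_apply_norm, Lp.norm_toLp]
    exact ENNReal.toReal_mono hM (hgM i)
  obtain ⟨Λ', -, φ, hφ, hlim⟩ := WeakDual.isSeqCompact_closedBall ℝ H 0 M.toReal hmem
  refine ⟨φ, hφ, fun k hk => ⟨Λ' (hk.toLp k), ?_⟩⟩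
  have h1 := (WeakBilin.tendsto_iff_forall_eval_tendsto _ (f := fun i => Λ (φ i))
    ContinuousLinearMap.coe_injective).1 hlim (hk.toLp k)
  refine h1.congr fun i => ?_
  change inner ℝ ((hg (φ i)).toLp (g (φ i))) (hk.toLp k) = _
  rw [L2.inner_def]
  apply integral_congr_ae
  filter_upwards [(hg (φ i)).coeFn_toLp, hk.coeFn_toLp] with z h1 h2
  rw [h1, h2]

/-- Each component of the mollification at `z` is a pairing of `u` with a fixed kernel, so weak
convergence of a sequence yields pointwise convergence of its mollifications. -/
lemma moll_eq_sum (φ : ContDiffBump (0 : Euc m)) {u : Euc m → Euc l} (hu : LocallyIntegrable u)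
    (z : Euc m) :
    moll φ u z = ∑ a, (∫ w, inner ℝ (u w)
      (φ.normed volume (z - w) • (EuclideanSpace.single a 1 : Euc l))) •
        (EuclideanSpace.single a 1 : Euc l) := by
  have h1 : moll φ u z = ∫ w, φ.normed volume (z - w) • u w := by
    have := integral_sub_left_eq_self (fun w => φ.normed volume (z - w) • u w)
      (volume : Measure (Euc m)) z
    rw [moll_apply, ← this]
    simp
  have h2 : Integrable fun w => φ.normed volume (z - w) • u w := by
    have := (moll_integrable φ hu z).comp_sub_left z
    simpa using this
  conv_lhs => rw [sum_apply_smul_single (moll φ u z)]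
  refine Finset.sum_congr rfl fun a _ => ?_
  congr 1
  have h3 := integral_inner (𝕜 := ℝ) h2 (EuclideanSpace.single a 1 : Euc l)
  rw [h1]
  have h4 : ∀ v : Euc l, v a = inner ℝ (EuclideanSpace.single a 1 : Euc l) v := fun v => by
    simp [EuclideanSpace.inner_single_left]
  rw [h4, ← h3]
  congr 1 with w
  rw [real_inner_smul_right, real_inner_smul_right, real_inner_comm]

lemma norm_moll_le (φ : ContDiffBump (0 : Euc m)) {u : Euc m → Euc l} {M : ℝ}
    (hM : ∀ᵐ z, ‖u z‖ ≤ M) (z : Euc m) : ‖moll φ u z‖ ≤ M := by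
  rw [moll_apply]
  have h : ∀ᵐ h : Euc m, ‖φ.normed volume h • u (z - h)‖ ≤ φ.normed volume h * M := by
    filter_upwards [(quasiMeasurePreserving_sub_left volume z).ae hM] with h hh
    rw [norm_smul, Real.norm_of_nonneg (φ.nonneg_normed h)]
    exact mul_le_mul_of_nonneg_left hh (φ.nonneg_normed h)
  refine (norm_integral_le_of_norm_le (φ.integrable_normed.mul_const M) h).trans ?_
  rw [integral_mul_const, φ.integral_normed, one_mul]

/-- **Rellich compactness** for bounded sequences which are equicontinuous in the mean. -/
lemma exists_subseq_tendstoLtwo {g : ℕ → Euc m → Euc l}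
    (hg : ∀ i, AEStronglyMeasurable (g i) (volume.restrict (Metric.ball 0 2)))
    {M : ℝ} (hM0 : 0 ≤ M) (hM : ∀ i, ∀ᵐ z ∂(volume.restrict (Metric.ball (0 : Euc m) 2)), ‖g i z‖ ≤ M) {C : ℝ}
    (hC : ∀ i (h : Euc m), ‖h‖ ≤ 1 →
      ∫ z in Metric.ball (0 : Euc m) 1, ‖g i (z + h) - g i z‖ ^ 2 ≤ C * ‖h‖ ^ 2) :
    ∃ φ : ℕ → ℕ, StrictMono φ ∧ ∃ G,
      TendstoLtwo (volume.restrict (Metric.ball 0 1)) (fun i => g (φ i)) G := by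
  set B₂ := Metric.ball (0 : Euc m) 2 with hB₂
  set B₁ := Metric.ball (0 : Euc m) 1 with hB₁
  have hB₂m : MeasurableSet B₂ := Metric.isOpen_ball.measurableSet
  have hB₁m : MeasurableSet B₁ := Metric.isOpen_ball.measurableSet
  have hsub : B₁ ⊆ B₂ := Metric.ball_subset_ball one_le_two
  set u : ℕ → Euc m → Euc l := fun i => B₂.indicator (g i) with hu
  have hgm : ∀ i, MemLp (g i) 2 (volume.restrict B₂) := fun i => MemLp.of_bound (hg i) M (hM i)
  have hum : ∀ i, MemLp (u i) 2 volume := fun i => (memLp_indicator_iff_restrict hB₂m).2 (hgm i)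
  have hul : ∀ i, LocallyIntegrable (u i) := fun i => (hum i).locallyIntegrable one_le_two
  have huM : ∀ i, ∀ᵐ z, ‖u i z‖ ≤ M := fun i => by
    filter_upwards [(ae_restrict_iff' hB₂m).1 (hM i)] with z hz
    by_cases h : z ∈ B₂
    · rw [hu]; simp only [indicator_of_mem h]; exact hz h
    · rw [hu]; simp only [indicator_of_notMem h, norm_zero]; exact hM0
  have hue : ∀ i, ∀ z ∈ B₂, u i z = g i z := fun i z hz => indicator_of_mem hz _
  -- For `‖h‖ ≤ 1` both arguments stay in `B₂`, where the truncation agrees with `g i`.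
  have htr : ∀ i (h : Euc m), ‖h‖ ≤ 1 →
      ∫⁻ z in B₁, ‖u i (z - h) - u i z‖ₑ ^ 2 ≤ ENNReal.ofReal (C * ‖h‖ ^ 2) := by
    intro i h hh
    have hm : MemLp (fun z => u i (z - h) - u i z) 2 (volume.restrict B₁) :=
      (((hum i).comp_measurePreserving (measurePreserving_sub_right volume h)).sub (hum i)).restrict _
    rw [← ofReal_integral_norm_sq hm]
    refine ENNReal.ofReal_le_ofReal (le_trans (le_of_eq ?_)
      ((hC i (-h) (by rwa [norm_neg])).trans_eq (by rw [norm_neg])))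
    refine setIntegral_congr_fun hB₁m fun z hz => ?_
    have hz' : z - h ∈ B₂ := by
      rw [hB₂, mem_ball_zero_iff]
      rw [hB₁, mem_ball_zero_iff] at hz
      linarith [norm_sub_le z h]
    simp only [hue i _ hz', hue i _ (hsub hz)]
    rw [sub_eq_add_neg z h]
  -- The subsequence converges weakly in `L²(B₂)`; the rest of the proof shows that it is strongly
  -- Cauchy in `L²(B₁)`.
  obtain ⟨φ, hφ, hweak⟩ := exists_subseq_tendsto_integral_inner (M :=
      (volume.restrict B₂ univ) ^ (2 : ℝ≥0∞).toReal⁻¹ * ENNReal.ofReal M) hgm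
    (ENNReal.mul_ne_top (ENNReal.rpow_ne_top_of_nonneg (by simp) (measure_ne_top _ _))
      ENNReal.ofReal_ne_top) (fun i => eLpNorm_le_of_ae_bound (hM i))
  refine ⟨φ, hφ, ?_⟩
  have hmollc : ∀ (b : ContDiffBump (0 : Euc m)) z, ∃ q, Tendsto (fun i => moll b (u (φ i)) z) atTop
      (𝓝 q) := by
    intro b z
    have hk : ∀ a : Fin l, MemLp (fun w : Euc m => b.normed volume (z - w) •
        (EuclideanSpace.single a 1 : Euc l)) 2 (volume.restrict B₂) := fun a =>
      memLp_ball_of_continuous (((b.continuous_normed).comp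
        (continuous_const.sub continuous_id)).smul continuous_const) _ _
    choose L hL using fun a => hweak _ (hk a)
    refine ⟨∑ a, L a • (EuclideanSpace.single a 1 : Euc l), ?_⟩
    have h1 : ∀ i, moll b (u (φ i)) z = ∑ a, (∫ w in B₂, inner ℝ (g (φ i) w)
      (b.normed volume (z - w) • (EuclideanSpace.single a 1 : Euc l))) •
        (EuclideanSpace.single a 1 : Euc l) := by
      intro i
      rw [moll_eq_sum b (hul _)]
      refine Finset.sum_congr rfl fun a _ => ?_
      congr 1
      rw [← integral_indicator hB₂m]
      congr 1 with w
      by_cases hw : w ∈ B₂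
      · rw [hue _ _ hw, indicator_of_mem hw]
      · rw [hu]; simp only [indicator_of_notMem hw, inner_zero_left]
    simp_rw [h1]
    exact tendsto_finsetSum _ fun a _ => (hL a).smul_const _
  -- At a fixed mollification scale the pointwise limits exist everywhere, and the uniform bound `M`
  -- upgrades them to `L²(B₁)` limits by dominated convergence.
  have hmollL : ∀ b : ContDiffBump (0 : Euc m), ∃ Q : Euc m → Euc l, Tendsto (fun i =>
      ∫⁻ z in B₁, ‖moll b (u (φ i)) z - Q z‖ₑ ^ 2) atTop (𝓝 0) ∧ AEStronglyMeasurable Q := by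
    intro b
    choose Q hQ using hmollc b
    have hcm : ∀ i, Continuous (moll b (u (φ i))) := fun i => (contDiff_moll b (hul _)).continuous
    have hQm : AEStronglyMeasurable Q := aestronglyMeasurable_of_tendsto_ae atTop
      (fun i => (hcm i).aestronglyMeasurable) (Eventually.of_forall hQ)
    have hQM : ∀ z, ‖Q z‖ ≤ M := fun z => le_of_tendsto (hQ z).norm
      (Eventually.of_forall fun i => norm_moll_le b (huM _) z)
    refine ⟨Q, ?_, hQm⟩
    have := tendsto_lintegral_of_dominated_convergence' (μ := volume.restrict B₁)
      (F := fun i z => ‖moll b (u (φ i)) z - Q z‖ₑ ^ 2) (f := fun _ => 0)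
      (fun _ => ENNReal.ofReal ((2 * M) ^ 2))
      (fun i => (((hcm i).aestronglyMeasurable.sub hQm).restrict.enorm.pow_const 2))
      (fun i => Eventually.of_forall fun z => ?_) ?_ (Eventually.of_forall fun z => ?_)
    · simpa using this
    · change ‖moll b (u (φ i)) z - Q z‖ₑ ^ 2 ≤ ENNReal.ofReal ((2 * M) ^ 2)
      rw [← ofReal_norm, ← ENNReal.ofReal_pow (norm_nonneg _)]
      refine ENNReal.ofReal_le_ofReal ?_
      gcongr
      calc ‖moll b (u (φ i)) z - Q z‖ ≤ ‖moll b (u (φ i)) z‖ + ‖Q z‖ := norm_sub_le _ _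
        _ ≤ 2 * M := by linarith [norm_moll_le b (huM (φ i)) z, hQM z]
    · rw [lintegral_const]
      exact ENNReal.mul_ne_top ENNReal.ofReal_ne_top (measure_ne_top _ _)
    · have h1 : Tendsto (fun i => moll b (u (φ i)) z - Q z) atTop (𝓝 0) := by
        simpa using (hQ z).sub_const (Q z)
      have h2 := (continuous_enorm.tendsto (0 : Euc l)).comp h1
      have h3 := ENNReal.Tendsto.pow h2 (n := 2)
      simpa using h3
  have hgm1 : ∀ i, MemLp (g (φ i)) 2 (volume.restrict B₁) := fun i =>
    (hgm _).mono_measure (Measure.restrict_mono hsub le_rfl)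
  have hcau : CauchySeq fun i => (hgm1 i).toLp (g (φ i)) := by
    rw [EMetric.cauchySeq_iff]
    intro ε hε
    obtain ⟨δ, hδ, hδε⟩ : ∃ δ : ℝ≥0∞, 0 < δ ∧ δ + δ + (δ + δ) < ε := by
      have hc0 : Tendsto (fun δ : ℝ≥0∞ => δ + δ + (δ + δ)) (𝓝 0) (𝓝 (0 + 0 + (0 + 0))) :=
        (tendsto_id.add tendsto_id).add (tendsto_id.add tendsto_id)
      simp only [add_zero] at hc0
      have h2 : ∀ᶠ δ in 𝓝[>] (0 : ℝ≥0∞), δ + δ + (δ + δ) < ε :=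
        (hc0.eventually (gt_mem_nhds hε)).filter_mono nhdsWithin_le_nhds
      obtain ⟨δ, h3, h4⟩ := (h2.and self_mem_nhdsWithin).exists
      exact ⟨δ, h4, h3⟩
    obtain ⟨ρ, hρ0, hρ1, hρ⟩ : ∃ ρ : ℝ, 0 < ρ ∧ ρ ≤ 1 ∧ ∀ h : Euc m, ‖h‖ < ρ →
        ENNReal.ofReal (C * ‖h‖ ^ 2) ≤ δ ^ 2 := by
      have hc0 : Tendsto (fun h : Euc m => ENNReal.ofReal (C * ‖h‖ ^ 2)) (𝓝 0) (𝓝 0) := by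
        have : Continuous fun h : Euc m => ENNReal.ofReal (C * ‖h‖ ^ 2) :=
          ENNReal.continuous_ofReal.comp (by fun_prop)
        simpa using this.tendsto 0
      obtain ⟨ρ, hρ, hh⟩ := Metric.eventually_nhds_iff.1
        (hc0.eventually (ge_mem_nhds (ENNReal.pow_pos hδ 2)))
      exact ⟨min ρ 1, lt_min hρ one_pos, min_le_right _ _, fun h hhρ =>
        hh (by rw [dist_zero_right]; exact hhρ.trans_le (min_le_left _ _))⟩
    -- At this scale mollification moves every member of the sequence by at most `δ` in `L²(B₁)`, so
    -- it suffices that the mollified sequence is close to its limit.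
    set b : ContDiffBump (0 : Euc m) := ⟨ρ / 2, ρ, by positivity, by linarith⟩ with hb
    obtain ⟨Q, hQ, hQm⟩ := hmollL b
    have e1 : ∀ i, eLpNorm (fun z => moll b (u i) z - u i z) 2 (volume.restrict B₁) ≤ δ := by
      intro i
      rw [← ENNReal.pow_le_pow_left_iff two_ne_zero, eLpNorm_two_sq]
      refine lintegral_enorm_moll_sub_sq_le b (hul i) B₁ fun h hh => ?_
      have hh : ‖h‖ < ρ := hh
      exact (htr i h (hh.le.trans hρ1)).trans (hρ h hh)
    have e2 : ∀ᶠ i in atTop, eLpNorm (fun z => moll b (u (φ i)) z - Q z) 2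
        (volume.restrict B₁) ≤ δ := by
      filter_upwards [hQ.eventually (ge_mem_nhds (ENNReal.pow_pos hδ 2))] with i hi
      rwa [← ENNReal.pow_le_pow_left_iff two_ne_zero, eLpNorm_two_sq]
    obtain ⟨n₀, hn₀⟩ := eventually_atTop.1 e2
    have hmm : ∀ i, AEStronglyMeasurable (moll b (u i)) (volume.restrict B₁) := fun i =>
      (contDiff_moll b (hul i)).continuous.aestronglyMeasurable
    have e3 : ∀ i ≥ n₀, eLpNorm (fun z => g (φ i) z - Q z) 2 (volume.restrict B₁) ≤ δ + δ := by
      intro i hi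
      have hcongr : eLpNorm (fun z => g (φ i) z - Q z) 2 (volume.restrict B₁) =
          eLpNorm ((fun z => u (φ i) z - moll b (u (φ i)) z) + fun z => moll b (u (φ i)) z - Q z) 2
            (volume.restrict B₁) := by
        apply eLpNorm_congr_ae
        filter_upwards [ae_restrict_mem hB₁m] with z hz
        rw [Pi.add_apply, hue _ _ (hsub hz)]
        abel
      rw [hcongr]
      refine (eLpNorm_add_le (((hum _).1.restrict).sub (hmm _)) ((hmm _).sub hQm.restrict)
        one_le_two).trans ?_
      gcongr
      · refine le_trans (le_of_eq ?_) (e1 (φ i))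
        rw [← eLpNorm_neg]
        congr 1
        ext1 z
        simp
      · exact hn₀ i hi
    refine ⟨n₀, fun i hi j hj => ?_⟩
    rw [Lp.edist_toLp_toLp]
    have hcongr : g (φ i) - g (φ j) = (fun z => g (φ i) z - Q z) + -fun z => g (φ j) z - Q z := by
      ext1 z; simp
    rw [hcongr]
    refine lt_of_le_of_lt ((eLpNorm_add_le ((hgm1 i).1.sub hQm.restrict)
      ((hgm1 j).1.sub hQm.restrict).neg one_le_two).trans ?_) hδε
    rw [eLpNorm_neg]
    exact add_le_add (e3 i hi) (e3 j hj)
  obtain ⟨G, hG⟩ := cauchySeq_tendsto_of_complete hcau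
  refine ⟨G, hgm1, Lp.memLp G, ?_⟩
  have h1 : Tendsto (fun i => (hgm1 i).toLp (g (φ i))) atTop
      (𝓝 ((Lp.memLp G).toLp G)) := by rwa [Lp.toLp_coeFn]
  rw [Lp.tendsto_Lp_iff_tendsto_eLpNorm''] at h1
  exact h1

end Rellich

/-! ### An everywhere defined measurable representative -/

section LimitRepresentative

variable {X Y : Type*}

/-- The positive rational radii tending to `0`. -/
def ratRadii : Filter ℚ := comap (fun q : ℚ => (q : ℝ)) (𝓝[>] 0)

instance : ratRadii.NeBot := by
  refine comap_neBot fun s hs => ?_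
  obtain ⟨δ, hδ, hs'⟩ := mem_nhdsGT_iff_exists_Ioo_subset.1 hs
  obtain ⟨q, hq1, hq2⟩ := exists_rat_btwn (show (0 : ℝ) < δ from hδ)
  exact ⟨q, hs' ⟨hq1, hq2⟩⟩

instance : ratRadii.IsCountablyGenerated := by
  unfold ratRadii
  infer_instance

/-- Nothing is lost by restricting to rational radii, because `a` is continuous and they are dense;
countability is what later makes the limit measurable. -/
lemma tendsto_ratRadii_iff [PseudoMetricSpace Y] {a : ℝ → Y} (ha : ContinuousOn a (Ioi 0)) {c : Y} :
    Tendsto (fun q : ℚ => a q) ratRadii (𝓝 c) ↔ Tendsto a (𝓝[>] 0) (𝓝 c) := by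
  refine ⟨fun h => ?_, fun h => h.comp tendsto_comap⟩
  rw [Metric.tendsto_nhds]
  intro ε hε
  have h1 := (Metric.tendsto_nhds.1 h) (ε / 2) (half_pos hε)
  rw [ratRadii, eventually_comap] at h1
  obtain ⟨δ, hδ, hδs⟩ := mem_nhdsGT_iff_exists_Ioo_subset.1 h1
  filter_upwards [Ioo_mem_nhdsGT (show (0 : ℝ) < δ from hδ)] with ρ hρ
  set S : Set ℝ := Ioo 0 δ ∩ range ((↑) : ℚ → ℝ) with hS
  have hρS : ρ ∈ closure S :=
    (Rat.isDenseEmbedding_coe_real.dense.open_subset_closure_inter isOpen_Ioo) hρ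
  have hcont : ContinuousWithinAt a S ρ := (ha ρ hρ.1).mono fun t ht => ht.1.1
  have hmem := hcont.mem_closure_image hρS
  have hsub : a '' S ⊆ Metric.closedBall c (ε / 2) := by
    rintro _ ⟨t, ⟨ht, q, rfl⟩, rfl⟩
    exact (hδs ht q rfl).le
  have := closure_minimal hsub Metric.isClosed_closedBall hmem
  rw [Metric.mem_closedBall] at this
  linarith

variable [MetricSpace Y] {N : Set Y}

open Classical in
/-- The limit of `A z ρ` as `ρ → 0`, if it exists in `N`, and `p` otherwise. -/
noncomputable def limRep (N : Set Y) (p : Y) (A : X → ℝ → Y) (z : X) : Y :=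
  if h : ∃ c ∈ N, Tendsto (A z) (𝓝[>] 0) (𝓝 c) then h.choose else p

lemma limRep_eq {p : Y} {A : X → ℝ → Y} {z : X} {c : Y} (hc : c ∈ N)
    (h : Tendsto (A z) (𝓝[>] 0) (𝓝 c)) : limRep N p A z = c := by
  have H : ∃ c ∈ N, Tendsto (A z) (𝓝[>] 0) (𝓝 c) := ⟨c, hc, h⟩
  unfold limRep
  rw [dif_pos H]
  exact tendsto_nhds_unique H.choose_spec.2 h

lemma limRep_mem {p : Y} (hp : p ∈ N) (A : X → ℝ → Y) (z : X) : limRep N p A z ∈ N := by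
  unfold limRep
  split_ifs with h
  · exact h.choose_spec.1
  · exact hp

/-- Rescaling the radius does not change a limit at `0`. An invariance of the means thus becomes an
invariance of the representative at every point, including the points where the default value is
used. -/
lemma limRep_congr {p : Y} {A : X → ℝ → Y} {z z' : X} {a : ℝ} (ha : 0 < a)
    (h : ∀ ρ, 0 < ρ → A z' (a * ρ) = A z ρ) : limRep N p A z' = limRep N p A z := by
  have key : ∀ c, Tendsto (A z') (𝓝[>] 0) (𝓝 c) ↔ Tendsto (A z) (𝓝[>] 0) (𝓝 c) := by
    have scale : ∀ b : ℝ, 0 < b → Tendsto (fun ρ : ℝ => b * ρ) (𝓝[>] 0) (𝓝[>] 0) := by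
      intro b hb
      refine tendsto_nhdsWithin_iff.2 ⟨?_, ?_⟩
      · have : Tendsto (fun ρ : ℝ => b * ρ) (𝓝 0) (𝓝 (b * 0)) := tendsto_id.const_mul b
        rw [mul_zero] at this
        exact this.mono_left nhdsWithin_le_nhds
      · filter_upwards [self_mem_nhdsWithin] with ρ hρ using mul_pos hb hρ
    intro c
    constructor
    · intro hc
      refine (hc.comp (scale a ha)).congr' ?_
      filter_upwards [self_mem_nhdsWithin] with ρ hρ using h ρ hρ
    · intro hc
      refine (hc.comp (scale a⁻¹ (inv_pos.2 ha))).congr' ?_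
      filter_upwards [self_mem_nhdsWithin] with ρ hρ
      have := h (a⁻¹ * ρ) (mul_pos (inv_pos.2 ha) hρ)
      rw [mul_inv_cancel_left₀ ha.ne'] at this
      exact this.symm
  by_cases H : ∃ c ∈ N, Tendsto (A z) (𝓝[>] 0) (𝓝 c)
  · obtain ⟨c, hc, hlim⟩ := H
    rw [limRep_eq hc hlim, limRep_eq hc ((key c).2 hlim)]
  · have H' : ¬ ∃ c ∈ N, Tendsto (A z') (𝓝[>] 0) (𝓝 c) := by
      simpa only [key] using H
    unfold limRep
    rw [dif_neg H, dif_neg H']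

/-- Along rational radii the set of convergence and the limit are measurable; requiring the limit to
lie in `N` cuts out a measurable set, off which the value is constant. -/
lemma measurable_limRep [MeasurableSpace X] [CompleteSpace Y] [MeasurableSpace Y] [BorelSpace Y]
    [SecondCountableTopology Y] (hN : MeasurableSet N) (p : Y) {A : X → ℝ → Y}
    (hA : ∀ z, ContinuousOn (A z) (Ioi 0)) (hm : ∀ ρ, Measurable fun z => A z ρ) :
    Measurable (limRep N p A) := by
  haveI : Nonempty Y := ⟨p⟩
  have hs : ∀ q : ℚ, StronglyMeasurable fun z => A z q := fun q => (hm q).stronglyMeasurable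
  have h1 : MeasurableSet {z | ∃ c, Tendsto (fun q : ℚ => A z q) ratRadii (𝓝 c)} :=
    StronglyMeasurable.measurableSet_exists_tendsto hs
  set L : X → Y := fun z => limUnder ratRadii fun q : ℚ => A z q with hL
  have h2 : Measurable L := (StronglyMeasurable.limUnder hs).measurable
  set D : Set X := {z | ∃ c, Tendsto (fun q : ℚ => A z q) ratRadii (𝓝 c)} ∩ L ⁻¹' N with hD
  have hDm : MeasurableSet D := h1.inter (h2 hN)
  classical
  have e : limRep N p A = D.piecewise L fun _ => p := by
    ext z
    by_cases hz : z ∈ D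
    · rw [piecewise_eq_of_mem _ _ _ hz]
      obtain ⟨⟨c, hc⟩, hzN⟩ := hz
      have hLc : L z = c := hc.limUnder_eq
      rw [hLc]
      rw [mem_preimage, hLc] at hzN
      exact limRep_eq hzN ((tendsto_ratRadii_iff (hA z)).1 hc)
    · rw [piecewise_eq_of_notMem _ _ _ hz]
      unfold limRep
      rw [dif_neg]
      rintro ⟨c, hcN, hc⟩
      have hc' := (tendsto_ratRadii_iff (hA z)).2 hc
      have hLc : L z = c := hc'.limUnder_eq
      exact hz ⟨⟨c, hc'⟩, by rw [mem_preimage, hLc]; exact hcN⟩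
  rw [e]
  exact h2.piecewise hDm measurable_const

end LimitRepresentative

/-! ### Homogeneous maps from invariant ball integrals -/

section Representation

variable {m l : ℕ} {G : Euc m → Euc l}

/-- The integral over a closed ball. -/
noncomputable def ballInt (G : Euc m → Euc l) (z : Euc m) (ρ : ℝ) : Euc l :=
  ∫ w in Metric.closedBall z ρ, G w

/-- The indicator of a closed ball is continuous in centre and radius off the bounding sphere, which
is a null set for positive radius. -/
lemma continuousAt_ballInt (hG : Integrable G) (z₀ : Euc m) {ρ₀ : ℝ} (hρ₀ : 0 < ρ₀) :
    ContinuousAt (fun p : Euc m × ℝ => ballInt G p.1 p.2) (z₀, ρ₀) := by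
  have e : (fun p : Euc m × ℝ => ballInt G p.1 p.2) =
      fun p => ∫ w, (Metric.closedBall p.1 p.2).indicator G w := by
    ext1 p
    exact (integral_indicator Metric.isClosed_closedBall.measurableSet).symm
  rw [e]
  refine continuousAt_of_dominated (bound := fun w => ‖G w‖)
    (Eventually.of_forall fun p => hG.1.indicator Metric.isClosed_closedBall.measurableSet)
    (Eventually.of_forall fun p => Eventually.of_forall fun w => norm_indicator_le_norm_self _ _)
    hG.norm ?_
  have hs : volume (Metric.sphere z₀ ρ₀) = 0 := Measure.addHaar_sphere_of_ne_zero _ _ hρ₀.ne'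
  filter_upwards [measure_eq_zero_iff_ae_notMem.1 hs] with w hw
  rw [Metric.mem_sphere] at hw
  have hc : Continuous fun p : Euc m × ℝ => dist w p.1 - p.2 := by fun_prop
  rcases lt_or_gt_of_ne hw with h | h
  · have : ∀ᶠ p : Euc m × ℝ in 𝓝 (z₀, ρ₀), (Metric.closedBall p.1 p.2).indicator G w = G w := by
      filter_upwards [hc.continuousAt.eventually (gt_mem_nhds (show dist w z₀ - ρ₀ < 0 by linarith))]
        with p hp
      refine indicator_of_mem ?_ _
      rw [Metric.mem_closedBall]
      linarith
    exact (continuousAt_const (y := G w)).congr (this.mono fun p hp => hp.symm)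
  · have : ∀ᶠ p : Euc m × ℝ in 𝓝 (z₀, ρ₀), (Metric.closedBall p.1 p.2).indicator G w = 0 := by
      filter_upwards [hc.continuousAt.eventually (lt_mem_nhds (show 0 < dist w z₀ - ρ₀ by linarith))]
        with p hp
      refine indicator_of_notMem ?_ _
      rw [Metric.mem_closedBall]
      linarith
    exact (continuousAt_const (y := (0 : Euc l))).congr (this.mono fun p hp => hp.symm)

/-- The mean of a dilation invariant map over an arbitrary ball, computed inside the unit ball. -/
noncomputable def homMean (G : Euc m → Euc l) (z : Euc m) (ρ : ℝ) : Euc l :=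
  ((‖z‖ + |ρ| + 1)⁻¹ ^ m * ρ ^ m * (volume : Measure (Euc m)).real (Metric.ball 0 1))⁻¹ •
    ballInt G ((‖z‖ + |ρ| + 1)⁻¹ • z) ((‖z‖ + |ρ| + 1)⁻¹ * ρ)

/-- `G` is dilation invariant in the unit ball, in terms of its ball integrals. -/
def DilInvariant (G : Euc m → Euc l) : Prop :=
  ∀ t ∈ Ioc (0 : ℝ) 1, ∀ z ρ, 0 < ρ → ‖z‖ + ρ < 1 → ballInt G (t • z) (t * ρ) = t ^ m • ballInt G z ρ

/-- `G` is invariant under small multiples of `v` in the unit ball, in terms of its ball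
integrals. -/
def TransInvariant (G : Euc m → Euc l) (v : Euc m) : Prop :=
  ∀ t ∈ Ioc (0 : ℝ) 1, ∀ z ρ, 0 < ρ → ‖z‖ + ρ < 1 → ‖z + t • v‖ + ρ < 1 →
    ballInt G (z + t • v) ρ = ballInt G z ρ

/-- Two contractions that bring the ball into the unit ball differ by a dilation, and dilation
invariance makes the normalised integrals equal. The particular factor in `homMean` is therefore
immaterial. -/
lemma homMean_eq (hD : DilInvariant G) {z : Euc m} {ρ t : ℝ} (hρ : 0 < ρ) (ht : 0 < t)
    (htz : t * (‖z‖ + ρ) < 1) :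
    homMean G z ρ = (t ^ m * ρ ^ m * (volume : Measure (Euc m)).real (Metric.ball 0 1))⁻¹ •
      ballInt G (t • z) (t * ρ) := by
  have key : ∀ s t : ℝ, 0 < s → s ≤ t → t * (‖z‖ + ρ) < 1 →
      (s ^ m * ρ ^ m * (volume : Measure (Euc m)).real (Metric.ball 0 1))⁻¹ •
        ballInt G (s • z) (s * ρ) =
      (t ^ m * ρ ^ m * (volume : Measure (Euc m)).real (Metric.ball 0 1))⁻¹ •
        ballInt G (t • z) (t * ρ) := by
    intro s t hs hst ht1
    have ht : 0 < t := hs.trans_le hst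
    have h := hD (s / t) ⟨by positivity, (div_le_one ht).2 hst⟩ (t • z) (t * ρ) (by positivity) (by
      rw [norm_smul, Real.norm_of_nonneg ht.le]
      linarith)
    rw [smul_smul, ← mul_assoc, div_mul_cancel₀ _ ht.ne'] at h
    rw [h, smul_smul, div_pow]
    congr 1
    have := pow_pos hs m
    have := pow_pos ht m
    simp only [mul_inv]
    field_simp
  set t₀ := (‖z‖ + |ρ| + 1)⁻¹ with ht₀
  have ht₀pos : 0 < t₀ := by positivity
  have ht₀1 : t₀ * (‖z‖ + ρ) < 1 := by
    rw [ht₀, inv_mul_lt_iff₀ (by positivity), abs_of_pos hρ]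
    linarith
  unfold homMean
  rw [← ht₀]
  rcases le_total t₀ t with h | h
  · exact key t₀ t ht₀pos h htz
  · exact (key t t₀ ht h ht₀1).symm

lemma homMean_scale (hD : DilInvariant G) {z : Euc m} {ρ a : ℝ} (hρ : 0 < ρ) (ha : 0 < a) :
    homMean G (a • z) (a * ρ) = homMean G z ρ := by
  set t := (a * (‖z‖ + ρ + 1))⁻¹ with ht
  have htp : 0 < t := by positivity
  have h1 : t * a * (‖z‖ + ρ) < 1 := by
    rw [ht, mul_inv]
    rw [show a⁻¹ * (‖z‖ + ρ + 1)⁻¹ * a = (‖z‖ + ρ + 1)⁻¹ by field_simp,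
      inv_mul_lt_iff₀ (by positivity)]
    linarith
  rw [homMean_eq hD (mul_pos ha hρ) htp (by
    rw [norm_smul, Real.norm_of_nonneg ha.le]; linarith),
    homMean_eq hD hρ (mul_pos htp ha) h1, smul_smul, mul_assoc t a ρ]
  congr 2
  ring

/-- The translations leaving the means invariant. -/
noncomputable def transSubmodule (hD : DilInvariant G) : Submodule ℝ (Euc m) where
  carrier := {v | ∀ z ρ, 0 < ρ → homMean G (z + v) ρ = homMean G z ρ}
  add_mem' := by
    intro v w hv hw z ρ hρ
    rw [← add_assoc, hw _ _ hρ, hv _ _ hρ]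
  zero_mem' := by simp
  smul_mem' := by
    -- Conjugating the translation by `v` with the dilation by `c > 0` gives the translation by `c
    -- v`; a negative multiple is the inverse of a positive one.
    have hpos : ∀ (c : ℝ) (v : Euc m), 0 < c →
        (∀ z ρ, 0 < ρ → homMean G (z + v) ρ = homMean G z ρ) →
        ∀ z ρ, 0 < ρ → homMean G (z + c • v) ρ = homMean G z ρ := by
      intro c v hc hv z ρ hρ
      have h1 : z + c • v = c • (c⁻¹ • z + v) := by
        rw [smul_add, smul_inv_smul₀ hc.ne']
      have h2 : ρ = c * (c⁻¹ * ρ) := by field_simp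
      have h3 : 0 < c⁻¹ * ρ := by positivity
      rw [h1, h2, homMean_scale hD h3 hc, hv _ _ h3, ← homMean_scale hD h3 hc,
        smul_inv_smul₀ hc.ne']
    intro c v hv z ρ hρ
    rcases lt_trichotomy c 0 with hc | rfl | hc
    · have h1 := hpos (-c) v (by linarith) hv (z + c • v) ρ hρ
      rw [← h1]
      congr 1
      module
    · simp
    · exact hpos c v hc hv z ρ hρ

/-- A common contraction takes the ball and its translate into the unit ball and replaces `v` by `t
v`, where the local invariance applies. -/
lemma mem_transSubmodule (hD : DilInvariant G) {v : Euc m} (hv : TransInvariant G v) :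
    v ∈ transSubmodule hD := by
  intro z ρ hρ
  set t := (‖z‖ + ‖v‖ + ρ + 1)⁻¹ with ht
  have htp : 0 < t := by positivity
  have ht1 : t ≤ 1 := by
    rw [ht]
    apply inv_le_one_of_one_le₀
    linarith [norm_nonneg z, norm_nonneg v]
  have hb : t * (‖z‖ + ‖v‖ + ρ) < 1 := by
    rw [ht, inv_mul_lt_iff₀ (by positivity)]
    linarith
  have h1 : t * (‖z‖ + ρ) < 1 := lt_of_le_of_lt (by
    gcongr; linarith [norm_nonneg v]) hb
  have h2 : t * (‖z + v‖ + ρ) < 1 := lt_of_le_of_lt (by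
    gcongr; linarith [norm_add_le z v]) hb
  rw [homMean_eq hD hρ htp h1, homMean_eq hD hρ htp h2, smul_add]
  congr 1
  refine hv t ⟨htp, ht1⟩ (t • z) (t * ρ) (by positivity) ?_ ?_
  · rw [norm_smul, Real.norm_of_nonneg htp.le]; linarith
  · rw [← smul_add, norm_smul, Real.norm_of_nonneg htp.le]; linarith

lemma continuousAt_homMean (hG : Integrable G) (z : Euc m) {ρ : ℝ} (hρ : 0 < ρ) :
    ContinuousAt (fun q : Euc m × ℝ => homMean G q.1 q.2) (z, ρ) := by
  have hpos : ∀ q : Euc m × ℝ, 0 < ‖q.1‖ + |q.2| + 1 := fun q => by positivity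
  have hinv : Continuous fun q : Euc m × ℝ => (‖q.1‖ + |q.2| + 1)⁻¹ :=
    Continuous.inv₀ (by fun_prop) fun q => (hpos q).ne'
  have h2 : Continuous fun q : Euc m × ℝ => ((‖q.1‖ + |q.2| + 1)⁻¹ • q.1,
    (‖q.1‖ + |q.2| + 1)⁻¹ * q.2) := (hinv.smul continuous_fst).prodMk (hinv.mul continuous_snd)
  have h3 := continuousAt_ballInt hG ((‖z‖ + |ρ| + 1)⁻¹ • z)
    (mul_pos (inv_pos.2 (hpos (z, ρ))) hρ)
  have h1 := Filter.Tendsto.comp h3 (h2.tendsto (z, ρ))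
  have hVp : 0 < (volume : Measure (Euc m)).real (Metric.ball 0 1) :=
    ENNReal.toReal_pos (Metric.measure_ball_pos _ _ one_pos).ne' measure_ball_lt_top.ne
  have hk : Continuous fun q : Euc m × ℝ => (‖q.1‖ + |q.2| + 1)⁻¹ ^ m * q.2 ^ m *
      (volume : Measure (Euc m)).real (Metric.ball 0 1) :=
    ((hinv.pow m).mul (continuous_snd.pow m)).mul continuous_const
  have hne : (‖z‖ + |ρ| + 1)⁻¹ ^ m * ρ ^ m * (volume : Measure (Euc m)).real (Metric.ball 0 1) ≠ 0 :=
    (mul_pos (mul_pos (pow_pos (inv_pos.2 (hpos (z, ρ))) m) (pow_pos hρ m)) hVp).ne'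
  exact ((hk.tendsto (z, ρ)).inv₀ hne).smul h1

/-- A map whose ball integrals are invariant under dilations and under translations along `v`
agrees almost everywhere in the unit ball with a homogeneous map. -/
lemma exists_isHomogeneousAt {N : Set (Euc l)} (hNc : IsClosed N) (hNe : N.Nonempty)
    (hG : Integrable G) (hGN : ∀ᵐ z ∂(volume.restrict (Metric.ball (0 : Euc m) 1)), G z ∈ N)
    (hD : DilInvariant G) {K : ℕ} {v : Fin K → Euc m} (hv : LinearIndependent ℝ v)
    (hT : ∀ j, TransInvariant G (v j)) :
    ∃ h, IsHomogeneousAt N K 0 h ∧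
      ∀ᵐ z ∂(volume.restrict (Metric.ball (0 : Euc m) 1)), h z = G z := by
  obtain ⟨p, hp⟩ := hNe
  have hscale : ∀ {ρ : ℝ}, 0 < ρ → ∀ z : Euc m, ContinuousAt (fun q : Euc m × ℝ => homMean G q.1 q.2)
      (z, ρ) := fun hρ z => continuousAt_homMean hG z hρ
  -- Homogeneity is required at every point, which an arbitrary representative of `G` need not
  -- satisfy; the limit of the invariant means does.
  set h := limRep N p (homMean G) with hh
  have hcont : ∀ z, ContinuousOn (homMean G z) (Ioi 0) := fun z ρ hρ =>
    ((hscale hρ z).comp (f := fun ρ : ℝ => (z, ρ))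
      (continuous_const.prodMk continuous_id).continuousAt).continuousWithinAt
  have hmeas : ∀ ρ, Measurable fun z => homMean G z ρ := by
    intro ρ
    rcases lt_trichotomy ρ 0 with hρ | rfl | hρ
    · have : (fun z : Euc m => homMean G z ρ) = fun _ => 0 := by
        ext1 z
        have h1 : (‖z‖ + |ρ| + 1)⁻¹ * ρ < 0 := mul_neg_of_pos_of_neg (by positivity) hρ
        unfold homMean ballInt
        rw [Metric.closedBall_eq_empty.2 h1, setIntegral_empty, smul_zero]
      rw [this]; exact measurable_const
    -- At radius `0` the factor `ρ ^ m` vanishes only when `m > 0`; for `m = 0` the domain is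
    -- countable.
    · rcases Nat.eq_zero_or_pos m with rfl | hm
      · exact measurable_of_countable _ 
      · have : (fun z : Euc m => homMean G z 0) = fun _ => 0 := by
          ext1 z
          unfold homMean
          rw [zero_pow hm.ne']
          simp
        rw [this]; exact measurable_const
    · have : Continuous fun z : Euc m => homMean G z ρ := continuous_iff_continuousAt.2 fun z =>
        (hscale hρ z).comp (f := fun z : Euc m => (z, ρ))
          (continuous_id.prodMk continuous_const).continuousAt
      exact this.measurable
  refine ⟨h, ⟨measurable_limRep hNc.measurableSet p hcont hmeas, limRep_mem hp _, ?_,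
    Submodule.span ℝ (range v), ?_, ?_⟩, ?_⟩
  · intro a ha z
    rw [zero_add, zero_add]
    exact limRep_congr ha fun ρ hρ => homMean_scale hD hρ ha
  · rw [finrank_span_eq_card hv, Fintype.card_fin]
  · intro z w hw
    have hw' : w ∈ transSubmodule hD := by
      have : Submodule.span ℝ (range v) ≤ transSubmodule hD :=
        Submodule.span_le.2 (by rintro _ ⟨j, rfl⟩; exact mem_transSubmodule hD (hT j))
      exact this hw
    exact limRep_congr one_pos fun ρ hρ => by rw [one_mul]; exact hw' z ρ hρ
  -- For small balls inside the unit ball `homMean` is the ordinary mean, so at Lebesgue points the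
  -- limit is `G z`.
  · have hleb := IsUnifLocDoublingMeasure.ae_tendsto_average (μ := (volume : Measure (Euc m)))
      hG.locallyIntegrable 1
    filter_upwards [ae_restrict_of_ae hleb, hGN, ae_restrict_mem Metric.isOpen_ball.measurableSet]
      with z hL hzN hz
    refine limRep_eq hzN ?_
    have hL' : Tendsto (fun r => ⨍ w in Metric.closedBall z r, G w) (𝓝[>] 0) (𝓝 (G z)) := by
      refine hL (fun _ => z) (fun t => t) tendsto_id ?_
      filter_upwards [self_mem_nhdsWithin] with t ht
      rw [one_mul]
      exact Metric.mem_closedBall_self (le_of_lt ht)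
    refine hL'.congr' ?_
    rw [mem_ball_zero_iff] at hz
    filter_upwards [Ioo_mem_nhdsGT (show (0 : ℝ) < 1 - ‖z‖ by linarith)] with ρ hρ
    rw [homMean_eq hD hρ.1 one_pos (by linarith [hρ.2]), one_smul, one_mul, one_pow, one_mul,
      setAverage_eq, Measure.addHaar_real_closedBall _ _ hρ.1.le, finrank_euclideanSpace_fin]
    rfl

end Representation

/-! ### Cone splitting in the limit -/

section Limits

variable {m l : ℕ}

lemma tendsto_eLpNorm_of_integral {α F : Type*} [MeasurableSpace α] {μ : Measure α}
    [NormedAddCommGroup F] {p : ℕ → α → F} (hp : ∀ i, MemLp (p i) 2 μ)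
    (h : Tendsto (fun i => ∫ z, ‖p i z‖ ^ 2 ∂μ) atTop (𝓝 0)) :
    Tendsto (fun i => eLpNorm (p i) 2 μ) atTop (𝓝 0) := by
  have h1 : ∀ i, eLpNorm (p i) 2 μ = ENNReal.ofReal (∫ z, ‖p i z‖ ^ 2 ∂μ) ^ (1 / 2 : ℝ) := by
    intro i
    rw [ofReal_integral_norm_sq (hp i), ← eLpNorm_two_sq, ← ENNReal.rpow_natCast,
      ← ENNReal.rpow_mul]
    norm_num
  simp_rw [h1]
  have h2 := (ENNReal.continuous_ofReal.tendsto 0).comp h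
  have h3 := (ENNReal.continuous_rpow_const (y := (1 / 2 : ℝ))).tendsto (ENNReal.ofReal 0) |>.comp h2
  simpa [Function.comp_def] using h3

lemma TendstoLtwo.integral_norm_sub_sq {α F : Type*} [MeasurableSpace α] {μ : Measure α}
    [NormedAddCommGroup F] [InnerProductSpace ℝ F] {p : ℕ → α → F} {q : α → F}
    (h : TendstoLtwo μ p q) : Tendsto (fun i => ∫ z, ‖p i z - q z‖ ^ 2 ∂μ) atTop (𝓝 0) := by
  have h0 : TendstoLtwo μ (fun i z => p i z - q z) (fun _ => 0) :=
    ⟨fun i => (h.memLp_seq i).sub h.memLp, MemLp.zero, by simpa using h.tendsto⟩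
  have := h0.integral_inner h0
  simpa only [real_inner_self_eq_norm_sq, norm_zero, ne_eq, OfNat.ofNat_ne_zero, not_false_eq_true,
    zero_pow, integral_zero] using this

lemma TendstoLtwo.subseq {α F : Type*} [MeasurableSpace α] {μ : Measure α}
    [NormedAddCommGroup F] {p : ℕ → α → F} {q : α → F} (h : TendstoLtwo μ p q) {φ : ℕ → ℕ}
    (hφ : StrictMono φ) : TendstoLtwo μ (fun i => p (φ i)) q :=
  ⟨fun i => h.memLp_seq _, h.memLp, h.tendsto.comp hφ.tendsto_atTop⟩

/-- A further subsequence converges almost everywhere, and `N` is closed. -/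
lemma TendstoLtwo.ae_mem {α F : Type*} [MeasurableSpace α] {μ : Measure α}
    [NormedAddCommGroup F] {p : ℕ → α → F} {q : α → F} (h : TendstoLtwo μ p q) {N : Set F}
    (hN : IsClosed N) (hp : ∀ i, ∀ᵐ z ∂μ, p i z ∈ N) : ∀ᵐ z ∂μ, q z ∈ N := by
  have h1 : TendstoInMeasure μ p atTop q :=
    tendstoInMeasure_of_tendsto_eLpNorm two_ne_zero (fun i => (h.memLp_seq i).1) h.memLp.1 h.tendsto
  obtain ⟨ns, -, hns⟩ := h1.exists_seq_tendsto_ae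
  filter_upwards [hns, ae_all_iff.2 hp] with z hz hpz
  exact hN.mem_of_tendsto hz (Eventually.of_forall fun i => hpz _)

lemma norm_ballInt_sub_le {g G : Euc m → Euc l}
    (hg : Integrable g (volume.restrict (Metric.ball 0 1)))
    (hG : Integrable G (volume.restrict (Metric.ball 0 1))) {z : Euc m} {ρ : ℝ}
    (hz : ‖z‖ + ρ < 1) :
    ‖ballInt g z ρ - ballInt ((Metric.ball 0 1).indicator G) z ρ‖ ≤
      ∫ w in Metric.ball 0 1, ‖g w - G w‖ := by
  have hsub : Metric.closedBall z ρ ⊆ Metric.ball 0 1 := by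
    refine Metric.closedBall_subset_ball' ?_
    rw [dist_zero_right]
    linarith
  have hle : volume.restrict (Metric.closedBall z ρ) ≤ volume.restrict (Metric.ball 0 1) :=
    Measure.restrict_mono hsub le_rfl
  have e : ballInt ((Metric.ball 0 1).indicator G) z ρ = ∫ w in Metric.closedBall z ρ, G w :=
    setIntegral_congr_fun Metric.isClosed_closedBall.measurableSet fun w hw =>
      indicator_of_mem (hsub hw) _
  rw [e]
  unfold ballInt
  rw [← integral_sub (hg.mono_measure hle) (hG.mono_measure hle)]
  exact (norm_integral_le_integral_norm _).trans (integral_mono_measure hle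
    (Eventually.of_forall fun w => norm_nonneg _) (hg.sub hG).norm)

/-- `L²(B₁)` convergence implies convergence of ball integrals. -/
lemma tendsto_ballInt {g : ℕ → Euc m → Euc l} {G : Euc m → Euc l}
    (h : TendstoLtwo (volume.restrict (Metric.ball 0 1)) g G) {z : ℕ → Euc m} {z₀ : Euc m} {ρ : ℝ}
    (hz : Tendsto z atTop (𝓝 z₀)) (hρ : 0 < ρ) (hzρ : ∀ i, ‖z i‖ + ρ < 1) :
    Tendsto (fun i => ballInt (g i) (z i) ρ) atTop
      (𝓝 (ballInt ((Metric.ball 0 1).indicator G) z₀ ρ)) := by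
  have hGi : Integrable ((Metric.ball 0 1).indicator G) :=
    (integrable_indicator_iff Metric.isOpen_ball.measurableSet).2 (h.memLp.integrable one_le_two)
  have h4 : Tendsto (fun i => (z i, ρ)) atTop (𝓝 (z₀, ρ)) := hz.prodMk_nhds tendsto_const_nhds
  have h1 : Tendsto (fun i => ballInt ((Metric.ball 0 1).indicator G) (z i) ρ) atTop
      (𝓝 (ballInt ((Metric.ball 0 1).indicator G) z₀ ρ)) := by
    have hc := (continuousAt_ballInt hGi z₀ hρ).tendsto
    generalize (Metric.ball (0 : Euc m) 1).indicator G = G' at hc ⊢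
    have h6 := Filter.Tendsto.comp hc h4
    simp only [Function.comp_def] at h6
    exact h6
  have h0 : TendstoLtwo (volume.restrict (Metric.ball (0 : Euc m) 1))
      (fun i w => ‖g i w - G w‖) (fun _ => (0 : ℝ)) := by
    refine ⟨fun i => ((h.memLp_seq i).sub h.memLp).norm, MemLp.zero, ?_⟩
    simp only [sub_zero]
    exact h.tendsto.congr fun i => (eLpNorm_norm (fun w => g i w - G w)).symm
  have h2 : Tendsto (fun i => ∫ w in Metric.ball 0 1, ‖g i w - G w‖) atTop (𝓝 0) := by
    have := h0.integral
    rwa [integral_zero] at this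
  have h3 : Tendsto (fun i => ballInt (g i) (z i) ρ - ballInt ((Metric.ball 0 1).indicator G) (z i) ρ)
      atTop (𝓝 0) :=
    squeeze_zero_norm (fun i => norm_ballInt_sub_le ((h.memLp_seq i).integrable one_le_two)
      (h.memLp.integrable one_le_two) (hzρ i)) h2
  have h5 := h3.add h1
  simp only [sub_add_cancel, zero_add] at h5
  exact h5

lemma ballInt_dilate (g : Euc m → Euc l) (b z : Euc m) (ρ : ℝ) {a : ℝ} (ha : 0 < a) :
    ballInt g (b + a • (z - b)) (a * ρ) =
      a ^ m • ∫ w in Metric.closedBall z ρ, g (b + a • (w - b)) := by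
  have h1 := Measure.setIntegral_comp_smul (volume : Measure (Euc m))
    (fun w => g ((b - a • b) + w)) (Metric.closedBall z ρ) ha.ne'
  have h2 := (measurePreserving_add_left (volume : Measure (Euc m)) (b - a • b)).setIntegral_preimage_emb
    (measurableEmbedding_addLeft _) g (Metric.closedBall (b + a • (z - b)) (a * ρ))
  have e : (fun w => (b - a • b) + w) ⁻¹' Metric.closedBall (b + a • (z - b)) (a * ρ) =
      a • Metric.closedBall z ρ := by
    rw [smul_closedBall' ha.ne', Real.norm_of_nonneg ha.le]
    ext w
    simp only [mem_preimage, Metric.mem_closedBall, dist_eq_norm]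
    congr! 2
    module
  have e3 : ∀ w, (b - a • b) + a • w = b + a • (w - b) := fun w => by module
  simp only [e3] at h1
  unfold ballInt
  rw [h1, ← h2, e, smul_smul, finrank_euclideanSpace_fin, abs_of_pos (by positivity),
    mul_inv_cancel₀ (by positivity), one_smul]

/-- A contraction towards a point of the unit ball maps the ball into itself and distorts volume by
at most `2^m`. -/
lemma memLp_dilate {g : Euc m → Euc l} (hg : MemLp g 2 (volume.restrict (Metric.ball 0 1)))
    {b : Euc m} (hb : ‖b‖ < 1) {c : ℝ} (hc : c ∈ Icc (-(1 / 2) : ℝ) 0) :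
    MemLp (fun w => g (w + c • (w - b))) 2 (volume.restrict (Metric.ball 0 1)) ∧
    eLpNorm (fun w => g (w + c • (w - b))) 2 (volume.restrict (Metric.ball 0 1)) ≤
      (2 ^ m : ℝ≥0∞) ^ (1 / (2 : ℝ≥0∞)).toReal *
        eLpNorm g 2 (volume.restrict (Metric.ball 0 1)) := by
  have hfield : ∀ w, w + affField (-(c • b)) c w = w + c • (w - b) := fun w => by
    unfold affField; module
  have hmap := map_affine_le (h := -(c • b)) (c := c) (B := Metric.ball 0 1) (B' := Metric.ball 0 1)
    (abs_le.2 ⟨hc.1, hc.2.trans (by norm_num)⟩) Metric.isOpen_ball.measurableSet fun z hz => by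
      rw [mem_ball_zero_iff] at hz
      rw [hfield, mem_ball_zero_iff]
      have e : z + c • (z - b) = (1 + c) • z + (-c) • b := by module
      rw [e]
      refine (norm_add_le _ _).trans_lt ?_
      rw [norm_smul, norm_smul, Real.norm_of_nonneg (by linarith [hc.1]),
        Real.norm_of_nonneg (by linarith [hc.2])]
      nlinarith [hc.1, hc.2, norm_nonneg b]
  have hm : Measurable fun z : Euc m => z + affField (-(c • b)) c z := by
    unfold affField; fun_prop
  have r1 := memLp_comp_of_map_le hm hmap (by simp) (by simp) hg
  have r2 := eLpNorm_comp_le_of_map_le hm hmap (by simp) hg.1 2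
  simp only [hfield] at r1 r2
  exact ⟨r1, r2⟩

/-- Almost invariance under a dilation about `b` passes to the limit. -/
lemma ballInt_dilate_of_tendsto {g : ℕ → Euc m → Euc l} {G : Euc m → Euc l}
    (h : TendstoLtwo (volume.restrict (Metric.ball 0 1)) g G) {b : ℕ → Euc m} {b₀ : Euc m}
    (hb : Tendsto b atTop (𝓝 b₀)) (hb1 : ∀ i, ‖b i‖ < 1) {a : ℝ} (ha : a ∈ Icc (1 / 2 : ℝ) 1)
    (hD : Tendsto (fun i => eLpNorm (fun w => g i (w + (a - 1) • (w - b i)) - g i w) 2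
      (volume.restrict (Metric.ball 0 1))) atTop (𝓝 0)) {z : Euc m} {ρ : ℝ} (hρ : 0 < ρ)
    (hz : ‖z‖ + ρ < 1) :
    ballInt ((Metric.ball 0 1).indicator G) (b₀ + a • (z - b₀)) (a * ρ) =
      a ^ m • ballInt ((Metric.ball 0 1).indicator G) z ρ := by
  set B := Metric.ball (0 : Euc m) 1 with hB
  have ha0 : 0 < a := by linarith [ha.1]
  have hc : a - 1 ∈ Icc (-(1 / 2) : ℝ) 0 := ⟨by linarith [ha.1], by linarith [ha.2]⟩
  have hsub : Metric.closedBall z ρ ⊆ B := by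
    refine Metric.closedBall_subset_ball' ?_
    rw [dist_zero_right]
    linarith
  have hle : volume.restrict (Metric.closedBall z ρ) ≤ volume.restrict B :=
    Measure.restrict_mono hsub le_rfl
  haveI : IsFiniteMeasure (volume.restrict (Metric.closedBall z ρ)) :=
    ⟨by rw [Measure.restrict_apply_univ]; exact measure_closedBall_lt_top⟩
  have e : ∀ i w, w + (a - 1) • (w - b i) = b i + a • (w - b i) := fun i w => by module
  have t1 := tendsto_ballInt h (z := fun i => b i + a • (z - b i)) (z₀ := b₀ + a • (z - b₀))
    (ρ := a * ρ) (hb.add ((tendsto_const_nhds.sub hb).const_smul a)) (by positivity) fun i => by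
      have e2 : b i + a • (z - b i) = (1 - a) • b i + a • z := by module
      rw [e2]
      have h1 := norm_add_le ((1 - a) • b i) (a • z)
      rw [norm_smul, norm_smul, Real.norm_of_nonneg (by linarith [ha.2]),
        Real.norm_of_nonneg ha0.le] at h1
      have h2 : (1 - a) * ‖b i‖ ≤ (1 - a) * 1 :=
        mul_le_mul_of_nonneg_left (hb1 i).le (by linarith [ha.2])
      nlinarith
  have t2 := tendsto_ballInt h (z := fun _ => z) tendsto_const_nhds hρ fun _ => hz
  have t0 : TendstoLtwo (volume.restrict B)
      (fun i w => g i (w + (a - 1) • (w - b i)) - g i w) (fun _ => 0) :=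
    ⟨fun i => (memLp_dilate (h.memLp_seq i) (hb1 i) hc).1.sub (h.memLp_seq i), MemLp.zero, by
      simpa using hD⟩
  have t3 : Tendsto (fun i => ∫ w in Metric.closedBall z ρ,
      (g i (w + (a - 1) • (w - b i)) - g i w)) atTop (𝓝 0) := by
    simpa using (t0.mono_measure hle).integral
  have key : ∀ i, ballInt (g i) (b i + a • (z - b i)) (a * ρ) = a ^ m •
      ((∫ w in Metric.closedBall z ρ, (g i (w + (a - 1) • (w - b i)) - g i w))
        + ballInt (g i) z ρ) := by
    intro i
    rw [ballInt_dilate _ _ _ _ ha0]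
    congr 1
    have i1 := (((memLp_dilate (h.memLp_seq i) (hb1 i) hc).1).integrable one_le_two).mono_measure hle
    have i2 := ((h.memLp_seq i).integrable one_le_two).mono_measure hle
    rw [integral_sub i1 i2]
    simp only [e]
    unfold ballInt
    abel
  have t4 := (t3.add t2).const_smul (a ^ m)
  rw [zero_add] at t4
  exact tendsto_nhds_unique (t1.congr key) t4

/-- In a nontrivial relation the vector of largest index with nonzero coefficient lies in the span
of its predecessors, at distance zero. This quantitative form of independence is used because it
passes to limits. -/
lemma linearIndependent_of_le_norm {K : ℕ} {v : Fin K → Euc m} {γ : ℝ} (hγ : 0 < γ)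
    (h : ∀ j (c : Fin K → ℝ), γ ≤ ‖v j - ∑ a ∈ Finset.Iio j, c a • v a‖) :
    LinearIndependent ℝ v := by
  rw [Fintype.linearIndependent_iff]
  intro c hc
  by_contra! hne
  have hS : (Finset.univ.filter fun i => c i ≠ 0).Nonempty :=
    hne.imp fun i hi => Finset.mem_filter.2 ⟨Finset.mem_univ _, hi⟩
  set j := (Finset.univ.filter fun i => c i ≠ 0).max' hS with hj
  have hcj : c j ≠ 0 := (Finset.mem_filter.1 (Finset.max'_mem _ hS)).2
  have hlt : ∀ i, j < i → c i = 0 := by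
    intro i hi
    by_contra hci
    exact absurd (Finset.le_max' _ i (Finset.mem_filter.2 ⟨Finset.mem_univ _, hci⟩)) (not_le.2 hi)
  have hsum : ∑ i, c i • v i = c j • v j + ∑ a ∈ Finset.Iio j, c a • v a := by
    have h1 : ∑ i, c i • v i = ∑ i ∈ Finset.Iic j, c i • v i := by
      refine (Finset.sum_subset (Finset.subset_univ _) fun i _ hi => ?_).symm
      rw [Finset.mem_Iic, not_le] at hi
      rw [hlt i hi, zero_smul]
    rw [h1, ← Finset.Iio_insert, Finset.sum_insert (by simp)]
  rw [hsum] at hc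
  have := h j fun a => -(c a / c j)
  have e : v j - ∑ a ∈ Finset.Iio j, (-(c a / c j)) • v a =
      (c j)⁻¹ • (c j • v j + ∑ a ∈ Finset.Iio j, c a • v a) := by
    rw [smul_add, inv_smul_smul₀ hcj, Finset.smul_sum]
    simp only [neg_smul, Finset.sum_neg_distrib, sub_neg_eq_add, smul_smul, div_eq_inv_mul]
  rw [e, hc, smul_zero, norm_zero] at this
  linarith

/-- Every factor in `(0, 1]` is a power of `1/2` times a factor in `[1/2, 1]`; iterate. -/
lemma dilInvariant_of_half {G : Euc m → Euc l}
    (h : ∀ t ∈ Icc (1 / 2 : ℝ) 1, ∀ z ρ, 0 < ρ → ‖z‖ + ρ < 1 →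
      ballInt G (t • z) (t * ρ) = t ^ m • ballInt G z ρ) : DilInvariant G := by
  have key : ∀ n : ℕ, ∀ t ∈ Icc ((1 / 2 : ℝ) ^ (n + 1)) 1, ∀ z ρ, 0 < ρ → ‖z‖ + ρ < 1 →
      ballInt G (t • z) (t * ρ) = t ^ m • ballInt G z ρ := by
    intro n
    induction n with
    | zero => simpa using h
    | succ n ih =>
      intro t ht z ρ hρ hz
      rcases le_total (1 / 2) t with h1 | h1
      · exact h t ⟨h1, ht.2⟩ z ρ hρ hz
      · have ht0 : 0 < t := lt_of_lt_of_le (by positivity) ht.1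
        have h2 := ih (2 * t) ⟨by have := ht.1; rw [pow_succ] at this; linarith, by linarith⟩ z ρ hρ hz
        have h3 := h (1 / 2) ⟨le_rfl, by norm_num⟩ ((2 * t) • z) (2 * t * ρ) (by positivity) (by
          rw [norm_smul, Real.norm_of_nonneg (by positivity)]
          nlinarith [norm_nonneg z])
        rw [smul_smul, show 1 / 2 * (2 * t) = t by ring, show 1 / 2 * (2 * t * ρ) = t * ρ by ring,
          h2, smul_smul, ← mul_pow, show 1 / 2 * (2 * t) = t by ring] at h3
        exact h3
  intro t ht z ρ hρ hz
  obtain ⟨n, hn⟩ := exists_pow_lt_of_lt_one ht.1 (by norm_num : (1 / 2 : ℝ) < 1)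
  refine key n t ⟨le_trans ?_ hn.le, ht.2⟩ z ρ hρ hz
  rw [pow_succ]
  exact mul_le_of_le_one_right (by positivity) (by norm_num)

/-- Maps with asymptotic dilation invariance about `0` and about `K` uniformly independent points
subconverge to a `K`-homogeneous map. -/
lemma exists_homogeneous_limit {N : Set (Euc l)} (hN : IsCompact N) (hNe : N.Nonempty)
    {g : ℕ → Euc m → Euc l}
    (hg : ∀ i, AEStronglyMeasurable (g i) (volume.restrict (Metric.ball 0 2)))
    (hgN : ∀ i, ∀ᵐ z ∂(volume.restrict (Metric.ball (0 : Euc m) 2)), g i z ∈ N) {C : ℝ}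
    (hC : ∀ i (h : Euc m), ‖h‖ ≤ 1 →
      ∫ z in Metric.ball (0 : Euc m) 1, ‖g i (z + h) - g i z‖ ^ 2 ≤ C * ‖h‖ ^ 2)
    {K : ℕ} {b : ℕ → Fin K → Euc m} (hb1 : ∀ i j, ‖b i j‖ < 1) {γ : ℝ} (hγ : 0 < γ)
    (hind : ∀ i j (c : Fin K → ℝ), γ ≤ ‖b i j - ∑ a ∈ Finset.Iio j, c a • b i a‖)
    (h0 : ∀ c ∈ Icc (-(1 / 2) : ℝ) 0, Tendsto (fun i => eLpNorm (fun w =>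
      g i (w + c • (w - 0)) - g i w) 2 (volume.restrict (Metric.ball 0 1))) atTop (𝓝 0))
    (hD : ∀ j, ∀ c ∈ Icc (-(1 / 2) : ℝ) 0, Tendsto (fun i => eLpNorm (fun w =>
      g i (w + c • (w - b i j)) - g i w) 2 (volume.restrict (Metric.ball 0 1))) atTop (𝓝 0)) :
    ∃ h, IsHomogeneousAt N K 0 h ∧ ∃ φ : ℕ → ℕ, StrictMono φ ∧
      Tendsto (fun i => meanSqDist (g (φ i)) h) atTop (𝓝 0) := by
  obtain ⟨M, hM⟩ := hN.isBounded.exists_norm_le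
  have hM0 : 0 ≤ M := by
    obtain ⟨p, hp⟩ := hNe
    exact (norm_nonneg p).trans (hM p hp)
  obtain ⟨φ₁, hφ₁, G, hG₁⟩ := exists_subseq_tendstoLtwo hg hM0
    (fun i => (hgN i).mono fun z hz => hM _ hz) hC
  obtain ⟨v, -, φ₂, hφ₂, hv⟩ := (isCompact_closedBall (0 : Fin K → Euc m) 1).tendsto_subseq
    (x := fun i => b (φ₁ i)) fun i => by
      rw [mem_closedBall_zero_iff, pi_norm_le_iff_of_nonneg zero_le_one]
      exact fun j => (hb1 _ j).le
  set φ := φ₁ ∘ φ₂ with hφ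
  have hφm : StrictMono φ := hφ₁.comp hφ₂
  have hG : TendstoLtwo (volume.restrict (Metric.ball 0 1)) (fun i => g (φ i)) G := hG₁.subseq hφ₂
  have hvj : ∀ j, Tendsto (fun i => b (φ i) j) atTop (𝓝 (v j)) := fun j =>
    (tendsto_pi_nhds.1 hv) j
  set B := Metric.ball (0 : Euc m) 1 with hB
  have hBm : MeasurableSet B := Metric.isOpen_ball.measurableSet
  set G' := B.indicator G with hG'
  have hGi : Integrable G' := (integrable_indicator_iff hBm).2 (hG.memLp.integrable one_le_two)
  have hsub : volume.restrict B ≤ volume.restrict (Metric.ball (0 : Euc m) 2) :=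
    Measure.restrict_mono (Metric.ball_subset_ball one_le_two) le_rfl
  have hGG' : ∀ᵐ z ∂(volume.restrict B), G' z = G z := by
    filter_upwards [ae_restrict_mem hBm] with z hz using indicator_of_mem hz _
  have hGN : ∀ᵐ z ∂(volume.restrict B), G' z ∈ N := by
    filter_upwards [hGG', hG.ae_mem hN.isClosed fun i => ae_mono hsub (hgN (φ i))] with z h1 h2
    rwa [h1]
  have hlin : LinearIndependent ℝ v := by
    refine linearIndependent_of_le_norm hγ fun j c => ?_
    have : Tendsto (fun i => ‖b (φ i) j - ∑ a ∈ Finset.Iio j, c a • b (φ i) a‖) atTop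
        (𝓝 ‖v j - ∑ a ∈ Finset.Iio j, c a • v a‖) :=
      ((hvj j).sub (tendsto_finsetSum _ fun a _ => (hvj a).const_smul (c a))).norm
    exact ge_of_tendsto this (Eventually.of_forall fun i => hind _ j c)
  have hdil : DilInvariant G' := by
    refine dilInvariant_of_half fun t ht z ρ hρ hz => ?_
    have := ballInt_dilate_of_tendsto hG (b := fun _ => 0) (b₀ := 0) tendsto_const_nhds (by simp) ht
      ((h0 (t - 1) ⟨by linarith [ht.1], by linarith [ht.2]⟩).comp hφm.tendsto_atTop) hρ hz
    simpa using this
  -- Cone splitting: with `a = 1/(1 + t)` one has `a (z + t v) = v + a (z - v)`. The same contracted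
  -- ball arises from the ball at `z + t v` by dilation about `0` and from the ball at `z` by
  -- dilation about `v`, so the integrals over the two balls agree.
  have htrans : ∀ j, TransInvariant G' (v j) := by
    intro j t ht z ρ hρ hz hzt
    set a := (1 + t)⁻¹ with ha
    have h1t : 0 < 1 + t := by linarith [ht.1]
    have ha0 : 0 < a := inv_pos.2 h1t
    have ha1 : a ∈ Icc (1 / 2 : ℝ) 1 := by
      constructor
      · rw [ha, one_div]
        apply inv_anti₀ h1t
        linarith [ht.2]
      · exact inv_le_one_of_one_le₀ (by linarith [ht.1])
    have h1 := ballInt_dilate_of_tendsto hG (hvj j) (fun i => hb1 _ j) ha1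
      ((hD j (a - 1) ⟨by linarith [ha1.1], by linarith [ha1.2]⟩).comp hφm.tendsto_atTop) hρ hz
    have h2 := hdil a ⟨ha0, ha1.2⟩ (z + t • v j) ρ hρ hzt
    have e : a • (z + t • v j) = v j + a • (z - v j) := by
      have hat : a * t = 1 - a := by
        rw [ha]; field_simp; ring
      rw [smul_add, smul_smul, hat]
      module
    rw [e, h1] at h2
    exact (smul_right_injective _ (pow_pos ha0 m).ne' h2).symm
  obtain ⟨h, hh, hhG⟩ := exists_isHomogeneousAt hN.isClosed hNe hGi hGN hdil hlin htrans
  refine ⟨h, hh, φ, hφm, ?_⟩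
  have hlim := hG.integral_norm_sub_sq
  have e : ∀ i, meanSqDist (g (φ i)) h = (volume.real B)⁻¹ * ∫ z in B, ‖g (φ i) z - G z‖ ^ 2 := by
    intro i
    unfold meanSqDist
    rw [setAverage_eq, smul_eq_mul]
    congr 1
    apply integral_congr_ae
    filter_upwards [hhG, hGG'] with z h1 h2
    rw [h1, h2]
  simp_rw [e]
  simpa using hlim.const_mul (volume.real B)⁻¹

end Limits

/-! ### Pinching and the union formula for the strata -/

section BlowUp

variable {m l : ℕ} {x : Euc m} {f : Euc m → Euc l} {N : Set (Euc l)}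

lemma quasiMeasurePreserving_blowUp {y : Euc m} (hy : y ∈ Metric.ball x 2) {s ρ : ℝ} (hs : 0 < s)
    (hρ : s * ρ ≤ 2) : Measure.QuasiMeasurePreserving (fun z : Euc m => y + s • z)
      (volume.restrict (Metric.ball 0 ρ)) (volume.restrict (Metric.ball x 4)) := by
  have h1 : Measure.QuasiMeasurePreserving (fun z : Euc m => s • z) volume volume :=
    ⟨measurable_const_smul s, by
      rw [Measure.map_addHaar_smul _ hs.ne']
      exact Measure.smul_absolutelyContinuous⟩
  refine ((measurePreserving_add_left volume y).quasiMeasurePreserving.comp h1).restrict ?_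
  intro z hz
  rw [mem_ball_zero_iff] at hz
  rw [Metric.mem_ball, dist_eq_norm] at hy ⊢
  simp only [Function.comp_apply]
  calc ‖y + s • z - x‖ = ‖(y - x) + s • z‖ := by congr 1; abel
    _ ≤ ‖y - x‖ + s * ‖z‖ := by
      refine (norm_add_le _ _).trans_eq ?_
      rw [norm_smul, Real.norm_of_nonneg hs.le]
    _ < 4 := by nlinarith

lemma aestronglyMeasurable_blowUp (hf : MemW22 (Metric.ball x 4) f) {y : Euc m}
    (hy : y ∈ Metric.ball x 2) {s ρ : ℝ} (hs : 0 < s) (hρ : s * ρ ≤ 2) :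
    AEStronglyMeasurable (blowUp f y s) (volume.restrict (Metric.ball 0 ρ)) :=
  hf.memLp.1.comp_quasiMeasurePreserving (quasiMeasurePreserving_blowUp hy hs hρ)

lemma ae_blowUp_mem (hf : MemW22Into (Metric.ball x 4) N f) {y : Euc m}
    (hy : y ∈ Metric.ball x 2) {s ρ : ℝ} (hs : 0 < s) (hρ : s * ρ ≤ 2) :
    ∀ᵐ z ∂(volume.restrict (Metric.ball (0 : Euc m) ρ)), blowUp f y s z ∈ N :=
  (quasiMeasurePreserving_blowUp hy hs hρ).ae hf.2

lemma memLp_ball_of_ae_mem (hN : Bornology.IsBounded N) {g : Euc m → Euc l} {ρ : ℝ}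
    (hg : AEStronglyMeasurable g (volume.restrict (Metric.ball 0 ρ)))
    (hgN : ∀ᵐ z ∂(volume.restrict (Metric.ball (0 : Euc m) ρ)), g z ∈ N) :
    MemLp g 2 (volume.restrict (Metric.ball 0 ρ)) := by
  haveI : IsFiniteMeasure (volume.restrict (Metric.ball (0 : Euc m) ρ)) :=
    ⟨by rw [Measure.restrict_apply_univ]; exact measure_ball_lt_top⟩
  obtain ⟨M, hM⟩ := hN.exists_norm_le
  exact MemLp.of_bound hg M (hgN.mono fun z hz => hM _ hz)

lemma memLp_blowUp (hN : Bornology.IsBounded N) (hf : MemW22Into (Metric.ball x 4) N f) {y : Euc m}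
    (hy : y ∈ Metric.ball x 2) {s ρ : ℝ} (hs : 0 < s) (hρ : s * ρ ≤ 2) :
    MemLp (blowUp f y s) 2 (volume.restrict (Metric.ball 0 ρ)) :=
  memLp_ball_of_ae_mem hN (aestronglyMeasurable_blowUp hf.1 hy hs hρ) (ae_blowUp_mem hf hy hs hρ)

lemma IsHomogeneousAt.memLp (hN : Bornology.IsBounded N) {k : ℕ} {h : Euc m → Euc l}
    (hh : IsHomogeneousAt N k 0 h) (ρ : ℝ) : MemLp h 2 (volume.restrict (Metric.ball 0 ρ)) :=
  memLp_ball_of_ae_mem hN hh.1.aestronglyMeasurable (Eventually.of_forall hh.2.1)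

lemma meanSqDist_comm (g h : Euc m → Euc l) : meanSqDist g h = meanSqDist h g := by
  unfold meanSqDist
  simp_rw [norm_sub_rev]

lemma meanSqDist_eq (g h : Euc m → Euc l) : meanSqDist g h =
    ((volume : Measure (Euc m)).real (Metric.ball 0 1))⁻¹ *
      ∫ z in Metric.ball (0 : Euc m) 1, ‖g z - h z‖ ^ 2 := by
  unfold meanSqDist
  rw [setAverage_eq, smul_eq_mul]

lemma volume_real_ball_pos : 0 < (volume : Measure (Euc m)).real (Metric.ball 0 1) :=
  ENNReal.toReal_pos (Metric.measure_ball_pos _ _ one_pos).ne' measure_ball_lt_top.ne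

/-- Closeness to a homogeneous map persists at comparable smaller scales. -/
lemma meanSqDist_blowUp_mul_le (hN : Bornology.IsBounded N) (hf : MemW22Into (Metric.ball x 4) N f)
    {y : Euc m} (hy : y ∈ Metric.ball x 2) {s a : ℝ} (hs : 0 < s) (hs1 : s ≤ 1) (ha : 0 < a)
    (ha1 : a ≤ 1) {k : ℕ} {h : Euc m → Euc l} (hh : IsHomogeneousAt N k 0 h) :
    meanSqDist (blowUp f y (a * s)) h ≤ (a ^ m)⁻¹ * meanSqDist (blowUp f y s) h := by
  have e := setIntegral_ball_comp_affine (fun w => ‖blowUp f y s w - h w‖ ^ 2) (0 : Euc m) ha 1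
  have e1 : ∀ z, ‖blowUp f y (a * s) z - h z‖ ^ 2 =
      ‖blowUp f y s (0 + a • z) - h (0 + a • z)‖ ^ 2 := fun z => by
    rw [hh.2.2.1 a ha z, zero_add, zero_add]
    simp only [blowUp, smul_smul, mul_comm s a]
  rw [meanSqDist_eq, meanSqDist_eq, mul_left_comm]
  simp_rw [e1]
  rw [e]
  have hi : Integrable (fun w => ‖blowUp f y s w - h w‖ ^ 2)
      (volume.restrict (Metric.ball 0 1)) :=
    integrable_norm_sq_of_memLp ((memLp_blowUp hN hf hy hs (by linarith)).sub (hh.memLp hN 1))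
  refine mul_le_mul_of_nonneg_left (mul_le_mul_of_nonneg_left ?_ (by positivity))
    (inv_nonneg.2 volume_real_ball_pos.le)
  exact setIntegral_mono_set hi (Eventually.of_forall fun w => by positivity)
    (LE.le.eventuallyLE (Metric.ball_subset_ball (by linarith)))

/-- A set containing no `K` uniformly independent points is close to a subspace of dimension less
than `K`. -/
lemma exists_independent_or_subspace (P : Set (Euc m)) (γ : ℝ) (K : ℕ) :
    (∃ b : Fin K → Euc m, (∀ j, b j ∈ P) ∧
      ∀ j (c : Fin K → ℝ), γ ≤ ‖b j - ∑ a ∈ Finset.Iio j, c a • b a‖) ∨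
    ∃ W : Submodule ℝ (Euc m), Module.finrank ℝ W < K ∧ ∀ p ∈ P, ∃ w ∈ W, ‖p - w‖ < γ := by
  induction K with
  | zero => exact Or.inl ⟨Fin.elim0, fun j => j.elim0, fun j => j.elim0⟩
  | succ K ih =>
    rcases ih with ⟨b, hbP, hb⟩ | ⟨W, hW, hWP⟩
    -- Greedy selection: either the span of the chosen points is already `γ`-close to all of `P`, or
    -- a point at distance at least `γ` from that span can be appended.
    · by_cases hex : ∀ p ∈ P, ∃ w ∈ Submodule.span ℝ (range b), ‖p - w‖ < γ
      · refine Or.inr ⟨_, ?_, hex⟩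
        have := finrank_range_le_card (R := ℝ) b
        rw [Fintype.card_fin] at this
        exact Nat.lt_succ_of_le this
      · push Not at hex
        obtain ⟨p, hp, hpw⟩ := hex
        refine Or.inl ⟨Fin.snoc b p, fun j => ?_, fun j c => ?_⟩
        · refine Fin.lastCases ?_ (fun i => ?_) j
          · simpa using hp
          · simpa using hbP i
        · refine Fin.lastCases ?_ (fun i => ?_) j
          · rw [Fin.snoc_last]
            refine hpw _ (Submodule.sum_mem _ fun a ha => Submodule.smul_mem _ _ ?_)
            rw [Finset.mem_Iio] at ha
            obtain ⟨a', rfl⟩ := Fin.exists_castSucc_eq.2 ha.ne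
            rw [Fin.snoc_castSucc]
            exact Submodule.subset_span (mem_range_self a')
          · have := hb i fun a => c a.castSucc
            rw [Fin.snoc_castSucc, ← Fin.map_castSuccEmb_Iio, Finset.sum_map]
            simpa using this
    · exact Or.inr ⟨W, hW.trans (Nat.lt_succ_self K), hWP⟩

lemma tendsto_eLpNorm_dilate {C : ℝ} (hC : 0 ≤ C) {x : ℕ → Euc m} {f : ℕ → Euc m → Euc l}
    {Θ : ℕ → Euc m → ℝ → ℝ} (D : ∀ i, IsDensity C (x i) (f i) (Θ i))
    (hN : Bornology.IsBounded N) (hf : ∀ i, MemW22Into (Metric.ball (x i) 4) N (f i))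
    {y : ℕ → Euc m} (hy : ∀ i, y i ∈ Metric.ball (x i) 2) {s : ℕ → ℝ} (hs : ∀ i, 0 < s i)
    (hs1 : ∀ i, 8 * s i ≤ 1) {b : ℕ → Euc m} (hb : ∀ i, ‖b i‖ < 1)
    (hyb : ∀ i, y i + s i • b i ∈ Metric.ball (x i) 2) {δ : ℕ → ℝ} (hδ : Tendsto δ atTop (𝓝 0))
    (hΘ : ∀ i, Θ i (y i + s i • b i) (8 * s i) - Θ i (y i + s i • b i) (4 * s i) ≤ δ i)
    {c : ℝ} (hc : c ∈ Icc (-(1 / 2) : ℝ) 0) :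
    Tendsto (fun i => eLpNorm (fun w => blowUp (f i) (y i) (s i) (w + c • (w - b i))
      - blowUp (f i) (y i) (s i) w) 2 (volume.restrict (Metric.ball 0 1))) atTop (𝓝 0) := by
  have hg : ∀ i, MemLp (blowUp (f i) (y i) (s i)) 2 (volume.restrict (Metric.ball 0 1)) :=
    fun i => memLp_blowUp hN (hf i) (hy i) (hs i) (by linarith [hs1 i])
  refine tendsto_eLpNorm_of_integral (fun i => (memLp_dilate (hg i) (hb i) hc).1.sub (hg i)) ?_
  refine squeeze_zero (fun i => integral_nonneg fun w => by positivity) (fun i => ?_)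
    (by simpa using hδ.const_mul (2 ^ (m + 2) * 4 ^ m * C))
  refine ((D i).integral_dilate_le hC (hf i).1 (hs i) (hs1 i) (hb i) (hyb i) hc).trans ?_
  exact mul_le_mul_of_nonneg_left (hΘ i) (by positivity)

/-- **Quantitative cone splitting.** Near a point whose blow-up is not close to a
`(k+1)`-homogeneous map, the points with small density drop lie near a `k`-plane. -/
lemma exists_pinching {N : Set (Euc l)} (hN : IsCompact N) (hNe : N.Nonempty) (k : ℕ) {C : ℝ}
    (hC : 0 ≤ C) {η γ : ℝ} (hη : 0 < η) (hγ : 0 < γ) :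
    ∃ δ > 0, ∀ (x : Euc m) (f : Euc m → Euc l) (Θ : Euc m → ℝ → ℝ), IsDensity C x f Θ →
      MemW22Into (Metric.ball x 4) N f → ∀ (y : Euc m) (s : ℝ), y ∈ Metric.ball x 2 → 0 < s →
      8 * s ≤ 1 → Θ y (8 * s) - Θ y (4 * s) ≤ δ →
      (∀ h, IsHomogeneousAt N (k + 1) 0 h → η < meanSqDist (blowUp f y s) h) →
      ∃ W : Submodule ℝ (Euc m), Module.finrank ℝ W < k + 1 ∧ ∀ b : Euc m, ‖b‖ < 1 →
        y + s • b ∈ Metric.ball x 2 → Θ (y + s • b) (8 * s) - Θ (y + s • b) (4 * s) ≤ δ →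
        ∃ w ∈ W, ‖b - w‖ < γ := by
  -- Argue by compactness with `δ = 1/(i + 1)`. The failing blow-ups have drops tending to zero at
  -- the base point and, since no subspace of dimension at most `k` is `γ`-close, at `k + 1`
  -- uniformly independent points. They subconverge to a `(k+1)`-homogeneous map, against the
  -- distance `η`.
  by_contra! H
  have hpos : ∀ i : ℕ, (0 : ℝ) < 1 / ((i : ℝ) + 1) := fun i => by positivity
  choose x f Θ D hf y s hy hs hs1 hΘ hfar hW using fun i => H _ (hpos i)
  have hb : ∀ i, ∃ b : Fin (k + 1) → Euc m, (∀ j, ‖b j‖ < 1 ∧ y i + s i • b j ∈ Metric.ball (x i) 2 ∧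
      Θ i (y i + s i • b j) (8 * s i) - Θ i (y i + s i • b j) (4 * s i) ≤ 1 / ((i : ℝ) + 1)) ∧
      ∀ j (c : Fin (k + 1) → ℝ), γ ≤ ‖b j - ∑ a ∈ Finset.Iio j, c a • b a‖ := by
    intro i
    rcases exists_independent_or_subspace {b : Euc m | ‖b‖ < 1 ∧
      y i + s i • b ∈ Metric.ball (x i) 2 ∧
      Θ i (y i + s i • b) (8 * s i) - Θ i (y i + s i • b) (4 * s i) ≤ 1 / ((i : ℝ) + 1)} γ (k + 1)
      with ⟨b, h1, h2⟩ | ⟨W, h1, h2⟩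
    · exact ⟨b, h1, h2⟩
    · obtain ⟨b, hb1, hb2, hb3, hb4⟩ := hW i W h1
      obtain ⟨w, hw, hwb⟩ := h2 b ⟨hb1, hb2, hb3⟩
      exact absurd hwb (not_lt.2 (hb4 w hw))
  choose b hb hind using hb
  have hδ := tendsto_one_div_add_atTop_nhds_zero_nat (𝕜 := ℝ)
  obtain ⟨h, hh, φ, -, hlim⟩ := exists_homogeneous_limit hN hNe
    (g := fun i => blowUp (f i) (y i) (s i))
    (fun i => aestronglyMeasurable_blowUp (hf i).1 (hy i) (hs i) (by linarith [hs1 i]))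
    (fun i => ae_blowUp_mem (hf i) (hy i) (hs i) (by linarith [hs1 i]))
    (fun i z hz => (D i).integral_translate_le (hf i).1 (hy i) (hs i) (by linarith [hs1 i, hs i]) hz)
    (b := b) (fun i j => (hb i j).1) hγ hind
    (fun c hc => tendsto_eLpNorm_dilate hC D hN.isBounded hf hy hs hs1 (b := fun _ => 0)
      (by simp) (by simpa using hy) hδ (by simpa using hΘ) hc)
    (fun j c hc => tendsto_eLpNorm_dilate hC D hN.isBounded hf hy hs hs1 (fun i => (hb i j).1)
      (fun i => (hb i j).2.1) hδ (fun i => (hb i j).2.2) hc)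
  obtain ⟨i, hi⟩ := (hlim.eventually_lt_const hη).exists
  exact lt_asymm hi (hfar _ h hh)

/-- Pairing with the unit vector `e j` annihilates the preceding vectors and leaves `1/2`. -/
lemma le_norm_sub_sum_of_orthonormal {K : ℕ} {e : Fin K → Euc m} (he : Orthonormal ℝ e) (j : Fin K)
    (c : Fin K → ℝ) : 1 / 2 ≤ ‖(1 / 2 : ℝ) • e j - ∑ a ∈ Finset.Iio j, c a • (1 / 2 : ℝ) • e a‖ := by
  have h1 : inner ℝ (e j) ((1 / 2 : ℝ) • e j - ∑ a ∈ Finset.Iio j, c a • (1 / 2 : ℝ) • e a) =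
      (1 / 2 : ℝ) := by
    rw [inner_sub_right, inner_sum, Finset.sum_eq_zero, inner_smul_right,
      real_inner_self_eq_norm_sq, he.1 j]
    · norm_num
    · intro a ha
      rw [inner_smul_right, inner_smul_right, he.2 (Finset.mem_Iio.1 ha).ne']
      simp
  have h2 := real_inner_le_norm (e j)
    ((1 / 2 : ℝ) • e j - ∑ a ∈ Finset.Iio j, c a • (1 / 2 : ℝ) • e a)
  rwa [h1, he.1 j, one_mul] at h2

/-- As `h` is unchanged by the dilation, the difference equals that for `g - h`, whose two terms are
bounded by the distortion factor and by `1`. -/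
lemma eLpNorm_dilate_sub_le {g h : Euc m → Euc l}
    (hg : MemLp g 2 (volume.restrict (Metric.ball 0 1)))
    (hh : MemLp h 2 (volume.restrict (Metric.ball 0 1))) {b : Euc m} (hb : ‖b‖ < 1) {c : ℝ}
    (hc : c ∈ Icc (-(1 / 2) : ℝ) 0) (hinv : ∀ w, h (w + c • (w - b)) = h w) :
    eLpNorm (fun w => g (w + c • (w - b)) - g w) 2 (volume.restrict (Metric.ball 0 1)) ≤
      ((2 ^ m : ℝ≥0∞) ^ (1 / (2 : ℝ≥0∞)).toReal + 1) *
        eLpNorm (fun w => g w - h w) 2 (volume.restrict (Metric.ball 0 1)) := by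
  have hgh := hg.sub hh
  have hd := memLp_dilate hgh hb hc
  have e : (fun w => g (w + c • (w - b)) - g w) =
      (fun w => (g - h) (w + c • (w - b))) - (g - h) := by
    ext1 w
    simp only [Pi.sub_apply, hinv]
    abel
  rw [e, add_mul, one_mul]
  exact (eLpNorm_sub_le hd.1.1 hgh.1 one_le_two).trans (add_le_add hd.2 le_rfl)

/-- The classical stratum is the union of the quantitative strata. -/
lemma stratum_inter_ball_eq {N : Set (Euc l)} (hN : IsCompact N) (hNe : N.Nonempty) {C : ℝ}
    {Θ : Euc m → ℝ → ℝ} (D : IsDensity C x f Θ) (hf : MemW22Into (Metric.ball x 4) N f) (k : ℕ) :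
    stratum (Metric.ball x 4) N k f ∩ Metric.ball x 2 =
      ⋃ (η : ℝ) (_ : 0 < η), etaStratum x N k η f := by
  apply Subset.antisymm
  · rintro y ⟨⟨-, hy⟩, hy2⟩
    by_contra hcon
    have hcon' : ∀ η : ℝ, 0 < η → ∃ s : ℝ, 0 < s ∧ s ≤ 1 ∧ ∃ h, IsHomogeneousAt N (k + 1) 0 h ∧
        meanSqDist (blowUp f y s) h ≤ η := by
      intro η hη
      by_contra! H
      refine hcon (mem_iUnion₂.2 ⟨η, hη, mem_iInter₂.2 fun r hr => ⟨hy2, fun s hrs hs1 h hh => ?_⟩⟩)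
      exact H s (hr.1.trans_le hrs) hs1 h hh
    -- The scales of good approximation need not tend to zero. Passing from `s_i` to `a_i s_i` costs
    -- a factor `a_i^(-m)`, so an error of at most `a_i^(m+1)` is requested at `s_i`; the factor
    -- `1/8` keeps the new scales in the admissible range.
    set a : ℕ → ℝ := fun i => 1 / 8 * (1 / ((i : ℝ) + 1)) with ha
    have ha0 : ∀ i, 0 < a i := fun i => by positivity
    have ha1 : ∀ i, a i ≤ 1 / 8 := fun i => by
      have : 1 / ((i : ℝ) + 1) ≤ 1 := by
        rw [div_le_one (by positivity)]
        linarith [(Nat.cast_nonneg i : (0 : ℝ) ≤ i)]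
      simp only [ha]
      linarith
    have hat : Tendsto a atTop (𝓝 0) := by
      have := (tendsto_one_div_add_atTop_nhds_zero_nat (𝕜 := ℝ)).const_mul (1 / 8)
      rwa [mul_zero] at this
    choose s hs0 hs1 h hh hd using fun i => hcon' (a i ^ (m + 1)) (pow_pos (ha0 i) _)
    have has0 : ∀ i, 0 < a i * s i := fun i => mul_pos (ha0 i) (hs0 i)
    have has : ∀ i, a i * s i ≤ 1 / 8 := fun i =>
      (mul_le_of_le_one_right (ha0 i).le (hs1 i)).trans (ha1 i)
    have hd' : ∀ i, meanSqDist (blowUp f y (a i * s i)) (h i) ≤ a i := fun i => by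
      refine (meanSqDist_blowUp_mul_le hN.isBounded hf hy2 (hs0 i) (hs1 i) (ha0 i)
        ((ha1 i).trans (by norm_num)) (hh i)).trans ?_
      calc (a i ^ m)⁻¹ * meanSqDist (blowUp f y (s i)) (h i) ≤ (a i ^ m)⁻¹ * a i ^ (m + 1) :=
            mul_le_mul_of_nonneg_left (hd i) (inv_nonneg.2 (pow_pos (ha0 i) _).le)
        _ = a i := by
            rw [pow_succ, inv_mul_cancel_left₀ (pow_pos (ha0 i) _).ne']
    have hg : ∀ i, MemLp (blowUp f y (a i * s i)) 2 (volume.restrict (Metric.ball 0 1)) :=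
      fun i => memLp_blowUp hN.isBounded hf hy2 (has0 i) (by linarith [has i])
    have hgh : Tendsto (fun i => eLpNorm (fun w => blowUp f y (a i * s i) w - h i w) 2
        (volume.restrict (Metric.ball 0 1))) atTop (𝓝 0) := by
      refine tendsto_eLpNorm_of_integral (fun i => (hg i).sub ((hh i).memLp hN.isBounded 1)) ?_
      refine squeeze_zero (g := fun i => (volume : Measure (Euc m)).real (Metric.ball 0 1) * a i)
        (fun i => integral_nonneg fun w => by positivity) (fun i => ?_) ?_
      · have := hd' i
        rwa [meanSqDist_eq, inv_mul_le_iff₀ volume_real_ball_pos] at this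
      · simpa using hat.const_mul ((volume : Measure (Euc m)).real (Metric.ball 0 1))
    choose V hVk hV using fun i => (hh i).2.2.2
    have hbasis : ∀ i, ∃ e : Fin (k + 1) → Euc m, Orthonormal ℝ e ∧ ∀ j, e j ∈ V i := fun i => by
      have B := (stdOrthonormalBasis ℝ (V i)).reindex (finCongr (hVk i))
      exact ⟨fun j => (B j : Euc m), B.orthonormal.comp_linearIsometry (V i).subtypeₗᵢ,
        fun j => (B j).2⟩
    choose e he heV using hbasis
    -- The blow-ups inherit from `h i`, asymptotically, the invariance under dilations about points
    -- of its invariant plane. The planes may vary with `i`, since orthonormal frames in them are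
    -- uniformly independent.
    have hdil : ∀ b : ℕ → Euc m, (∀ i, ‖b i‖ < 1) → (∀ i, b i ∈ V i) → ∀ c ∈ Icc (-(1 / 2) : ℝ) 0,
        Tendsto (fun i => eLpNorm (fun w => blowUp f y (a i * s i) (w + c • (w - b i)) -
          blowUp f y (a i * s i) w) 2 (volume.restrict (Metric.ball 0 1))) atTop (𝓝 0) := by
      intro b hb hbV c hc
      have hK : ((2 ^ m : ℝ≥0∞) ^ (1 / (2 : ℝ≥0∞)).toReal + 1) ≠ ⊤ :=
        ENNReal.add_ne_top.2 ⟨ENNReal.rpow_ne_top_of_nonneg ENNReal.toReal_nonneg (by simp),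
          ENNReal.one_ne_top⟩
      have ht := ENNReal.Tendsto.const_mul hgh (Or.inr hK)
      rw [mul_zero] at ht
      refine tendsto_of_tendsto_of_tendsto_of_le_of_le tendsto_const_nhds ht
        (fun i => zero_le) fun i => ?_
      refine eLpNorm_dilate_sub_le (hg i) ((hh i).memLp hN.isBounded 1) (hb i) hc fun w => ?_
      have e1 : w + c • (w - b i) = (1 + c) • w + (-c) • b i := by module
      have e2 := (hh i).2.2.1 (1 + c) (by linarith [hc.1]) w
      rw [zero_add, zero_add] at e2
      rw [e1, hV i _ _ ((V i).smul_mem _ (hbV i)), e2]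
    obtain ⟨T, hT, φ, hφ, hlim⟩ := exists_homogeneous_limit hN hNe
      (g := fun i => blowUp f y (a i * s i))
      (fun i => aestronglyMeasurable_blowUp hf.1 hy2 (has0 i) (by linarith [has i]))
      (fun i => ae_blowUp_mem hf hy2 (has0 i) (by linarith [has i]))
      (fun i z hz => D.integral_translate_le hf.1 hy2 (has0 i) (by linarith [has i]) hz)
      (b := fun i j => (1 / 2 : ℝ) • e i j)
      (fun i j => by rw [norm_smul, (he i).1 j]; norm_num) (by norm_num : (0 : ℝ) < 1 / 2)
      (fun i j c => le_norm_sub_sum_of_orthonormal (he i) j c)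
      (hdil (fun _ => 0) (by simp) fun i => (V i).zero_mem)
      (fun j => hdil (fun i => (1 / 2 : ℝ) • e i j)
        (fun i => by rw [norm_smul, (he i).1 j]; norm_num) fun i => (V i).smul_mem _ (heV i j))
    refine hy T ⟨hT.1, hT.2.1, fun i => a (φ i) * s (φ i), fun i => has0 _, ?_, ?_⟩ hT
    · exact squeeze_zero (fun i => (has0 _).le)
        (fun i => mul_le_of_le_one_right (ha0 _).le (hs1 _)) (hat.comp hφ.tendsto_atTop)
    · simpa only [meanSqDist_comm T] using hlim
  · intro y hy
    obtain ⟨η, hη, hy⟩ := mem_iUnion₂.1 hy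
    have hq : ∀ r : ℝ, 0 < r → r < 1 → y ∈ quantStratum x N k η r f := fun r h0 h1 =>
      mem_iInter₂.1 hy r ⟨h0, h1⟩
    have hy2 : y ∈ Metric.ball x 2 := (hq (1 / 2) (by norm_num) (by norm_num)).1
    refine ⟨⟨Metric.ball_subset_ball (by norm_num) hy2, ?_⟩, hy2⟩
    -- A `(k+1)`-homogeneous tangent map would be a competitor closer than `η` at some scale `r_i <
    -- 1`.
    rintro T ⟨-, -, r, hr0, hr, hlim⟩ hT
    obtain ⟨i, hi1, hi2⟩ := ((hlim.eventually_lt_const hη).and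
      (hr.eventually_lt_const one_pos)).exists
    have := (hq (r i) (hr0 i) hi2).2 (r i) le_rfl hi2.le T hT
    rw [meanSqDist_comm] at this
    exact lt_asymm this hi1

end BlowUp

/-! ### Coverings of sets near subspaces -/

section Covering

/-- `E` is covered by at most `n` sets of diameter controlled by `d`. -/
def SmallCover {X : Type*} [PseudoMetricSpace X] (n d : ℝ) (E : Set X) : Prop :=
  ∃ T : Finset (Set X), (T.card : ℝ) ≤ n ∧ E ⊆ ⋃ s ∈ T, s ∧ ∀ s ∈ T, ∀ p ∈ s, ∀ q ∈ s, dist p q < d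

namespace SmallCover

variable {X : Type*} [PseudoMetricSpace X] {n n' d d' : ℝ} {E F : Set X}

lemma mono (h : SmallCover n d E) (hn : n ≤ n') (hd : d ≤ d') (hF : F ⊆ E) :
    SmallCover n' d' F := by
  obtain ⟨T, h1, h2, h3⟩ := h
  exact ⟨T, h1.trans hn, hF.trans h2, fun s hs p hp q hq => (h3 s hs p hp q hq).trans_le hd⟩

lemma of_key {K : Type*} (key : X → K) (S : Finset K) (hS : ∀ p ∈ E, key p ∈ S)
    (h : ∀ p ∈ E, ∀ q ∈ E, key p = key q → dist p q < d) : SmallCover S.card d E := by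
  classical
  refine ⟨S.image fun a => {p ∈ E | key p = a}, by exact_mod_cast Finset.card_image_le, ?_, ?_⟩
  · intro p hp
    exact mem_iUnion₂.2 ⟨_, Finset.mem_image_of_mem _ (hS p hp), hp, rfl⟩
  · intro s hs
    obtain ⟨a, -, rfl⟩ := Finset.mem_image.1 hs
    exact fun p hp q hq => h p hp.1 q hq.1 (hp.2.trans hq.2.symm)

lemma biUnion {ι : Type*} (S : Finset ι) {E : ι → Set X} (h : ∀ i ∈ S, SmallCover n d (E i)) :
    SmallCover (S.card * n) d (⋃ i ∈ S, E i) := by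
  classical
  choose! T h1 h2 h3 using h
  refine ⟨S.biUnion T, ?_, ?_, ?_⟩
  · calc ((S.biUnion T).card : ℝ) ≤ ∑ i ∈ S, ((T i).card : ℝ) := by
          exact_mod_cast Finset.card_biUnion_le
      _ ≤ ∑ i ∈ S, n := Finset.sum_le_sum h1
      _ = S.card * n := by rw [Finset.sum_const, nsmul_eq_mul]
  · intro p hp
    obtain ⟨i, hi, hp⟩ := mem_iUnion₂.1 hp
    obtain ⟨s, hs, hp⟩ := mem_iUnion₂.1 (h2 i hi hp)
    exact mem_iUnion₂.2 ⟨s, Finset.mem_biUnion.2 ⟨i, hi, hs⟩, hp⟩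
  · intro s hs
    obtain ⟨i, hi, hs⟩ := Finset.mem_biUnion.1 hs
    exact h3 i hi s hs

lemma trans (h : SmallCover n d E) (hn' : 0 ≤ n')
    (h' : ∀ F ⊆ E, (∀ p ∈ F, ∀ q ∈ F, dist p q < d) → SmallCover n' d' F) :
    SmallCover (n * n') d' E := by
  obtain ⟨T, h1, h2, h3⟩ := h
  refine (biUnion T (E := fun s => s ∩ E) fun s hs => h' _ inter_subset_right fun p hp q hq =>
    h3 s hs p hp.1 q hq.1).mono (mul_le_mul_of_nonneg_right h1 hn') le_rfl fun p hp => ?_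
  obtain ⟨s, hs, hp'⟩ := mem_iUnion₂.1 (h2 hp)
  exact mem_iUnion₂.2 ⟨s, hs, hp', hp⟩

end SmallCover

variable {m l : ℕ}

/-- Sets of diameter `ρ` close to a `k`-plane have few pieces at scale `γρ`. -/
lemma smallCover_near_subspace {E : Set (Euc m)} {ρ γ : ℝ} (hρ : 0 < ρ) (hγ : 0 < γ) (hγ1 : γ ≤ 1)
    (hE : ∀ p ∈ E, ∀ q ∈ E, dist p q < ρ) (W : Submodule ℝ (Euc m)) {p₀ : Euc m}
    (hp₀ : ∀ p ∈ E, ∃ w ∈ W, ‖p - p₀ - w‖ < γ * ρ) :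
    SmallCover ((5 / γ) ^ Module.finrank ℝ W) ((Module.finrank ℝ W + 2) * (γ * ρ)) E := by
  classical
  rcases E.eq_empty_or_nonempty with rfl | ⟨p₁, hp₁⟩
  · exact ⟨∅, by simpa using by positivity, by simp, by simp⟩
  set k := Module.finrank ℝ W with hk
  have hγρ : 0 < γ * ρ := mul_pos hγ hρ
  set e := stdOrthonormalBasis ℝ W
  -- Coordinates along `W`, measured from a point of `E` and rounded to a grid of mesh `γρ`. Each
  -- takes at most `2⌈1/γ⌉ + 1 ≤ 5/γ` values.
  set key : Euc m → Fin k → ℤ := fun p i => ⌊inner ℝ (e i : Euc m) (p - p₁) / (γ * ρ)⌋ with hkey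
  set L := ⌈1 / γ⌉₊ with hL
  have hL1 : 1 / γ ≤ L := Nat.le_ceil _
  have hL2 : (L : ℝ) < 1 / γ + 1 := Nat.ceil_lt_add_one (by positivity)
  have he : ∀ i, ‖(e i : Euc m)‖ = 1 := fun i => e.orthonormal.1 i
  have h1 := SmallCover.of_key (E := E) (d := (k + 2) * (γ * ρ)) key
    (Fintype.piFinset fun _ => Finset.Icc (-(L : ℤ)) L) ?_ ?_
  · refine h1.mono ?_ le_rfl Subset.rfl
    rw [Fintype.card_piFinset_const, Int.card_Icc]
    push_cast
    have h2 : (((L : ℤ) + 1 - -(L : ℤ)).toNat : ℝ) = 2 * L + 1 := by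
      have : ((L : ℤ) + 1 - -(L : ℤ)).toNat = 2 * L + 1 := by omega
      rw [this]; push_cast; ring
    rw [h2]
    refine pow_le_pow_left₀ (by positivity) ?_ k
    have h3 : 1 ≤ 1 / γ := (one_le_div hγ).2 hγ1
    have h4 : 5 / γ = 5 * (1 / γ) := by ring
    rw [h4]
    linarith
  · intro p hp
    refine Fintype.mem_piFinset.2 fun i => Finset.mem_Icc.2 ?_
    have h2 : |inner ℝ (e i : Euc m) (p - p₁)| ≤ ρ := by
      refine (abs_real_inner_le_norm _ _).trans ?_
      rw [he i, one_mul, ← dist_eq_norm]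
      exact (hE p hp p₁ hp₁).le
    have h3 : |inner ℝ (e i : Euc m) (p - p₁) / (γ * ρ)| ≤ L := by
      rw [abs_div, abs_of_pos hγρ]
      refine le_trans ?_ hL1
      rw [div_le_div_iff₀ hγρ hγ, one_mul]
      nlinarith
    rw [abs_le] at h3
    constructor
    · exact Int.le_floor.2 (by push_cast; exact h3.1)
    · exact Int.cast_le (R := ℝ).1 ((Int.floor_le _).trans (by push_cast; exact h3.2))
  · intro p hp q hq hpq
    -- Transversally each of two points deviates by less than `γρ` from the plane, and along `W` a
    -- shared grid cell contributes at most `γρ` per coordinate; this gives the factor `dim W + 2`.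
    have hperp : ∀ p ∈ E, ‖(p - p₀) - W.starProjection (p - p₀)‖ < γ * ρ := fun p hp => by
      obtain ⟨w, hw, hpw⟩ := hp₀ p hp
      refine lt_of_le_of_lt ?_ hpw
      rw [Submodule.starProjection_minimal]
      exact ciInf_le ⟨0, Set.forall_mem_range.mpr fun _ => norm_nonneg _⟩ (⟨w, hw⟩ : W)
    have hproj : ‖W.starProjection (p - q)‖ ≤ k * (γ * ρ) := by
      have e1 : W.starProjection (p - q) = ∑ i, inner ℝ (e i : Euc m) (p - q) • (e i : Euc m) := by
        have := e.starProjection_eq_sum_rankOne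
        rw [this]
        simp [InnerProductSpace.rankOne_apply]
      rw [e1]
      refine (norm_sum_le _ _).trans ?_
      have : ∀ i ∈ (Finset.univ : Finset (Fin k)),
          ‖inner ℝ (e i : Euc m) (p - q) • (e i : Euc m)‖ ≤ γ * ρ := fun i _ => by
        rw [norm_smul, he i, mul_one, Real.norm_eq_abs]
        have h2 := Int.abs_sub_lt_one_of_floor_eq_floor (congrFun hpq i)
        rw [← sub_div, ← inner_sub_right, sub_sub_sub_cancel_right, abs_div, abs_of_pos hγρ,
          div_lt_one hγρ] at h2
        exact h2.le
      simpa using Finset.sum_le_card_nsmul _ _ _ this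
    have e2 : p - q = W.starProjection (p - q) + (((p - p₀) - W.starProjection (p - p₀)) -
        ((q - p₀) - W.starProjection (q - p₀))) := by
      have : W.starProjection (p - q) = W.starProjection (p - p₀) - W.starProjection (q - p₀) := by
        rw [← map_sub]; congr 1; abel
      rw [this]; abel
    rw [dist_eq_norm, e2]
    have h3 := norm_sub_le ((p - p₀) - W.starProjection (p - p₀))
      ((q - p₀) - W.starProjection (q - p₀))
    have h4 := norm_add_le (W.starProjection (p - q)) (((p - p₀) - W.starProjection (p - p₀)) -
        ((q - p₀) - W.starProjection (q - p₀)))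
    have h5 := hperp p hp
    have h6 := hperp q hq
    linarith

/-- The case where `W` is the whole space, with `γ / (m + 2)` in place of `γ` to compensate for the
factor `m + 2` in the diameter. -/
lemma smallCover_of_dist_lt {E : Set (Euc m)} {ρ γ : ℝ} (hρ : 0 < ρ) (hγ : 0 < γ) (hγ1 : γ ≤ 1)
    (hE : ∀ p ∈ E, ∀ q ∈ E, dist p q < ρ) :
    SmallCover ((5 * (m + 2) / γ) ^ m) (γ * ρ) E := by
  have hm : (0 : ℝ) < m + 2 := by positivity
  have h := smallCover_near_subspace (γ := γ / (m + 2)) hρ (by positivity)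
    (by rw [div_le_one hm]; linarith [(Nat.cast_nonneg m : (0 : ℝ) ≤ m)]) hE ⊤ (p₀ := 0)
    fun p _ => ⟨p, trivial, by simpa using by positivity⟩
  rw [finrank_top, finrank_euclideanSpace_fin] at h
  refine h.mono (le_of_eq ?_) (le_of_eq ?_) Subset.rfl
  · congr 1
    field_simp
  · field_simp

/-- One refinement step near a plane of dimension at most `k`. -/
lemma smallCover_near_plane {E : Set (Euc m)} {ρ γ : ℝ} (hρ : 0 < ρ) (hγ : 0 < γ) (hγ1 : γ ≤ 1)
    (hE : ∀ p ∈ E, ∀ q ∈ E, dist p q < ρ) {k : ℕ} {W : Submodule ℝ (Euc m)}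
    (hW : Module.finrank ℝ W < k + 1) {p₀ : Euc m}
    (hp₀ : ∀ p ∈ E, ∃ w ∈ W, ‖p - p₀ - w‖ < γ * ρ) :
    SmallCover ((5 * (m + 2) * (k + 2)) ^ m * 5 ^ k * (γ⁻¹) ^ k) (γ * ρ) E := by
  have hk : (0 : ℝ) < k + 2 := by positivity
  have h5 : 1 ≤ 5 / γ := by rw [le_div_iff₀ hγ]; linarith
  have h1 := (smallCover_near_subspace hρ hγ hγ1 hE W hp₀).mono
    (pow_le_pow_right₀ h5 (Nat.lt_succ_iff.1 hW)) (d' := (k + 2) * (γ * ρ)) (by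
      have : (Module.finrank ℝ W : ℝ) ≤ k := by exact_mod_cast Nat.lt_succ_iff.1 hW
      gcongr) Subset.rfl
  -- Pieces of diameter `(k + 2)γρ` are cut down to `γρ` at a cost independent of `γ`, so the
  -- dependence on `γ` stays `γ^(-k)`.
  have h2 := h1.trans (n' := (5 * (m + 2) * (k + 2)) ^ m) (d' := γ * ρ) (by positivity)
    fun F _ hF => by
      have := smallCover_of_dist_lt (γ := 1 / (k + 2)) (by positivity) (by positivity)
        (by rw [div_le_one hk]; linarith) hF
      refine this.mono (le_of_eq ?_) (le_of_eq ?_) Subset.rfl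
      · rw [div_div_eq_mul_div, div_one]
      · field_simp
  refine h2.mono (le_of_eq ?_) le_rfl Subset.rfl
  rw [div_pow, inv_pow, div_eq_mul_inv]
  ring

end Covering

/-! ### Covering the quantitative strata -/

section StratumCovering

variable {m l : ℕ} {x : Euc m} {f : Euc m → Euc l} {C : ℝ} {Θ : Euc m → ℝ → ℝ} {N : Set (Euc l)}

open Classical in
/-- The scales `γ ^ j / 8`, `j < n`, at which the density at `y` drops by more than `δ`. -/
noncomputable def badScales (Θ : Euc m → ℝ → ℝ) (γ δ : ℝ) (n : ℕ) (y : Euc m) : Finset ℕ :=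
  (Finset.range n).filter fun j => δ < Θ y (8 * (γ ^ j / 8)) - Θ y (4 * (γ ^ j / 8))

/-- For `γ ≤ 1/2` the intervals `[γ^j / 2, γ^j]` do not overlap, so by monotonicity the drops over
them sum to at most `Θ(1) - Θ(γ^n) ≤ C`. -/
lemma IsDensity.card_badScales_le (D : IsDensity C x f Θ) {y : Euc m} (hy : y ∈ Metric.ball x 2)
    {γ δ : ℝ} (hγ : 0 < γ) (hγ1 : γ ≤ 1 / 2) (n : ℕ) :
    ((badScales Θ γ δ n y).card : ℝ) * δ ≤ C := by
  classical
  have hp : ∀ j, 0 < γ ^ j := fun j => pow_pos hγ j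
  have hp1 : ∀ j, γ ^ j ≤ 1 := fun j => pow_le_one₀ hγ.le (by linarith)
  have hmono := D.monotone y hy
  have h4 : ∀ j, Θ y (γ ^ (j + 1)) ≤ Θ y (4 * (γ ^ j / 8)) := fun j => by
    refine hmono ⟨hp _, hp1 _⟩ ⟨by linarith [hp j], by linarith [hp1 j, hp j]⟩ ?_
    rw [pow_succ]
    nlinarith [hp j]
  have h8 : ∀ j, 8 * (γ ^ j / 8) = γ ^ j := fun j => by ring
  have hnn : ∀ j, 0 ≤ Θ y (8 * (γ ^ j / 8)) - Θ y (4 * (γ ^ j / 8)) := fun j => by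
    rw [h8, sub_nonneg]
    exact hmono ⟨by linarith [hp j], by linarith [hp1 j, hp j]⟩ ⟨hp _, hp1 _⟩ (by linarith [hp j])
  calc ((badScales Θ γ δ n y).card : ℝ) * δ = ∑ j ∈ badScales Θ γ δ n y, δ := by
        rw [Finset.sum_const, nsmul_eq_mul]
    _ ≤ ∑ j ∈ badScales Θ γ δ n y, (Θ y (8 * (γ ^ j / 8)) - Θ y (4 * (γ ^ j / 8))) :=
        Finset.sum_le_sum fun j hj => (Finset.mem_filter.1 hj).2.le
    _ ≤ ∑ j ∈ Finset.range n, (Θ y (8 * (γ ^ j / 8)) - Θ y (4 * (γ ^ j / 8))) :=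
        Finset.sum_le_sum_of_subset_of_nonneg (Finset.filter_subset _ _) fun j _ _ => hnn j
    _ ≤ ∑ j ∈ Finset.range n, (Θ y (γ ^ j) - Θ y (γ ^ (j + 1))) :=
        Finset.sum_le_sum fun j _ => by rw [h8]; linarith [h4 j]
    _ = Θ y (γ ^ 0) - Θ y (γ ^ n) := Finset.sum_range_sub' _ _
    _ ≤ C := by
        have h1 := D.le y hy (γ ^ 0) ⟨hp _, hp1 _⟩
        have h2 := D.nonneg y hy (γ ^ n) ⟨hp _, hp1 _⟩
        linarith

/-- Covering of the points with a prescribed pattern of bad scales. -/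
lemma smallCover_of_badScales_subset {k : ℕ} {η γ δ : ℝ} (hγ : 0 < γ) (hγ1 : γ ≤ 1)
    (hpinch : ∀ (y : Euc m) (s : ℝ), y ∈ Metric.ball x 2 → 0 < s →
      8 * s ≤ 1 → Θ y (8 * s) - Θ y (4 * s) ≤ δ →
      (∀ h, IsHomogeneousAt N (k + 1) 0 h → η < meanSqDist (blowUp f y s) h) →
      ∃ W : Submodule ℝ (Euc m), Module.finrank ℝ W < k + 1 ∧ ∀ b : Euc m, ‖b‖ < 1 →
        y + s • b ∈ Metric.ball x 2 → Θ (y + s • b) (8 * s) - Θ (y + s • b) (4 * s) ≤ δ →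
        ∃ w ∈ W, ‖b - w‖ < γ)
    (B : Finset ℕ) {E : Set (Euc m)} (hE : ∀ p ∈ E, ∀ q ∈ E, dist p q < 1 / 8)
    (hE2 : E ⊆ Metric.ball x 2) (n : ℕ)
    (hfar : ∀ y ∈ E, ∀ j < n, ∀ h, IsHomogeneousAt N (k + 1) 0 h →
      η < meanSqDist (blowUp f y (γ ^ j / 8)) h)
    (hB : ∀ y ∈ E, ∀ j < n, j ∉ B → Θ y (8 * (γ ^ j / 8)) - Θ y (4 * (γ ^ j / 8)) ≤ δ) :
    SmallCover (∏ j ∈ Finset.range n, if j ∈ B then (5 * (m + 2) / γ) ^ m else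
      (5 * (m + 2) * (k + 2)) ^ m * 5 ^ k * (γ⁻¹) ^ k) (γ ^ n / 8) E := by
  induction n with
  | zero =>
    refine ⟨{E}, by simp, by simp, ?_⟩
    simpa using hE
  | succ n ih =>
    have h1 := ih (fun y hy j hj => hfar y hy j (hj.trans n.lt_succ_self))
      fun y hy j hj => hB y hy j (hj.trans n.lt_succ_self)
    rw [Finset.prod_range_succ, show γ ^ (n + 1) / 8 = γ * (γ ^ n / 8) by ring]
    have hs : 0 < γ ^ n / 8 := by positivity
    have hs1 : 8 * (γ ^ n / 8) ≤ 1 := by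
      have := pow_le_one₀ hγ.le hγ1 (n := n)
      linarith
    refine h1.trans (by split_ifs <;> positivity) fun F hFE hF => ?_
    -- A bad scale is paid for with the full dimension `m`. At a good scale, pinching at one point
    -- of the piece places the whole piece near a plane, since by hypothesis every point of the
    -- piece has a small drop there.
    split_ifs with hn
    · exact smallCover_of_dist_lt hs hγ hγ1 hF
    · rcases F.eq_empty_or_nonempty with rfl | ⟨y, hy⟩
      · exact ⟨∅, by simpa using by positivity, by simp, by simp⟩
      obtain ⟨W, hW, hWb⟩ := hpinch y _ (hE2 (hFE hy)) hs hs1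
        (hB y (hFE hy) n n.lt_succ_self hn) (hfar y (hFE hy) n n.lt_succ_self)
      refine smallCover_near_plane hs hγ hγ1 hF hW (p₀ := y) fun p hp => ?_
      set s := γ ^ n / 8 with hsd
      have e : y + s • (s⁻¹ • (p - y)) = p := by
        rw [smul_inv_smul₀ hs.ne']; abel
      obtain ⟨w, hw, hwb⟩ := hWb (s⁻¹ • (p - y))
        (by
          rw [norm_smul, Real.norm_of_nonneg (inv_pos.2 hs).le, ← dist_eq_norm,
            inv_mul_lt_iff₀ hs, mul_one]
          exact hF p hp y hy)
        (by rw [e]; exact hE2 (hFE hp)) (by rw [e]; exact hB p (hFE hp) n n.lt_succ_self hn)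
      refine ⟨s • w, W.smul_mem _ hw, ?_⟩
      have e2 : p - y - s • w = s • (s⁻¹ • (p - y) - w) := by
        rw [smul_sub, smul_inv_smul₀ hs.ne']
      rw [e2, norm_smul, Real.norm_of_nonneg hs.le, mul_comm γ]
      exact mul_lt_mul_of_pos_left hwb hs

lemma smallCover_ball (x : Euc m) {r : ℝ} (hr : 0 < r) (hr1 : r ≤ 1) :
    SmallCover ((20 * (m + 2) / r) ^ m) r (Metric.ball x 2) := by
  have h : ∀ p ∈ Metric.ball x 2, ∀ q ∈ Metric.ball x 2, dist p q < 4 := fun p hp q hq => by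
    have h1 := dist_triangle_right p q x
    rw [Metric.mem_ball] at hp hq
    linarith
  refine (smallCover_of_dist_lt (γ := r / 4) (by norm_num : (0 : ℝ) < 4) (by positivity)
    (by linarith) h).mono (le_of_eq ?_) (le_of_eq ?_) Subset.rfl
  · congr 1
    field_simp
    norm_num
  · ring

/-- Sort the points by their pattern of bad scales. There are at most `2^n` patterns, each with at
most `K` bad scales, so the number of pieces is bounded by a constant times `M^K (2a)^n`, and `2a ≤
γ^(-(k + η))`. -/
lemma exists_smallCover_quantStratum_of_index (hN : IsCompact N) (hNe : N.Nonempty) (hC : 0 ≤ C)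
    (k : ℕ) {η : ℝ} (hη : 0 < η) : ∃ C' : ℝ, ∀ (x : Euc m) (f : Euc m → Euc l)
      (Θ : Euc m → ℝ → ℝ), IsDensity C x f Θ → MemW22Into (Metric.ball x 4) N f →
      ∀ r : ℝ, 0 < r → r < 1 →
        SmallCover (C' * r ^ (-((k : ℝ) + η))) r (quantStratum x N k η r f) := by
  classical
  set A : ℝ := 2 * ((5 * (m + 2) * (k + 2)) ^ m * 5 ^ k) with hA
  have hA0 : 0 < A := by positivity
  -- Chosen so that `A ≤ γ^(-η)`. The constant lost at each scale, including the factor `2` that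
  -- pays for the patterns, is absorbed by the `η` in the exponent; `A` does not involve `γ`, so
  -- there is no circularity.
  set γ : ℝ := min (1 / 2) (A ^ (-(1 / η))) with hγd
  have hγ : 0 < γ := lt_min (by norm_num) (Real.rpow_pos_of_pos hA0 _)
  have hγ2 : γ ≤ 1 / 2 := min_le_left _ _
  have hγ1 : γ ≤ 1 := hγ2.trans (by norm_num)
  have hAγ : A ≤ γ ^ (-η) := by
    have h1 : (A ^ (-(1 / η))) ^ (-η) ≤ γ ^ (-η) :=
      Real.rpow_le_rpow_of_nonpos hγ (min_le_right _ _) (by linarith)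
    rwa [← Real.rpow_mul hA0.le, show -(1 / η) * -η = 1 by field_simp, Real.rpow_one] at h1
  obtain ⟨δ, hδ, hpinch⟩ := exists_pinching (m := m) hN hNe k hC hη hγ
  set M : ℝ := (5 * (m + 2) / γ) ^ m with hM
  set a : ℝ := (5 * (m + 2) * (k + 2)) ^ m * 5 ^ k * (γ⁻¹) ^ k with ha
  have hm2 : (2 : ℝ) ≤ m + 2 := by linarith [(Nat.cast_nonneg m : (0 : ℝ) ≤ m)]
  have hk2 : (2 : ℝ) ≤ k + 2 := by linarith [(Nat.cast_nonneg k : (0 : ℝ) ≤ k)]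
  have hM1 : 1 ≤ M := one_le_pow₀ (by rw [le_div_iff₀ hγ]; nlinarith)
  have ha1 : 1 ≤ a := by
    refine one_le_mul_of_one_le_of_one_le (one_le_mul_of_one_le_of_one_le ?_ ?_) ?_
    · exact one_le_pow₀ (by nlinarith)
    · exact one_le_pow₀ (by norm_num)
    · exact one_le_pow₀ ((one_le_inv₀ hγ).2 hγ1)
  -- The largest possible number of bad scales, independent of `r`.
  set K := ⌊C / δ⌋₊ with hK
  refine ⟨(20 * (m + 2) / (1 / 8)) ^ m * M ^ K * γ ^ (-((k : ℝ) + η)), ?_⟩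
  intro x f Θ D hf r hr hr1
  have hex : ∃ n, γ ^ n / 8 < r := by
    obtain ⟨n, hn⟩ := exists_pow_lt_of_lt_one hr (hγ2.trans_lt (by norm_num : (1 : ℝ) / 2 < 1))
    exact ⟨n, by linarith [pow_pos hγ n]⟩
  -- The first index with `γ^n / 8 < r`. All earlier scales are at least `r`, so the defining
  -- condition of the stratum applies to them; minimality gives `γ r ≤ γ^n`, which bounds the count
  -- from above.
  set n := Nat.find hex with hn
  have hnr : γ ^ n / 8 < r := Nat.find_spec hex
  have hnj : ∀ j < n, r ≤ γ ^ j / 8 := fun j hj => not_lt.1 (Nat.find_min hex hj)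
  have hγn : γ * r ≤ γ ^ n := by
    rcases Nat.eq_zero_or_pos n with h0 | h0
    · rw [h0, pow_zero]
      nlinarith
    · have := hnj (n - 1) (by omega)
      obtain ⟨i, hi⟩ := Nat.exists_eq_succ_of_ne_zero h0.ne'
      rw [hi, Nat.succ_sub_one] at this
      rw [hi, pow_succ, mul_comm]
      exact mul_le_mul_of_nonneg_right (by linarith) hγ.le
  have h0 := (smallCover_ball x (by norm_num : (0 : ℝ) < 1 / 8) (by norm_num)).mono le_rfl le_rfl
    (F := quantStratum x N k η r f) fun y hy => hy.1
  have h1 : SmallCover ((20 * (m + 2) / (1 / 8)) ^ m * (2 ^ n * (M ^ K * a ^ n))) r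
      (quantStratum x N k η r f) := by
    refine h0.trans (by positivity) fun F hFE hF => ?_
    set S := (Finset.range n).powerset.filter fun B => B.card ≤ K with hS
    have hSc : (S.card : ℝ) ≤ 2 ^ n := by
      have : S.card ≤ 2 ^ n := by
        refine (Finset.card_filter_le _ _).trans ?_
        rw [Finset.card_powerset, Finset.card_range]
      exact_mod_cast this
    have h2 : SmallCover (S.card * (M ^ K * a ^ n)) r
        (⋃ B ∈ S, {y ∈ F | badScales Θ γ δ n y = B}) := by
      refine SmallCover.biUnion S fun B hB => ?_
      obtain ⟨hBn, hBK⟩ := Finset.mem_filter.1 hB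
      rw [Finset.mem_powerset] at hBn
      have h3 := smallCover_of_badScales_subset (N := N) (η := η) hγ hγ1 (hpinch x f Θ D hf) B
        (E := {y ∈ F | badScales Θ γ δ n y = B}) (fun p hp q hq => hF p hp.1 q hq.1)
        (fun y hy => (hFE hy.1).1) n
        (fun y hy j hj => (hFE hy.1).2 _ (hnj j hj) (by
          have := pow_le_one₀ hγ.le hγ1 (n := j)
          linarith))
        (fun y hy j hj hjB => by
          by_contra hcon
          exact hjB (hy.2 ▸ Finset.mem_filter.2 ⟨Finset.mem_range.2 hj, not_le.1 hcon⟩))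
      refine h3.mono ?_ hnr.le Subset.rfl
      rw [Finset.prod_ite, Finset.prod_const, Finset.prod_const]
      refine mul_le_mul (pow_le_pow_right₀ hM1 ?_) (pow_le_pow_right₀ ha1 ?_) (by positivity)
        (by positivity)
      · refine (Finset.card_le_card fun j hj => ?_).trans hBK
        exact (Finset.mem_filter.1 hj).2
      · exact (Finset.card_filter_le _ _).trans (Finset.card_range n).le
    refine h2.mono (mul_le_mul_of_nonneg_right hSc (by positivity)) le_rfl fun y hy => ?_
    refine mem_iUnion₂.2 ⟨badScales Θ γ δ n y, Finset.mem_filter.2 ⟨?_, ?_⟩, hy, rfl⟩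
    · exact Finset.mem_powerset.2 (Finset.filter_subset _ _)
    · exact Nat.le_floor ((le_div_iff₀ hδ).2 (D.card_badScales_le (hFE hy).1 hγ hγ2 n))
  refine h1.mono ?_ le_rfl Subset.rfl
  have h2 : 2 * a ≤ γ ^ (-((k : ℝ) + η)) := by
    rw [neg_add, Real.rpow_add hγ, Real.rpow_neg hγ.le, Real.rpow_natCast, ← inv_pow]
    calc 2 * a = (γ⁻¹) ^ k * A := by rw [ha, hA]; ring
      _ ≤ _ := mul_le_mul_of_nonneg_left hAγ (by positivity)
  have h3 : (2 * a) ^ n ≤ γ ^ (-((k : ℝ) + η)) * r ^ (-((k : ℝ) + η)) := by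
    calc (2 * a) ^ n ≤ (γ ^ (-((k : ℝ) + η))) ^ n := pow_le_pow_left₀ (by positivity) h2 n
      _ = (γ ^ n) ^ (-((k : ℝ) + η)) := by
          rw [← Real.rpow_natCast, ← Real.rpow_natCast, ← Real.rpow_mul hγ.le,
            ← Real.rpow_mul hγ.le, mul_comm]
      _ ≤ (γ * r) ^ (-((k : ℝ) + η)) :=
          Real.rpow_le_rpow_of_nonpos (by positivity) hγn (by
            have : (0 : ℝ) ≤ k := Nat.cast_nonneg k
            linarith)
      _ = _ := Real.mul_rpow hγ.le hr.le
  calc (20 * ((m : ℝ) + 2) / (1 / 8)) ^ m * (2 ^ n * (M ^ K * a ^ n))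
      = (20 * ((m : ℝ) + 2) / (1 / 8)) ^ m * M ^ K * (2 * a) ^ n := by rw [mul_pow]; ring
    _ ≤ (20 * ((m : ℝ) + 2) / (1 / 8)) ^ m * M ^ K *
        (γ ^ (-((k : ℝ) + η)) * r ^ (-((k : ℝ) + η))) := by gcongr
    _ = _ := by ring

/-- The covering estimate, with a constant independent of the dimension of the stratum. -/
lemma exists_smallCover_quantStratum (hN : IsCompact N) (hNe : N.Nonempty) (hC : 0 ≤ C)
    {η : ℝ} (hη : 0 < η) : ∃ C' : ℝ, 0 ≤ C' ∧ ∀ (x : Euc m) (f : Euc m → Euc l)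
      (Θ : Euc m → ℝ → ℝ), IsDensity C x f Θ → MemW22Into (Metric.ball x 4) N f →
      ∀ (k : ℕ) (r : ℝ), 0 < r → r < 1 →
        SmallCover (C' * r ^ (-((k : ℝ) + η))) r (quantStratum x N k η r f) := by
  classical
  choose c hc using fun k => exists_smallCover_quantStratum_of_index (m := m) hN hNe hC k hη
  obtain ⟨M, hM⟩ := Finset.exists_le ((Finset.range m).image c)
  refine ⟨max M ((20 * (m + 2)) ^ m), le_max_of_le_right (by positivity), ?_⟩
  intro x f Θ D hf k r hr hr1
  have hr0 : 0 < r ^ (-((k : ℝ) + η)) := Real.rpow_pos_of_pos hr _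
  rcases lt_or_ge k m with hk | hk
  · refine (hc k x f Θ D hf r hr hr1).mono ?_ le_rfl Subset.rfl
    refine mul_le_mul_of_nonneg_right (le_max_of_le_left ?_) hr0.le
    exact hM _ (Finset.mem_image_of_mem _ (Finset.mem_range.2 hk))
  -- For `k ≥ m` the trivial covering of the ball by a multiple of `r^(-m)` pieces suffices, so only
  -- finitely many constants have to be maximised.
  · refine (smallCover_ball x hr hr1.le).mono ?_ le_rfl fun y hy => hy.1
    rw [div_pow, div_eq_mul_inv]
    refine mul_le_mul (le_max_right _ _) ?_ (by positivity) (le_max_of_le_right (by positivity))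
    rw [← Real.rpow_natCast, ← Real.rpow_neg hr.le]
    refine Real.rpow_le_rpow_of_exponent_ge hr hr1.le ?_
    have : (m : ℝ) ≤ k := by exact_mod_cast hk
    linarith

end StratumCovering

/-! ### From coverings to volume and dimension -/

section Dimension

variable {m l : ℕ} {x : Euc m} {f : Euc m → Euc l} {N : Set (Euc l)}

/-- The `r`-neighbourhood of a piece of diameter at most `r` lies in a ball of radius `2r`. -/
lemma volume_thickening_le {E : Set (Euc m)} {n r : ℝ} (hn : 0 ≤ n) (hr : 0 < r)
    (h : SmallCover n r E) : volume (Metric.thickening r E) ≤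
      ENNReal.ofReal (n * ((2 * r) ^ m * (volume : Measure (Euc m)).real (Metric.ball 0 1))) := by
  obtain ⟨T, hT, hET, hd⟩ := h
  have hvol : ∀ p : Euc m, volume (Metric.ball p (2 * r)) =
      ENNReal.ofReal ((2 * r) ^ m * (volume : Measure (Euc m)).real (Metric.ball 0 1)) := fun p => by
    rw [Measure.addHaar_ball_of_pos volume p (by positivity), finrank_euclideanSpace_fin,
      ENNReal.ofReal_mul (by positivity), Measure.real, ENNReal.ofReal_toReal measure_ball_lt_top.ne]
  have hs : ∀ s ∈ T, volume (Metric.thickening r s) ≤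
      ENNReal.ofReal ((2 * r) ^ m * (volume : Measure (Euc m)).real (Metric.ball 0 1)) := by
    intro s hs
    rcases s.eq_empty_or_nonempty with rfl | ⟨p, hp⟩
    · simp
    · rw [← hvol p]
      refine measure_mono fun y hy => ?_
      obtain ⟨z, hz, hyz⟩ := Metric.mem_thickening_iff.1 hy
      rw [Metric.mem_ball]
      linarith [dist_triangle y z p, hd s hs z hz p hp]
  have hsub : Metric.thickening r E ⊆ ⋃ s ∈ T, Metric.thickening r s := fun y hy => by
    obtain ⟨z, hz, hyz⟩ := Metric.mem_thickening_iff.1 hy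
    obtain ⟨s, hs, hzs⟩ := mem_iUnion₂.1 (hET hz)
    exact mem_iUnion₂.2 ⟨s, hs, Metric.mem_thickening_iff.2 ⟨z, hzs, hyz⟩⟩
  refine (measure_mono hsub).trans ((measure_biUnion_finset_le T _).trans
    ((Finset.sum_le_sum hs).trans ?_))
  rw [Finset.sum_const, nsmul_eq_mul, ENNReal.ofReal_mul hn, ← ENNReal.ofReal_natCast]
  gcongr

/-- A cover by `C r^(-(k+ε))` pieces of diameter at most `r` has `(k+ε)`-dimensional sum at most
`C`. Letting `r → 0` bounds the Hausdorff measure in that dimension, and `ε` is arbitrary. -/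
lemma dimH_le_of_smallCover {E : Set (Euc m)} {k : ℕ}
    (h : ∀ ε : ℝ, 0 < ε → ∃ C : ℝ, ∀ r : ℝ, 0 < r → r < 1 →
      SmallCover (C * r ^ (-((k : ℝ) + ε))) r E) : dimH E ≤ k := by
  refine ENNReal.le_of_forall_pos_le_add fun ε hε _ => ?_
  obtain ⟨C, hC⟩ := h ε hε
  have hr0 : ∀ n : ℕ, (0 : ℝ) < 1 / 2 * (1 / ((n : ℝ) + 1)) := fun n => by positivity
  have hr1 : ∀ n : ℕ, 1 / 2 * (1 / ((n : ℝ) + 1)) < 1 := fun n => by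
    have : 1 / ((n : ℝ) + 1) ≤ 1 := by
      rw [div_le_one (by positivity)]
      linarith [(Nat.cast_nonneg n : (0 : ℝ) ≤ n)]
    linarith
  have hrt : Tendsto (fun n : ℕ => ENNReal.ofReal (1 / 2 * (1 / ((n : ℝ) + 1)))) atTop (𝓝 0) := by
    have h1 := (tendsto_one_div_add_atTop_nhds_zero_nat (𝕜 := ℝ)).const_mul (1 / 2)
    rw [mul_zero] at h1
    have h2 := ENNReal.tendsto_ofReal h1
    rwa [ENNReal.ofReal_zero] at h2
  choose T hT hET hd using fun n : ℕ => hC _ (hr0 n) (hr1 n)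
  have hdiam : ∀ n, ∀ s : T n, Metric.ediam (s : Set (Euc m)) ≤
      ENNReal.ofReal (1 / 2 * (1 / ((n : ℝ) + 1))) := fun n s =>
    Metric.ediam_le fun p hp q hq => by
      rw [edist_dist]
      exact ENNReal.ofReal_le_ofReal (hd n s s.2 p hp q hq).le
  have hd0 : (0 : ℝ) ≤ (k : ℝ) + ε := by positivity
  have hH := Measure.hausdorffMeasure_le_liminf_sum (ι := fun n => T n) ((k : ℝ) + ε) E
    (l := atTop) _ hrt (fun n s => (s : Set (Euc m))) (Eventually.of_forall hdiam)
    (Eventually.of_forall fun n p hp => by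
      obtain ⟨s, hs, hps⟩ := mem_iUnion₂.1 (hET n hp)
      exact mem_iUnion.2 ⟨⟨s, hs⟩, hps⟩)
  have hle : ∀ n, ∑ s : T n, Metric.ediam (s : Set (Euc m)) ^ ((k : ℝ) + ε) ≤ ENNReal.ofReal C := by
    intro n
    set r := 1 / 2 * (1 / ((n : ℝ) + 1)) with hr
    have hrp : 0 < r ^ ((k : ℝ) + ε) := Real.rpow_pos_of_pos (hr0 n) _
    calc ∑ s : T n, Metric.ediam (s : Set (Euc m)) ^ ((k : ℝ) + ε)
        ≤ ∑ s : T n, ENNReal.ofReal (r ^ ((k : ℝ) + ε)) := Finset.sum_le_sum fun s _ => by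
          rw [← ENNReal.ofReal_rpow_of_pos (hr0 n)]
          exact ENNReal.rpow_le_rpow (hdiam n s) hd0
      _ = ENNReal.ofReal ((T n).card * r ^ ((k : ℝ) + ε)) := by
          rw [Finset.sum_const, nsmul_eq_mul, Finset.card_univ, Fintype.card_coe,
            ENNReal.ofReal_mul (by positivity), ENNReal.ofReal_natCast]
      _ ≤ ENNReal.ofReal C := by
          refine ENNReal.ofReal_le_ofReal ((mul_le_mul_of_nonneg_right (hT n) hrp.le).trans_eq ?_)
          rw [mul_assoc, ← Real.rpow_add (hr0 n), neg_add_cancel, Real.rpow_zero, mul_one]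
  have hfin : μH[((k + ε : NNReal) : ℝ)] E ≠ ⊤ := by
    rw [show ((k + ε : NNReal) : ℝ) = (k : ℝ) + ε by push_cast; rfl]
    refine ne_top_of_le_ne_top (ENNReal.ofReal_ne_top (r := C)) (hH.trans ?_)
    exact (liminf_le_liminf (Eventually.of_forall hle)).trans (by simp)
  simpa using dimH_le_of_hausdorffMeasure_ne_top hfin

lemma quantStratum_anti {k : ℕ} {η η' : ℝ} (h : η' ≤ η) (r : ℝ) :
    quantStratum x N k η r f ⊆ quantStratum x N k η' r f :=
  fun _ hy => ⟨hy.1, fun s hr hs g hg => h.trans_lt (hy.2 s hr hs g hg)⟩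

lemma etaStratum_subset_quantStratum (x : Euc m) (N : Set (Euc l)) (k : ℕ) {η η' r : ℝ}
    (h : η' ≤ η) (hr : 0 < r) (hr1 : r < 1) (f : Euc m → Euc l) :
    etaStratum x N k η f ⊆ quantStratum x N k η' r f :=
  (iInter₂_subset r ⟨hr, hr1⟩).trans (quantStratum_anti h r)

/-- The thickenings have volume `O(r^(m-k-ε))`, so every `k + ε` is admissible in the infimum. -/
lemma minkowskiDim_le_of_smallCover {E : Set (Euc m)} {k : ℕ}
    (h : ∀ ε : ℝ, 0 < ε → ∃ C : ℝ, 0 ≤ C ∧ ∀ r : ℝ, 0 < r → r < 1 →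
      SmallCover (C * r ^ (-((k : ℝ) + ε))) r E) : minkowskiDim E ≤ k := by
  refine ENNReal.le_of_forall_pos_le_add fun ε hε _ => ?_
  obtain ⟨C, hC0, hC⟩ := h ε hε
  have key : limsup (fun δ : ℝ => volume (Metric.thickening δ E) /
      ENNReal.ofReal (δ ^ ((m : ℝ) - (k + ε : NNReal)))) (𝓝[>] 0) < ⊤ := by
    refine lt_of_le_of_lt (limsup_le_of_le (h := ?_))
      (ENNReal.ofReal_lt_top (r := C * 2 ^ m * (volume : Measure (Euc m)).real (Metric.ball 0 1)))
    filter_upwards [Ioo_mem_nhdsGT (zero_lt_one (α := ℝ))] with r hr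
    have hr0 := hr.1
    refine ENNReal.div_le_of_le_mul ?_
    refine (volume_thickening_le (by positivity) hr0 (hC r hr0 hr.2)).trans ?_
    rw [← ENNReal.ofReal_mul (by positivity)]
    refine ENNReal.ofReal_le_ofReal (le_of_eq ?_)
    have e : r ^ ((m : ℝ) - (k + ε : NNReal)) = r ^ (-((k : ℝ) + ε)) * r ^ m := by
      rw [← Real.rpow_natCast, ← Real.rpow_add hr0]
      congr 1
      push_cast
      ring
    rw [e, mul_pow]
    ring
  have := iInf₂_le (f := fun (d : NNReal) (_ : limsup (fun δ : ℝ => volume (Metric.thickening δ E) /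
    ENNReal.ofReal (δ ^ ((m : ℝ) - d))) (𝓝[>] 0) < ⊤) => (d : ℝ≥0∞)) (k + ε : NNReal) key
  unfold minkowskiDim
  simpa using this

lemma MemW22Into.nonempty (hf : MemW22Into (Metric.ball x 4) N f) : N.Nonempty := by
  have hne : volume.restrict (Metric.ball x 4) ≠ 0 := by
    rw [Ne, Measure.restrict_eq_zero]
    exact (Metric.measure_ball_pos volume x (by norm_num)).ne'
  haveI := ae_neBot.2 hne
  obtain ⟨y, hy⟩ := hf.2.exists
  exact ⟨_, hy⟩

lemma MemH2.exists_isDensity {Λ C : ℝ}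
    (hC : ∀ (l : ℕ) (x : Euc m) (f : Euc m → Euc l), MemW22 (Metric.ball x 4) f →
      (∀ ξ : Euc m → Euc m, IsTest (Metric.ball x 4) ξ →
        HasDerivAt (fun t : ℝ => biEnergy (Metric.ball x 4) fun y => f (y + t • ξ y)) 0 0) →
      ∫ y in Metric.ball x 4, (gradSq (Metric.ball x 4) f y + hessSq (Metric.ball x 4) f y) < Λ →
      ∃ Θ : Euc m → ℝ → ℝ, IsDensity C x f Θ)
    (h : MemH2 Λ x 4 N f) (hs : IsStationaryBiharmonic (Metric.ball x 4) N f) :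
    ∃ Θ : Euc m → ℝ → ℝ, IsDensity C x f Θ :=
  hC l x f h.mem.1 hs.2 h.sobolev_bound

/-- The covering estimate for the quantitative strata of stationary biharmonic maps. -/
lemma exists_smallCover_of_stationary (hm : 4 ≤ m) (hN : IsCompact N) (Λ : ℝ) {η : ℝ}
    (hη : 0 < η) : ∃ C : ℝ, 0 ≤ C ∧ ∀ (x : Euc m) (f : Euc m → Euc l),
      IsStationaryBiharmonic (Metric.ball x 4) N f → MemH2 Λ x 4 N f →
      ∀ (k : ℕ) (r : ℝ), 0 < r → r < 1 →
        SmallCover (C * r ^ (-((k : ℝ) + η))) r (quantStratum x N k η r f) := by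
  -- An empty target admits no maps, so any constant serves; otherwise compactness of `N` supplies
  -- the limit maps.
  rcases N.eq_empty_or_nonempty with rfl | hNe
  · exact ⟨0, le_rfl, fun x f _ h => absurd h.mem.nonempty not_nonempty_empty⟩
  obtain ⟨C, hC0, hC⟩ := Biharmonic.exists_isDensity hm Λ
  obtain ⟨C', hC'0, hC'⟩ := exists_smallCover_quantStratum (m := m) hN hNe hC0.le hη
  refine ⟨C', hC'0, fun x f hs h => ?_⟩
  obtain ⟨Θ, D⟩ := h.exists_isDensity hC hs
  exact hC' x f Θ D h.mem

end Dimension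

end Biharmonic

theorem theorem3p1 {m l n : ℕ} (hm : 4 ≤ m) (N : Set (Biharmonic.Euc l))
    (hN : Biharmonic.IsCompactSubmanifold n N) (Λ : ℝ) (hΛ : 0 < Λ) :
    (∀ η : ℝ, 0 < η → ∃ C : ℝ, ∀ (x : Biharmonic.Euc m) (f : Biharmonic.Euc m → Biharmonic.Euc l),
      Biharmonic.IsStationaryBiharmonic (Metric.ball x 4) N f → Biharmonic.MemH2 Λ x 4 N f →
      ∀ (k : ℕ) (r : ℝ), 0 < r → r < 1 →
        volume (Metric.thickening r (Biharmonic.quantStratum x N k η r f) ∩ Metric.ball x 1) ≤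
          ENNReal.ofReal (C * r ^ ((m : ℝ) - k - η))) ∧
    (∀ (x : Biharmonic.Euc m) (f : Biharmonic.Euc m → Biharmonic.Euc l),
      Biharmonic.IsStationaryBiharmonic (Metric.ball x 4) N f → Biharmonic.MemH2 Λ x 4 N f →
      ∀ k : ℕ,
        Biharmonic.stratum (Metric.ball x 4) N k f ∩ Metric.ball x 2 =
          ⋃ (η : ℝ) (_ : 0 < η), Biharmonic.etaStratum x N k η f ∧
        (∀ η : ℝ, 0 < η →
          Biharmonic.minkowskiDim (Biharmonic.etaStratum x N k η f ∩ Metric.ball x 1) ≤ k) ∧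
        dimH (Biharmonic.stratum (Metric.ball x 4) N k f ∩ Metric.ball x 1) ≤ k) := by
  have hcover := fun (η : ℝ) (hη : 0 < η) =>
    Biharmonic.exists_smallCover_of_stationary hm hN.isCompact Λ hη
  refine ⟨fun η hη => ?_, fun x f hs h k => ?_⟩
  · obtain ⟨C, hC0, hC⟩ := hcover η hη
    refine ⟨C * 2 ^ m * (volume : Measure (Biharmonic.Euc m)).real (Metric.ball 0 1),
      fun x f hs h k r hr hr1 => ?_⟩
    refine (measure_mono inter_subset_left).trans ((Biharmonic.volume_thickening_le
      (by positivity) hr (hC x f hs h k r hr hr1)).trans (ENNReal.ofReal_le_ofReal (le_of_eq ?_)))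
    have e : r ^ ((m : ℝ) - k - η) = r ^ (-((k : ℝ) + η)) * r ^ m := by
      rw [← Real.rpow_natCast, ← Real.rpow_add hr]
      congr 1
      ring
    rw [e, mul_pow]
    ring
  -- The strata grow as `η` decreases, so the covering bound with parameter `min η ε` applies to the
  -- stratum of `η` and yields the exponent `k + ε` for every `ε`.
  · have heta : ∀ η : ℝ, 0 < η → ∀ ε : ℝ, 0 < ε → ∃ C : ℝ, 0 ≤ C ∧ ∀ r : ℝ, 0 < r → r < 1 →
        Biharmonic.SmallCover (C * r ^ (-((k : ℝ) + ε))) r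
          (Biharmonic.etaStratum x N k η f ∩ Metric.ball x 1) := by
      intro η hη ε hε
      obtain ⟨C, hC0, hC⟩ := hcover (min η ε) (lt_min hη hε)
      refine ⟨C, hC0, fun r hr hr1 => (hC x f hs h k r hr hr1).mono ?_ le_rfl
        (inter_subset_left.trans (Biharmonic.etaStratum_subset_quantStratum x N k
          (min_le_left _ _) hr hr1 f))⟩
      refine mul_le_mul_of_nonneg_left (Real.rpow_le_rpow_of_exponent_ge hr hr1.le ?_) hC0
      linarith [min_le_right η ε]
    obtain ⟨C, -, hC⟩ := Biharmonic.exists_isDensity hm Λ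
    obtain ⟨Θ, D⟩ := h.exists_isDensity hC hs
    have hunion := Biharmonic.stratum_inter_ball_eq hN.isCompact h.mem.nonempty D h.mem k
    refine ⟨hunion, fun η hη => Biharmonic.minkowskiDim_le_of_smallCover (heta η hη), ?_⟩
    -- Countably many values of `η` exhaust the stratum. Hausdorff dimension is stable under
    -- countable unions, which upper Minkowski dimension is not.
    have hsub : Biharmonic.stratum (Metric.ball x 4) N k f ∩ Metric.ball x 1 ⊆
        ⋃ i : ℕ, Biharmonic.etaStratum x N k (1 / ((i : ℝ) + 1)) f ∩ Metric.ball x 1 := by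
      rintro y ⟨hy, hy1⟩
      have hy2 : y ∈ Biharmonic.stratum (Metric.ball x 4) N k f ∩ Metric.ball x 2 :=
        ⟨hy, Metric.ball_subset_ball one_le_two hy1⟩
      rw [hunion] at hy2
      obtain ⟨η, hη, hyη⟩ := mem_iUnion₂.1 hy2
      obtain ⟨i, hi⟩ := exists_nat_one_div_lt hη
      refine mem_iUnion.2 ⟨i, mem_iInter₂.2 fun r hr => ?_, hy1⟩
      exact Biharmonic.etaStratum_subset_quantStratum x N k hi.le hr.1 hr.2 f hyη
    refine (dimH_mono hsub).trans ?_
    rw [dimH_iUnion]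
    refine iSup_le fun i => Biharmonic.dimH_le_of_smallCover fun ε hε => ?_
    obtain ⟨C, -, hC⟩ := heta (1 / ((i : ℝ) + 1)) (by positivity) ε hε
    exact ⟨C, hC⟩
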